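/- **Setting.** Let $\Omega\subset\mathbb R^2$ be a bounded, nonempty open set with finitely many line segments (fractures) $D_{f,l}\subset\overline\Omega$ of aperture $d_l>0$. Write $\Omega=D_m\oplus_l d_lD_{f,l}$, so that $\int_\Omega g\,dx=\int_{D_m}g\,dx+\sum_l d_l\int_{D_{f,l}}g\,ds$; the norm and inner product of $[L^2(\Omega)]^2$ are taken in this sense. Let $\rho,\sigma\ge0$, and let $\kappa_i,\kappa_{l,i},c_i,c_{l,i}$ ($i=1,2$) be measurable with $0<\underline\kappa\le\kappa_i,\kappa_{l,i}\le\overline\kappa$ and $0<\underline c\le c_i,c_{l,i}\le\overline c$. Put $$c(u,v)=\sum_i\Big(\int_{D_m}c_iu_iv_i\,dx+\sum_l\int_{D_{f,l}}c_{l,i}u_iv_i\,ds\Big),$$ $$a_Q(u,v)=\sum_i\Big(\int_{D_m}\kappa_i\nabla u_i\cdot\nabla v_i\,dx+\sum_l\int_{D_{f,l}}\kappa_{l,i}\nabla_fu_i\cdot\nabla_fv_i\,ds\Big)+\sum_{i}\sum_{l=1}^{2}\rho\sigma\int_\Omega(u_i-u_l)v_i\,dx,$$ where $\nabla_f$ is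 the tangential gradient, and write $\|u\|_c^2=c(u,u)$, $\|u\|_{a_Q}^2=a_Q(u,u)$. Let $V$ be $[H^1_0(\Omega)]^2$ with square integrable tangential gradients on the fractures (the closure of $[C_c^\infty(\Omega)]^2$ in the energy norm). **Method.** Let $K_1,\dots,K_N$ be a conforming partition of $\overline\Omega$ into closed strictly convex quadrilaterals, with mesh size $H=\max_j\operatorname{diam}K_j$ and bilinear partition of unity functions $\chi_k$ such that $|\nabla\chi_k|\le\gamma/H$ on every element. Let $a_Q^{(j)}$ be $a_Q$ with all integrals restricted to $K_j$, let $$s^{(j)}(u,v)=\sum_i\Big(\int_{K_j}\kappa_i\sum_k|\nabla\chi_k|^2u_iv_i\,dx+\sum_l\int_{D_{f,l}\cap K_j}\kappa_{l,i}\sum_k|\nabla_f\chi_k|^2u_iv_i\,ds\Big),\qquad s=\sum_js^{(j)},$$ and let $V(K_j)$ be the space of restrictions to $K_j$ of functions in $V$ (closed in the local energy norm). Let $\lambda^{(j)}_1\le\lambda^{(j)}_2\le\cdots$ be all eigenvalues, with multiplicity, of $a_Q^{(j)}(\phi,v)=\lambda s^{(j)}(\phi,v)$ for all $v\in V(K_j)$,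 with $s^{(j)}$-orthogonal eigenfunctions $\phi^{(j)}_k\in V(K_j)$, extended by zero. Let $V_{aux}^{(j)}=\mathrm{span}\{\phi_k^{(j)}:k\le L_j\}$ and $$\Lambda=\min_j\lambda^{(j)}_{L_j+1},\qquad \lambda_{max}=\max_j\max_{k\le L_j}\lambda_k^{(j)},\qquad C_\pi=\sup_j\ \sup_{0\ne\nu\in V_{aux}^{(j)}}\frac{s^{(j)}(\nu,\nu)}{s^{(j)}(B_j\nu,\nu)},$$ where $B_j$ is the product of the four $\chi_k$ belonging to the corners of $K_j$. Let $K_{j,m}$ be $K_j$ enlarged by $m$ layers of coarse elements. For $k\le L_j$ let $\psi_{k,ms}^{(j)}$ minimize $a_Q(\psi,\psi)$ among all $\psi\in V$ supported in $K_{j,m}$ with zero trace on $\partial K_{j,m}$ that satisfy $s(\psi,\phi_{k'}^{(j')})=\delta_{jj'}\delta_{kk'}$ for all $j'$ and all $k'\le L_{j'}$, and let $V_{ms}$ be the span of all $\psi_{k,ms}^{(j)}$. **Theorem.** There is a constant $C$, depending only on $\Omega$, the fractures and their apertures, $\rho$, $\sigma$, $\underline c$, $\overline c$ and $\gamma$,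 and for all positive numbers $\underline\kappa,\Lambda_0,\overline\lambda,\overline C_\pi$ there is a constant $K_0$, depending only on these numbers and on the data that $C$ depends on, such that the following holds for all coefficients and coarse meshes as above (for any $\overline\kappa$ and $H$) with $\Lambda\ge\Lambda_0$, $\lambda_{max}\le\overline\lambda$ and $C_\pi\le\overline C_\pi$. Let the number $m\ge2$ of oversampling layers satisfy $m\ge K_0\max\{1,\log(\overline\kappa/H)\}$, let $T>0$, $f\in L^2(0,T;[L^2(\Omega)]^2)$ and $p^0\in V$. Let $p\in L^2(0,T;V)$ with $\partial_tp\in L^2(0,T;[L^2(\Omega)]^2)$ and $p(t)\in V$ for all $t\in[0,T]$ solve $$c(\partial_tp,v)+a_Q(p,v)=(f,v)\quad\text{for all }v\in V\text{ and a.e. }t\in(0,T),\qquad p(0)=p^0,$$ and let $p_{ms}$ solve the same problem with $V$ replaced by $V_{ms}$, its initial value $p_{ms}(0)\in V_{ms}$ being the elliptic projection of $p^0$, that is, $a_Q(p_{ms}(0),v)=a_Q(p^0,v)$ for all $v\in V_{ms}$. Then $$\|p(T)-p_{ms}(T)\|_c^2+\int_0^T\|p-p_{ms}\|_{a_Q}^2\,dt\le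 CH^2\underline\kappa^{-1}\Lambda^{-1}\Big(\|p^0\|_{a_Q}^2+\int_0^T\|f\|_{[L^2(\Omega)]^2}^2\,dt\Big).$$ -/

import Mathlib

open MeasureTheory Set
open scoped InnerProductSpace ContDiff

namespace DualContinuum

noncomputable section

/-- Points of the plane. -/
abbrev Pt := EuclideanSpace ℝ (Fin 2)

/-- Values `(p₁, p₂)` of a pair of pressures, one for each continuum. -/
abbrev Pair := EuclideanSpace ℝ (Fin 2)

/-- Values `(∇p₁, ∇p₂)` of the gradients of a pair of pressures. -/
abbrev GradPair := PiLp 2 (fun _ : Fin 2 => Pt)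

/-! ### The domain `Ω = D_m ⊕ᵢ dᵢ D_{f,i}` -/

/-- A bounded open planar set with finitely many one-dimensional fractures: the `l`-th fracture is
the line segment from `a l` to `b l` and has aperture `d l`. -/
structure FracturedDomain where
  Ω : Set Pt
  isOpen : IsOpen Ω
  nonempty : Ω.Nonempty
  isBounded : Bornology.IsBounded Ω
  nf : ℕ
  a : Fin nf → Pt
  b : Fin nf → Pt
  a_ne_b : ∀ l, a l ≠ b l
  d : Fin nf → ℝ
  d_pos : ∀ l, 0 < d l
  seg_subset : ∀ l, segment ℝ (a l) (b l) ⊆ closure Ω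

namespace FracturedDomain

variable (G : FracturedDomain)

/-- The `l`-th fracture. -/
def seg (l : Fin G.nf) : Set Pt := segment ℝ (G.a l) (G.b l)

/-- The measure behind `∫_Ω … dx = ∫_{D_m} … dx + ∑ₗ dₗ ∫_{D_{f,l}} … ds`: area on `Ω` (the
fractures have no area) plus, on each fracture, `dₗ` times arc length. -/
def meas : Measure Pt :=
  (volume : Measure Pt).restrict G.Ω +
    ∑ l, ENNReal.ofReal (G.d l) • (Measure.hausdorffMeasure 1 : Measure Pt).restrict (G.seg l)

/-- The direction of the `l`-th fracture. -/
def tangent (l : Fin G.nf) : Submodule ℝ Pt := Submodule.span ℝ {G.b l - G.a l}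

/-- The tangent space of `Ω = D_m ⊕ᵢ dᵢ D_{f,i}` at `x`: the direction of the fracture through `x`,
and the whole plane when there is no such fracture. (It is `0` where fractures cross
transversally, which happens in finitely many points.) -/
def tangentAt (x : Pt) : Submodule ℝ Pt := ⨅ l, ⨅ _ : x ∈ G.seg l, G.tangent l

/-- The pair of gradients of a smooth pair `φ`: `∇φᵢ` in the matrix, and the tangential gradient
`∇_f φᵢ` on the fractures. -/
def smoothGrad (φ : Pt → Pair) (x : Pt) : GradPair :=
  WithLp.toLp 2 (fun i => (G.tangentAt x).starProjection (gradient (fun y => φ y i) x))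

end FracturedDomain

/-! ### Function spaces -/

/-- `[L²]²` with respect to the measure `ν`. -/
abbrev L2 (ν : Measure Pt) := Lp Pair 2 ν

/-- A pair of square integrable functions (first component) together with the pair of its
square integrable gradients (second component). -/
abbrev EField (ν : Measure Pt) := Lp Pair 2 ν × Lp GradPair 2 ν

/-- The closure, in the energy norm with respect to the measure `ν`, of the pairs of smooth
functions with compact support in `U`; each function is recorded together with its gradient. -/
def energySpace (G : FracturedDomain) (ν : Measure Pt) (U : Set Pt) : Submodule ℝ (EField ν) :=
  (Submodule.span ℝ {w : EField ν | ∃ φ : Pt → Pair, ContDiff ℝ ∞ φ ∧ HasCompactSupport φ ∧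
    tsupport φ ⊆ U ∧ w.1 =ᵐ[ν] φ ∧ w.2 =ᵐ[ν] G.smoothGrad φ}).topologicalClosure

namespace FracturedDomain

variable (G : FracturedDomain)

/-- `V = [H¹₀(Ω)]²`, with square integrable tangential derivative on the fractures. -/
def V : Submodule ℝ (EField G.meas) := energySpace G G.meas G.Ω

/-- `V₀(D)`, the functions of `V` that live on `D` and have zero trace on `∂D`
(extended by zero to `Ω`). -/
def V0 (D : Set Pt) : Submodule ℝ (EField G.meas) := energySpace G G.meas (G.Ω ∩ interior D)

/-- `V(D)`, the restrictions to `D` of the functions of `V` (closed in the energy norm of `D`):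
no boundary condition on the part of `∂D` that lies inside `Ω`. -/
def VRestr (D : Set Pt) : Submodule ℝ (EField (G.meas.restrict D)) :=
  energySpace G (G.meas.restrict D) G.Ω

end FracturedDomain

/-! ### Coefficients and bilinear forms -/

/-- The coefficients `κᵢ`, `cᵢ` of the matrix and `κ_{l,i}`, `c_{l,i}` of the fractures. -/
structure Coefficients (G : FracturedDomain) where
  κ : Fin 2 → Pt → ℝ
  κf : Fin G.nf → Fin 2 → Pt → ℝ
  c : Fin 2 → Pt → ℝ
  cf : Fin G.nf → Fin 2 → Pt → ℝ
  measurable_κ : ∀ i, Measurable (κ i)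
  measurable_κf : ∀ l i, Measurable (κf l i)
  measurable_c : ∀ i, Measurable (c i)
  measurable_cf : ∀ l i, Measurable (cf l i)

namespace Coefficients

variable {G : FracturedDomain} (co : Coefficients G)

/-- `lo ≤ κᵢ, κ_{l,i} ≤ hi`. -/
def KappaBetween (lo hi : ℝ) : Prop :=
  (∀ i, ∀ x ∈ G.Ω, lo ≤ co.κ i x ∧ co.κ i x ≤ hi) ∧
    ∀ l i, ∀ x ∈ G.seg l, lo ≤ co.κf l i x ∧ co.κf l i x ≤ hi

/-- `lo ≤ cᵢ, c_{l,i} ≤ hi`. -/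
def CBetween (lo hi : ℝ) : Prop :=
  (∀ i, ∀ x ∈ G.Ω, lo ≤ co.c i x ∧ co.c i x ≤ hi) ∧
    ∀ l i, ∀ x ∈ G.seg l, lo ≤ co.cf l i x ∧ co.cf l i x ≤ hi

/-- The form `c(u, v)`. -/
def cForm (u v : Pt → Pair) : ℝ :=
  ∑ i : Fin 2, ((∫ x in G.Ω, co.c i x * u x i * v x i) +
    ∑ l, ∫ x in G.seg l, co.cf l i x * u x i * v x i ∂(Measure.hausdorffMeasure 1))

/-- The form `a(p, v)` with all integrals restricted to `D`; `P` and `Q` are the gradients of `p`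
and `v`. -/
def aForm (D : Set Pt) (P Q : Pt → GradPair) : ℝ :=
  ∑ i : Fin 2, ((∫ x in G.Ω ∩ D, co.κ i x * ⟪P x i, Q x i⟫_ℝ) +
    ∑ l, ∫ x in G.seg l ∩ D, co.κf l i x * ⟪P x i, Q x i⟫_ℝ ∂(Measure.hausdorffMeasure 1))

end Coefficients

/-- The form `q(p, v) = ∑ᵢ ∑ₗ ρσ ∫ (pᵢ - pₗ) vᵢ`, with the integral restricted to `D`. -/
def qForm (G : FracturedDomain) (ρ σ : ℝ) (D : Set Pt) (p v : Pt → Pair) : ℝ :=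
  ∑ i : Fin 2, ∑ l : Fin 2, ρ * σ * ∫ x in D, (p x i - p x l) * v x i ∂G.meas

/-- The form `a_Q = a + q`, restricted to `D`. -/
def aQ {G : FracturedDomain} (co : Coefficients G) (ρ σ : ℝ) (D : Set Pt) {ν : Measure Pt}
    (u v : EField ν) : ℝ :=
  co.aForm D u.2 v.2 + qForm G ρ σ D u.1 v.1

/-! ### The coarse grid -/

/-- The bilinear shape functions of the unit square, for the corners in cyclic order. -/
def refShape : Fin 4 → ℝ × ℝ → ℝ :=
  ![fun ξ => (1 - ξ.1) * (1 - ξ.2), fun ξ => ξ.1 * (1 - ξ.2), fun ξ => ξ.1 * ξ.2,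
    fun ξ => (1 - ξ.1) * ξ.2]

/-- The cross product of two vectors of the plane. -/
def cross (u v : Pt) : ℝ := u 0 * v 1 - u 1 * v 0

/-- A mesh of `N` quadrilaterals with `Nc` nodes: `vtx j a` is the number of the `a`-th corner
of the `j`-th element. -/
structure QuadMesh where
  N : ℕ
  Nc : ℕ
  pos : Fin Nc → Pt
  vtx : Fin N → Fin 4 → Fin Nc

namespace QuadMesh

variable (M : QuadMesh)

/-- The `a`-th corner of the `j`-th element. -/
def corner (j : Fin M.N) (a : Fin 4) : Pt := M.pos (M.vtx j a)

/-- The (closed) coarse element `K_j`. -/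
def elem (j : Fin M.N) : Set Pt := convexHull ℝ (range (M.corner j))

/-- `M` is a conforming partition of `Ω` into strictly convex quadrilaterals, whose corners are
listed counterclockwise: two elements meet in the convex hull of their common nodes. -/
structure IsCoarseGrid (G : FracturedDomain) : Prop where
  pos_injective : Function.Injective M.pos
  convex : ∀ j a, 0 < cross (M.corner j (a + 1) - M.corner j a) (M.corner j (a + 3) - M.corner j a)
  iUnion_elem : ⋃ j, M.elem j = closure G.Ω
  disjoint_interior : ∀ j j', j ≠ j' → Disjoint (interior (M.elem j)) (interior (M.elem j'))
  conforming : ∀ j j', j ≠ j' →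
    M.elem j ∩ M.elem j' = convexHull ℝ (M.pos '' (range (M.vtx j) ∩ range (M.vtx j')))

/-- The coarse mesh size `H`. -/
def meshSize : ℝ := ⨆ j, Metric.diam (M.elem j)

/-- The bilinear map of the unit square onto the `j`-th element. -/
def refMap (j : Fin M.N) (ξ : ℝ × ℝ) : Pt := ∑ a, refShape a ξ • M.corner j a

/-- The inverse of `refMap j` on the `j`-th element. -/
def localCoord (j : Fin M.N) (x : Pt) : ℝ × ℝ :=
  Function.invFunOn (M.refMap j) (Icc (0 : ℝ) 1 ×ˢ Icc (0 : ℝ) 1) x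

/-- The bilinear partition of unity function `χ_k` on the `j`-th element: the shape function
of the corner `k`, and zero when `k` is not a corner of the element. -/
def chi (j : Fin M.N) (k : Fin M.Nc) (x : Pt) : ℝ :=
  ∑ a, if M.vtx j a = k then refShape a (M.localCoord j x) else 0

/-- `∇χ_k` on the `j`-th element. -/
def gradChi (j : Fin M.N) (k : Fin M.Nc) (x : Pt) : Pt := gradientWithin (M.chi j k) (M.elem j) x

/-- `|∇χ_k| ≤ γ / H`. -/
def ShapeRegular (γ : ℝ) : Prop := ∀ j k, ∀ x ∈ M.elem j, ‖M.gradChi j k x‖ ≤ γ / M.meshSize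

/-- The bubble function of `K_j`: the product of the `χ_k` over the corners of `K_j`. -/
def bubble (j : Fin M.N) (x : Pt) : ℝ := ∏ a, M.chi j (M.vtx j a) x

/-- The elements of `K_j` enlarged by `m` coarse grid layers. -/
def layer (j : Fin M.N) : ℕ → Set (Fin M.N)
  | 0 => {j}
  | m + 1 => {j' | ∃ i ∈ layer j m, (M.elem i ∩ M.elem j').Nonempty}

/-- The oversampled domain `K_{j,m}`. -/
def oversampled (j : Fin M.N) (m : ℕ) : Set Pt := ⋃ i ∈ M.layer j m, M.elem i

end QuadMesh

/-! ### The multiscale space -/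

section Method

variable {G : FracturedDomain} (co : Coefficients G) (ρ σ : ℝ) (M : QuadMesh)

/-- The form `s^{(j)}(p, v)` with the weights `κ̃ᵢ = κᵢ ∑ₖ |∇χₖ|²` and
`κ̃_{l,i} = κ_{l,i} ∑ₖ |∇_f χₖ|²`. -/
def sForm (j : Fin M.N) (p v : Pt → Pair) : ℝ :=
  ∑ i : Fin 2, ((∫ x in G.Ω ∩ M.elem j,
      co.κ i x * (∑ k, ‖M.gradChi j k x‖ ^ 2) * p x i * v x i) +
    ∑ l, ∫ x in G.seg l ∩ M.elem j,
      co.κf l i x * (∑ k, ‖(G.tangent l).starProjection (M.gradChi j k x)‖ ^ 2) *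
        p x i * v x i ∂(Measure.hausdorffMeasure 1))

/-- Local functions on `K_j`. -/
abbrev LocalField (G : FracturedDomain) (M : QuadMesh) (j : Fin M.N) :=
  EField (G.meas.restrict (M.elem j))

/-- `φ ∈ V(K_j)` solves `a_Q^{(j)}(φ, v) = lam s^{(j)}(φ, v)` for all `v ∈ V(K_j)`. -/
def IsEigen (j : Fin M.N) (lam : ℝ) (φ : LocalField G M j) : Prop :=
  φ ∈ G.VRestr (M.elem j) ∧
    ∀ v ∈ G.VRestr (M.elem j), aQ co ρ σ (M.elem j) φ v = lam * sForm co M j φ.1 v.1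

/-- `lam 0 ≤ lam 1 ≤ …` are all the eigenvalues of the spectral problem on `K_j`, listed with
multiplicity, and `φ 0, φ 1, …` are corresponding `s^{(j)}`-orthogonal eigenfunctions. -/
structure IsSpectralSequence (j : Fin M.N) (lam : ℕ → ℝ) (φ : ℕ → LocalField G M j) : Prop where
  eigen : ∀ k, IsEigen co ρ σ M j (lam k) (φ k)
  ne_zero : ∀ k, φ k ≠ 0
  orthogonal : ∀ k k', k ≠ k' → sForm co M j (φ k).1 (φ k').1 = 0
  monotone : Monotone lam
  complete : ∀ (μ : ℝ) (w : LocalField G M j), IsEigen co ρ σ M j μ w →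
    w ∈ Submodule.span ℝ (φ '' {k | lam k = μ})

/-- The local auxiliary space `V_aux^{(j)}`, spanned by the first `n` eigenfunctions. -/
def auxSpace (j : Fin M.N) (n : ℕ) (φ : ℕ → LocalField G M j) : Submodule ℝ (LocalField G M j) :=
  Submodule.span ℝ (φ '' Iio n)

/-- `ψ` is `φ_k^{(j)}`-orthogonal: `s(ψ, φ_{k'}^{(j')}) = δ_{jj'} δ_{kk'}`, where each
`φ_{k'}^{(j')}` is extended by zero from `K_{j'}`. -/
def IsPhiOrthogonal (L : Fin M.N → ℕ) (φ : (j : Fin M.N) → ℕ → LocalField G M j)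
    (j : Fin M.N) (k : ℕ) (ψ : EField G.meas) : Prop :=
  ∀ j', ∀ k' < L j', sForm co M j' ψ.1 (φ j' k').1 = if j = j' ∧ k = k' then 1 else 0

/-- `ψ j k`, `k < L j`, are the localized multiscale basis functions: `ψ j k` minimizes
`a_Q(ψ, ψ)` over the `φ_k^{(j)}`-orthogonal `ψ ∈ V₀(K_{j,m})`. -/
def IsMultiscaleBasis (L : Fin M.N → ℕ) (φ : (j : Fin M.N) → ℕ → LocalField G M j) (m : ℕ)
    (ψ : Fin M.N → ℕ → EField G.meas) : Prop :=
  ∀ j, ∀ k < L j,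
    ψ j k ∈ {w : EField G.meas | w ∈ G.V0 (M.oversampled j m) ∧ IsPhiOrthogonal co M L φ j k w} ∧
    IsMinOn (fun w : EField G.meas => aQ co ρ σ univ w w)
      {w : EField G.meas | w ∈ G.V0 (M.oversampled j m) ∧ IsPhiOrthogonal co M L φ j k w} (ψ j k)

/-- `V_ms = span {ψ j k : k < L j}`. -/
def msSpace (L : Fin M.N → ℕ) (ψ : Fin M.N → ℕ → EField G.meas) : Submodule ℝ (EField G.meas) :=
  Submodule.span ℝ {w | ∃ j, ∃ k < L j, w = ψ j k}

/-- `w` is the `a_Q`-elliptic projection of `u` onto `W`. -/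
def IsEllipticProjection (W : Submodule ℝ (EField G.meas)) (u w : EField G.meas) : Prop :=
  w ∈ W ∧ ∀ v ∈ W, aQ co ρ σ univ w v = aQ co ρ σ univ u v

/-- `p` solves, on `[0, T]`, `c(∂p/∂t, v) + a_Q(p, v) = (f, v)` for all `v ∈ W`, with
`p(t) ∈ W` and initial value `p0`. Here `p ∈ L²(0, T; V)`, and `dp = ∂p/∂t` is the
time derivative of `p`, in `L²(0, T; [L²(Ω)]²)`. -/
def IsSolution (W : Submodule ℝ (EField G.meas)) (T : ℝ) (f : ℝ → L2 G.meas) (p0 : EField G.meas)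
    (p : ℝ → EField G.meas) : Prop :=
  p 0 = p0 ∧ (∀ t ∈ Icc 0 T, p t ∈ W) ∧ MemLp p 2 (volume.restrict (Ioc 0 T)) ∧
    ∃ dp : ℝ → L2 G.meas, MemLp dp 2 (volume.restrict (Ioc 0 T)) ∧
      (∀ t ∈ Icc 0 T, (p t).1 = p0.1 + ∫ s in (0 : ℝ)..t, dp s) ∧
      ∀ᵐ t ∂(volume.restrict (Ioc 0 T)), ∀ v ∈ W,
        co.cForm (dp t) v.1 + aQ co ρ σ univ (p t) v = ⟪f t, v.1⟫_ℝ

end Method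

end

end DualContinuum

open DualContinuum

namespace DualContinuum

noncomputable section

open scoped Topology ENNReal Convolution
open Filter (atTop Tendsto)
open ENNReal (ofReal ofReal_ne_top toReal_ofReal ofReal_mul ofReal_le_ofReal)
open Finset (sum_le_sum sum_congr mul_sum sum_nonneg sum_eq_zero single_le_sum sum_eq_single sum_add_distrib sum_image
  sum_const sum_subset sum_smul sum_mul sum_eq_single_of_mem sum_coe_sort prod_nonneg prod_le_one)

/-- A nonnegative symmetric bilinear form with bounded quadratic form is continuous. -/
lemma exists_continuousBilin {E : Type*} [NormedAddCommGroup E] [NormedSpace ℝ E]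
    (b : E → E → ℝ) (hadd : ∀ u u' v, b (u + u') v = b u v + b u' v)
    (hsmul : ∀ (r : ℝ) u v, b (r • u) v = r * b u v) (hsymm : ∀ u v, b u v = b v u)
    (hpos : ∀ u, 0 ≤ b u u) (C : ℝ) (hC : ∀ u, b u u ≤ C * ‖u‖ ^ 2) :
    ∃ B : E →L[ℝ] E →L[ℝ] ℝ, ∀ u v, B u v = b u v := by
  let B₀ : E →ₗ[ℝ] E →ₗ[ℝ] ℝ := LinearMap.mk₂ ℝ b hadd hsmul (fun u v v' => by rw [hsymm, hadd, hsymm v, hsymm v'])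
    (fun r u v => by rw [hsymm, hsmul, hsymm]; rfl)
  have hCS : ∀ u v, b u v ^ 2 ≤ b u u * b v v := fun u v => by
    have h := LinearMap.BilinForm.apply_mul_apply_le_of_forall_zero_le B₀ hpos u v
    have e1 : B₀ u v = b u v := rfl
    have e2 : B₀ v u = b u v := (hsymm v u)
    rw [e1, e2] at h; rw [pow_two]; exact h
  refine ⟨B₀.mkContinuous₂ |C| fun u v => ?_, fun u v => rfl⟩
  have h1 : b u v ^ 2 ≤ (|C| * ‖u‖ * ‖v‖) ^ 2 := by
    refine (hCS u v).trans ?_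
    have hu : b u u ≤ |C| * ‖u‖ ^ 2 := (hC u).trans (by gcongr; exact le_abs_self C)
    have hv : b v v ≤ |C| * ‖v‖ ^ 2 := (hC v).trans (by gcongr; exact le_abs_self C)
    calc b u u * b v v ≤ (|C| * ‖u‖ ^ 2) * (|C| * ‖v‖ ^ 2) :=
          mul_le_mul hu hv (hpos v) (by positivity)
      _ = _ := by ring
  exact abs_le_of_sq_le_sq h1 (by positivity)

lemma integrable_mul_inner {X F : Type*} [MeasurableSpace X] [NormedAddCommGroup F]
    [InnerProductSpace ℝ F] {m : Measure X} {w : X → ℝ} {C : ℝ} {f g : X → F}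
    (hw : AEStronglyMeasurable w m) (hC : ∀ᵐ x ∂m, |w x| ≤ C) (hf : MemLp f 2 m)
    (hg : MemLp g 2 m) : Integrable (fun x => w x * ⟪f x, g x⟫_ℝ) m := by
  have h : Integrable (fun x => ⟪f x, g x⟫_ℝ) m := by
    refine (L2.integrable_inner (𝕜 := ℝ) (hf.toLp f) (hg.toLp g)).congr ?_
    filter_upwards [hf.coeFn_toLp, hg.coeFn_toLp] with x h1 h2
    rw [h1, h2]
  exact h.bdd_mul hw (c := C) (by simpa using hC)

lemma restrict_finsetSum {α ι : Type*} [MeasurableSpace α] (t : Finset ι) (m : ι → Measure α)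
    (s : Set α) : (∑ i ∈ t, m i).restrict s = ∑ i ∈ t, (m i).restrict s := by
  simp only [← Measure.restrictₗ_apply, map_sum]

namespace FracturedDomain

variable (G : FracturedDomain)

/-- Index of a piece of `Ω` (`0` for the matrix, `l + 1` for the `l`-th fracture), and a point. -/
abbrev Piece := Fin (G.nf + 1) × Pt

/-- Area on the matrix, arc length on the fractures. -/
def pieceMeas (o : Fin (G.nf + 1)) : Measure Pt := Fin.cases ((volume : Measure Pt).restrict G.Ω)
    (fun l => (Measure.hausdorffMeasure 1 : Measure Pt).restrict (G.seg l)) o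

/-- The aperture of a piece. -/
def aper (o : Fin (G.nf + 1)) : ℝ := Fin.cases 1 G.d o

@[simp] lemma pieceMeas_zero : G.pieceMeas 0 = (volume : Measure Pt).restrict G.Ω := rfl
@[simp] lemma pieceMeas_succ (l : Fin G.nf) :
    G.pieceMeas l.succ = (Measure.hausdorffMeasure 1 : Measure Pt).restrict (G.seg l) := rfl
@[simp] lemma aper_zero : G.aper 0 = 1 := rfl
@[simp] lemma aper_succ (l : Fin G.nf) : G.aper l.succ = G.d l := rfl

lemma aper_pos (o : Fin (G.nf + 1)) : 0 < G.aper o := by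
  refine Fin.cases ?_ (fun l => ?_) o
  · simp
  · simpa using G.d_pos l

/-- The disjoint union of the pieces. -/
def mu : Measure G.Piece := ∑ o, (G.pieceMeas o).map (fun x => (o, x))

lemma meas_eq : G.meas = ∑ o, ofReal (G.aper o) • G.pieceMeas o := by rw [Fin.sum_univ_succ]; simp [meas, seg]

instance : IsFiniteMeasure G.meas := by
  have h0 : IsFiniteMeasure ((volume : Measure Pt).restrict G.Ω) := ⟨by simpa using G.isBounded.measure_lt_top⟩
  have h1 : ∀ l, IsFiniteMeasure ((Measure.hausdorffMeasure 1 : Measure Pt).restrict (G.seg l)) :=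
    fun l => ⟨by simp [seg, hausdorffMeasure_segment, edist_lt_top]⟩
  unfold meas
  have : ∀ l, IsFiniteMeasure (ofReal (G.d l) •
      (Measure.hausdorffMeasure 1 : Measure Pt).restrict (G.seg l)) := fun l =>
    MeasureTheory.Measure.smul_finite _ ofReal_ne_top
  infer_instance

lemma measurable_mk (o : Fin (G.nf + 1)) : Measurable (fun x : Pt => ((o, x) : G.Piece)) :=
  measurable_const.prodMk measurable_id

lemma measurableEmbedding_mk (o : Fin (G.nf + 1)) : MeasurableEmbedding (fun x : Pt => ((o, x) : G.Piece)) :=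
  MeasurableEmbedding.prodMk_left o MeasurableEmbedding.id

lemma pieceMeas_le (o : Fin (G.nf + 1)) : G.pieceMeas o ≤ ofReal (G.aper o)⁻¹ • G.meas := by
  have h : ofReal (G.aper o) • G.pieceMeas o ≤ G.meas := by
    rw [meas_eq]
    exact single_le_sum (f := fun o => ofReal (G.aper o) • G.pieceMeas o)
      (fun _ _ => Measure.zero_le _) (Finset.mem_univ o)
  have e : G.pieceMeas o = ofReal (G.aper o)⁻¹ • (ofReal (G.aper o) • G.pieceMeas o) := by
    rw [smul_smul, ← ofReal_mul (inv_nonneg.2 (G.aper_pos o).le), inv_mul_cancel₀ (G.aper_pos o).ne']; simp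
  rw [e]; gcongr

lemma map_snd_mu : G.mu.map Prod.snd = ∑ o, G.pieceMeas o := by
  rw [mu, ← Measure.mapₗ_apply_of_measurable measurable_snd, map_sum]
  refine sum_congr rfl fun o _ => ?_
  rw [Measure.mapₗ_apply_of_measurable measurable_snd, Measure.map_map measurable_snd (G.measurable_mk o)]
  exact Measure.map_id

/-- The reciprocal of the smallest aperture, up to a harmless factor. -/
def aperInv : ℝ := ∑ o, (G.aper o)⁻¹

lemma aperInv_nonneg : 0 ≤ G.aperInv := sum_nonneg fun o _ => inv_nonneg.2 (G.aper_pos o).le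

lemma one_le_aperInv_mul (o : Fin (G.nf + 1)) : 1 ≤ G.aperInv * G.aper o := by
  have : (G.aper o)⁻¹ ≤ G.aperInv := single_le_sum (f := fun o => (G.aper o)⁻¹)
    (fun o _ => inv_nonneg.2 (G.aper_pos o).le) (Finset.mem_univ o)
  calc (1 : ℝ) = (G.aper o)⁻¹ * G.aper o := (inv_mul_cancel₀ (G.aper_pos o).ne').symm
    _ ≤ _ := by gcongr; exact (G.aper_pos o).le

/-- An upper bound of the apertures. -/
def aperSup : ℝ := ∑ o, G.aper o

lemma aper_le_aperSup (o : Fin (G.nf + 1)) : G.aper o ≤ G.aperSup :=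
  single_le_sum (f := G.aper) (fun o _ => (G.aper_pos o).le) (Finset.mem_univ o)

lemma one_le_aperSup : 1 ≤ G.aperSup := by simpa using G.aper_le_aperSup 0

lemma map_snd_mu_le : G.mu.map Prod.snd ≤ ofReal G.aperInv • G.meas := by
  rw [map_snd_mu, aperInv, ENNReal.ofReal_sum_of_nonneg fun o _ => inv_nonneg.2 (G.aper_pos o).le, sum_smul]
  exact sum_le_sum fun o _ => G.pieceMeas_le o

lemma ae_mu_iff {P : G.Piece → Prop} : (∀ᵐ z ∂G.mu, P z) ↔ ∀ o, ∀ᵐ x ∂G.pieceMeas o, P (o, x) := by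
  rw [mu, ← Measure.sum_fintype, Measure.ae_sum_iff]
  exact forall_congr' fun o => (G.measurableEmbedding_mk o).ae_map_iff

lemma ae_meas_iff {P : Pt → Prop} : (∀ᵐ x ∂G.meas, P x) ↔ ∀ o, ∀ᵐ x ∂G.pieceMeas o, P x := by
  rw [meas_eq, ← Measure.sum_fintype, Measure.ae_sum_iff]
  refine forall_congr' fun o => ?_
  rw [Measure.ae_ennreal_smul_measure_eq]; simpa using G.aper_pos o

lemma ae_mu_snd_iff {P : Pt → Prop} : (∀ᵐ z ∂G.mu, P z.2) ↔ ∀ᵐ x ∂G.meas, P x := by rw [ae_mu_iff, ae_meas_iff]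

lemma mu_restrict {D : Set Pt} (hD : MeasurableSet D) :
    G.mu.restrict (Prod.snd ⁻¹' D) = ∑ o, ((G.pieceMeas o).restrict D).map (fun x => (o, x)) := by
  rw [mu, restrict_finsetSum]
  refine sum_congr rfl fun o _ => ?_
  rw [Measure.restrict_map (G.measurable_mk o) (measurable_snd hD)]; rfl

lemma integrableOn_mu_iff {D : Set Pt} (hD : MeasurableSet D) {F : Type*} [NormedAddCommGroup F]
    {f : G.Piece → F} : IntegrableOn f (Prod.snd ⁻¹' D) G.mu ↔
      ∀ o, IntegrableOn (fun x => f (o, x)) D (G.pieceMeas o) := by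
  rw [IntegrableOn, mu_restrict G hD, integrable_finsetSum_measure]; simp only [Finset.mem_univ, true_implies]
  exact forall_congr' fun o => (G.measurableEmbedding_mk o).integrable_map_iff

lemma setIntegral_mu {D : Set Pt} (hD : MeasurableSet D) {F : Type*} [NormedAddCommGroup F]
    [NormedSpace ℝ F] {f : G.Piece → F} (hf : IntegrableOn f (Prod.snd ⁻¹' D) G.mu) :
    ∫ z in Prod.snd ⁻¹' D, f z ∂G.mu = ∑ o, ∫ x in D, f (o, x) ∂G.pieceMeas o := by
  have hf' := (G.integrableOn_mu_iff hD).1 hf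
  rw [mu_restrict G hD, integral_finsetSum_measure]
  · exact sum_congr rfl fun o _ => (G.measurableEmbedding_mk o).integral_map _
  · intro o _; exact (G.measurableEmbedding_mk o).integrable_map_iff.2 (hf' o)

lemma map_snd_mu_restrict_le {D : Set Pt} (hD : MeasurableSet D) :
    (G.mu.restrict (Prod.snd ⁻¹' D)).map Prod.snd ≤ ofReal G.aperInv • G.meas.restrict D := by
  rw [← Measure.restrict_map measurable_snd hD, ← Measure.restrict_smul]
  exact Measure.restrict_mono subset_rfl G.map_snd_mu_le

lemma memLp_snd {D : Set Pt} (hD : MeasurableSet D) {F : Type*} [NormedAddCommGroup F] {f : Pt → F}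
    {p : ℝ≥0∞} (hf : MemLp f p (G.meas.restrict D)) :
    MemLp (fun z : G.Piece => f z.2) p (G.mu.restrict (Prod.snd ⁻¹' D)) :=
  (hf.of_measure_le_smul (c := ofReal G.aperInv) ofReal_ne_top
    (G.map_snd_mu_restrict_le hD)).comp_of_map measurable_snd.aemeasurable

lemma setIntegral_meas {D : Set Pt} (hD : MeasurableSet D) {f : Pt → ℝ} (hf : IntegrableOn f D G.meas) :
    ∫ x in D, f x ∂G.meas = ∫ z in Prod.snd ⁻¹' D, G.aper z.1 * f z.2 ∂G.mu := by
  have h1 : ∀ o, IntegrableOn f D (G.pieceMeas o) := fun o =>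
    Integrable.of_measure_le_smul (c := ofReal (G.aper o)⁻¹) ofReal_ne_top
      (by rw [← Measure.restrict_smul]; exact Measure.restrict_mono subset_rfl (G.pieceMeas_le o)) hf
  rw [setIntegral_mu G hD (f := fun z => G.aper z.1 * f z.2)
    ((G.integrableOn_mu_iff hD).2 fun o => (h1 o).const_mul _)]
  rw [meas_eq, restrict_finsetSum, integral_finsetSum_measure]
  · refine sum_congr rfl fun o _ => ?_
    rw [Measure.restrict_smul, integral_smul_measure, toReal_ofReal (G.aper_pos o).le, smul_eq_mul]
    exact (integral_const_mul _ _).symm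
  · intro o _; rw [Measure.restrict_smul]
    exact (h1 o).smul_measure ofReal_ne_top

end FracturedDomain

variable {G : FracturedDomain}

/-- The weighted form `∑ᵢ ∫_D wᵢ uᵢ vᵢ` over the matrix and the fractures. -/
def wForm (w : Fin 2 → G.Piece → ℝ) (D : Set Pt) (u v : Pt → Pair) : ℝ :=
  ∫ z in Prod.snd ⁻¹' D, ∑ i, w i z * (u z.2 i * v z.2 i) ∂G.mu

/-- A nonnegative bounded weight on `D`. -/
structure IsWeight (w : Fin 2 → G.Piece → ℝ) (D : Set Pt) (C : ℝ) : Prop where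
  meas : ∀ i, AEStronglyMeasurable (w i) (G.mu.restrict (Prod.snd ⁻¹' D))
  nonneg : ∀ i, ∀ᵐ z ∂G.mu.restrict (Prod.snd ⁻¹' D), 0 ≤ w i z
  le : ∀ i, ∀ᵐ z ∂G.mu.restrict (Prod.snd ⁻¹' D), w i z ≤ C

lemma IsWeight.integrable {w : Fin 2 → G.Piece → ℝ} {D : Set Pt} {C : ℝ} (h : IsWeight w D C)
    (hD : MeasurableSet D) {F : Type*} [NormedAddCommGroup F] [InnerProductSpace ℝ F] (i : Fin 2)
    {f g : Pt → F} (hf : MemLp f 2 (G.meas.restrict D)) (hg : MemLp g 2 (G.meas.restrict D)) :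
    IntegrableOn (fun z => w i z * ⟪f z.2, g z.2⟫_ℝ) (Prod.snd ⁻¹' D) G.mu := by
  refine integrable_mul_inner (C := C) (h.meas i) ?_ (G.memLp_snd hD hf) (G.memLp_snd hD hg)
  filter_upwards [h.nonneg i, h.le i] with z h1 h2
  rw [abs_of_nonneg h1]; exact h2

lemma MemLp.pair_apply {m : Measure Pt} {u : Pt → Pair} {p : ℝ≥0∞} (hu : MemLp u p m) (i : Fin 2) :
    MemLp (fun x => u x i) p m :=
  (EuclideanSpace.proj (𝕜 := ℝ) i).lipschitz.comp_memLp (by simp) hu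

lemma MemLp.gradPair_apply {m : Measure Pt} {u : Pt → GradPair} {p : ℝ≥0∞} (hu : MemLp u p m)
    (i : Fin 2) : MemLp (fun x => u x i) p m :=
  (PiLp.proj (𝕜 := ℝ) 2 (fun _ : Fin 2 => Pt) i).lipschitz.comp_memLp (by simp) hu

lemma IsWeight.integrable_pair {w : Fin 2 → G.Piece → ℝ} {D : Set Pt} {C : ℝ} (h : IsWeight w D C)
    (hD : MeasurableSet D) {u v : Pt → Pair} (hu : MemLp u 2 (G.meas.restrict D))
    (hv : MemLp v 2 (G.meas.restrict D)) (i : Fin 2) :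
    IntegrableOn (fun z => w i z * (u z.2 i * v z.2 i)) (Prod.snd ⁻¹' D) G.mu := by
  have := h.integrable hD i (MemLp.pair_apply hu i) (MemLp.pair_apply hv i)
  refine this.congr (.of_forall fun z => ?_)
  simp [mul_comm]

lemma IsWeight.integrable_sum {w : Fin 2 → G.Piece → ℝ} {D : Set Pt} {C : ℝ} (h : IsWeight w D C)
    (hD : MeasurableSet D) {u v : Pt → Pair} (hu : MemLp u 2 (G.meas.restrict D))
    (hv : MemLp v 2 (G.meas.restrict D)) :
    IntegrableOn (fun z => ∑ i, w i z * (u z.2 i * v z.2 i)) (Prod.snd ⁻¹' D) G.mu :=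
  integrable_finsetSum _ fun i _ => h.integrable_pair hD hu hv i

/-- The coefficients of the forms as functions on the disjoint union of the pieces. -/
def Coefficients.kap (co : Coefficients G) (i : Fin 2) (z : G.Piece) : ℝ :=
  Fin.cases (co.κ i z.2) (fun l => co.κf l i z.2) z.1

def Coefficients.cap (co : Coefficients G) (i : Fin 2) (z : G.Piece) : ℝ :=
  Fin.cases (co.c i z.2) (fun l => co.cf l i z.2) z.1

lemma measurable_piece {β : Type*} [MeasurableSpace β] {f : G.Piece → β}
    (h : ∀ o, Measurable fun x => f (o, x)) : Measurable f :=
  measurable_from_prod_countable_right h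

lemma Coefficients.measurable_kap (co : Coefficients G) (i : Fin 2) : Measurable (co.kap i) := by
  refine measurable_piece fun o => ?_
  refine Fin.cases ?_ (fun l => ?_) o
  · exact co.measurable_κ i
  · exact co.measurable_κf l i

lemma Coefficients.measurable_cap (co : Coefficients G) (i : Fin 2) : Measurable (co.cap i) := by
  refine measurable_piece fun o => ?_
  refine Fin.cases ?_ (fun l => ?_) o
  · exact co.measurable_c i
  · exact co.measurable_cf l i

lemma measurableSet_seg (l : Fin G.nf) : MeasurableSet (G.seg l) := (by
    have : IsCompact (G.seg l) := by
      rw [FracturedDomain.seg, segment_eq_image_lineMap]; exact isCompact_Icc.image (AffineMap.lineMap_continuous)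
    exact this.isClosed.measurableSet)

lemma ae_mu_of_forall {P : G.Piece → Prop} (h0 : ∀ x ∈ G.Ω, P (0, x))
    (h1 : ∀ l, ∀ x ∈ G.seg l, P (l.succ, x)) : ∀ᵐ z ∂G.mu, P z := by
  rw [G.ae_mu_iff]; intro o
  refine Fin.cases ?_ (fun l => ?_) o
  · exact (ae_restrict_iff' G.isOpen.measurableSet).2 (.of_forall h0)
  · exact (ae_restrict_iff' (measurableSet_seg l)).2 (.of_forall (h1 l))

lemma Coefficients.KappaBetween.ae {co : Coefficients G} {lo hi : ℝ} (h : co.KappaBetween lo hi) :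
    ∀ᵐ z ∂G.mu, ∀ i, lo ≤ co.kap i z ∧ co.kap i z ≤ hi :=
  ae_mu_of_forall (fun x hx i => h.1 i x hx) (fun l x hx i => h.2 l i x hx)

lemma Coefficients.CBetween.ae {co : Coefficients G} {lo hi : ℝ} (h : co.CBetween lo hi) :
    ∀ᵐ z ∂G.mu, ∀ i, lo ≤ co.cap i z ∧ co.cap i z ≤ hi :=
  ae_mu_of_forall (fun x hx i => h.1 i x hx) (fun l x hx i => h.2 l i x hx)

lemma Coefficients.KappaBetween.isWeight {co : Coefficients G} {lo hi : ℝ} (hlo : 0 < lo)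
    (h : co.KappaBetween lo hi) (D : Set Pt) : IsWeight co.kap D hi where
  meas i := (co.measurable_kap i).aestronglyMeasurable
  nonneg i := ae_restrict_of_ae (h.ae.mono fun z hz => hlo.le.trans (hz i).1)
  le i := ae_restrict_of_ae (h.ae.mono fun z hz => (hz i).2)

lemma Coefficients.CBetween.isWeight {co : Coefficients G} {lo hi : ℝ} (hlo : 0 < lo)
    (h : co.CBetween lo hi) (D : Set Pt) : IsWeight co.cap D hi where
  meas i := (co.measurable_cap i).aestronglyMeasurable
  nonneg i := ae_restrict_of_ae (h.ae.mono fun z hz => hlo.le.trans (hz i).1)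
  le i := ae_restrict_of_ae (h.ae.mono fun z hz => (hz i).2)

variable (G) in
/-- The aperture as a weight. -/
def aperW (_ : Fin 2) (z : G.Piece) : ℝ := G.aper z.1

lemma isWeight_aperW (D : Set Pt) : IsWeight (aperW G) D G.aperSup where
  meas i := (measurable_piece fun o => measurable_const).aestronglyMeasurable
  nonneg i := .of_forall fun z => (G.aper_pos _).le
  le i := .of_forall fun z => G.aper_le_aperSup _

lemma sum_swap_setIntegral {D : Set Pt} (hD : MeasurableSet D) {f : Fin 2 → G.Piece → ℝ}
    (hf : ∀ i, IntegrableOn (f i) (Prod.snd ⁻¹' D) G.mu) :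
    ∫ z in Prod.snd ⁻¹' D, ∑ i, f i z ∂G.mu = ∑ i, ((∫ x in G.Ω ∩ D, f i (0, x)) +
        ∑ l, ∫ x in G.seg l ∩ D, f i (Fin.succ l, x) ∂(Measure.hausdorffMeasure 1)) := by
  rw [integral_finsetSum _ fun i _ => hf i]
  refine sum_congr rfl fun i _ => ?_
  rw [G.setIntegral_mu hD (hf i), Fin.sum_univ_succ]
  simp only [FracturedDomain.pieceMeas_zero, FracturedDomain.pieceMeas_succ,
    Measure.restrict_restrict hD, Set.inter_comm D]

lemma cForm_eq {co : Coefficients G} {lo hi : ℝ} (hlo : 0 < lo) (h : co.CBetween lo hi)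
    {u v : Pt → Pair} (hu : MemLp u 2 G.meas) (hv : MemLp v 2 G.meas) :
    co.cForm u v = wForm co.cap univ u v := by
  rw [wForm, sum_swap_setIntegral MeasurableSet.univ fun i =>
    (h.isWeight hlo univ).integrable_pair MeasurableSet.univ (by simpa using hu) (by simpa using hv) i]
  simp [Coefficients.cForm, Coefficients.cap, mul_assoc]

variable {M : QuadMesh}

/-- The weight `∑ₖ |∇χₖ|²`, with the tangential gradient on the fractures. -/
def chiWeight (G : FracturedDomain) (M : QuadMesh) (j : Fin M.N) (z : G.Piece) : ℝ :=
  Fin.cases (∑ k, ‖M.gradChi j k z.2‖ ^ 2) (fun l => ∑ k, ‖(G.tangent l).starProjection (M.gradChi j k z.2)‖ ^ 2) z.1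

/-- The weight of the form `s`. -/
def sWeight (co : Coefficients G) (M : QuadMesh) (j : Fin M.N) (i : Fin 2) (z : G.Piece) : ℝ :=
  co.kap i z * chiWeight G M j z

lemma measurableSet_elem (j : Fin M.N) : MeasurableSet (M.elem j) :=
  ((Set.finite_range _).isCompact_convexHull (𝕜 := ℝ)).isClosed.measurableSet

lemma sForm_eq {co : Coefficients G} {C : ℝ} {j : Fin M.N} (h : IsWeight (sWeight co M j) (M.elem j) C)
    {u v : Pt → Pair} (hu : MemLp u 2 (G.meas.restrict (M.elem j)))
    (hv : MemLp v 2 (G.meas.restrict (M.elem j))) :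
    sForm co M j u v = wForm (sWeight co M j) (M.elem j) u v := by
  rw [wForm, sum_swap_setIntegral (measurableSet_elem j) fun i =>
    h.integrable_pair (measurableSet_elem j) hu hv i]
  simp [sForm, sWeight, chiWeight, Coefficients.kap, mul_assoc]

/-- The density of the form `a_Q`; the first components are the values, the second components are
the gradients. -/
def aDen (co : Coefficients G) (ρ σ : ℝ) (z : G.Piece) (U V : Pair × GradPair) : ℝ :=
  ∑ i, co.kap i z * ⟪U.2 i, V.2 i⟫_ℝ + ρ * σ * G.aper z.1 * ((U.1 0 - U.1 1) * (V.1 0 - V.1 1))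

/-- Values and gradients of a field. -/
def st {ν : Measure Pt} (u : EField ν) (x : Pt) : Pair × GradPair := (u.1 x, u.2 x)

/-- The integral of the density of `a_Q` over `D`. -/
def aInt (co : Coefficients G) (ρ σ : ℝ) (D : Set Pt) (u v : Pt → Pair × GradPair) : ℝ :=
  ∫ z in Prod.snd ⁻¹' D, aDen co ρ σ z (u z.2) (v z.2) ∂G.mu

lemma MemLp.prod_fst {m : Measure Pt} {u : Pt → Pair × GradPair} {p : ℝ≥0∞} (hu : MemLp u p m) :
    MemLp (fun x => (u x).1) p m :=
  (ContinuousLinearMap.fst ℝ Pair GradPair).lipschitz.comp_memLp (by simp) hu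

lemma MemLp.prod_snd {m : Measure Pt} {u : Pt → Pair × GradPair} {p : ℝ≥0∞} (hu : MemLp u p m) :
    MemLp (fun x => (u x).2) p m :=
  (ContinuousLinearMap.snd ℝ Pair GradPair).lipschitz.comp_memLp (by simp) hu

lemma MemLp.prod_of {m : Measure Pt} {u : Pt → Pair × GradPair} {p : ℝ≥0∞}
    (h1 : MemLp (fun x => (u x).1) p m) (h2 : MemLp (fun x => (u x).2) p m) : MemLp u p m := by
  have h3 := ((ContinuousLinearMap.inl ℝ Pair GradPair).lipschitz.comp_memLp (by simp) h1).add
    ((ContinuousLinearMap.inr ℝ Pair GradPair).lipschitz.comp_memLp (by simp) h2)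
  refine h3.ae_eq (.of_forall fun x => ?_)
  simp

lemma memLp_st {ν : Measure Pt} (u : EField ν) : MemLp (st u) 2 ν := MemLp.prod_of (Lp.memLp u.1) (Lp.memLp u.2)

lemma memLp_diff {m : Measure Pt} {u : Pt → Pair} {p : ℝ≥0∞} (hu : MemLp u p m) : MemLp (fun x => u x 0 - u x 1) p m :=
  (MemLp.pair_apply hu 0).sub (MemLp.pair_apply hu 1)

lemma integrable_qDen {D : Set Pt} (hD : MeasurableSet D) {u v : Pt → Pair}
    (hu : MemLp u 2 (G.meas.restrict D)) (hv : MemLp v 2 (G.meas.restrict D)) :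
    IntegrableOn (fun z : G.Piece => G.aper z.1 * ((u z.2 0 - u z.2 1) * (v z.2 0 - v z.2 1)))
      (Prod.snd ⁻¹' D) G.mu := by
  refine ((isWeight_aperW D).integrable hD 0 (memLp_diff hu) (memLp_diff hv)).congr (.of_forall fun z => ?_)
  simp [aperW, mul_comm]

lemma integrable_kap_inner {w : Fin 2 → G.Piece → ℝ} {C : ℝ} {D : Set Pt} (hw : IsWeight w D C)
    (hD : MeasurableSet D) {u v : Pt → Pair × GradPair} (hu : MemLp u 2 (G.meas.restrict D))
    (hv : MemLp v 2 (G.meas.restrict D)) (i : Fin 2) :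
    IntegrableOn (fun z => w i z * ⟪(u z.2).2 i, (v z.2).2 i⟫_ℝ) (Prod.snd ⁻¹' D) G.mu := by
  have h1 := MemLp.gradPair_apply (u := fun x => (u x).2) (MemLp.prod_snd hu) i
  have h2 := MemLp.gradPair_apply (u := fun x => (v x).2) (MemLp.prod_snd hv) i
  exact hw.integrable (F := Pt) hD i (f := fun x => (u x).2 i) (g := fun x => (v x).2 i) h1 h2

lemma integrable_aDen {co : Coefficients G} {ρ σ C : ℝ} {D : Set Pt} (hw : IsWeight co.kap D C)
    (hD : MeasurableSet D) {u v : Pt → Pair × GradPair} (hu : MemLp u 2 (G.meas.restrict D))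
    (hv : MemLp v 2 (G.meas.restrict D)) :
    IntegrableOn (fun z => aDen co ρ σ z (u z.2) (v z.2)) (Prod.snd ⁻¹' D) G.mu := by
  have h1 : IntegrableOn (fun z => ∑ i, co.kap i z * ⟪(u z.2).2 i, (v z.2).2 i⟫_ℝ)
      (Prod.snd ⁻¹' D) G.mu := integrable_finsetSum _ fun i _ => integrable_kap_inner hw hD hu hv i
  have h2 := (integrable_qDen hD (MemLp.prod_fst hu) (MemLp.prod_fst hv)).const_mul (ρ * σ)
  refine (h1.add h2).congr (.of_forall fun z => ?_)
  simp only [aDen, Pi.add_apply]; ring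

lemma aQ_eq {co : Coefficients G} {ρ σ C : ℝ} {D : Set Pt} (hw : IsWeight co.kap D C)
    (hD : MeasurableSet D) {ν : Measure Pt} (hν : G.meas.restrict D ≤ ν) (u v : EField ν) :
    aQ co ρ σ D u v = aInt co ρ σ D (st u) (st v) := by
  have hu := (memLp_st u).mono_measure hν
  have hv := (memLp_st v).mono_measure hν
  have h1 : ∀ i, IntegrableOn (fun z => co.kap i z * ⟪(st u z.2).2 i, (st v z.2).2 i⟫_ℝ)
      (Prod.snd ⁻¹' D) G.mu := fun i => integrable_kap_inner hw hD hu hv i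
  have hu1 : MemLp u.1 2 (G.meas.restrict D) := (Lp.memLp u.1).mono_measure hν
  have hv1 : MemLp v.1 2 (G.meas.restrict D) := (Lp.memLp v.1).mono_measure hν
  have h2 := integrable_qDen hD hu1 hv1
  have hm : ∀ i l : Fin 2, IntegrableOn (fun x => (u.1 x i - u.1 x l) * v.1 x i) D G.meas :=
    fun i l => ((MemLp.pair_apply hu1 i).sub (MemLp.pair_apply hu1 l)).integrable_mul (MemLp.pair_apply hv1 i)
  have h3 : qForm G ρ σ D u.1 v.1 = ρ * σ * ∫ x in D, (u.1 x 0 - u.1 x 1) * (v.1 x 0 - v.1 x 1) ∂G.meas := by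
    have e : ∀ x, (u.1 x 0 - u.1 x 1) * (v.1 x 0 - v.1 x 1) =
        (u.1 x 0 - u.1 x 1) * v.1 x 0 + (u.1 x 1 - u.1 x 0) * v.1 x 1 := fun x => by ring
    simp only [qForm, Fin.sum_univ_two, sub_self, zero_mul, integral_zero, mul_zero, zero_add, add_zero, e]
    rw [integral_add (hm 0 1) (hm 1 0)]; ring
  have h4 : IntegrableOn (fun x => (u.1 x 0 - u.1 x 1) * (v.1 x 0 - v.1 x 1)) D G.meas :=
    (memLp_diff hu1).integrable_mul (memLp_diff hv1)
  have h5 : aInt co ρ σ D (st u) (st v) =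
      (∫ z in Prod.snd ⁻¹' D, ∑ i, co.kap i z * ⟪(st u z.2).2 i, (st v z.2).2 i⟫_ℝ ∂G.mu) +
      ∫ z in Prod.snd ⁻¹' D, ρ * σ * (G.aper z.1 * ((u.1 z.2 0 - u.1 z.2 1) * (v.1 z.2 0 - v.1 z.2 1))) ∂G.mu := by
    rw [← integral_add (integrable_finsetSum _ fun i _ => h1 i) (h2.const_mul _)]
    refine integral_congr_ae (.of_forall fun z => ?_)
    simp only [aDen, st]; ring
  rw [h5, sum_swap_setIntegral hD h1, integral_const_mul, aQ, h3, G.setIntegral_meas hD h4]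
  simp [Coefficients.aForm, Coefficients.kap, st]

section Density

variable (co : Coefficients G) (ρ σ : ℝ) (z : G.Piece)

lemma aDen_symm (U V : Pair × GradPair) : aDen co ρ σ z U V = aDen co ρ σ z V U := by
  simp only [aDen, real_inner_comm]; ring_nf

lemma aDen_add_left (U U' V : Pair × GradPair) :
    aDen co ρ σ z (U + U') V = aDen co ρ σ z U V + aDen co ρ σ z U' V := by
  simp [aDen, Fin.sum_univ_two, inner_add_left]; ring

lemma aDen_smul_left (r : ℝ) (U V : Pair × GradPair) : aDen co ρ σ z (r • U) V = r * aDen co ρ σ z U V := by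
  simp [aDen, Fin.sum_univ_two, real_inner_smul_left]; ring

lemma aDen_sub_left (U U' V : Pair × GradPair) :
    aDen co ρ σ z (U - U') V = aDen co ρ σ z U V - aDen co ρ σ z U' V := by
  simp [aDen, Fin.sum_univ_two, inner_sub_left]; ring

lemma aDen_self (U : Pair × GradPair) : aDen co ρ σ z U U =
    ∑ i, co.kap i z * ‖U.2 i‖ ^ 2 + ρ * σ * G.aper z.1 * (U.1 0 - U.1 1) ^ 2 := by
  simp [aDen, real_inner_self_eq_norm_sq, pow_two]

variable {co ρ σ z}

lemma aDen_self_nonneg (hk : ∀ i, 0 ≤ co.kap i z) (h : 0 ≤ ρ * σ) (U : Pair × GradPair) : 0 ≤ aDen co ρ σ z U U := by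
  rw [aDen_self]
  have := G.aper_pos z.1
  have h1 : 0 ≤ ∑ i, co.kap i z * ‖U.2 i‖ ^ 2 := sum_nonneg fun i _ => mul_nonneg (hk i) (sq_nonneg _)
  positivity

/-- Young's inequality for the density of `a_Q`. -/
lemma two_aDen_le (hk : ∀ i, 0 ≤ co.kap i z) (h : 0 ≤ ρ * σ) {t : ℝ} (ht : 0 < t) (U V : Pair × GradPair) :
    2 * |aDen co ρ σ z U V| ≤ t * aDen co ρ σ z U U + t⁻¹ * aDen co ρ σ z V V := by
  have hs : ∀ W, aDen co ρ σ z W (t • U) = t * aDen co ρ σ z U W := fun W => by rw [aDen_symm, aDen_smul_left]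
  have h1 := aDen_self_nonneg hk h (t • U - V)
  have h2 := aDen_self_nonneg hk h (t • U + V)
  rw [aDen_sub_left, aDen_symm co ρ σ z _ (t • U - V), aDen_symm co ρ σ z _ (t • U - V),
    aDen_sub_left, aDen_sub_left, aDen_smul_left, aDen_smul_left, hs, hs] at h1
  rw [aDen_add_left, aDen_symm co ρ σ z _ (t • U + V), aDen_symm co ρ σ z _ (t • U + V),
    aDen_add_left, aDen_add_left, aDen_smul_left, aDen_smul_left, hs, hs] at h2
  rw [abs_eq_max_neg, mul_max_of_nonneg _ _ (by norm_num : (0:ℝ) ≤ 2)]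
  have key : ∀ x y w : ℝ, 0 ≤ t * (t * x) + 2 * (t * y) + w → - (2 * y) ≤ t * x + t⁻¹ * w := by
    intro x y w hxy
    have : 0 ≤ t⁻¹ * (t * (t * x) + 2 * (t * y) + w) := mul_nonneg (inv_nonneg.2 ht.le) hxy
    have e : t⁻¹ * (t * (t * x) + 2 * (t * y) + w) = t * x + 2 * y + t⁻¹ * w := by field_simp
    linarith
  refine max_le ?_ ?_
  · have := key (aDen co ρ σ z U U) (- aDen co ρ σ z U V) (aDen co ρ σ z V V) (by linarith)
    linarith
  · have := key (aDen co ρ σ z U U) (aDen co ρ σ z U V) (aDen co ρ σ z V V) (by linarith)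
    linarith

lemma aDen_add_self_le (hk : ∀ i, 0 ≤ co.kap i z) (h : 0 ≤ ρ * σ) (U V : Pair × GradPair) :
    aDen co ρ σ z (U + V) (U + V) ≤ 2 * aDen co ρ σ z U U + 2 * aDen co ρ σ z V V := by
  have h1 := aDen_self_nonneg hk h (U - V)
  rw [aDen_sub_left, aDen_symm co ρ σ z _ (U - V), aDen_symm co ρ σ z _ (U - V), aDen_sub_left, aDen_sub_left] at h1
  rw [aDen_add_left, aDen_symm co ρ σ z _ (U + V), aDen_symm co ρ σ z _ (U + V), aDen_add_left, aDen_add_left]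
  linarith [aDen_symm co ρ σ z U V]

end Density

lemma norm_sq_L2 {α F : Type*} [MeasurableSpace α] {ν : Measure α} [NormedAddCommGroup F]
    [InnerProductSpace ℝ F] (f : Lp F 2 ν) : ‖f‖ ^ 2 = ∫ x, ‖f x‖ ^ 2 ∂ν := by
  rw [← real_inner_self_eq_norm_sq, L2.inner_def]; simp

lemma norm_sq_L2_restrict {α F : Type*} [MeasurableSpace α] {m ν : Measure α} [NormedAddCommGroup F]
    [InnerProductSpace ℝ F] (h : m = ν) (f : Lp F 2 ν) : ‖f‖ ^ 2 = ∫ x, ‖f x‖ ^ 2 ∂m := by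
  subst h; exact norm_sq_L2 f

lemma integrable_norm_sq {α F : Type*} [MeasurableSpace α] {ν : Measure α} [NormedAddCommGroup F]
    {f : α → F} (hf : MemLp f 2 ν) : Integrable (fun x => ‖f x‖ ^ 2) ν :=
  (memLp_two_iff_integrable_sq_norm hf.1).1 hf

lemma integrable_aper_norm_sq {D : Set Pt} (hD : MeasurableSet D) {F : Type*} [NormedAddCommGroup F]
    [InnerProductSpace ℝ F] {f : Pt → F} (hf : MemLp f 2 (G.meas.restrict D)) :
    IntegrableOn (fun z : G.Piece => G.aper z.1 * ‖f z.2‖ ^ 2) (Prod.snd ⁻¹' D) G.mu := by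
  refine ((isWeight_aperW D).integrable hD 0 hf hf).congr (.of_forall fun z => ?_)
  simp [aperW]

lemma setIntegral_aper_norm_sq {D : Set Pt} (hD : MeasurableSet D) {F : Type*} [NormedAddCommGroup F]
    [InnerProductSpace ℝ F] {f : Pt → F} (hf : MemLp f 2 (G.meas.restrict D)) :
    ∫ z in Prod.snd ⁻¹' D, G.aper z.1 * ‖f z.2‖ ^ 2 ∂G.mu = ∫ x in D, ‖f x‖ ^ 2 ∂G.meas :=
  (G.setIntegral_meas hD (integrable_norm_sq hf)).symm

lemma setIntegral_aper_norm_sq_le {D : Set Pt} (hD : MeasurableSet D) {F : Type*}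
    [NormedAddCommGroup F] [InnerProductSpace ℝ F] {ν : Measure Pt} (hν : G.meas.restrict D ≤ ν)
    (f : Lp F 2 ν) : ∫ z in Prod.snd ⁻¹' D, G.aper z.1 * ‖f z.2‖ ^ 2 ∂G.mu ≤ ‖f‖ ^ 2 := by
  rw [setIntegral_aper_norm_sq hD ((Lp.memLp f).mono_measure hν), norm_sq_L2]
  exact integral_mono_measure hν (.of_forall fun x => sq_nonneg _) (integrable_norm_sq (Lp.memLp f))

/-! ### Algebra of the form `a_Q` -/

lemma ae_restrict_kap_nonneg {co : Coefficients G} {lo hi : ℝ} (hlo : 0 < lo)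
    (h : co.KappaBetween lo hi) (D : Set G.Piece) :
    ∀ᵐ z ∂G.mu.restrict D, ∀ i, 0 ≤ co.kap i z :=
  ae_restrict_of_ae (h.ae.mono fun z hz i => hlo.le.trans (hz i).1)

lemma ae_snd_of_ae {D : Set Pt} (hD : MeasurableSet D) {P : Pt → Prop}
    (h : ∀ᵐ x ∂G.meas.restrict D, P x) : ∀ᵐ z ∂G.mu.restrict (Prod.snd ⁻¹' D), P z.2 := by
  rw [ae_restrict_iff' (measurable_snd hD)]; exact G.ae_mu_snd_iff.2 ((ae_restrict_iff' hD).1 h)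

lemma aInt_congr {co : Coefficients G} {ρ σ : ℝ} {D : Set Pt} (hD : MeasurableSet D)
    {u u' v v' : Pt → Pair × GradPair} (hu : u =ᵐ[G.meas.restrict D] u')
    (hv : v =ᵐ[G.meas.restrict D] v') : aInt co ρ σ D u v = aInt co ρ σ D u' v' := by
  refine integral_congr_ae ?_
  filter_upwards [ae_snd_of_ae hD hu, ae_snd_of_ae hD hv] with z h1 h2
  rw [h1, h2]

lemma st_add {ν : Measure Pt} (u v : EField ν) : st (u + v) =ᵐ[ν] fun x => st u x + st v x := by
  filter_upwards [Lp.coeFn_add u.1 v.1, Lp.coeFn_add u.2 v.2] with x h1 h2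
  simp only [st, Prod.fst_add, Prod.snd_add, h1, h2]; rfl

lemma st_sub {ν : Measure Pt} (u v : EField ν) : st (u - v) =ᵐ[ν] fun x => st u x - st v x := by
  filter_upwards [Lp.coeFn_sub u.1 v.1, Lp.coeFn_sub u.2 v.2] with x h1 h2
  simp only [st, Prod.fst_sub, Prod.snd_sub, h1, h2]; rfl

lemma st_smul {ν : Measure Pt} (r : ℝ) (v : EField ν) : st (r • v) =ᵐ[ν] fun x => r • st v x := by
  filter_upwards [Lp.coeFn_smul r v.1, Lp.coeFn_smul r v.2] with x h1 h2
  simp only [st, Prod.smul_fst, Prod.smul_snd, h1, h2]; rfl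

lemma exists_aQ_bilin {co : Coefficients G} {ρ σ lo hi : ℝ} (hlo : 0 < lo)
    (h : co.KappaBetween lo hi) (hρσ : 0 ≤ ρ * σ) {D : Set Pt} (hD : MeasurableSet D)
    {ν : Measure Pt} (hν : G.meas.restrict D ≤ ν) :
    ∃ B : EField ν →L[ℝ] EField ν →L[ℝ] ℝ, ∀ u v, B u v = aQ co ρ σ D u v := by
  have hw := h.isWeight hlo D
  have hm : ∀ u : EField ν, MemLp (st u) 2 (G.meas.restrict D) := fun u => (memLp_st u).mono_measure hν
  have hac := Measure.ae_le_iff_absolutelyContinuous.2 (Measure.absolutelyContinuous_of_le hν)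
  simp only [aQ_eq hw hD hν]
  refine exists_continuousBilin _ ?_ ?_ ?_ ?_ (hi * G.aperInv + 2 * (ρ * σ) + (hi * G.aperInv + 2 * (ρ * σ))) ?_
  · intro u u' v; rw [aInt_congr hD (v := st v) ((st_add u u').filter_mono hac) ae_eq_rfl]
    unfold aInt; rw [← integral_add (integrable_aDen hw hD (hm u) (hm v)) (integrable_aDen hw hD (hm u') (hm v))]
    simp only [aDen_add_left]
  · intro r u v; rw [aInt_congr hD (v := st v) ((st_smul r u).filter_mono hac) ae_eq_rfl]
    unfold aInt; rw [← integral_const_mul]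
    simp only [aDen_smul_left]
  · intro u v; unfold aInt
    simp only [aDen_symm co ρ σ _ (st u _)]
  · intro u
    exact integral_nonneg_of_ae ((ae_restrict_kap_nonneg hlo h _).mono fun z hz => aDen_self_nonneg hz hρσ _)
  · intro u
    set K := hi * G.aperInv + 2 * (ρ * σ)
    have i1 := integrable_aper_norm_sq hD (MemLp.prod_fst (hm u))
    have i2 := integrable_aper_norm_sq hD (MemLp.prod_snd (hm u))
    have hle : aInt co ρ σ D (st u) (st u) ≤ ∫ z in Prod.snd ⁻¹' D,
        K * (G.aper z.1 * ‖u.1 z.2‖ ^ 2 + G.aper z.1 * ‖u.2 z.2‖ ^ 2) ∂G.mu := by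
      refine integral_mono_ae (integrable_aDen hw hD (hm u) (hm u)) ((i1.add i2).const_mul K) ?_
      filter_upwards [ae_restrict_of_ae h.ae] with z hz
      rw [aDen_self]; simp only [st]
      have hi0 : 0 ≤ hi := hlo.le.trans ((hz 0).1.trans (hz 0).2)
      have e1 : ‖u.2 z.2‖ ^ 2 = ∑ i, ‖u.2 z.2 i‖ ^ 2 := PiLp.norm_sq_eq_of_L2 _ _
      have e2 : ‖u.1 z.2‖ ^ 2 = u.1 z.2 0 ^ 2 + u.1 z.2 1 ^ 2 := by simp [EuclideanSpace.norm_sq_eq, Fin.sum_univ_two]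
      have ha := G.aper_pos z.1
      have h1 : ∑ i, co.kap i z * ‖u.2 z.2 i‖ ^ 2 ≤ hi * ‖u.2 z.2‖ ^ 2 := by
        rw [e1, mul_sum]; exact sum_le_sum fun i _ => by gcongr; exact (hz i).2
      have h2 : hi * ‖u.2 z.2‖ ^ 2 ≤ hi * (G.aperInv * G.aper z.1) * ‖u.2 z.2‖ ^ 2 := by
        gcongr
        exact le_mul_of_one_le_right hi0 (G.one_le_aperInv_mul _)
      have h3 : ρ * σ * G.aper z.1 * (u.1 z.2 0 - u.1 z.2 1) ^ 2 ≤ ρ * σ * G.aper z.1 * (2 * ‖u.1 z.2‖ ^ 2) := by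
        gcongr
        rw [e2]; nlinarith [sq_nonneg (u.1 z.2 0 + u.1 z.2 1)]
      have h4 : 0 ≤ hi * G.aperInv * (G.aper z.1 * ‖u.1 z.2‖ ^ 2) := by
        have := G.aperInv_nonneg; positivity
      have h5 : 0 ≤ 2 * (ρ * σ) * (G.aper z.1 * ‖u.2 z.2‖ ^ 2) := by positivity
      simp only [K]; linarith
    have hi0 : 0 ≤ hi := by
      obtain ⟨x, hx⟩ := G.nonempty
      exact hlo.le.trans ((h.1 0 x hx).1.trans (h.1 0 x hx).2)
    have hK0 : 0 ≤ K := by have := G.aperInv_nonneg; positivity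
    refine hle.trans ?_
    have e3 := integral_add i1 i2
    simp only [st] at e3; rw [integral_const_mul, e3]
    have j1 := setIntegral_aper_norm_sq_le hD hν u.1
    have j2 := setIntegral_aper_norm_sq_le hD hν u.2
    have j3 : ‖u.1‖ ^ 2 ≤ ‖u‖ ^ 2 := by gcongr; exact norm_fst_le u
    have j4 : ‖u.2‖ ^ 2 ≤ ‖u‖ ^ 2 := by gcongr; exact norm_snd_le u
    calc K * (_ + _) ≤ K * (‖u‖ ^ 2 + ‖u‖ ^ 2) := by
          refine mul_le_mul_of_nonneg_left ?_ hK0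
          exact add_le_add (j1.trans j3) (j2.trans j4)
      _ = _ := by ring

/-- Coercivity of `a_Q` with respect to the gradients. -/
lemma norm_grad_sq_le {co : Coefficients G} {ρ σ lo hi : ℝ} (hlo : 0 < lo)
    (h : co.KappaBetween lo hi) (hρσ : 0 ≤ ρ * σ) {D : Set Pt} (hD : MeasurableSet D)
    {ν : Measure Pt} (hν : G.meas.restrict D = ν) (u : EField ν) :
    lo * ‖u.2‖ ^ 2 ≤ G.aperSup * aQ co ρ σ D u u := by
  have hw := h.isWeight hlo D
  have hm : MemLp (st u) 2 (G.meas.restrict D) := hν ▸ memLp_st u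
  rw [aQ_eq hw hD hν.le, norm_sq_L2_restrict hν]; change lo * ∫ x in D, ‖(st u x).2‖ ^ 2 ∂G.meas ≤ _
  rw [← setIntegral_aper_norm_sq hD (MemLp.prod_snd hm)]; unfold aInt
  rw [← integral_const_mul, ← integral_const_mul]
  refine integral_mono_ae ((integrable_aper_norm_sq hD (MemLp.prod_snd hm)).const_mul _)
    ((integrable_aDen hw hD hm hm).const_mul _) ?_
  filter_upwards [ae_restrict_of_ae h.ae] with z hz
  rw [aDen_self]
  have ha := G.aper_pos z.1
  have e1 : ‖(st u z.2).2‖ ^ 2 = ∑ i, ‖(st u z.2).2 i‖ ^ 2 := PiLp.norm_sq_eq_of_L2 _ _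
  have h1 : lo * ‖(st u z.2).2‖ ^ 2 ≤ ∑ i, co.kap i z * ‖(st u z.2).2 i‖ ^ 2 := by
    rw [e1, mul_sum]; exact sum_le_sum fun i _ => by gcongr; exact (hz i).1
  have h2 := G.aper_le_aperSup z.1
  have h3 : 0 ≤ ρ * σ * G.aper z.1 * ((st u z.2).1 0 - (st u z.2).1 1) ^ 2 := by positivity
  calc lo * (G.aper z.1 * ‖(st u z.2).2‖ ^ 2) = G.aper z.1 * (lo * ‖(st u z.2).2‖ ^ 2) := by ring
    _ ≤ G.aperSup * (lo * ‖(st u z.2).2‖ ^ 2) := by gcongr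
    _ ≤ _ := by
      refine mul_le_mul_of_nonneg_left (by linarith) (ha.le.trans h2)

/-! ### Weighted forms -/

lemma wForm_congr {w : Fin 2 → G.Piece → ℝ} {D : Set Pt} (hD : MeasurableSet D)
    {u u' v v' : Pt → Pair} (hu : u =ᵐ[G.meas.restrict D] u')
    (hv : v =ᵐ[G.meas.restrict D] v') : wForm w D u v = wForm w D u' v' := by
  refine integral_congr_ae ?_
  filter_upwards [ae_snd_of_ae hD hu, ae_snd_of_ae hD hv] with z h1 h2
  rw [h1, h2]

lemma wForm_self_nonneg {w : Fin 2 → G.Piece → ℝ} {D : Set Pt} {C : ℝ} (hw : IsWeight w D C)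
    (u : Pt → Pair) : 0 ≤ wForm w D u u := by
  refine integral_nonneg_of_ae ?_
  filter_upwards [hw.nonneg 0, hw.nonneg 1] with z h0 h1
  simp only [Fin.sum_univ_two, Pi.zero_apply]
  nlinarith [mul_self_nonneg (u z.2 0), mul_self_nonneg (u z.2 1), mul_nonneg h0 (mul_self_nonneg (u z.2 0)), mul_nonneg h1 (mul_self_nonneg (u z.2 1))]

lemma wForm_mono {w w' : Fin 2 → G.Piece → ℝ} {D : Set Pt} {C C' : ℝ} (hD : MeasurableSet D)
    (hw : IsWeight w D C) (hw' : IsWeight w' D C') {u : Pt → Pair}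
    (hu : MemLp u 2 (G.meas.restrict D))
    (h : ∀ᵐ z ∂G.mu.restrict (Prod.snd ⁻¹' D), ∀ i, w i z ≤ w' i z) :
    wForm w D u u ≤ wForm w' D u u := by
  refine integral_mono_ae (hw.integrable_sum hD hu hu) (hw'.integrable_sum hD hu hu) ?_
  filter_upwards [h] with z hz
  exact sum_le_sum fun i _ => mul_le_mul_of_nonneg_right (hz i) (mul_self_nonneg _)

lemma wForm_const_smul (r : ℝ) (w : Fin 2 → G.Piece → ℝ) (D : Set Pt) (u v : Pt → Pair) :
    wForm (fun i z => r * w i z) D u v = r * wForm w D u v := by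
  unfold wForm; rw [← integral_const_mul]
  simp only [mul_sum, mul_assoc]

lemma wForm_aperW {D : Set Pt} (hD : MeasurableSet D) {u : Pt → Pair}
    (hu : MemLp u 2 (G.meas.restrict D)) : wForm (aperW G) D u u = ∫ x in D, ‖u x‖ ^ 2 ∂G.meas := by
  rw [← setIntegral_aper_norm_sq hD hu, wForm]
  refine integral_congr_ae (.of_forall fun z => ?_)
  simp only [EuclideanSpace.norm_sq_eq, aperW, mul_sum]; simp [pow_two]

lemma IsWeight.const_smul {w : Fin 2 → G.Piece → ℝ} {D : Set Pt} {C r : ℝ} (hr : 0 ≤ r)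
    (hw : IsWeight w D C) : IsWeight (fun i z => r * w i z) D (r * C) where
  meas i := (hw.meas i).const_mul r
  nonneg i := (hw.nonneg i).mono fun _ hz => mul_nonneg hr hz
  le i := (hw.le i).mono fun _ hz => mul_le_mul_of_nonneg_left hz hr

lemma wForm_le {w : Fin 2 → G.Piece → ℝ} {D : Set Pt} {C : ℝ} (hD : MeasurableSet D)
    (hw : IsWeight w D C) (hC : 0 ≤ C) {ν : Measure Pt} (hν : G.meas.restrict D ≤ ν) (u : L2 ν) :
    wForm w D u u ≤ C * G.aperInv * ‖u‖ ^ 2 := by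
  have hu : MemLp u 2 (G.meas.restrict D) := (Lp.memLp u).mono_measure hν
  have hc : 0 ≤ C * G.aperInv := mul_nonneg hC G.aperInv_nonneg
  have h1 := wForm_mono hD hw ((isWeight_aperW D).const_smul hc) hu ?_
  · rw [wForm_const_smul, wForm_aperW hD hu, ← setIntegral_aper_norm_sq hD hu] at h1
    exact h1.trans (mul_le_mul_of_nonneg_left (setIntegral_aper_norm_sq_le hD hν u) hc)
  · filter_upwards [hw.le 0, hw.le 1] with z h0 h1 i
    have : C ≤ C * G.aperInv * G.aper z.1 := by
      rw [mul_assoc]; exact le_mul_of_one_le_right hC (G.one_le_aperInv_mul _)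
    fin_cases i
    · exact h0.trans this
    · exact h1.trans this

lemma le_wForm {w : Fin 2 → G.Piece → ℝ} {D : Set Pt} {C c : ℝ} (hD : MeasurableSet D)
    (hw : IsWeight w D C) (hc : 0 ≤ c)
    (h : ∀ᵐ z ∂G.mu.restrict (Prod.snd ⁻¹' D), ∀ i, c ≤ w i z)
    {ν : Measure Pt} (hν : G.meas.restrict D = ν) (u : L2 ν) :
    c * ‖u‖ ^ 2 ≤ G.aperSup * wForm w D u u := by
  have hu : MemLp u 2 (G.meas.restrict D) := hν ▸ (Lp.memLp u)
  have hs := G.one_le_aperSup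
  have h1 := wForm_mono hD ((isWeight_aperW (G := G) D).const_smul hc) (hw.const_smul (zero_le_one.trans hs)) hu ?_
  · rw [wForm_const_smul, wForm_const_smul, wForm_aperW hD hu] at h1; rwa [norm_sq_L2_restrict hν]
  · filter_upwards [h] with z hz i
    calc c * aperW G i z ≤ c * G.aperSup := by gcongr; exact G.aper_le_aperSup _
      _ = G.aperSup * c := mul_comm _ _
      _ ≤ _ := by gcongr; exact hz i

lemma exists_wForm_bilin {w : Fin 2 → G.Piece → ℝ} {D : Set Pt} {C : ℝ} (hD : MeasurableSet D)
    (hw : IsWeight w D C) (hC : 0 ≤ C) {ν : Measure Pt} (hν : G.meas.restrict D ≤ ν) :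
    ∃ B : L2 ν →L[ℝ] L2 ν →L[ℝ] ℝ, ∀ u v, B u v = wForm w D u v := by
  have hm : ∀ u : L2 ν, MemLp u 2 (G.meas.restrict D) := fun u => (Lp.memLp u).mono_measure hν
  have hac := Measure.ae_le_iff_absolutelyContinuous.2 (Measure.absolutelyContinuous_of_le hν)
  refine exists_continuousBilin (fun u v : L2 ν => wForm w D u v) ?_ ?_ ?_ ?_ (C * G.aperInv)
    (fun u => wForm_le hD hw hC hν u)
  · intro u u' v; rw [wForm_congr hD (v := v) ((Lp.coeFn_add u u').filter_mono hac) ae_eq_rfl]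
    unfold wForm; rw [← integral_add (hw.integrable_sum hD (hm u) (hm v)) (hw.integrable_sum hD (hm u') (hm v))]
    refine integral_congr_ae (.of_forall fun z => ?_)
    simp [Fin.sum_univ_two]; ring
  · intro r u v; rw [wForm_congr hD (v := v) ((Lp.coeFn_smul r u).filter_mono hac) ae_eq_rfl]
    unfold wForm; rw [← integral_const_mul]
    refine integral_congr_ae (.of_forall fun z => ?_)
    simp [Fin.sum_univ_two]; ring
  · intro u v
    refine integral_congr_ae (.of_forall fun z => ?_)
    simp [Fin.sum_univ_two]; ring
  · exact fun u => wForm_self_nonneg hw u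

/-! ### Restriction of fields -/

variable (G) in
/-- Restriction of fields to `D`. -/
def restrField (D : Set Pt) : EField G.meas →L[ℝ] EField (G.meas.restrict D) :=
  (LpToLpRestrictCLM Pt Pair ℝ G.meas 2 D).prodMap (LpToLpRestrictCLM Pt GradPair ℝ G.meas 2 D)

lemma restrField_fst (D : Set Pt) (u : EField G.meas) :
    (restrField G D u).1 =ᵐ[G.meas.restrict D] u.1 := LpToLpRestrictCLM_coeFn ℝ D u.1

lemma restrField_snd (D : Set Pt) (u : EField G.meas) :
    (restrField G D u).2 =ᵐ[G.meas.restrict D] u.2 := LpToLpRestrictCLM_coeFn ℝ D u.2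

lemma st_restrField (D : Set Pt) (u : EField G.meas) : st (restrField G D u) =ᵐ[G.meas.restrict D] st u := by
  filter_upwards [restrField_fst D u, restrField_snd D u] with x h1 h2
  simp only [st, h1, h2]

lemma restrField_mem (D : Set Pt) {u : EField G.meas} (hu : u ∈ G.V) : restrField G D u ∈ G.VRestr D := by
  have h : ∀ w ∈ Submodule.span ℝ {w : EField G.meas | ∃ φ : Pt → Pair, ContDiff ℝ ∞ φ ∧
      HasCompactSupport φ ∧ tsupport φ ⊆ G.Ω ∧ w.1 =ᵐ[G.meas] φ ∧ w.2 =ᵐ[G.meas] G.smoothGrad φ},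
      restrField G D w ∈ G.VRestr D := by
    intro w hw; induction hw using Submodule.span_induction with
    | mem w hw =>
      obtain ⟨φ, h1, h2, h3, h4, h5⟩ := hw
      exact Submodule.le_topologicalClosure _ (Submodule.subset_span ⟨φ, h1, h2, h3,
        (restrField_fst D w).trans (ae_restrict_of_ae h4),
        (restrField_snd D w).trans (ae_restrict_of_ae h5)⟩)
    | zero => simp
    | add a b _ _ ha hb => rw [map_add]; exact add_mem ha hb
    | smul r a _ ha => rw [map_smul]; exact Submodule.smul_mem _ r ha
  have hcl : IsClosed {w : EField G.meas | restrField G D w ∈ G.VRestr D} :=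
    (Submodule.isClosed_topologicalClosure _).preimage (restrField G D).continuous
  exact closure_minimal h hcl hu

lemma energySpace_mono {ν : Measure Pt} {U U' : Set Pt} (h : U ⊆ U') : energySpace G ν U ≤ energySpace G ν U' := by
  refine Submodule.topologicalClosure_mono (Submodule.span_mono ?_)
  rintro w ⟨φ, h1, h2, h3, h4⟩; exact ⟨φ, h1, h2, h3.trans h, h4⟩

lemma V0_le_V (D : Set Pt) : G.V0 D ≤ G.V := energySpace_mono inter_subset_left

lemma V0_mono {D D' : Set Pt} (h : D ⊆ D') : G.V0 D ≤ G.V0 D' :=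
  energySpace_mono (inter_subset_inter_right _ (interior_mono h))

lemma cross_apply (u v : Pt) : cross u v = u 0 * v 1 - u 1 * v 0 := rfl

lemma Pt.ext {x y : Pt} (h0 : x 0 = y 0) (h1 : x 1 = y 1) : x = y := by
  ext i; fin_cases i
  · exact h0
  · exact h1

lemma abs_cross_le (u v : Pt) : |cross u v| ≤ ‖u‖ * ‖v‖ := by
  refine abs_le_of_sq_le_sq ?_ (by positivity)
  rw [mul_pow, EuclideanSpace.norm_sq_eq, EuclideanSpace.norm_sq_eq]
  simp only [Fin.sum_univ_two, Real.norm_eq_abs, sq_abs, cross_apply]; nlinarith [sq_nonneg (u 0 * v 0 + u 1 * v 1)]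

/-- The clockwise rotation by a right angle, so that `⟪rotate u, v⟫ = cross v u`. -/
def rotate (u : Pt) : Pt := !₂[u 1, - u 0]

lemma inner_rotate (u v : Pt) : ⟪rotate u, v⟫_ℝ = cross v u := by
  simp [rotate, PiLp.inner_apply, Fin.sum_univ_two, cross_apply]; ring

lemma continuous_rotate : Continuous rotate := by
  refine (PiLp.continuous_toLp 2 _).comp (continuous_pi fun i => ?_)
  fin_cases i
  · exact (EuclideanSpace.proj (𝕜 := ℝ) (1 : Fin 2)).continuous
  · exact (EuclideanSpace.proj (𝕜 := ℝ) (0 : Fin 2)).continuous.neg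

/-- A quadrilateral with corners listed counterclockwise that is strictly convex. -/
def StrictQuad (q : Fin 4 → Pt) : Prop := ∀ a, 0 < cross (q (a + 1) - q a) (q (a + 3) - q a)

/-- The unit square. -/
abbrev unitSq : Set (ℝ × ℝ) := Icc (0 : ℝ) 1 ×ˢ Icc (0 : ℝ) 1

/-- The bilinear map of the unit square onto a quadrilateral. -/
def quadMap (q : Fin 4 → Pt) (ξ : ℝ × ℝ) : Pt := ∑ a, refShape a ξ • q a

def quadInv (q : Fin 4 → Pt) (x : Pt) : ℝ × ℝ := Function.invFunOn (quadMap q) unitSq x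

/-- The partial derivatives of `quadMap`. -/
def quadD1 (q : Fin 4 → Pt) (ξ : ℝ × ℝ) : Pt := (1 - ξ.2) • (q 1 - q 0) + ξ.2 • (q 2 - q 3)
def quadD2 (q : Fin 4 → Pt) (ξ : ℝ × ℝ) : Pt := (1 - ξ.1) • (q 3 - q 0) + ξ.1 • (q 2 - q 1)

def quadJac (q : Fin 4 → Pt) (ξ : ℝ × ℝ) : ℝ := cross (quadD1 q ξ) (quadD2 q ξ)

/-- The partial derivatives of the shape functions. -/
def shapeD1 : Fin 4 → ℝ × ℝ → ℝ := ![fun ξ => -(1 - ξ.2), fun ξ => 1 - ξ.2, fun ξ => ξ.2, fun ξ => -ξ.2]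
def shapeD2 : Fin 4 → ℝ × ℝ → ℝ := ![fun ξ => -(1 - ξ.1), fun ξ => -ξ.1, fun ξ => ξ.1, fun ξ => 1 - ξ.1]

lemma refShape_nonneg {ξ : ℝ × ℝ} (h : ξ ∈ unitSq) (a : Fin 4) : 0 ≤ refShape a ξ := by
  obtain ⟨⟨h1, h2⟩, h3, h4⟩ := h
  fin_cases a <;> simp [refShape] <;> apply mul_nonneg <;> linarith

lemma refShape_sum (ξ : ℝ × ℝ) : ∑ a, refShape a ξ = 1 := by simp [Fin.sum_univ_four, refShape]; ring

lemma refShape_le_one {ξ : ℝ × ℝ} (h : ξ ∈ unitSq) (a : Fin 4) : refShape a ξ ≤ 1 := by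
  rw [← refShape_sum ξ]
  exact single_le_sum (f := fun a => refShape a ξ) (fun a _ => refShape_nonneg h a) (Finset.mem_univ a)

lemma refShape_sub (a : Fin 4) (ξ η : ℝ × ℝ) : refShape a ξ - refShape a η =
    shapeD1 a (midpoint ℝ ξ η) * (ξ.1 - η.1) + shapeD2 a (midpoint ℝ ξ η) * (ξ.2 - η.2) := by
  fin_cases a <;> simp [refShape, shapeD1, shapeD2, midpoint_eq_smul_add] <;> ring

lemma quadMap_apply (q : Fin 4 → Pt) (ξ : ℝ × ℝ) (i : Fin 2) :
    quadMap q ξ i = (1 - ξ.1) * (1 - ξ.2) * q 0 i + ξ.1 * (1 - ξ.2) * q 1 i + ξ.1 * ξ.2 * q 2 i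
      + (1 - ξ.1) * ξ.2 * q 3 i := by
  simp [quadMap, Fin.sum_univ_four, refShape]

lemma quadMap_sub (q : Fin 4 → Pt) (ξ η : ℝ × ℝ) : quadMap q ξ - quadMap q η =
    (ξ.1 - η.1) • quadD1 q (midpoint ℝ ξ η) + (ξ.2 - η.2) • quadD2 q (midpoint ℝ ξ η) := by
  apply Pt.ext <;>
    simp [quadMap_apply, quadD1, quadD2, midpoint_eq_smul_add] <;> ring

lemma quadJac_eq (q : Fin 4 → Pt) (ξ : ℝ × ℝ) : quadJac q ξ = (1 - ξ.1) * (1 - ξ.2) * cross (q 1 - q 0) (q 3 - q 0)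
    + ξ.1 * (1 - ξ.2) * cross (q 2 - q 1) (q 0 - q 1)
    + ξ.1 * ξ.2 * cross (q 3 - q 2) (q 1 - q 2)
    + (1 - ξ.1) * ξ.2 * cross (q 0 - q 3) (q 2 - q 3) := by
  simp [quadJac, quadD1, quadD2, cross_apply]; ring

section Quad

variable {q : Fin 4 → Pt}

lemma StrictQuad.pos (hq : StrictQuad q) : 0 < cross (q 1 - q 0) (q 3 - q 0) ∧
    0 < cross (q 2 - q 1) (q 0 - q 1) ∧ 0 < cross (q 3 - q 2) (q 1 - q 2) ∧
    0 < cross (q 0 - q 3) (q 2 - q 3) := ⟨hq 0, hq 1, hq 2, hq 3⟩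

lemma StrictQuad.exists_jac_ge (hq : StrictQuad q) : ∃ c > 0, ∀ ξ ∈ unitSq, c ≤ quadJac q ξ := by
  obtain ⟨h0, h1, h2, h3⟩ := hq.pos
  set p0 := cross (q 1 - q 0) (q 3 - q 0)
  set p1 := cross (q 2 - q 1) (q 0 - q 1)
  set p2 := cross (q 3 - q 2) (q 1 - q 2)
  set p3 := cross (q 0 - q 3) (q 2 - q 3)
  refine ⟨min (min p0 p1) (min p2 p3), by simp [h0, h1, h2, h3], fun ξ hξ => ?_⟩
  set m := min (min p0 p1) (min p2 p3)
  have m0 : m ≤ p0 := (min_le_left _ _).trans (min_le_left _ _)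
  have m1 : m ≤ p1 := (min_le_left _ _).trans (min_le_right _ _)
  have m2 : m ≤ p2 := (min_le_right _ _).trans (min_le_left _ _)
  have m3 : m ≤ p3 := (min_le_right _ _).trans (min_le_right _ _)
  rw [quadJac_eq]
  obtain ⟨⟨a1, a2⟩, b1, b2⟩ := hξ
  have e : m = (1 - ξ.1) * (1 - ξ.2) * m + ξ.1 * (1 - ξ.2) * m + ξ.1 * ξ.2 * m
    + (1 - ξ.1) * ξ.2 * m := by ring
  rw [e]; gcongr

lemma StrictQuad.jac_pos (hq : StrictQuad q) {ξ : ℝ × ℝ} (h : ξ ∈ unitSq) : 0 < quadJac q ξ := by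
  obtain ⟨c, hc, h'⟩ := hq.exists_jac_ge
  exact hc.trans_le (h' ξ h)

lemma midpoint_mem_unitSq {ξ η : ℝ × ℝ} (h : ξ ∈ unitSq) (h' : η ∈ unitSq) : midpoint ℝ ξ η ∈ unitSq :=
  Convex.midpoint_mem ((convex_Icc 0 1).prod (convex_Icc 0 1)) h h'

lemma coord_sub_mul_jac (ξ η : ℝ × ℝ) : (ξ.1 - η.1) * quadJac q (midpoint ℝ ξ η) =
      cross (quadMap q ξ - quadMap q η) (quadD2 q (midpoint ℝ ξ η)) ∧
    (ξ.2 - η.2) * quadJac q (midpoint ℝ ξ η) = cross (quadD1 q (midpoint ℝ ξ η)) (quadMap q ξ - quadMap q η) := by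
  rw [quadMap_sub]; constructor <;> simp [quadJac, cross_apply] <;> ring

lemma StrictQuad.injOn (hq : StrictQuad q) : InjOn (quadMap q) unitSq := by
  intro ξ hξ η hη h
  have hJ := hq.jac_pos (midpoint_mem_unitSq hξ hη)
  obtain ⟨h1, h2⟩ := coord_sub_mul_jac (q := q) ξ η
  rw [h, sub_self] at h1 h2
  have z1 : cross 0 (quadD2 q (midpoint ℝ ξ η)) = 0 := by simp [cross_apply]
  have z2 : cross (quadD1 q (midpoint ℝ ξ η)) 0 = 0 := by simp [cross_apply]
  rw [z1] at h1; rw [z2] at h2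
  have := (mul_eq_zero.1 h1).resolve_right hJ.ne'
  have := (mul_eq_zero.1 h2).resolve_right hJ.ne'
  ext <;> linarith

lemma StrictQuad.cross_two_pos (hq : StrictQuad q) (a : Fin 4) : 0 < cross (q (a + 1) - q a) (q (a + 2) - q a) := by
  have := hq (a + 1)
  rw [show a + 1 + 1 = a + 2 by rw [add_assoc]; rfl, show a + 1 + 3 = a by rw [add_assoc]; simp] at this
  simp only [cross_apply, PiLp.sub_apply] at this ⊢; linarith

lemma convex_halfPlane (u p : Pt) : Convex ℝ {x | 0 ≤ cross u (x - p)} := by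
  have : {x : Pt | 0 ≤ cross u (x - p)} = {x | cross u p ≤ cross u x} := by
    ext x; simp [cross_apply, mul_sub]; constructor <;> intro h <;> linarith
  rw [this]
  refine convex_halfSpace_ge ⟨fun x y => ?_, fun c x => ?_⟩ _
  · simp [cross_apply]; ring
  · simp [cross_apply]; ring

lemma StrictQuad.cross_nonneg (hq : StrictQuad q) {x : Pt} (hx : x ∈ convexHull ℝ (range q))
    (a : Fin 4) : 0 ≤ cross (q (a + 1) - q a) (x - q a) := by
  refine convexHull_min ?_ (convex_halfPlane (q (a + 1) - q a) (q a)) hx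
  rintro _ ⟨b, rfl⟩
  obtain rfl | rfl | rfl | rfl : b = a ∨ b = a + 1 ∨ b = a + 2 ∨ b = a + 3 := by revert a b; decide
  · simp [cross_apply]
  · simp [cross_apply]; ring_nf; rfl
  · exact (hq.cross_two_pos _).le
  · exact (hq _).le

lemma eq_zero_of_cross {u w y : Pt} (h : cross u w ≠ 0) (h1 : cross u y = 0) (h2 : cross w y = 0) : y = 0 := by
  simp only [cross_apply] at *; apply Pt.ext
  · have : (u 0 * w 1 - u 1 * w 0) * y 0 = 0 := by linear_combination w 0 * h1 - u 0 * h2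
    simpa using (mul_eq_zero.1 this).resolve_left h
  · have : (u 0 * w 1 - u 1 * w 0) * y 1 = 0 := by linear_combination w 1 * h1 - u 1 * h2
    simpa using (mul_eq_zero.1 this).resolve_left h

lemma StrictQuad.mem_image (hq : StrictQuad q) {x : Pt}
    (hx : ∀ a, 0 ≤ cross (q (a + 1) - q a) (x - q a)) : x ∈ quadMap q '' unitSq := by
  have c0 := hx 0
  have c1 := hx 1
  have c2 := hx 2
  have c3 := hx 3
  have p0 := hq 0
  have p0' := hq.cross_two_pos 0
  have p2 := hq 2
  have p2' := hq.cross_two_pos 2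
  norm_num at c0 c1 c2 c3 p0 p0' p2 p2'
  simp only [show (3 : Fin 4) + 1 = 0 from rfl, show (2 : Fin 4) + 3 = 1 from rfl,
    show (2 : Fin 4) + 2 = 0 from rfl, show (2 : Fin 4) + 1 = 3 from rfl,
    show (1 : Fin 4) + 1 = 2 from rfl] at c0 c1 c2 c3 p0 p0' p2 p2'
  let P : ℝ → Pt := fun s => (1 - s) • q 0 + s • q 1
  let Q : ℝ → Pt := fun s => (1 - s) • q 3 + s • q 2
  let g : ℝ → ℝ := fun s => cross (Q s - P s) (x - P s)
  have hg : Continuous g := by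
    simp only [g, P, Q, cross_apply, PiLp.sub_apply, PiLp.add_apply, PiLp.smul_apply, smul_eq_mul]; fun_prop
  have g0 : g 0 ≤ 0 := by
    simp only [g, P, Q, cross_apply, PiLp.sub_apply, PiLp.add_apply, PiLp.smul_apply, smul_eq_mul] at c3 ⊢; nlinarith
  have g1 : 0 ≤ g 1 := by
    simp only [g, P, Q, cross_apply, PiLp.sub_apply, PiLp.add_apply, PiLp.smul_apply, smul_eq_mul] at c1 ⊢; nlinarith
  obtain ⟨s, ⟨hs0, hs1⟩, hs⟩ := intermediate_value_Icc zero_le_one hg.continuousOn ⟨g0, g1⟩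
  have hk : 0 < cross (q 1 - q 0) (Q s - P s) := by
    have e : cross (q 1 - q 0) (Q s - P s) =
        (1 - s) * cross (q 1 - q 0) (q 3 - q 0) + s * cross (q 1 - q 0) (q 2 - q 0) := by
      simp only [P, Q, cross_apply, PiLp.sub_apply, PiLp.add_apply, PiLp.smul_apply, smul_eq_mul]; ring
    rw [e]
    rcases hs0.eq_or_lt with h | h
    · rw [← h]; simpa using p0
    · have := sub_nonneg.2 hs1
      positivity
  have hk' : 0 < cross (q 3 - q 2) (P s - q 2) := by
    have e : cross (q 3 - q 2) (P s - q 2) =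
        (1 - s) * cross (q 3 - q 2) (q 0 - q 2) + s * cross (q 3 - q 2) (q 1 - q 2) := by
      simp only [P, cross_apply, PiLp.sub_apply, PiLp.add_apply, PiLp.smul_apply, smul_eq_mul]; ring
    rw [e]
    rcases hs0.eq_or_lt with h | h
    · rw [← h]; simpa using p2'
    · have := sub_nonneg.2 hs1
      positivity
  set t := cross (q 1 - q 0) (x - P s) / cross (q 1 - q 0) (Q s - P s) with ht
  have ht' : t * cross (q 1 - q 0) (Q s - P s) = cross (q 1 - q 0) (x - P s) := by rw [ht]; field_simp
  have hz : x - P s - t • (Q s - P s) = 0 := by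
    refine eq_zero_of_cross hk.ne' ?_ ?_
    · have e : cross (q 1 - q 0) (x - P s - t • (Q s - P s)) =
          cross (q 1 - q 0) (x - P s) - t * cross (q 1 - q 0) (Q s - P s) := by
        simp only [cross_apply, PiLp.sub_apply, PiLp.smul_apply, smul_eq_mul]; ring
      rw [e, ht', sub_self]
    · have e : cross (Q s - P s) (x - P s - t • (Q s - P s)) = cross (Q s - P s) (x - P s) := by
        simp only [cross_apply, PiLp.sub_apply, PiLp.smul_apply, smul_eq_mul]; ring
      rw [e]; exact hs
  have hx0 : x 0 = P s 0 + t * (Q s 0 - P s 0) := by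
    have := congrArg (fun v : Pt => v 0) hz
    simp at this; linarith
  have hx1 : x 1 = P s 1 + t * (Q s 1 - P s 1) := by
    have := congrArg (fun v : Pt => v 1) hz
    simp at this; linarith
  have t0 : 0 ≤ t := by
    refine div_nonneg ?_ hk.le
    have e : cross (q 1 - q 0) (x - P s) = cross (q 1 - q 0) (x - q 0) := by
      simp only [P, cross_apply, PiLp.sub_apply, PiLp.add_apply, PiLp.smul_apply, smul_eq_mul]; ring
    rw [e]; exact c0
  have t1 : t ≤ 1 := by
    have e : cross (q 3 - q 2) (x - q 2) = (1 - t) * cross (q 3 - q 2) (P s - q 2) := by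
      simp only [cross_apply, PiLp.sub_apply, hx0, hx1]
      simp only [P, Q, PiLp.add_apply, PiLp.smul_apply, smul_eq_mul]; ring
    rw [e] at c2
    have := nonneg_of_mul_nonneg_left c2 hk'
    linarith
  refine ⟨(s, t), ⟨⟨hs0, hs1⟩, t0, t1⟩, ?_⟩
  apply Pt.ext
  · rw [quadMap_apply, hx0]; simp only [P, Q, PiLp.add_apply, PiLp.smul_apply, smul_eq_mul]; ring
  · rw [quadMap_apply, hx1]; simp only [P, Q, PiLp.add_apply, PiLp.smul_apply, smul_eq_mul]; ring

lemma StrictQuad.surjOn (hq : StrictQuad q) : SurjOn (quadMap q) unitSq (convexHull ℝ (range q)) :=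
  fun _ hx => hq.mem_image fun a => hq.cross_nonneg hx a

lemma StrictQuad.quadInv_mem (hq : StrictQuad q) {x : Pt} (hx : x ∈ convexHull ℝ (range q)) :
    quadInv q x ∈ unitSq := Function.invFunOn_mem (hq.surjOn hx)

lemma StrictQuad.quadMap_quadInv (hq : StrictQuad q) {x : Pt} (hx : x ∈ convexHull ℝ (range q)) :
    quadMap q (quadInv q x) = x := Function.invFunOn_eq (hq.surjOn hx)

lemma quadMap_mem {ξ : ℝ × ℝ} (h : ξ ∈ unitSq) : quadMap q ξ ∈ convexHull ℝ (range q) :=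
  (convex_convexHull ℝ _).sum_mem (fun a _ => refShape_nonneg h a) (refShape_sum ξ)
    (fun a _ => subset_convexHull ℝ _ ⟨a, rfl⟩)

lemma StrictQuad.quadInv_quadMap (hq : StrictQuad q) {ξ : ℝ × ℝ} (h : ξ ∈ unitSq) : quadInv q (quadMap q ξ) = ξ :=
  hq.injOn (hq.quadInv_mem (quadMap_mem h)) h (hq.quadMap_quadInv (quadMap_mem h))

lemma continuous_quadD1 : Continuous (quadD1 q) := by unfold quadD1; fun_prop
lemma continuous_quadD2 : Continuous (quadD2 q) := by unfold quadD2; fun_prop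
lemma continuous_shapeD1 (a : Fin 4) : Continuous (shapeD1 a) := by fin_cases a <;> simp [shapeD1] <;> fun_prop
lemma continuous_shapeD2 (a : Fin 4) : Continuous (shapeD2 a) := by fin_cases a <;> simp [shapeD2] <;> fun_prop
lemma continuous_cross {α : Type*} [TopologicalSpace α] {u v : α → Pt} (hu : Continuous u)
    (hv : Continuous v) : Continuous fun x => cross (u x) (v x) := by
  simp only [cross_apply]; fun_prop

lemma isCompact_unitSq : IsCompact unitSq := isCompact_Icc.prod isCompact_Icc

lemma StrictQuad.exists_lipschitz (hq : StrictQuad q) : ∃ C, ∀ x ∈ convexHull ℝ (range q),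
    ∀ y ∈ convexHull ℝ (range q), ‖quadInv q x - quadInv q y‖ ≤ C * ‖x - y‖ := by
  obtain ⟨c, hc, hJ⟩ := hq.exists_jac_ge
  obtain ⟨C1, hC1⟩ := isCompact_unitSq.exists_bound_of_continuousOn (continuous_quadD1 (q := q)).continuousOn
  obtain ⟨C2, hC2⟩ := isCompact_unitSq.exists_bound_of_continuousOn (continuous_quadD2 (q := q)).continuousOn
  refine ⟨max C1 C2 / c, fun x hx y hy => ?_⟩
  have hξ := hq.quadInv_mem hx
  have hη := hq.quadInv_mem hy
  have hm := midpoint_mem_unitSq hξ hη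
  obtain ⟨h1, h2⟩ := coord_sub_mul_jac (q := q) (quadInv q x) (quadInv q y)
  rw [hq.quadMap_quadInv hx, hq.quadMap_quadInv hy] at h1 h2
  set m := midpoint ℝ (quadInv q x) (quadInv q y)
  have key : ∀ r : ℝ, |r * quadJac q m| ≤ max C1 C2 * ‖x - y‖ → |r| ≤ max C1 C2 / c * ‖x - y‖ := by
    intro r hr; rw [abs_mul, abs_of_pos (hc.trans_le (hJ m hm))] at hr
    rw [div_mul_eq_mul_div, le_div_iff₀ hc]; exact (mul_le_mul_of_nonneg_left (hJ m hm) (abs_nonneg r)).trans hr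
  rw [Prod.norm_def]
  refine max_le (key _ ?_) (key _ ?_)
  · rw [Prod.fst_sub, h1]
    refine (abs_cross_le _ _).trans ?_
    rw [mul_comm]; exact mul_le_mul_of_nonneg_right ((hC2 m hm).trans (le_max_right _ _)) (norm_nonneg _)
  · rw [Prod.snd_sub, h2]
    refine (abs_cross_le _ _).trans ?_
    exact mul_le_mul_of_nonneg_right ((hC1 m hm).trans (le_max_left _ _)) (norm_nonneg _)

lemma StrictQuad.continuousOn_quadInv (hq : StrictQuad q) : ContinuousOn (quadInv q) (convexHull ℝ (range q)) := by
  obtain ⟨C, hC⟩ := hq.exists_lipschitz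
  have : LipschitzOnWith (Real.toNNReal C) (quadInv q) (convexHull ℝ (range q)) := by
    refine LipschitzOnWith.of_dist_le_mul fun x hx y hy => ?_
    rw [dist_eq_norm, dist_eq_norm]; exact (hC x hx y hy).trans (by gcongr; exact Real.le_coe_toNNReal C)
  exact this.continuousOn

/-- The gradient of a shape function in physical coordinates. -/
def shapeGrad (q : Fin 4 → Pt) (a : Fin 4) (ξ : ℝ × ℝ) : Pt :=
  (quadJac q ξ)⁻¹ • (shapeD1 a ξ • rotate (quadD2 q ξ) - shapeD2 a ξ • rotate (quadD1 q ξ))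

lemma StrictQuad.continuousOn_shapeGrad (hq : StrictQuad q) (a : Fin 4) : ContinuousOn (shapeGrad q a) unitSq := by
  refine ContinuousOn.smul (ContinuousOn.inv₀ ?_ fun ξ hξ => (hq.jac_pos hξ).ne') ?_
  · exact (continuous_cross continuous_quadD1 continuous_quadD2).continuousOn
  · exact (((continuous_shapeD1 a).smul (continuous_rotate.comp continuous_quadD2)).sub
      ((continuous_shapeD2 a).smul (continuous_rotate.comp continuous_quadD1))).continuousOn

lemma StrictQuad.shape_sub (hq : StrictQuad q) {x y : Pt} (hx : x ∈ convexHull ℝ (range q))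
    (hy : y ∈ convexHull ℝ (range q)) (a : Fin 4) :
    refShape a (quadInv q x) - refShape a (quadInv q y) =
      ⟪shapeGrad q a (midpoint ℝ (quadInv q x) (quadInv q y)), x - y⟫_ℝ := by
  have hm := midpoint_mem_unitSq (hq.quadInv_mem hx) (hq.quadInv_mem hy)
  have hJ := (hq.jac_pos hm).ne'
  obtain ⟨h1, h2⟩ := coord_sub_mul_jac (q := q) (quadInv q x) (quadInv q y)
  rw [hq.quadMap_quadInv hx, hq.quadMap_quadInv hy] at h1 h2; rw [refShape_sub]
  set m := midpoint ℝ (quadInv q x) (quadInv q y)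
  rw [shapeGrad, real_inner_smul_left, inner_sub_left, real_inner_smul_left, real_inner_smul_left,
    inner_rotate, inner_rotate, ← h1]
  have h3 : cross (x - y) (quadD1 q m) = - ((quadInv q x).2 - (quadInv q y).2) * quadJac q m := by
    rw [neg_mul, h2]; simp only [cross_apply]; ring
  rw [h3]; field_simp
  ring

lemma StrictQuad.hasGradientWithinAt (hq : StrictQuad q) {x : Pt} (hx : x ∈ convexHull ℝ (range q)) (a : Fin 4) :
    HasGradientWithinAt (fun y => refShape a (quadInv q y)) (shapeGrad q a (quadInv q x))
      (convexHull ℝ (range q)) x := by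
  rw [hasGradientWithinAt_iff_isLittleO, Asymptotics.isLittleO_iff]; intro ε hε
  have hc : ContinuousOn (fun y => shapeGrad q a (midpoint ℝ (quadInv q y) (quadInv q x)))
      (convexHull ℝ (range q)) := by
    refine (hq.continuousOn_shapeGrad a).comp ?_ fun y hy =>
      midpoint_mem_unitSq (hq.quadInv_mem hy) (hq.quadInv_mem hx)
    simp only [midpoint_eq_smul_add]; exact (hq.continuousOn_quadInv.add continuousOn_const).const_smul (⅟2 : ℝ)
  have h := Metric.continuousWithinAt_iff'.1 (hc x hx) ε hε
  filter_upwards [h, self_mem_nhdsWithin] with y hy hyK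
  rw [hq.shape_sub hyK hx, ← inner_sub_left]
  refine (norm_inner_le_norm _ _).trans (mul_le_mul_of_nonneg_right ?_ (norm_nonneg _))
  rw [dist_eq_norm, midpoint_self] at hy; exact hy.le

end Quad

lemma fin_four_cases (a b : Fin 4) : b = a ∨ b = a + 1 ∨ b = a + 2 ∨ b = a + 3 := by revert a b; decide

section Quad

variable {q : Fin 4 → Pt}

lemma StrictQuad.mem_of_cross (hq : StrictQuad q) {x : Pt}
    (hx : ∀ a, 0 ≤ cross (q (a + 1) - q a) (x - q a)) : x ∈ convexHull ℝ (range q) := by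
  obtain ⟨ξ, hξ, rfl⟩ := hq.mem_image hx
  exact quadMap_mem hξ

lemma StrictQuad.mem_interior (hq : StrictQuad q) {x : Pt}
    (hx : ∀ a, 0 < cross (q (a + 1) - q a) (x - q a)) : x ∈ interior (convexHull ℝ (range q)) := by
  have ho : IsOpen {y : Pt | ∀ a, 0 < cross (q (a + 1) - q a) (y - q a)} := by
    simp only [setOf_forall]
    exact isOpen_iInter_of_finite fun a =>
      isOpen_lt continuous_const (continuous_cross continuous_const (continuous_id.sub continuous_const))
  exact interior_maximal (fun y hy => hq.mem_of_cross fun a => (hy a).le) ho hx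

lemma sum_fin_four {F : Type*} [AddCommMonoid F] (a : Fin 4) (f : Fin 4 → F) :
    ∑ b, f b = f a + f (a + 1) + f (a + 2) + f (a + 3) := by
  rw [Fin.sum_univ_four]; fin_cases a
  · rfl
  · change f 0 + f 1 + f 2 + f 3 = f 1 + f 2 + f 3 + f 0; abel
  · change f 0 + f 1 + f 2 + f 3 = f 2 + f 3 + f 0 + f 1; abel
  · change f 0 + f 1 + f 2 + f 3 = f 3 + f 0 + f 1 + f 2; abel

lemma StrictQuad.cross_weights (a : Fin 4) {β : Fin 4 → ℝ} (h1 : ∑ b, β b = 1) :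
    cross (q (a + 1) - q a) (∑ b, β b • q b - q a) = β (a + 2) * cross (q (a + 1) - q a) (q (a + 2) - q a) +
      β (a + 3) * cross (q (a + 1) - q a) (q (a + 3) - q a) := by
  rw [sum_fin_four a] at h1 ⊢
  have : β a = 1 - β (a + 1) - β (a + 2) - β (a + 3) := by linarith
  simp only [cross_apply, PiLp.sub_apply, PiLp.add_apply, PiLp.smul_apply, smul_eq_mul, this]; ring

lemma StrictQuad.interior_nonempty (hq : StrictQuad q) : (interior (convexHull ℝ (range q))).Nonempty := by
  refine ⟨∑ b, (1 / 4 : ℝ) • q b, hq.mem_interior fun a => ?_⟩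
  rw [StrictQuad.cross_weights (β := fun _ => 1 / 4) a (by simp)]
  have := hq a
  have := hq.cross_two_pos a
  positivity

lemma StrictQuad.uniqueDiffOn (hq : StrictQuad q) : UniqueDiffOn ℝ (convexHull ℝ (range q)) :=
  uniqueDiffOn_convex (convex_convexHull ℝ _) hq.interior_nonempty

lemma StrictQuad.succ_ne (hq : StrictQuad q) (a : Fin 4) : q (a + 1) - q a ≠ 0 := by
  intro h
  have := hq a
  rw [h] at this; simp [cross_apply] at this

lemma StrictQuad.injective (hq : StrictQuad q) : Function.Injective q := by
  intro a b h; by_contra hab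
  obtain rfl | rfl | rfl : b = a + 1 ∨ b = a + 2 ∨ b = a + 3 := (fin_four_cases a b).resolve_left fun h => hab h.symm
  · exact hq.succ_ne a (by rw [h, sub_self])
  · have := hq.cross_two_pos a
    rw [h, sub_self] at this; simp [cross_apply] at this
  · have := hq a
    rw [h, sub_self] at this; simp [cross_apply] at this

/-- On the boundary, the convex weights of the corners are unique. -/
lemma StrictQuad.weights_unique (hq : StrictQuad q) {β β' : Fin 4 → ℝ} (h0 : ∀ b, 0 ≤ β b)
    (h1 : ∑ b, β b = 1) (h0' : ∀ b, 0 ≤ β' b) (h1' : ∑ b, β' b = 1)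
    (he : ∑ b, β b • q b = ∑ b, β' b • q b)
    (hx : ∑ b, β b • q b ∉ interior (convexHull ℝ (range q))) : β = β' := by
  have : ∃ a, cross (q (a + 1) - q a) (∑ b, β b • q b - q a) ≤ 0 := by
    by_contra! h
    exact hx (hq.mem_interior h)
  obtain ⟨a, ha⟩ := this
  have p2 := hq.cross_two_pos a
  have p3 := hq a
  have key : ∀ γ : Fin 4 → ℝ, (∀ b, 0 ≤ γ b) → ∑ b, γ b = 1 → cross (q (a + 1) - q a) (∑ b, γ b • q b - q a) ≤ 0 →
      γ (a + 2) = 0 ∧ γ (a + 3) = 0 ∧ γ a = 1 - γ (a + 1) ∧ ∑ b, γ b • q b - q a = γ (a + 1) • (q (a + 1) - q a) := by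
    intro γ g0 g1 hle; rw [StrictQuad.cross_weights a g1] at hle
    have e2 := mul_nonneg (g0 (a + 2)) p2.le
    have e3 := mul_nonneg (g0 (a + 3)) p3.le
    have z2 : γ (a + 2) = 0 := (mul_eq_zero.1 (le_antisymm (by linarith) e2)).resolve_right p2.ne'
    have z3 : γ (a + 3) = 0 := (mul_eq_zero.1 (le_antisymm (by linarith) e3)).resolve_right p3.ne'
    have ga : γ a = 1 - γ (a + 1) := by rw [sum_fin_four a, z2, z3] at g1; linarith
    refine ⟨z2, z3, ga, ?_⟩
    rw [sum_fin_four a, z2, z3, ga]; module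
  obtain ⟨a2, a3, a0, ae⟩ := key β h0 h1 ha
  obtain ⟨b2, b3, b0, be⟩ := key β' h0' h1' (he ▸ ha)
  have e1 : β (a + 1) = β' (a + 1) := by
    rw [he, be] at ae; exact (smul_left_injective ℝ (hq.succ_ne a) ae).symm
  funext b
  obtain rfl | rfl | rfl | rfl : b = a ∨ b = a + 1 ∨ b = a + 2 ∨ b = a + 3 := fin_four_cases a b
  · rw [a0, b0, e1]
  · exact e1
  · rw [a2, b2]
  · rw [a3, b3]

end Quad

namespace QuadMesh

lemma IsCoarseGrid.strict (hM : M.IsCoarseGrid G) (j : Fin M.N) : StrictQuad (M.corner j) := hM.convex j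

lemma IsCoarseGrid.vtx_injective (hM : M.IsCoarseGrid G) (j : Fin M.N) : Function.Injective (M.vtx j) := fun a b h =>
  (hM.strict j).injective (congrArg M.pos h)

lemma localCoord_eq (j : Fin M.N) (x : Pt) : M.localCoord j x = quadInv (M.corner j) x := rfl

lemma IsCoarseGrid.chi_vtx (hM : M.IsCoarseGrid G) (j : Fin M.N) (a : Fin 4) (x : Pt) :
    M.chi j (M.vtx j a) x = refShape a (M.localCoord j x) := by
  unfold chi; rw [sum_eq_single a]
  · simp
  · intro b _ hb; rw [if_neg fun h => hb (hM.vtx_injective j h)]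
  · simp

lemma chi_of_notMem {j : Fin M.N} {k : Fin M.Nc} (h : k ∉ range (M.vtx j)) : M.chi j k = fun _ => 0 := by
  funext x
  refine sum_eq_zero fun a _ => if_neg fun h' => h ⟨a, h'⟩

lemma elem_convex (j : Fin M.N) : Convex ℝ (M.elem j) := convex_convexHull ℝ _

lemma isCompact_elem (j : Fin M.N) : IsCompact (M.elem j) := (Set.finite_range _).isCompact_convexHull (𝕜 := ℝ)

lemma isClosed_elem (j : Fin M.N) : IsClosed (M.elem j) := (isCompact_elem j).isClosed

lemma IsCoarseGrid.uniqueDiffOn (hM : M.IsCoarseGrid G) (j : Fin M.N) :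
    UniqueDiffOn ℝ (M.elem j) := (hM.strict j).uniqueDiffOn

/-- The gradient of the shape function of the `a`-th corner of `K_j`. -/
def gradShape (M : QuadMesh) (j : Fin M.N) (a : Fin 4) (x : Pt) : Pt := shapeGrad (M.corner j) a (M.localCoord j x)

lemma gradientWithin_eq {f : Pt → ℝ} {s : Set Pt} {x g : Pt} (hs : UniqueDiffWithinAt ℝ s x)
    (h : HasGradientWithinAt f g s x) : gradientWithin f s x = g := by
  unfold gradientWithin; rw [h.hasFDerivWithinAt.fderivWithin hs]
  simp

lemma IsCoarseGrid.hasGradientWithinAt_chi (hM : M.IsCoarseGrid G) (j : Fin M.N) (k : Fin M.Nc)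
    {x : Pt} (hx : x ∈ M.elem j) : HasGradientWithinAt (M.chi j k) (M.gradChi j k x) (M.elem j) x := by
  have : ∃ g, HasGradientWithinAt (M.chi j k) g (M.elem j) x := by
    by_cases hk : k ∈ range (M.vtx j)
    · obtain ⟨a, rfl⟩ := hk
      have e : M.chi j (M.vtx j a) = fun y => refShape a (quadInv (M.corner j) y) := funext fun y => hM.chi_vtx j a y
      rw [e]; exact ⟨_, (hM.strict j).hasGradientWithinAt hx a⟩
    · rw [chi_of_notMem hk]; exact ⟨0, hasGradientWithinAt_const _ _ _⟩
  obtain ⟨g, hg⟩ := this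
  rw [gradChi, gradientWithin_eq (hM.uniqueDiffOn j x hx) hg]; exact hg

lemma IsCoarseGrid.gradChi_vtx (hM : M.IsCoarseGrid G) (j : Fin M.N) (a : Fin 4) {x : Pt}
    (hx : x ∈ M.elem j) : M.gradChi j (M.vtx j a) x = M.gradShape j a x := by
  have e : M.chi j (M.vtx j a) = fun y => refShape a (quadInv (M.corner j) y) := funext fun y => hM.chi_vtx j a y
  rw [gradChi, e]; exact gradientWithin_eq (hM.uniqueDiffOn j x hx) ((hM.strict j).hasGradientWithinAt hx a)

lemma gradChi_of_notMem {j : Fin M.N} {k : Fin M.Nc} (h : k ∉ range (M.vtx j)) (x : Pt) : M.gradChi j k x = 0 := by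
  rw [gradChi, chi_of_notMem h]; unfold gradientWithin
  simp

lemma IsCoarseGrid.sum_gradChi (hM : M.IsCoarseGrid G) (j : Fin M.N) {x : Pt} (hx : x ∈ M.elem j)
    {F : Type*} [AddCommMonoid F] (f : Pt → F) (hf : f 0 = 0) :
    ∑ k, f (M.gradChi j k x) = ∑ a, f (M.gradShape j a x) := by
  classical
  rw [← sum_subset (Finset.subset_univ (Finset.univ.image (M.vtx j)))]
  · rw [sum_image fun a _ b _ h => hM.vtx_injective j h]
    exact sum_congr rfl fun a _ => by rw [hM.gradChi_vtx j a hx]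
  · intro k _ hk; rw [gradChi_of_notMem, hf]
    simpa using hk

lemma IsCoarseGrid.continuousOn_gradShape (hM : M.IsCoarseGrid G) (j : Fin M.N) (a : Fin 4) :
    ContinuousOn (M.gradShape j a) (M.elem j) :=
  ((hM.strict j).continuousOn_shapeGrad a).comp (hM.strict j).continuousOn_quadInv
    fun _ hx => (hM.strict j).quadInv_mem hx

lemma IsCoarseGrid.continuousOn_gradChi (hM : M.IsCoarseGrid G) (j : Fin M.N) (k : Fin M.Nc) :
    ContinuousOn (M.gradChi j k) (M.elem j) := by
  by_cases hk : k ∈ range (M.vtx j)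
  · obtain ⟨a, rfl⟩ := hk
    exact (hM.continuousOn_gradShape j a).congr fun x hx => hM.gradChi_vtx j a hx
  · exact continuousOn_const.congr fun x _ => gradChi_of_notMem hk x

lemma N_pos (hM : M.IsCoarseGrid G) : 0 < M.N := by
  rcases Nat.eq_zero_or_pos M.N with h | h
  · exfalso
    have : IsEmpty (Fin M.N) := by rw [h]; infer_instance
    have h2 := hM.iUnion_elem
    rw [iUnion_of_empty] at h2
    obtain ⟨x, hx⟩ := G.nonempty
    have := subset_closure hx
    rw [← h2] at this; exact this
  · exact h

lemma diam_le_meshSize (j : Fin M.N) : Metric.diam (M.elem j) ≤ M.meshSize :=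
  le_ciSup (f := fun j => Metric.diam (M.elem j)) (Set.finite_range _).bddAbove j

lemma dist_le_meshSize {j : Fin M.N} {x y : Pt} (hx : x ∈ M.elem j) (hy : y ∈ M.elem j) : ‖x - y‖ ≤ M.meshSize := by
  rw [← dist_eq_norm]; exact (Metric.dist_le_diam_of_mem (isCompact_elem j).isBounded hx hy).trans (diam_le_meshSize j)

lemma corner_mem (j : Fin M.N) (a : Fin 4) : M.corner j a ∈ M.elem j := subset_convexHull ℝ _ ⟨a, rfl⟩

lemma IsCoarseGrid.meshSize_pos (hM : M.IsCoarseGrid G) : 0 < M.meshSize := by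
  let j : Fin M.N := ⟨0, N_pos hM⟩
  have h := (hM.strict j).succ_ne 0
  exact (norm_pos_iff.2 h).trans_le (dist_le_meshSize (corner_mem j _) (corner_mem j _))

/-- The shape functions reproduce affine functions, hence a lower bound of their gradients. -/
lemma IsCoarseGrid.sum_sq_inner_gradShape (hM : M.IsCoarseGrid G) (j : Fin M.N) {x : Pt}
    (hx : x ∈ M.elem j) {e : Pt} (he : ‖e‖ = 1) :
    1 / (4 * M.meshSize ^ 2) ≤ ∑ a, ⟪M.gradShape j a x, e⟫_ℝ ^ 2 := by
  have hq := hM.strict j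
  have hH := hM.meshSize_pos
  have hu := hM.uniqueDiffOn j x hx
  have hd : ∀ a, HasFDerivWithinAt (fun y => refShape a (quadInv (M.corner j) y))
      ((InnerProductSpace.toDual ℝ Pt) (M.gradShape j a x)) (M.elem j) x := fun a =>
    (hq.hasGradientWithinAt hx a).hasFDerivWithinAt
  have h1 : ∑ a, ⟪M.gradShape j a x, e⟫_ℝ • (M.corner j a - x) = e := by
    have d1 : HasFDerivWithinAt (fun y => ∑ a, refShape a (quadInv (M.corner j) y) • (M.corner j a - x))
        (∑ a, ((InnerProductSpace.toDual ℝ Pt) (M.gradShape j a x)).smulRight (M.corner j a - x))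
        (M.elem j) x := HasFDerivWithinAt.fun_sum fun a _ => (hd a).smul_const _
    have d2 : HasFDerivWithinAt (fun y => ∑ a, refShape a (quadInv (M.corner j) y) • (M.corner j a - x))
        (ContinuousLinearMap.id ℝ Pt) (M.elem j) x := by
      refine ((hasFDerivWithinAt_id x (M.elem j)).sub_const x).congr (fun y hy => ?_) ?_
      all_goals
        simp only [smul_sub, Finset.sum_sub_distrib, ← sum_smul, refShape_sum, one_smul, id]
      · have := hq.quadMap_quadInv hy
        rw [quadMap] at this; rw [this]
      · have := hq.quadMap_quadInv hx
        rw [quadMap] at this; rw [this]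
    have := congrArg (fun L : Pt →L[ℝ] Pt => L e) (hu.eq d1 d2)
    simpa [sum_apply] using this
  have h2 : 1 ≤ ∑ a, |⟪M.gradShape j a x, e⟫_ℝ| * M.meshSize := by
    calc (1 : ℝ) = ‖∑ a, ⟪M.gradShape j a x, e⟫_ℝ • (M.corner j a - x)‖ := by rw [h1, he]
      _ ≤ ∑ a, ‖⟪M.gradShape j a x, e⟫_ℝ • (M.corner j a - x)‖ := norm_sum_le _ _
      _ ≤ _ := sum_le_sum fun a _ => by
        rw [norm_smul, Real.norm_eq_abs]
        exact mul_le_mul_of_nonneg_left (dist_le_meshSize (corner_mem j a) hx) (abs_nonneg _)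
  rw [← sum_mul] at h2
  have h3 : (∑ a, |⟪M.gradShape j a x, e⟫_ℝ|) ^ 2 ≤ 4 * ∑ a, ⟪M.gradShape j a x, e⟫_ℝ ^ 2 := by
    have := sq_sum_le_card_mul_sum_sq (s := Finset.univ) (f := fun a => |⟪M.gradShape j a x, e⟫_ℝ|)
    simpa [sq_abs] using this
  rw [div_le_iff₀ (by positivity)]; nlinarith [mul_le_mul_of_nonneg_right h3 (sq_nonneg M.meshSize)]

end QuadMesh

lemma norm_starProjection_span {e : Pt} (he : ‖e‖ = 1) (v : Pt) :
    ‖(Submodule.span ℝ {e}).starProjection v‖ = |⟪v, e⟫_ℝ| := by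
  rw [Submodule.starProjection_unit_singleton ℝ he, norm_smul, he, mul_one, real_inner_comm, Real.norm_eq_abs]

lemma tangent_eq_span (G : FracturedDomain) (l : Fin G.nf) :
    ∃ e : Pt, ‖e‖ = 1 ∧ G.tangent l = Submodule.span ℝ {e} ∧ G.b l - G.a l = ‖G.b l - G.a l‖ • e := by
  have h : G.b l - G.a l ≠ 0 := sub_ne_zero.2 (G.a_ne_b l).symm
  have hn : ‖G.b l - G.a l‖ ≠ 0 := norm_ne_zero_iff.2 h
  refine ⟨‖G.b l - G.a l‖⁻¹ • (G.b l - G.a l), ?_, ?_, ?_⟩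
  · rw [norm_smul, norm_inv, norm_norm, inv_mul_cancel₀ hn]
  · exact (Submodule.span_singleton_smul_eq (IsUnit.mk0 _ (inv_ne_zero hn)) _).symm
  · rw [smul_smul, mul_inv_cancel₀ hn, one_smul]

lemma le_chiWeight (hM : M.IsCoarseGrid G) (j : Fin M.N) {z : G.Piece} (hz : z.2 ∈ M.elem j) :
    1 / (4 * M.meshSize ^ 2) ≤ chiWeight G M j z := by
  obtain ⟨o, x⟩ := z
  have key : ∀ e : Pt, ‖e‖ = 1 → 1 / (4 * M.meshSize ^ 2) ≤ ∑ a, ⟪M.gradShape j a x, e⟫_ℝ ^ 2 :=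
    fun e he => hM.sum_sq_inner_gradShape j hz he
  refine Fin.cases ?_ (fun l => ?_) o
  · change _ ≤ ∑ k, ‖M.gradChi j k x‖ ^ 2
    rw [hM.sum_gradChi j hz (fun v => ‖v‖ ^ 2) (by simp)]
    refine (key (EuclideanSpace.single 0 1) (by simp)).trans (sum_le_sum fun a _ => ?_)
    have := abs_real_inner_le_norm (M.gradShape j a x) (EuclideanSpace.single 0 1)
    rw [← sq_abs]; gcongr
    simpa using this
  · change _ ≤ ∑ k, ‖(G.tangent l).starProjection (M.gradChi j k x)‖ ^ 2
    rw [hM.sum_gradChi j hz (fun v => ‖(G.tangent l).starProjection v‖ ^ 2) (by simp)]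
    obtain ⟨e, he, ht, -⟩ := tangent_eq_span G l
    simp only [ht]
    refine (key e he).trans (sum_le_sum fun a _ => ?_)
    rw [norm_starProjection_span he, sq_abs]

lemma chiWeight_le (hM : M.IsCoarseGrid G) {γ : ℝ} (hγ : M.ShapeRegular γ) (j : Fin M.N)
    {z : G.Piece} (hz : z.2 ∈ M.elem j) : chiWeight G M j z ≤ 4 * (γ / M.meshSize) ^ 2 := by
  obtain ⟨o, x⟩ := z
  have key : ∑ k, ‖M.gradChi j k x‖ ^ 2 ≤ 4 * (γ / M.meshSize) ^ 2 := by
    rw [hM.sum_gradChi j hz (fun v => ‖v‖ ^ 2) (by simp)]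
    calc ∑ a, ‖M.gradShape j a x‖ ^ 2 ≤ ∑ a : Fin 4, (γ / M.meshSize) ^ 2 := by
          refine sum_le_sum fun a _ => ?_
          rw [← hM.gradChi_vtx j a hz]; gcongr
          exact hγ j _ x hz
      _ = _ := by simp
  refine Fin.cases key (fun l => ?_) o
  refine le_trans (b := ∑ k, ‖M.gradChi j k x‖ ^ 2) ?_ key
  change ∑ k, ‖(G.tangent l).starProjection (M.gradChi j k x)‖ ^ 2 ≤ _
  refine sum_le_sum fun k _ => ?_
  gcongr
  exact Submodule.norm_starProjection_apply_le _ _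

lemma measurable_chiWeight (hM : M.IsCoarseGrid G) (j : Fin M.N) :
    AEStronglyMeasurable (chiWeight G M j) (G.mu.restrict (Prod.snd ⁻¹' M.elem j)) := by
  classical
  let f : G.Piece → ℝ := fun z => (M.elem j).indicator (fun x => chiWeight G M j (z.1, x)) z.2
  have hf : Measurable f := by
    refine measurable_piece fun o => ?_
    have hc : ContinuousOn (fun x => chiWeight G M j (o, x)) (M.elem j) := by
      refine Fin.cases ?_ (fun l => ?_) o
      · change ContinuousOn (fun x => ∑ k, ‖M.gradChi j k x‖ ^ 2) (M.elem j)
        exact continuousOn_finsetSum _ fun k _ => (hM.continuousOn_gradChi j k).norm.pow 2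
      · change ContinuousOn (fun x => ∑ k, ‖(G.tangent l).starProjection (M.gradChi j k x)‖ ^ 2) (M.elem j)
        exact continuousOn_finsetSum _ fun k _ =>
          ((G.tangent l).starProjection.continuous.comp_continuousOn (hM.continuousOn_gradChi j k)).norm.pow 2
    exact hc.measurable_piecewise continuousOn_const (measurableSet_elem j)
  refine hf.aestronglyMeasurable.congr ?_
  filter_upwards [ae_restrict_mem (measurable_snd (measurableSet_elem j))] with z hz
  exact indicator_of_mem (s := M.elem j) hz _

lemma isWeight_sWeight {co : Coefficients G} {lo hi : ℝ} (hlo : 0 < lo) (h : co.KappaBetween lo hi)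
    (hM : M.IsCoarseGrid G) {γ : ℝ} (hγ : M.ShapeRegular γ) (j : Fin M.N) :
    IsWeight (sWeight co M j) (M.elem j) (hi * (4 * (γ / M.meshSize) ^ 2)) := by
  have hae : ∀ᵐ z ∂G.mu.restrict (Prod.snd ⁻¹' M.elem j), (∀ i, lo ≤ co.kap i z ∧ co.kap i z ≤ hi) ∧ z.2 ∈ M.elem j :=
    (ae_restrict_of_ae h.ae).and (ae_restrict_mem (measurable_snd (measurableSet_elem j)))
  refine ⟨fun i => (co.measurable_kap i).aestronglyMeasurable.mul (measurable_chiWeight hM j),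
    fun i => hae.mono fun z hz => ?_, fun i => hae.mono fun z hz => ?_⟩
  · have := le_chiWeight hM j hz.2
    exact mul_nonneg (hlo.le.trans (hz.1 i).1) (le_trans (by positivity) this)
  · have h1 := le_chiWeight hM j hz.2
    have h2 := chiWeight_le hM hγ j hz.2
    exact mul_le_mul (hz.1 i).2 h2 (le_trans (by positivity) h1) (hlo.le.trans ((hz.1 i).1.trans (hz.1 i).2))

/-! ### Area of the elements and counting -/

lemma norm_rotate (u : Pt) : ‖rotate u‖ = ‖u‖ := by
  have : ‖rotate u‖ ^ 2 = ‖u‖ ^ 2 := by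
    rw [EuclideanSpace.norm_sq_eq, EuclideanSpace.norm_sq_eq]; simp [rotate, Fin.sum_univ_two, add_comm]
  exact (sq_eq_sq₀ (norm_nonneg _) (norm_nonneg _)).1 this

/-- A small square. -/
def smallSq : Set Pt := {v | ∀ i, 0 < v i ∧ v i < 1 / 2}

def areaConst : ℝ := (volume smallSq).toReal

lemma isOpen_smallSq : IsOpen smallSq := by
  simp only [smallSq, setOf_forall]
  refine isOpen_iInter_of_finite fun i => ?_
  have h : Continuous fun v : Pt => v i := (EuclideanSpace.proj (𝕜 := ℝ) i).continuous
  exact (isOpen_lt continuous_const h).inter (isOpen_lt h continuous_const)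

lemma smallSq_subset : smallSq ⊆ Metric.closedBall 0 1 := by
  intro v hv; rw [mem_closedBall_zero_iff, ← sq_le_one_iff₀ (norm_nonneg _), EuclideanSpace.norm_sq_eq]
  simp only [Fin.sum_univ_two, Real.norm_eq_abs, sq_abs]; nlinarith [hv 0, hv 1, (hv 0).1, (hv 0).2, (hv 1).1, (hv 1).2]

lemma volume_smallSq_lt_top : volume smallSq < ⊤ := (measure_mono smallSq_subset).trans_lt measure_closedBall_lt_top

lemma areaConst_pos : 0 < areaConst := by
  refine ENNReal.toReal_pos (IsOpen.measure_ne_zero volume isOpen_smallSq ?_) volume_smallSq_lt_top.ne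
  refine ⟨!₂[1 / 4, 1 / 4], fun i => ?_⟩
  fin_cases i <;> norm_num

/-- The linear map with given columns. -/
def colMap (u v : Pt) : Pt →ₗ[ℝ] Pt := (EuclideanSpace.proj (𝕜 := ℝ) (0 : Fin 2)).toLinearMap.smulRight u +
    (EuclideanSpace.proj (𝕜 := ℝ) (1 : Fin 2)).toLinearMap.smulRight v

lemma colMap_apply (u v x : Pt) : colMap u v x = x 0 • u + x 1 • v := rfl

lemma det_colMap (u v : Pt) : LinearMap.det (colMap u v) = cross u v := by
  rw [← LinearMap.det_toMatrix (EuclideanSpace.basisFun (Fin 2) ℝ).toBasis, Matrix.det_fin_two]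
  simp [LinearMap.toMatrix_apply, colMap_apply, cross_apply]
  ring

lemma StrictQuad.volume_ge {q : Fin 4 → Pt} (hq : StrictQuad q) :
    ofReal (cross (q 1 - q 0) (q 3 - q 0) * areaConst) ≤ volume (convexHull ℝ (range q)) := by
  set L := colMap (q 1 - q 0) (q 3 - q 0)
  have h1 : (fun x => q 0 + x) '' (L '' smallSq) ⊆ convexHull ℝ (range q) := by
    rintro _ ⟨_, ⟨x, hx, rfl⟩, rfl⟩
    have e : q 0 + L x = ∑ b, (![1 - x 0 - x 1, x 0, 0, x 1] : Fin 4 → ℝ) b • q b := by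
      simp [L, colMap_apply, Fin.sum_univ_four]
      module
    change q 0 + L x ∈ _
    rw [e]
    refine (convex_convexHull ℝ _).sum_mem (fun b _ => ?_) ?_ fun b _ => subset_convexHull ℝ _ ⟨b, rfl⟩
    · obtain ⟨a1, a2⟩ := hx 0
      obtain ⟨b1, b2⟩ := hx 1
      fin_cases b <;> simp <;> linarith
    · simp [Fin.sum_univ_four]; ring
  refine le_trans ?_ (measure_mono h1)
  rw [image_add_left, measure_preimage_add, Measure.addHaar_image_linearMap, det_colMap,
    abs_of_pos hq.pos.1, ofReal_mul hq.pos.1.le, areaConst,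
    ENNReal.ofReal_toReal volume_smallSq_lt_top.ne]

namespace QuadMesh

lemma ShapeRegular.sq_le_cross {γ : ℝ} (hγ : M.ShapeRegular γ) (hM : M.IsCoarseGrid G) (j : Fin M.N) : M.meshSize ^ 2 ≤
      γ ^ 2 * cross (M.corner j 1 - M.corner j 0) (M.corner j 3 - M.corner j 0) := by
  have hq := hM.strict j
  have hH := hM.meshSize_pos
  have hmem : ((0, 0) : ℝ × ℝ) ∈ unitSq := by simp [unitSq]
  have h00 : quadMap (M.corner j) (0, 0) = M.corner j 0 := by apply Pt.ext <;> simp [quadMap_apply]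
  have hinv : M.localCoord j (M.corner j 0) = (0, 0) := by rw [localCoord_eq, ← h00, hq.quadInv_quadMap hmem]
  have hJ : quadJac (M.corner j) (0, 0) = cross (M.corner j 1 - M.corner j 0) (M.corner j 3 - M.corner j 0) := by
    simp [quadJac, quadD1, quadD2]
  have g1 := hγ j (M.vtx j 1) _ (corner_mem j 0)
  have g3 := hγ j (M.vtx j 3) _ (corner_mem j 0)
  rw [hM.gradChi_vtx j _ (corner_mem j 0), gradShape, hinv, shapeGrad, hJ] at g1 g3
  set u := M.corner j 1 - M.corner j 0
  set v := M.corner j 3 - M.corner j 0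
  have hc : 0 < cross u v := hq.pos.1
  have e1 : ‖(cross u v)⁻¹ • (shapeD1 1 (0, 0) • rotate (quadD2 (M.corner j) (0, 0)) -
      shapeD2 1 (0, 0) • rotate (quadD1 (M.corner j) (0, 0)))‖ = (cross u v)⁻¹ * ‖v‖ := by
    simp [shapeD1, shapeD2, norm_smul, norm_rotate, quadD2, abs_of_pos hc, v]
  have e3 : ‖(cross u v)⁻¹ • (shapeD1 3 (0, 0) • rotate (quadD2 (M.corner j) (0, 0)) -
      shapeD2 3 (0, 0) • rotate (quadD1 (M.corner j) (0, 0)))‖ = (cross u v)⁻¹ * ‖u‖ := by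
    simp [shapeD1, shapeD2, norm_smul, norm_rotate, quadD1, abs_of_pos hc, u]
  rw [e1, inv_mul_le_iff₀ hc] at g1; rw [e3, inv_mul_le_iff₀ hc] at g3
  have h1 : ‖u‖ * ‖v‖ ≤ (cross u v * (γ / M.meshSize)) * (cross u v * (γ / M.meshSize)) :=
    mul_le_mul g3 g1 (norm_nonneg _) ((norm_nonneg _).trans g3)
  have h2 : cross u v ≤ ‖u‖ * ‖v‖ := (le_abs_self _).trans (abs_cross_le u v)
  have h3 : cross u v * 1 ≤ cross u v * (cross u v * (γ / M.meshSize) ^ 2) := by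
    rw [mul_one]; exact (h2.trans h1).trans_eq (by ring)
  have h4 := le_of_mul_le_mul_left h3 hc
  rw [div_pow, ← mul_div_assoc, le_div_iff₀ (by positivity)] at h4; linarith

lemma ShapeRegular.sq_pos {γ : ℝ} (hγ : M.ShapeRegular γ) (hM : M.IsCoarseGrid G) : 0 < γ ^ 2 := by
  let j : Fin M.N := ⟨0, N_pos hM⟩
  have h1 := hγ.sq_le_cross hM j
  have h2 := hM.meshSize_pos
  by_contra h
  have h4 : γ ^ 2 = 0 := le_antisymm (not_lt.1 h) (sq_nonneg _)
  rw [h4, zero_mul] at h1; nlinarith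

lemma interior_nonempty (hM : M.IsCoarseGrid G) (j : Fin M.N) : (interior (M.elem j)).Nonempty :=
  (hM.strict j).interior_nonempty

lemma volume_interior_elem (j : Fin M.N) : volume (interior (M.elem j)) = volume (M.elem j) := by
  refine le_antisymm (measure_mono interior_subset) ?_
  have h := (elem_convex j).addHaar_frontier (volume : Measure Pt)
  calc volume (M.elem j) ≤ volume (interior (M.elem j) ∪ frontier (M.elem j)) :=
        measure_mono fun x hx => by
          by_cases h : x ∈ interior (M.elem j)
          · exact Or.inl h
          · exact Or.inr ⟨subset_closure hx, h⟩
    _ ≤ _ := measure_union_le _ _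
    _ = _ := by rw [h, add_zero]

/-- A lower bound of the area of the elements bounds the number of elements inside a set. -/
lemma ShapeRegular.card_mul_le {γ : ℝ} (hγ : M.ShapeRegular γ) (hM : M.IsCoarseGrid G)
    (I : Finset (Fin M.N)) {B : Set Pt} (hB : ∀ i ∈ I, M.elem i ⊆ B) (hfin : volume B ≠ ⊤) :
    I.card * (M.meshSize ^ 2 * areaConst) ≤ γ ^ 2 * (volume B).toReal := by
  have hg := hγ.sq_pos hM
  have h1 : ∀ i, ofReal (M.meshSize ^ 2 / γ ^ 2 * areaConst) ≤ volume (interior (M.elem i)) := by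
    intro i; rw [volume_interior_elem]
    refine le_trans (ofReal_le_ofReal ?_) (hM.strict i).volume_ge
    refine mul_le_mul_of_nonneg_right ?_ areaConst_pos.le
    rw [div_le_iff₀ hg, mul_comm]; exact hγ.sq_le_cross hM i
  have h2 : ∑ i ∈ I, volume (interior (M.elem i)) ≤ volume B := by
    rw [← measure_biUnion_finset (fun i _ j _ hij => hM.disjoint_interior i j hij)
      (fun i _ => isOpen_interior.measurableSet)]
    exact measure_mono (iUnion₂_subset fun i hi => interior_subset.trans (hB i hi))
  have h3 : (I.card : ENNReal) * ofReal (M.meshSize ^ 2 / γ ^ 2 * areaConst) ≤ volume B := by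
    refine le_trans ?_ h2
    rw [← nsmul_eq_mul, ← sum_const]; exact sum_le_sum fun i _ => h1 i
  have h4 := ENNReal.toReal_mono hfin h3
  have hpos : 0 ≤ M.meshSize ^ 2 / γ ^ 2 * areaConst := mul_nonneg (by positivity) areaConst_pos.le
  rw [ENNReal.toReal_mul, toReal_ofReal hpos, ENNReal.toReal_natCast] at h4
  have h5 := mul_le_mul_of_nonneg_left h4 hg.le
  have hg' : γ ≠ 0 := by rintro rfl; simp at hg
  refine le_trans (le_of_eq ?_) h5
  field_simp

/-- An upper bound of the number of elements that meet in a point. -/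
def overlap (γ : ℝ) : ℝ := γ ^ 2 * (volume (Metric.closedBall (0 : Pt) 1)).toReal / areaConst

lemma ShapeRegular.card_le_overlap {γ : ℝ} (hγ : M.ShapeRegular γ) (hM : M.IsCoarseGrid G) (x : Pt)
    (I : Finset (Fin M.N)) (hI : ∀ i ∈ I, x ∈ M.elem i) : I.card ≤ overlap γ := by
  have hH := hM.meshSize_pos
  have h := hγ.card_mul_le hM I (B := Metric.closedBall x M.meshSize) (fun i hi y hy => by
    rw [mem_closedBall_iff_norm]; exact dist_le_meshSize hy (hI i hi)) measure_closedBall_lt_top.ne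
  rw [Measure.addHaar_closedBall' _ _ hH.le] at h; rw [ENNReal.toReal_mul, toReal_ofReal (by positivity)] at h
  simp only [finrank_euclideanSpace, Fintype.card_fin] at h; rw [overlap, le_div_iff₀ areaConst_pos]
  have h2 : 0 < M.meshSize ^ 2 := by positivity
  refine le_of_mul_le_mul_left ?_ h2
  linarith

lemma ShapeRegular.N_mul_le {γ : ℝ} (hγ : M.ShapeRegular γ) (hM : M.IsCoarseGrid G) :
    M.N * M.meshSize ^ 2 ≤ γ ^ 2 * (volume (closure G.Ω)).toReal / areaConst := by
  have h := hγ.card_mul_le hM Finset.univ (B := closure G.Ω) (fun i _ => by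
    rw [← hM.iUnion_elem]; exact subset_iUnion M.elem i) G.isBounded.closure.measure_lt_top.ne
  rw [le_div_iff₀ areaConst_pos]; simp only [Finset.card_univ, Fintype.card_fin] at h
  linarith

/-! ### The shape functions are continuous across element boundaries -/

lemma IsCoarseGrid.notMem_interior (hM : M.IsCoarseGrid G) {i i' : Fin M.N} (hii : i ≠ i') {x : Pt}
    (hx' : x ∈ M.elem i') : x ∉ interior (M.elem i) := by
  intro hx
  have hcl : closure (interior (M.elem i')) = closure (M.elem i') :=
    (elem_convex i').closure_interior_eq_closure_of_nonempty_interior (interior_nonempty hM i')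
  have h1 : x ∈ closure (interior (M.elem i')) := by rw [hcl]; exact subset_closure hx'
  obtain ⟨y, hy, hy'⟩ := mem_closure_iff.1 h1 _ isOpen_interior hx
  exact Set.disjoint_left.1 (hM.disjoint_interior i i' hii) hy hy'

lemma IsCoarseGrid.chi_eq_weight (hM : M.IsCoarseGrid G) {i : Fin M.N} {x : Pt} (hx : x ∈ M.elem i)
    (hxi : x ∉ interior (M.elem i)) {S : Finset (Fin M.Nc)} (hS : (S : Set (Fin M.Nc)) ⊆ range (M.vtx i))
    {β : Fin M.Nc → ℝ} (hβ : ∀ k, 0 ≤ β k) (hβS : ∀ k ∉ S, β k = 0) (h1 : ∑ k ∈ S, β k = 1)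
    (hxβ : ∑ k ∈ S, β k • M.pos k = x) (k : Fin M.Nc) : M.chi i k x = β k := by
  classical
  have hq := hM.strict i
  have key : ∀ {F : Type} [AddCommMonoid F] [Module ℝ F] (f : Fin M.Nc → F),
      ∑ a, β (M.vtx i a) • f (M.vtx i a) = ∑ k ∈ S, β k • f k := by
    intro F _ _ f
    rw [← sum_image (f := fun k => β k • f k) (g := M.vtx i) (s := Finset.univ)
      fun a _ b _ h => hM.vtx_injective i h]
    refine (sum_subset ?_ fun k _ hk => by rw [hβS k hk, zero_smul]).symm
    intro k hk
    obtain ⟨a, rfl⟩ := hS hk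
    exact Finset.mem_image_of_mem _ (Finset.mem_univ a)
  have hw : (fun a => refShape a (M.localCoord i x)) = fun a => β (M.vtx i a) := by
    refine hq.weights_unique (fun a => refShape_nonneg (hq.quadInv_mem hx) a) (refShape_sum _) (fun a => hβ _) ?_ ?_ ?_
    · have := key (F := ℝ) (fun _ => 1)
      simpa [h1] using this
    · have e := key (F := Pt) M.pos
      rw [hxβ] at e; change quadMap (M.corner i) (quadInv (M.corner i) x) = _
      rw [hq.quadMap_quadInv hx, ← e]; rfl
    · change quadMap (M.corner i) (quadInv (M.corner i) x) ∉ _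
      rw [hq.quadMap_quadInv hx]; exact hxi
  by_cases hk : k ∈ range (M.vtx i)
  · obtain ⟨a, rfl⟩ := hk
    rw [hM.chi_vtx]; exact congrFun hw a
  · rw [chi_of_notMem hk, hβS k fun h => hk (hS h)]

lemma IsCoarseGrid.chi_eq (hM : M.IsCoarseGrid G) {i i' : Fin M.N} {x : Pt} (hx : x ∈ M.elem i)
    (hx' : x ∈ M.elem i') (k : Fin M.Nc) : M.chi i k x = M.chi i' k x := by
  classical
  rcases eq_or_ne i i' with rfl | hii
  · rfl
  have hmem : x ∈ convexHull ℝ (M.pos '' (range (M.vtx i) ∩ range (M.vtx i'))) := by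
    rw [← hM.conforming i i' hii]; exact ⟨hx, hx'⟩
  set S : Finset (Fin M.Nc) := (range (M.vtx i) ∩ range (M.vtx i')).toFinset with hSdef
  have hSc : (S : Set (Fin M.Nc)) = range (M.vtx i) ∩ range (M.vtx i') := by simp [hSdef]
  rw [← hSc, ← Finset.coe_image, Finset.mem_convexHull] at hmem
  obtain ⟨w, w0, w1, wx⟩ := hmem
  have inj : ∀ a ∈ S, ∀ b ∈ S, M.pos a = M.pos b → a = b := fun a _ b _ h => hM.pos_injective h
  rw [Finset.centerMass_eq_of_sum_1 _ _ w1, sum_image inj] at wx; rw [sum_image inj] at w1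
  let β : Fin M.Nc → ℝ := fun k => if k ∈ S then w (M.pos k) else 0
  have hβ : ∀ k, 0 ≤ β k := fun k => by
    by_cases h : k ∈ S
    · simp only [β, if_pos h]; exact w0 _ (Finset.mem_image_of_mem _ h)
    · simp [β, h]
  have hβS : ∀ k ∉ S, β k = 0 := fun k h => if_neg h
  have hβ1 : ∑ k ∈ S, β k = 1 := by rw [← w1]; exact sum_congr rfl fun k hk => if_pos hk
  have hβx : ∑ k ∈ S, β k • M.pos k = x := by
    rw [← wx]
    refine sum_congr rfl fun k hk => ?_
    simp only [β, if_pos hk, id]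
  rw [hM.chi_eq_weight hx (hM.notMem_interior hii hx') (by rw [hSc]; exact inter_subset_left) hβ hβS hβ1 hβx,
    hM.chi_eq_weight hx' (hM.notMem_interior hii.symm hx) (by rw [hSc]; exact inter_subset_right) hβ hβS hβ1 hβx]

lemma IsCoarseGrid.bubble_eq_zero (hM : M.IsCoarseGrid G) {i : Fin M.N} {x : Pt} (hx : x ∈ M.elem i)
    (hxi : x ∉ interior (M.elem i)) : M.bubble i x = 0 := by
  have hq := hM.strict i
  have : ∃ a, cross (M.corner i (a + 1) - M.corner i a) (x - M.corner i a) ≤ 0 := by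
    by_contra! h
    exact hxi (hq.mem_interior h)
  obtain ⟨a, ha⟩ := this
  have e := hq.quadMap_quadInv hx
  rw [quadMap] at e; rw [← e, StrictQuad.cross_weights a (refShape_sum _)] at ha
  have h2 := mul_nonneg (refShape_nonneg (hq.quadInv_mem hx) (a + 2)) (hq.cross_two_pos a).le
  have h3 := mul_nonneg (refShape_nonneg (hq.quadInv_mem hx) (a + 3)) (hq a).le
  have z2 : refShape (a + 2) (quadInv (M.corner i) x) = 0 :=
    (mul_eq_zero.1 (le_antisymm (by linarith) h2)).resolve_right (hq.cross_two_pos a).ne'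
  refine Finset.prod_eq_zero (Finset.mem_univ (a + 2)) ?_
  rw [hM.chi_vtx]; exact z2

/-! ### Piecewise continuously differentiable functions -/

/-- A function on the mesh that is continuously differentiable on each element and continuous
across element boundaries. -/
structure PiecewiseC1 (M : QuadMesh) (h : Fin M.N → Pt → ℝ) (g : Fin M.N → Pt → Pt) : Prop where
  grad : ∀ i, ∀ x ∈ M.elem i, HasGradientWithinAt (h i) (g i x) (M.elem i) x
  cont : ∀ i, ContinuousOn (g i) (M.elem i)
  agree : ∀ i i' x, x ∈ M.elem i → x ∈ M.elem i' → h i x = h i' x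

/-- The nodes of the elements in the first `n` layers around `K_j`. -/
def nodes (M : QuadMesh) (j : Fin M.N) (n : ℕ) : Set (Fin M.Nc) := {k | ∃ i ∈ M.layer j n, k ∈ range (M.vtx i)}

open Classical in
/-- The cut-off function: one on the first `n` layers, zero outside the first `n + 1` layers. -/
def cutFun (M : QuadMesh) (j : Fin M.N) (n : ℕ) (i : Fin M.N) (x : Pt) : ℝ :=
  ∑ k, if k ∈ M.nodes j n then M.chi i k x else 0

open Classical in
def cutGrad (M : QuadMesh) (j : Fin M.N) (n : ℕ) (i : Fin M.N) (x : Pt) : Pt :=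
  ∑ k, if k ∈ M.nodes j n then M.gradChi i k x else 0

lemma layer_subset_succ (hM : M.IsCoarseGrid G) (j : Fin M.N) (n : ℕ) : M.layer j n ⊆ M.layer j (n + 1) := fun i hi =>
  ⟨i, hi, ((interior_nonempty hM i).mono interior_subset).mono (by simp)⟩

lemma mem_layer_succ_of_nodes {j : Fin M.N} {n : ℕ} {i : Fin M.N} {k : Fin M.Nc}
    (hk : k ∈ range (M.vtx i)) (hn : k ∈ M.nodes j n) : i ∈ M.layer j (n + 1) := by
  obtain ⟨i', hi', a', rfl⟩ := hn
  obtain ⟨a, ha⟩ := hk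
  exact ⟨i', hi', M.corner i' a', corner_mem i' a', by rw [corner, ← ha]; exact corner_mem i a⟩

lemma piecewiseC1_cut (hM : M.IsCoarseGrid G) (j : Fin M.N) (n : ℕ) :
    M.PiecewiseC1 (M.cutFun j n) (M.cutGrad j n) where
  grad i x hx := by
    classical
    rw [hasGradientWithinAt_iff_hasFDerivWithinAt]; unfold cutFun cutGrad
    rw [map_sum]
    refine HasFDerivWithinAt.fun_sum fun k _ => ?_
    by_cases hk : k ∈ M.nodes j n
    · simp only [if_pos hk]; exact (hM.hasGradientWithinAt_chi i k hx).hasFDerivWithinAt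
    · simp only [if_neg hk, map_zero]; exact hasFDerivWithinAt_const _ _ _
  cont i := by
    classical
    refine continuousOn_finsetSum _ fun k _ => ?_
    by_cases hk : k ∈ M.nodes j n
    · simp only [if_pos hk]; exact hM.continuousOn_gradChi i k
    · simp only [if_neg hk]; exact continuousOn_const
  agree i i' x hx hx' := by
    classical
    exact sum_congr rfl fun k _ => by rw [hM.chi_eq hx hx']

lemma IsCoarseGrid.sum_chi (hM : M.IsCoarseGrid G) (i : Fin M.N) (x : Pt) : ∑ k, M.chi i k x = 1 := by
  classical
  unfold chi; rw [Finset.sum_comm]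
  simp [refShape_sum]

lemma IsCoarseGrid.chi_nonneg (hM : M.IsCoarseGrid G) {i : Fin M.N} {x : Pt} (hx : x ∈ M.elem i)
    (k : Fin M.Nc) : 0 ≤ M.chi i k x := by
  refine sum_nonneg fun a _ => ?_
  split_ifs
  · exact refShape_nonneg ((hM.strict i).quadInv_mem hx) a
  · exact le_rfl

lemma cutFun_mem (hM : M.IsCoarseGrid G) (j : Fin M.N) (n : ℕ) {i : Fin M.N} {x : Pt}
    (hx : x ∈ M.elem i) : 0 ≤ M.cutFun j n i x ∧ M.cutFun j n i x ≤ 1 := by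
  classical
  constructor
  · refine sum_nonneg fun k _ => ?_
    split_ifs
    · exact hM.chi_nonneg hx k
    · exact le_rfl
  · rw [← hM.sum_chi i x]
    refine sum_le_sum fun k _ => ?_
    split_ifs
    · exact le_rfl
    · exact hM.chi_nonneg hx k

lemma cutFun_eq_one (hM : M.IsCoarseGrid G) {j : Fin M.N} {n : ℕ} {i : Fin M.N}
    (hi : i ∈ M.layer j n) (x : Pt) : M.cutFun j n i x = 1 := by
  classical
  rw [← hM.sum_chi i x]
  refine sum_congr rfl fun k _ => ?_
  split_ifs with h
  · rfl
  · rw [chi_of_notMem fun hk => h ⟨i, hi, hk⟩]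

lemma cutFun_eq_zero {j : Fin M.N} {n : ℕ} {i : Fin M.N} (hi : i ∉ M.layer j (n + 1)) (x : Pt) :
    M.cutFun j n i x = 0 := by
  classical
  refine sum_eq_zero fun k _ => ?_
  split_ifs with h
  · rw [chi_of_notMem fun hk => hi (mem_layer_succ_of_nodes hk h)]
  · rfl

lemma cutGrad_eq_zero {j : Fin M.N} {n : ℕ} {i : Fin M.N} (hi : i ∉ M.layer j (n + 1)) (x : Pt) :
    M.cutGrad j n i x = 0 := by
  classical
  refine sum_eq_zero fun k _ => ?_
  split_ifs with h
  · rw [gradChi_of_notMem fun hk => hi (mem_layer_succ_of_nodes hk h)]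
  · rfl

lemma cutGrad_eq_zero' (hM : M.IsCoarseGrid G) {j : Fin M.N} {n : ℕ} {i : Fin M.N}
    (hi : i ∈ M.layer j n) {x : Pt} (hx : x ∈ M.elem i) : M.cutGrad j n i x = 0 := by
  have h1 := (piecewiseC1_cut hM j n).grad i x hx
  have h2 : HasGradientWithinAt (M.cutFun j n i) 0 (M.elem i) x := by
    have e : M.cutFun j n i = fun _ => 1 := funext fun y => cutFun_eq_one hM hi y
    rw [e]; exact hasGradientWithinAt_const _ _ _
  rw [← gradientWithin_eq (hM.uniqueDiffOn i x hx) h1, gradientWithin_eq (hM.uniqueDiffOn i x hx) h2]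

lemma norm_cutGrad_le (hM : M.IsCoarseGrid G) {γ : ℝ} (hγ : M.ShapeRegular γ) (j : Fin M.N) (n : ℕ)
    {i : Fin M.N} {x : Pt} (hx : x ∈ M.elem i) : ‖M.cutGrad j n i x‖ ≤ 4 * (γ / M.meshSize) := by
  classical
  calc ‖∑ k, if k ∈ M.nodes j n then M.gradChi i k x else 0‖
      ≤ ∑ k, ‖if k ∈ M.nodes j n then M.gradChi i k x else 0‖ := norm_sum_le _ _
    _ ≤ ∑ k, ‖M.gradChi i k x‖ := sum_le_sum fun k _ => by split_ifs <;> simp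
    _ = ∑ a, ‖M.gradShape i a x‖ := hM.sum_gradChi i hx (fun v => ‖v‖) (by simp)
    _ ≤ ∑ a : Fin 4, γ / M.meshSize := sum_le_sum fun a _ => by rw [← hM.gradChi_vtx i a hx]; exact hγ i _ x hx
    _ = _ := by simp

end QuadMesh

/-! ### A continuously differentiable truncation -/

lemma hasDerivAt_max_zero_sq (x : ℝ) : HasDerivAt (fun y : ℝ => max y 0 ^ 2) (2 * max x 0) x := by
  rcases lt_trichotomy x 0 with h | rfl | h
  · rw [max_eq_right h.le, mul_zero]
    refine (hasDerivAt_const x (0 : ℝ)).congr_of_eventuallyEq ?_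
    filter_upwards [Iio_mem_nhds h] with y hy
    rw [max_eq_right (le_of_lt hy)]; norm_num
  · rw [max_self, mul_zero, hasDerivAt_iff_isLittleO, Asymptotics.isLittleO_iff]; intro c hc
    filter_upwards [Metric.ball_mem_nhds (0 : ℝ) hc] with y hy
    rw [Metric.mem_ball, dist_zero_right, Real.norm_eq_abs] at hy
    have h1 : max y 0 ≤ |y| := max_le (le_abs_self y) (abs_nonneg y)
    have h2 : 0 ≤ max y 0 := le_max_right _ _
    simp only [max_self, sub_zero, smul_zero, Real.norm_eq_abs]
    rw [show max y 0 ^ 2 - 0 ^ 2 = max y 0 ^ 2 by ring, abs_of_nonneg (sq_nonneg _)]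
    nlinarith [abs_nonneg y]
  · rw [max_eq_left h.le]
    have := (hasDerivAt_pow 2 x)
    simp only [Nat.cast_ofNat, Nat.add_one_sub_one, pow_one] at this
    refine this.congr_of_eventuallyEq ?_
    filter_upwards [Ioi_mem_nhds h] with y hy
    rw [max_eq_left (le_of_lt hy)]

/-- `truncRatio δ s = (s - δ)₊ / max s δ`. -/
def truncRatio (δ s : ℝ) : ℝ := max (s - δ) 0 / max s δ

/-- `trunc δ s = (s - δ)₊² / s`. -/
def trunc (δ s : ℝ) : ℝ := max (s - δ) 0 ^ 2 / max s δ

def truncDeriv (δ s : ℝ) : ℝ := 2 * truncRatio δ s - truncRatio δ s ^ 2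

variable {δ : ℝ}

lemma continuous_truncDeriv (hδ : 0 < δ) : Continuous (truncDeriv δ) := by
  have : Continuous (truncRatio δ) := by
    refine Continuous.div (by fun_prop) (by fun_prop) fun s => ?_
    exact (hδ.trans_le (le_max_right s δ)).ne'
  unfold truncDeriv; fun_prop

lemma trunc_of_le {s : ℝ} (h : s ≤ δ) : trunc δ s = 0 := by rw [trunc, max_eq_right (by linarith : s - δ ≤ 0)]; simp

lemma truncRatio_of_le {s : ℝ} (h : s ≤ δ) : truncRatio δ s = 0 := by
  rw [truncRatio, max_eq_right (by linarith : s - δ ≤ 0)]; simp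

lemma hasDerivAt_trunc (hδ : 0 < δ) (s : ℝ) : HasDerivAt (trunc δ) (truncDeriv δ s) s := by
  rcases lt_or_ge s δ with h | h
  · have e : truncDeriv δ s = 0 := by simp [truncDeriv, truncRatio_of_le h.le]
    rw [e]
    refine (hasDerivAt_const s (0 : ℝ)).congr_of_eventuallyEq ?_
    filter_upwards [Iio_mem_nhds h] with y hy
    exact trunc_of_le (le_of_lt hy)
  · have hs : 0 < s := hδ.trans_le h
    have h1 : HasDerivAt (fun y : ℝ => max (y - δ) 0 ^ 2) (2 * max (s - δ) 0) s := by
      have h := HasDerivAt.comp s (hasDerivAt_max_zero_sq (s - δ)) ((hasDerivAt_id s).sub_const δ)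
      rw [mul_one] at h; exact h
    have h2 : HasDerivAt (fun y : ℝ => max (y - δ) 0 ^ 2 / y)
        ((2 * max (s - δ) 0 * s - max (s - δ) 0 ^ 2 * 1) / s ^ 2) s := h1.div (hasDerivAt_id s) hs.ne'
    have e : truncDeriv δ s = (2 * max (s - δ) 0 * s - max (s - δ) 0 ^ 2 * 1) / s ^ 2 := by
      rw [truncDeriv, truncRatio, max_eq_left h]; field_simp
    rw [e]
    refine h2.congr_of_eventuallyEq ?_
    filter_upwards [Ioi_mem_nhds hs] with y hy
    rcases le_total δ y with h' | h'
    · rw [trunc, max_eq_left h']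
    · rw [trunc_of_le h', max_eq_right (by linarith : y - δ ≤ 0)]; simp

lemma truncRatio_mem (hδ : 0 < δ) (s : ℝ) : 0 ≤ truncRatio δ s ∧ truncRatio δ s ≤ 1 := by
  have h : 0 < max s δ := hδ.trans_le (le_max_right s δ)
  constructor
  · exact div_nonneg (le_max_right _ _) h.le
  · rw [truncRatio, div_le_one h]
    refine max_le ?_ h.le
    linarith [le_max_left s δ]

lemma abs_truncDeriv_le (hδ : 0 < δ) (s : ℝ) : |truncDeriv δ s| ≤ 1 := by
  obtain ⟨h0, h1⟩ := truncRatio_mem hδ s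
  rw [truncDeriv, abs_le]; constructor <;> nlinarith

lemma trunc_nonneg (hδ : 0 < δ) (s : ℝ) : 0 ≤ trunc δ s := div_nonneg (sq_nonneg _) (hδ.trans_le (le_max_right s δ)).le

lemma trunc_le (hδ : 0 < δ) {s : ℝ} (hs : 0 ≤ s) : trunc δ s ≤ s := by
  rcases le_total s δ with h | h
  · rw [trunc_of_le h]; exact hs
  · have hs : 0 < s := hδ.trans_le h
    rw [trunc, max_eq_left h, max_eq_left (by linarith), div_le_iff₀ hs]; nlinarith

lemma sub_le_trunc (hδ : 0 < δ) {s : ℝ} : s - 2 * δ ≤ trunc δ s := by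
  rcases le_total s δ with h | h
  · rw [trunc_of_le h]; linarith
  · have hs : 0 < s := hδ.trans_le h
    rw [trunc, max_eq_left h, max_eq_left (by linarith), le_div_iff₀ hs]; nlinarith [sq_nonneg δ]

namespace QuadMesh

/-- The gradient of the bubble function. -/
def bubbleGrad (M : QuadMesh) (j : Fin M.N) (x : Pt) : Pt :=
  ∑ a, (∏ b ∈ Finset.univ.erase a, M.chi j (M.vtx j b) x) • M.gradChi j (M.vtx j a) x

lemma hasGradientWithinAt_bubble (hM : M.IsCoarseGrid G) (j : Fin M.N) {x : Pt} (hx : x ∈ M.elem j) :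
    HasGradientWithinAt (M.bubble j) (M.bubbleGrad j x) (M.elem j) x := by
  rw [hasGradientWithinAt_iff_hasFDerivWithinAt]
  have h := HasFDerivWithinAt.finsetProd (u := (Finset.univ : Finset (Fin 4))) (x := x)
    (g := fun a => M.chi j (M.vtx j a)) (fun a _ =>
      (hM.hasGradientWithinAt_chi j (M.vtx j a) hx).hasFDerivWithinAt)
  have e : (InnerProductSpace.toDual ℝ Pt) (M.bubbleGrad j x) =
      ∑ a, (∏ b ∈ Finset.univ.erase a, M.chi j (M.vtx j b) x) •
        (InnerProductSpace.toDual ℝ Pt) (M.gradChi j (M.vtx j a) x) := by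
    rw [bubbleGrad, map_sum]; simp
  rw [e]; exact h

lemma continuousOn_chi (hM : M.IsCoarseGrid G) (j : Fin M.N) (k : Fin M.Nc) :
    ContinuousOn (M.chi j k) (M.elem j) := fun _ hx =>
  (hM.hasGradientWithinAt_chi j k hx).differentiableWithinAt.continuousWithinAt

lemma bubble_mem (hM : M.IsCoarseGrid G) {j : Fin M.N} {x : Pt} (hx : x ∈ M.elem j) :
    0 ≤ M.bubble j x ∧ M.bubble j x ≤ 1 := by
  have h : ∀ a, 0 ≤ M.chi j (M.vtx j a) x ∧ M.chi j (M.vtx j a) x ≤ 1 := fun a => by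
    rw [hM.chi_vtx]
    exact ⟨refShape_nonneg ((hM.strict j).quadInv_mem hx) a, refShape_le_one ((hM.strict j).quadInv_mem hx) a⟩
  exact ⟨prod_nonneg fun a _ => (h a).1, prod_le_one (fun a _ => (h a).1) fun a _ => (h a).2⟩

lemma norm_bubbleGrad_le (hM : M.IsCoarseGrid G) {γ : ℝ} (hγ : M.ShapeRegular γ) {j : Fin M.N} {x : Pt}
    (hx : x ∈ M.elem j) : ‖M.bubbleGrad j x‖ ≤ 4 * (γ / M.meshSize) := by
  have h : ∀ a, 0 ≤ M.chi j (M.vtx j a) x ∧ M.chi j (M.vtx j a) x ≤ 1 := fun a => by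
    rw [hM.chi_vtx]
    exact ⟨refShape_nonneg ((hM.strict j).quadInv_mem hx) a, refShape_le_one ((hM.strict j).quadInv_mem hx) a⟩
  calc ‖M.bubbleGrad j x‖ ≤ ∑ a : Fin 4, γ / M.meshSize := by
        refine (norm_sum_le _ _).trans (sum_le_sum fun a _ => ?_)
        rw [norm_smul, Real.norm_eq_abs, abs_of_nonneg (prod_nonneg fun b _ => (h b).1)]
        have h1 := prod_le_one (s := Finset.univ.erase a) (fun b _ => (h b).1) fun b _ => (h b).2
        have h2 := hγ j (M.vtx j a) x hx
        calc _ ≤ 1 * ‖M.gradChi j (M.vtx j a) x‖ := by gcongr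
          _ ≤ _ := by rw [one_mul]; exact h2
    _ = _ := by simp

open Classical in
/-- The truncated bubble function of `K_j`, extended by zero. -/
def truncBubble (M : QuadMesh) (δ : ℝ) (j i : Fin M.N) (x : Pt) : ℝ := if i = j then trunc δ (M.bubble j x) else 0

open Classical in
def truncBubbleGrad (M : QuadMesh) (δ : ℝ) (j i : Fin M.N) (x : Pt) : Pt :=
  if i = j then truncDeriv δ (M.bubble j x) • M.bubbleGrad j x else 0

lemma piecewiseC1_truncBubble (hM : M.IsCoarseGrid G) (hδ : 0 < δ) (j : Fin M.N) :
    M.PiecewiseC1 (M.truncBubble δ j) (M.truncBubbleGrad δ j) where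
  grad i x hx := by
    rcases eq_or_ne i j with rfl | h
    · have h1 := hasGradientWithinAt_bubble hM i hx
      rw [hasGradientWithinAt_iff_hasFDerivWithinAt] at h1 ⊢
      have h2 := (hasDerivAt_trunc hδ (M.bubble i x)).comp_hasFDerivWithinAt x h1
      have e1 : M.truncBubble δ i i = trunc δ ∘ M.bubble i := by funext y; simp [truncBubble]
      have e2 : M.truncBubbleGrad δ i i x = truncDeriv δ (M.bubble i x) • M.bubbleGrad i x := by simp [truncBubbleGrad]
      rw [e1, e2]; simpa using h2
    · have e1 : M.truncBubble δ j i = fun _ => 0 := by funext y; simp [truncBubble, h]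
      have e2 : M.truncBubbleGrad δ j i x = 0 := by simp [truncBubbleGrad, h]
      rw [e1, e2]; exact hasGradientWithinAt_const _ _ _
  cont i := by
    rcases eq_or_ne i j with rfl | h
    · have e2 : M.truncBubbleGrad δ i i = fun x => truncDeriv δ (M.bubble i x) • M.bubbleGrad i x := by
        funext x; simp [truncBubbleGrad]
      rw [e2]
      have hb : ContinuousOn (M.bubble i) (M.elem i) := fun x hx =>
        (hasGradientWithinAt_bubble hM i hx).differentiableWithinAt.continuousWithinAt
      refine ((continuous_truncDeriv hδ).comp_continuousOn hb).smul ?_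
      exact continuousOn_finsetSum _ fun a _ => (continuousOn_finsetProd _ fun b _ =>
        continuousOn_chi hM i _).smul (hM.continuousOn_gradChi i _)
    · have e2 : M.truncBubbleGrad δ j i = fun _ => 0 := by funext x; simp [truncBubbleGrad, h]
      rw [e2]; exact continuousOn_const
  agree i i' x hx hx' := by
    have key : ∀ i i', x ∈ M.elem i → x ∈ M.elem i' → i ≠ i' → M.truncBubble δ j i x = 0 := by
      intro i i' hx hx' hne
      rcases eq_or_ne i j with rfl | h
      · simp only [truncBubble, if_true]; rw [hM.bubble_eq_zero hx (hM.notMem_interior hne hx'), trunc_of_le hδ.le]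
      · simp [truncBubble, h]
    rcases eq_or_ne i i' with rfl | hne
    · rfl
    · rw [key i i' hx hx' hne, key i' i hx' hx hne.symm]

end QuadMesh

namespace FracturedDomain

variable (G : FracturedDomain)

/-- Length and unit tangent of a fracture. -/
def len (l : Fin G.nf) : ℝ := ‖G.b l - G.a l‖
def dir (l : Fin G.nf) : Pt := (G.len l)⁻¹ • (G.b l - G.a l)

lemma len_pos (l : Fin G.nf) : 0 < G.len l := norm_pos_iff.2 (sub_ne_zero.2 (G.a_ne_b l).symm)

lemma norm_dir (l : Fin G.nf) : ‖G.dir l‖ = 1 := by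
  have := (G.len_pos l).ne'
  rw [dir, norm_smul, norm_inv, Real.norm_eq_abs, abs_of_pos (G.len_pos l)]; exact inv_mul_cancel₀ this

lemma len_smul_dir (l : Fin G.nf) : G.len l • G.dir l = G.b l - G.a l := by
  rw [dir, smul_smul, mul_inv_cancel₀ (G.len_pos l).ne', one_smul]

lemma tangent_eq (l : Fin G.nf) : G.tangent l = Submodule.span ℝ {G.dir l} :=
  (Submodule.span_singleton_smul_eq (IsUnit.mk0 _ (inv_ne_zero (G.len_pos l).ne')) _).symm

/-- Arc length parametrization. -/
def param (l : Fin G.nf) (t : ℝ) : Pt := G.a l + t • G.dir l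

lemma continuous_param (l : Fin G.nf) : Continuous (G.param l) := by unfold param; fun_prop

lemma isometry_param (l : Fin G.nf) : Isometry (G.param l) := by
  refine Isometry.of_dist_eq fun s t => ?_
  rw [dist_eq_norm, dist_eq_norm, param, param, add_sub_add_left_eq_sub, ← sub_smul, norm_smul, norm_dir, mul_one]

lemma seg_eq (l : Fin G.nf) : G.seg l = G.param l '' Icc 0 (G.len l) := by
  have hl := G.len_pos l
  rw [seg, segment_eq_image']; ext x
  constructor
  · rintro ⟨θ, hθ, rfl⟩
    refine ⟨θ * G.len l, ⟨by have := hθ.1; positivity, by nlinarith [hθ.2]⟩, ?_⟩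
    simp only [param]; rw [mul_smul, len_smul_dir]
  · rintro ⟨t, ht, rfl⟩
    refine ⟨t / G.len l, ⟨div_nonneg ht.1 hl.le, (div_le_one hl).2 ht.2⟩, ?_⟩
    simp only [param]; rw [← len_smul_dir, smul_smul, div_mul_cancel₀ _ hl.ne']

lemma preimage_seg (l : Fin G.nf) : G.param l ⁻¹' G.seg l = Icc 0 (G.len l) := by
  rw [seg_eq, preimage_image_eq _ (G.isometry_param l).injective]

lemma pieceMeas_succ_eq_map (l : Fin G.nf) :
    G.pieceMeas l.succ = ((volume : Measure ℝ).restrict (Icc 0 (G.len l))).map (G.param l) := by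
  have hm : MeasurableSet (G.seg l) := measurableSet_seg l
  have h := (G.isometry_param l).map_hausdorffMeasure (d := 1) (Or.inl zero_le_one)
  rw [hausdorffMeasure_real] at h
  rw [pieceMeas_succ, ← preimage_seg, ← Measure.restrict_map (G.continuous_param l).measurable hm, h,
    Measure.restrict_restrict hm, inter_eq_left.2]
  rw [seg_eq]; exact image_subset_range _ _

lemma ae_pieceMeas_succ_iff (l : Fin G.nf) {P : Pt → Prop} :
    (∀ᵐ x ∂G.pieceMeas l.succ, P x) ↔ ∀ᵐ t ∂(volume : Measure ℝ).restrict (Icc 0 (G.len l)), P (G.param l t) := by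
  rw [pieceMeas_succ_eq_map]; exact (G.isometry_param l).isClosedEmbedding.measurableEmbedding.ae_map_iff

/-- The tangent space on a piece. -/
def tan (o : Fin (G.nf + 1)) : Submodule ℝ Pt := Fin.cases ⊤ G.tangent o

lemma volume_seg (l : Fin G.nf) : (volume : Measure Pt) (G.seg l) = 0 := by
  have h1 : G.seg l ⊆ (AffineSubspace.mk' (G.a l) (G.tangent l) : Set Pt) := by
    rw [seg_eq]; rintro _ ⟨t, -, rfl⟩
    rw [SetLike.mem_coe, AffineSubspace.mem_mk', param, vsub_eq_sub, add_sub_cancel_left, tangent_eq]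
    exact Submodule.smul_mem _ _ (Submodule.mem_span_singleton_self _)
  refine measure_mono_null h1 (Measure.addHaar_affineSubspace _ _ fun h => ?_)
  have h2 : G.tangent l = ⊤ := by
    have := congrArg AffineSubspace.direction h
    simpa using this
  have h3 := finrank_span_singleton (K := ℝ) (v := G.dir l) (by
    intro h; have := G.norm_dir l; rw [h] at this; simp at this)
  rw [← tangent_eq, h2, finrank_top] at h3; simp at h3

lemma tangent_eq_of_mem {l l' : Fin G.nf} {x y : Pt} (hx : x ∈ G.seg l) (hx' : x ∈ G.seg l')
    (hy : y ∈ G.seg l) (hy' : y ∈ G.seg l') (hxy : x ≠ y) : G.tangent l = G.tangent l' := by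
  have key : ∀ l, x ∈ G.seg l → y ∈ G.seg l → G.tangent l = Submodule.span ℝ {y - x} := by
    intro l hx hy; rw [seg_eq] at hx hy
    obtain ⟨s, -, rfl⟩ := hx
    obtain ⟨t, -, rfl⟩ := hy
    have : t - s ≠ 0 := by
      intro h; apply hxy; rw [sub_eq_zero.1 h]
    rw [param, param, add_sub_add_left_eq_sub, ← sub_smul, tangent_eq]
    exact (Submodule.span_singleton_smul_eq (IsUnit.mk0 _ this) _).symm
  rw [key l hx hy, key l' hx' hy']

instance : NullSingletonClass (Measure.hausdorffMeasure 1 : Measure Pt) :=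
  Measure.nullSingletonClass_hausdorff Pt zero_lt_one

lemma tangentAt_ae : ∀ᵐ z ∂G.mu, G.tangentAt z.2 = G.tan z.1 := by
  rw [ae_mu_iff]; intro o
  refine Fin.cases ?_ (fun l => ?_) o
  · have h : ∀ᵐ x ∂(volume : Measure Pt), ∀ l, x ∉ G.seg l := ae_all_iff.2 fun l =>
      measure_eq_zero_iff_ae_notMem.1 (G.volume_seg l)
    filter_upwards [ae_restrict_of_ae h] with x hx
    change G.tangentAt x = ⊤
    simp [tangentAt, hx]
  · have h : ∀ᵐ x ∂G.pieceMeas l.succ, ∀ l', x ∈ G.seg l' → G.tangent l ≤ G.tangent l' := by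
      refine ae_all_iff.2 fun l' => ?_
      by_cases hl : G.tangent l = G.tangent l'
      · exact .of_forall fun x _ => hl.le
      · rw [pieceMeas_succ, ae_restrict_iff' (measurableSet_seg l)]
        have hs : (G.seg l ∩ G.seg l').Subsingleton := fun x hx y hy => by
          by_contra hxy
          exact hl (G.tangent_eq_of_mem hx.1 hx.2 hy.1 hy.2 hxy)
        filter_upwards [measure_eq_zero_iff_ae_notMem.1 (hs.measure_zero (Measure.hausdorffMeasure 1))]
          with x hx hx1 hx2
        exact absurd ⟨hx1, hx2⟩ hx
    have h2 : ∀ᵐ x ∂G.pieceMeas l.succ, x ∈ G.seg l := ae_restrict_mem (measurableSet_seg l)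
    filter_upwards [h, h2] with x hx hxl
    refine le_antisymm (iInf₂_le l hxl) (le_iInf₂ hx)

end FracturedDomain

lemma aestronglyMeasurable_meas_iff {F : Type*} [TopologicalSpace F] [TopologicalSpace.PseudoMetrizableSpace F]
    {f : Pt → F} : AEStronglyMeasurable f G.meas ↔ ∀ o, AEStronglyMeasurable f (G.pieceMeas o) := by
  constructor
  · intro h o; exact (h.smul_measure _).mono_measure (G.pieceMeas_le o)
  · intro h; rw [G.meas_eq, ← Measure.sum_fintype, aestronglyMeasurable_sum_measure_iff]
    exact fun o => (h o).smul_measure _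

lemma aestronglyMeasurable_proj {v : Pt → Pt} (hv : AEStronglyMeasurable v G.meas) :
    AEStronglyMeasurable (fun x => (G.tangentAt x).starProjection (v x)) G.meas := by
  rw [aestronglyMeasurable_meas_iff] at hv ⊢; intro o
  have h := (G.ae_mu_iff.1 G.tangentAt_ae) o
  refine ((G.tan o).starProjection.continuous.comp_aestronglyMeasurable (hv o)).congr ?_
  filter_upwards [h] with x hx
  simp only [hx]

namespace QuadMesh

/-- Almost everywhere, the tangential gradients of a piecewise `C¹` function from the elements that
meet in a point agree. -/
lemma PiecewiseC1.ae_proj_eq (hM : M.IsCoarseGrid G) {h : Fin M.N → Pt → ℝ} {g : Fin M.N → Pt → Pt}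
    (hh : M.PiecewiseC1 h g) : ∀ᵐ x ∂G.meas, ∀ i i', x ∈ M.elem i → x ∈ M.elem i' →
      (G.tangentAt x).starProjection (g i x) = (G.tangentAt x).starProjection (g i' x) := by
  have h0 : ∀ᵐ z ∂G.mu, ∀ i i', z.2 ∈ M.elem i → z.2 ∈ M.elem i' →
      (G.tan z.1).starProjection (g i z.2) = (G.tan z.1).starProjection (g i' z.2) := by
    rw [G.ae_mu_iff]; intro o
    refine Fin.cases ?_ (fun l => ?_) o
    · have hf : ∀ᵐ x ∂(volume : Measure Pt), ∀ i, x ∉ frontier (M.elem i) := ae_all_iff.2 fun i =>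
        measure_eq_zero_iff_ae_notMem.1 ((elem_convex i).addHaar_frontier volume)
      filter_upwards [ae_restrict_of_ae hf] with x hx i i' hi hi'
      rcases eq_or_ne i i' with rfl | hne
      · rfl
      · exact absurd ⟨subset_closure hi, hM.notMem_interior hne hi'⟩ (hx i)
    · rw [G.ae_pieceMeas_succ_iff]
      have hconv : ∀ i, Convex ℝ (G.param l ⁻¹' M.elem i) := fun i => by
        intro s hs t ht α β hα hβ hαβ
        have := elem_convex i hs ht hα hβ hαβ
        have e : G.param l (α • s + β • t) = α • G.param l s + β • G.param l t := by
          simp only [FracturedDomain.param]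
          have : G.a l = (α + β) • G.a l := by rw [hαβ, one_smul]
          nth_rw 1 [this]
          simp only [smul_eq_mul]; module
        rw [mem_preimage, e]; exact this
      have hf : ∀ᵐ t ∂(volume : Measure ℝ), ∀ i, t ∉ frontier (G.param l ⁻¹' M.elem i) :=
        ae_all_iff.2 fun i => measure_eq_zero_iff_ae_notMem.1 ((hconv i).addHaar_frontier volume)
      filter_upwards [ae_restrict_of_ae hf] with t ht i i' hi hi'
      have hint : ∀ i, G.param l t ∈ M.elem i → G.param l ⁻¹' M.elem i ∈ 𝓝 t := by
        intro i hi; by_contra hcon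
        exact ht i ⟨subset_closure hi, fun hh => hcon (mem_interior_iff_mem_nhds.1 hh)⟩
      have hd : ∀ i, G.param l t ∈ M.elem i →
          HasDerivAt (fun s => h i (G.param l s)) ⟪g i (G.param l t), G.dir l⟫_ℝ t := by
        intro i hi
        have hp : HasDerivAt (G.param l) (G.dir l) t := by
          have : HasDerivAt (fun s : ℝ => G.a l + s • G.dir l) ((1 : ℝ) • G.dir l) t :=
            ((hasDerivAt_id t).smul_const (G.dir l)).const_add (G.a l)
          rw [one_smul] at this; exact this
        have := (hh.grad i _ hi).hasFDerivWithinAt.comp_hasDerivWithinAt t hp.hasDerivWithinAt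
          (mapsTo_preimage (G.param l) (M.elem i))
        exact this.hasDerivAt (hint i hi)
      have heq : (fun s => h i (G.param l s)) =ᶠ[𝓝 t] fun s => h i' (G.param l s) := by
        filter_upwards [hint i hi, hint i' hi'] with s hs hs'
        exact hh.agree i i' _ hs hs'
      have := (hd i hi).unique ((hd i' hi').congr_of_eventuallyEq heq)
      change (G.tangent l).starProjection (g i (G.param l t)) = (G.tangent l).starProjection (g i' (G.param l t))
      rw [← sub_eq_zero, ← map_sub, ← norm_eq_zero]; simp only [G.tangent_eq]
      rw [norm_starProjection_span (G.norm_dir l), inner_sub_left, this, sub_self, abs_zero]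
  rw [← G.ae_mu_snd_iff]
  filter_upwards [h0, G.tangentAt_ae] with z hz ht
  rw [ht]; exact hz

open Classical in
/-- The function on the union of the elements with the given values on the elements. -/
def glue {F : Type*} [Zero F] (M : QuadMesh) (h : Fin M.N → Pt → F) (x : Pt) : F :=
  if hx : ∃ i, x ∈ M.elem i then h hx.choose x else 0

lemma glue_of_notMem {F : Type*} [Zero F] {h : Fin M.N → Pt → F} {x : Pt} (hx : ∀ i, x ∉ M.elem i) :
    M.glue h x = 0 := by
  rw [glue, dif_neg]; push Not; exact hx

lemma exists_glue_eq {F : Type*} [Zero F] (h : Fin M.N → Pt → F) {x : Pt} {i : Fin M.N} (hx : x ∈ M.elem i) :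
    ∃ i', x ∈ M.elem i' ∧ M.glue h x = h i' x := by
  have hx' : ∃ i, x ∈ M.elem i := ⟨i, hx⟩
  exact ⟨hx'.choose, hx'.choose_spec, by rw [glue, dif_pos hx']⟩

lemma PiecewiseC1.glue_eq {h : Fin M.N → Pt → ℝ} {g : Fin M.N → Pt → Pt} (hh : M.PiecewiseC1 h g)
    {x : Pt} {i : Fin M.N} (hx : x ∈ M.elem i) : M.glue h x = h i x := by
  obtain ⟨i', hi', e⟩ := exists_glue_eq h hx
  rw [e]; exact hh.agree _ _ _ hi' hx

lemma eventually_mem_elem (M : QuadMesh) (x : Pt) : ∀ᶠ y in 𝓝 x, ∀ i, y ∈ M.elem i → x ∈ M.elem i := by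
  rw [Filter.eventually_all]; intro i
  by_cases hx : x ∈ M.elem i
  · exact .of_forall fun _ _ => hx
  · filter_upwards [(isClosed_elem i).isOpen_compl.mem_nhds hx] with y hy hy'
    exact absurd hy' hy

lemma IsCoarseGrid.exists_mem (hM : M.IsCoarseGrid G) {x : Pt} (hx : x ∈ G.Ω) : ∃ i, x ∈ M.elem i := by
  have : x ∈ ⋃ i, M.elem i := by rw [hM.iUnion_elem]; exact subset_closure hx
  simpa using this

variable {h : Fin M.N → Pt → ℝ} {g : Fin M.N → Pt → Pt}

lemma PiecewiseC1.continuousOn (hh : M.PiecewiseC1 h g) (i : Fin M.N) : ContinuousOn (h i) (M.elem i) :=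
  fun _ hx => (hh.grad i _ hx).differentiableWithinAt.continuousWithinAt

lemma PiecewiseC1.continuousOn_glue (hh : M.PiecewiseC1 h g) : ContinuousOn (M.glue h) (⋃ i, M.elem i) := by
  refine (locallyFinite_of_finite M.elem).continuousOn_iUnion (fun i => isClosed_elem i) fun i => ?_
  exact (hh.continuousOn i).congr fun x hx => hh.glue_eq hx

lemma PiecewiseC1.exists_bound (hh : M.PiecewiseC1 h g) :
    ∃ B, 0 ≤ B ∧ ∀ i, ∀ x ∈ M.elem i, ‖h i x‖ ≤ B ∧ ‖g i x‖ ≤ B := by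
  have h1 : ∀ i, ∃ B, ∀ x ∈ M.elem i, ‖h i x‖ ≤ B := fun i =>
    (isCompact_elem i).exists_bound_of_continuousOn (hh.continuousOn i)
  have h2 : ∀ i, ∃ B, ∀ x ∈ M.elem i, ‖g i x‖ ≤ B := fun i =>
    (isCompact_elem i).exists_bound_of_continuousOn (hh.cont i)
  choose B1 hB1 using h1
  choose B2 hB2 using h2
  refine ⟨∑ i, (|B1 i| + |B2 i|), sum_nonneg fun i _ => by positivity, fun i x hx => ?_⟩
  have := single_le_sum (f := fun i => |B1 i| + |B2 i|) (fun i _ => by positivity) (Finset.mem_univ i)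
  exact ⟨by linarith [hB1 i x hx, le_abs_self (B1 i), abs_nonneg (B2 i)],
    by linarith [hB2 i x hx, le_abs_self (B2 i), abs_nonneg (B1 i)]⟩

lemma PiecewiseC1.neg (hh : M.PiecewiseC1 h g) : M.PiecewiseC1 (fun i x => - h i x) (fun i x => - g i x) where
  grad i x hx := by
    have := hh.grad i x hx
    rw [hasGradientWithinAt_iff_hasFDerivWithinAt] at this ⊢; rw [map_neg]
    exact this.neg
  cont i := (hh.cont i).neg
  agree i i' x hx hx' := by rw [hh.agree i i' x hx hx']

lemma PiecewiseC1.glue_sub_le (hh : M.PiecewiseC1 h g) {z w : Pt} {c : ℝ}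
    (hseg : ∀ t ∈ Icc (0 : ℝ) 1, ∃ i, z + t • w ∈ M.elem i)
    (hc : ∀ t ∈ Icc (0 : ℝ) 1, ∀ i, z + t • w ∈ M.elem i → ⟪g i (z + t • w), w⟫_ℝ ≤ c) :
    M.glue h (z + w) - M.glue h z ≤ c := by
  set y : ℝ → Pt := fun t => z + t • w with hy
  have hyc : Continuous y := by fun_prop
  have hcont : ContinuousOn (fun t => M.glue h (y t)) (Icc 0 1) :=
    hh.continuousOn_glue.comp hyc.continuousOn fun t ht => mem_iUnion.2 (hseg t ht)
  have key := image_le_of_liminf_slope_right_le_deriv_boundary (f := fun t => M.glue h (y t))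
    (B := fun t => M.glue h (y 0) + c * t) (B' := fun _ => c) hcont (by simp) (by fun_prop)
    (fun t _ => by
      have := ((hasDerivAt_id t).const_mul c).const_add (M.glue h (y 0))
      rw [mul_one] at this; exact this.hasDerivWithinAt)
    (fun t ht r hr => by
      refine Filter.Eventually.frequently ?_
      have hall : ∀ i, ∀ᶠ s in 𝓝[>] t, y s ∈ M.elem i → slope (fun t => M.glue h (y t)) t s < r := by
        intro i
        by_cases hi : y t ∈ M.elem i
        · have hd : HasDerivWithinAt (fun s => h i (y s)) ⟪g i (y t), w⟫_ℝ (y ⁻¹' M.elem i) t := by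
            have hp : HasDerivAt y w t := by
              have : HasDerivAt y ((1 : ℝ) • w) t := ((hasDerivAt_id t).smul_const w).const_add z
              rwa [one_smul] at this
            exact (hh.grad i _ hi).hasFDerivWithinAt.comp_hasDerivWithinAt t hp.hasDerivWithinAt
              (mapsTo_preimage y (M.elem i))
          rw [hasDerivWithinAt_iff_tendsto_slope] at hd
          have hlt := hd.eventually_lt_const ((hc t ⟨ht.1, ht.2.le⟩ i hi).trans_lt hr)
          rw [eventually_nhdsWithin_iff] at hlt ⊢
          filter_upwards [hlt] with s hs hts hsi
          have := hs ⟨hsi, (ne_of_gt hts)⟩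
          rw [slope_def_field] at this ⊢; rw [hh.glue_eq hsi, hh.glue_eq hi]
          exact this
        · have : ∀ᶠ s in 𝓝 t, y s ∉ M.elem i :=
            hyc.continuousAt.eventually ((isClosed_elem i).isOpen_compl.mem_nhds hi)
          filter_upwards [nhdsWithin_le_nhds this] with s hs hs'
          exact absurd hs' hs
      rw [← Filter.eventually_all] at hall
      have h1 : ∀ᶠ s in 𝓝[>] t, s ∈ Icc (0 : ℝ) 1 := by
        filter_upwards [Ioo_mem_nhdsGT ht.2] with s hs
        exact ⟨ht.1.trans hs.1.le, hs.2.le⟩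
      filter_upwards [hall, h1] with s hs h1
      obtain ⟨i, hi⟩ := hseg s h1
      exact hs i hi)
  have := key (right_mem_Icc.2 zero_le_one)
  simp only [hy, one_smul, zero_smul, add_zero, mul_one] at this; linarith

lemma PiecewiseC1.glue_neg (hh : M.PiecewiseC1 h g) (x : Pt) : M.glue (fun i x => - h i x) x = - M.glue h x := by
  by_cases hx : ∃ i, x ∈ M.elem i
  · obtain ⟨i, hi⟩ := hx
    rw [hh.neg.glue_eq hi, hh.glue_eq hi]
  · push Not at hx
    rw [glue_of_notMem hx, glue_of_notMem hx, neg_zero]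

lemma PiecewiseC1.abs_glue_sub_le (hh : M.PiecewiseC1 h g) {z w : Pt} {c η : ℝ}
    (hseg : ∀ t ∈ Icc (0 : ℝ) 1, ∃ i, z + t • w ∈ M.elem i)
    (hc : ∀ t ∈ Icc (0 : ℝ) 1, ∀ i, z + t • w ∈ M.elem i → |⟪g i (z + t • w), w⟫_ℝ - c| ≤ η) :
    |M.glue h (z + w) - M.glue h z - c| ≤ η := by
  have h1 := hh.glue_sub_le (c := c + η) hseg fun t ht i hi => by linarith [(abs_le.1 (hc t ht i hi)).2]
  have h2 := hh.neg.glue_sub_le (c := -c + η) hseg fun t ht i hi => by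
    rw [inner_neg_left]; linarith [(abs_le.1 (hc t ht i hi)).1]
  rw [hh.glue_neg, hh.glue_neg] at h2
  rw [abs_le]; constructor <;> linarith

lemma aestronglyMeasurable_of_elem {F : Type*} [TopologicalSpace F] [TopologicalSpace.PseudoMetrizableSpace F]
    [Zero F] {ν : Measure Pt} {f : Pt → F} (hf : ∀ i, AEStronglyMeasurable f (ν.restrict (M.elem i)))
    (h0 : ∀ x, (∀ i, x ∉ M.elem i) → f x = 0) : AEStronglyMeasurable f ν := by
  have hm : MeasurableSet (⋃ i, M.elem i) := MeasurableSet.iUnion fun i => (isClosed_elem i).measurableSet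
  have e : (⋃ i, M.elem i).indicator f = f := by
    rw [indicator_eq_self]; intro x hx
    by_contra hcon
    exact hx (h0 x (by simpa using hcon))
  rw [← e, aestronglyMeasurable_indicator_iff hm, aestronglyMeasurable_iUnion_iff]; exact hf

lemma PiecewiseC1.aestronglyMeasurable_glue (hh : M.PiecewiseC1 h g) (ν : Measure Pt) :
    AEStronglyMeasurable (M.glue h) ν := by
  refine aestronglyMeasurable_of_elem (fun i => ?_) fun x hx => glue_of_notMem hx
  have hm := (isClosed_elem (M := M) i).measurableSet
  exact ((hh.continuousOn_glue.mono (subset_iUnion _ i)).aestronglyMeasurable hm)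

lemma PiecewiseC1.aestronglyMeasurable_proj_glue (hM : M.IsCoarseGrid G) (hh : M.PiecewiseC1 h g) :
    AEStronglyMeasurable (fun x => (G.tangentAt x).starProjection (M.glue g x)) G.meas := by
  refine aestronglyMeasurable_of_elem (fun i => ?_) fun x hx => by rw [glue_of_notMem hx, map_zero]
  have hm := (isClosed_elem (M := M) i).measurableSet
  have h1 : AEStronglyMeasurable ((M.elem i).indicator (g i)) G.meas :=
    (aestronglyMeasurable_indicator_iff hm).2 ((hh.cont i).aestronglyMeasurable hm)
  refine (aestronglyMeasurable_proj h1).restrict.congr ?_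
  filter_upwards [ae_restrict_of_ae (hh.ae_proj_eq hM), ae_restrict_mem hm] with x hx hxi
  obtain ⟨i', hi', e⟩ := exists_glue_eq g hxi
  rw [e, indicator_of_mem hxi]; exact hx _ _ hxi hi'

lemma PiecewiseC1.abs_glue_le (hh : M.PiecewiseC1 h g) {B : ℝ} (hB0 : 0 ≤ B)
    (hB : ∀ i, ∀ x ∈ M.elem i, ‖h i x‖ ≤ B ∧ ‖g i x‖ ≤ B) (x : Pt) : |M.glue h x| ≤ B := by
  by_cases hx : ∃ i, x ∈ M.elem i
  · obtain ⟨i, hi⟩ := hx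
    rw [hh.glue_eq hi]; exact (hB i x hi).1
  · push Not at hx
    rw [glue_of_notMem hx, abs_zero]; exact hB0

end QuadMesh

/-- The mollified function. -/
def mollify (f : Pt → ℝ) (b : ContDiffBump (0 : Pt)) : Pt → ℝ :=
  (b.normed volume) ⋆[ContinuousLinearMap.lsmul ℝ ℝ, volume] f

section Mollify

variable {f : Pt → ℝ} {b : ContDiffBump (0 : Pt)} {B : ℝ}

lemma locallyIntegrable_of_bound (hf : AEStronglyMeasurable f volume) (hB : ∀ x, |f x| ≤ B) :
    LocallyIntegrable f volume := by
  rw [locallyIntegrable_iff]; intro k hk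
  refine Measure.integrableOn_of_bounded hk.measure_lt_top.ne hf (M := B) ?_
  exact .of_forall fun x => hB x

lemma contDiff_mollify (hf : AEStronglyMeasurable f volume) (hB : ∀ x, |f x| ≤ B) : ContDiff ℝ ∞ (mollify f b) :=
  HasCompactSupport.contDiff_convolution_left (n := ⊤) _ b.hasCompactSupport_normed b.contDiff_normed
    (locallyIntegrable_of_bound hf hB)

lemma abs_mollify_sub_le (hf : AEStronglyMeasurable f volume) {x : Pt} {c η : ℝ} (hη : 0 ≤ η)
    (h : ∀ y ∈ Metric.ball x b.rOut, |f y - c| ≤ η) : |mollify f b x - c| ≤ η :=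
  dist_convolution_le (μ := volume) hη b.support_normed_eq.subset b.nonneg_normed b.integral_normed hf h

lemma mollify_add_sub (hf : AEStronglyMeasurable f volume) (hB : ∀ x, |f x| ≤ B) (x w : Pt) :
    mollify f b (x + w) - mollify f b x = mollify (fun y => f (y + w) - f y) b x := by
  have hi : ∀ x, Integrable (fun t => (ContinuousLinearMap.lsmul ℝ ℝ) (b.normed volume t) (f (x - t))) volume :=
    (b.hasCompactSupport_normed.convolutionExists_left _ b.continuous_normed (locallyIntegrable_of_bound hf hB))
  simp only [mollify, convolution_def]; rw [← integral_sub (hi _) (hi _)]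
  congr 1; funext t
  rw [← map_sub]; congr 2
  abel_nf

lemma abs_inner_gradient_mollify_sub_le (hf : AEStronglyMeasurable f volume) (hB : ∀ x, |f x| ≤ B)
    {x τ : Pt} {c η δ : ℝ} (hη : 0 ≤ η) (hδ : 0 < δ)
    (h : ∀ t, |t| < δ → ∀ y ∈ Metric.ball x b.rOut, |f (y + t • τ) - f y - t * c| ≤ η * |t|) :
    |⟪gradient (mollify f b) x, τ⟫_ℝ - c| ≤ η := by
  have hd : HasFDerivAt (mollify f b) (innerSL ℝ (gradient (mollify f b) x)) x := by
    have := ((contDiff_mollify (b := b) hf hB).differentiable (by simp) x).hasGradientAt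
    rw [hasGradientAt_iff_hasFDerivAt] at this; exact this
  have hp : HasDerivAt (fun t : ℝ => x + t • τ) ((1 : ℝ) • τ) 0 := ((hasDerivAt_id (0 : ℝ)).smul_const τ).const_add x
  have e0 : x + (0 : ℝ) • τ = x := by simp
  have h1 : HasDerivAt (fun t : ℝ => mollify f b (x + t • τ)) ⟪gradient (mollify f b) x, τ⟫_ℝ 0 := by
    have := HasFDerivAt.comp_hasDerivAt (0 : ℝ) (l := mollify f b) (by rw [e0]; exact hd) hp
    exact this.congr_deriv (by rw [one_smul]; rfl)
  have h2 : HasDerivAt (fun t : ℝ => mollify f b (x + t • τ) - t * c) (⟪gradient (mollify f b) x, τ⟫_ℝ - c) 0 := by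
    have := h1.sub ((hasDerivAt_id (0 : ℝ)).mul_const c)
    exact this.congr_deriv (by rw [one_mul])
  have h3 := h2.hasFDerivAt.le_of_lip' hη (by
    have hball : Metric.ball (0 : ℝ) δ ∈ 𝓝 0 := Metric.ball_mem_nhds _ hδ
    filter_upwards [hball] with t ht
    rw [Metric.mem_ball, dist_zero_right, Real.norm_eq_abs] at ht
    have hm : AEStronglyMeasurable (fun y => f (y + t • τ) - f y) volume :=
      (hf.comp_measurePreserving (measurePreserving_add_right volume (t • τ))).sub hf
    have := abs_mollify_sub_le (b := b) (x := x) hm (by positivity) (h t ht)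
    rw [← mollify_add_sub hf hB] at this; rw [e0, zero_mul, sub_zero, sub_zero, Real.norm_eq_abs, Real.norm_eq_abs]
    refine le_trans (le_of_eq ?_) this
    congr 1; ring)
  simpa using h3

end Mollify

namespace QuadMesh

variable {h : Fin M.N → Pt → ℝ} {g : Fin M.N → Pt → Pt} {B : ℝ} {b : ContDiffBump (0 : Pt)}

lemma PiecewiseC1.inner_gradient_mollify (hM : M.IsCoarseGrid G) (hh : M.PiecewiseC1 h g)
    (hB0 : 0 ≤ B) (hB : ∀ i, ∀ x ∈ M.elem i, ‖h i x‖ ≤ B ∧ ‖g i x‖ ≤ B) {x τ : Pt} {r η c : ℝ}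
    (hr : Metric.ball x r ⊆ G.Ω) (hb : b.rOut ≤ r / 2) (hη : 0 ≤ η)
    (hc : ∀ y ∈ Metric.ball x r, ∀ i, y ∈ M.elem i → |⟪g i y, τ⟫_ℝ - c| ≤ η) :
    |⟪gradient (mollify (M.glue h) b) x, τ⟫_ℝ - c| ≤ η := by
  have hr0 : 0 < r := by linarith [b.rOut_pos]
  refine abs_inner_gradient_mollify_sub_le (δ := r / (2 * (‖τ‖ + 1))) (hh.aestronglyMeasurable_glue _)
    (hh.abs_glue_le hB0 hB) hη (by positivity) fun t ht y hy => ?_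
  have htτ : ‖t • τ‖ < r / 2 := by
    rw [lt_div_iff₀ (by positivity)] at ht; rw [norm_smul, Real.norm_eq_abs]
    nlinarith [norm_nonneg τ, abs_nonneg t]
  have hin : ∀ s ∈ Icc (0 : ℝ) 1, y + s • t • τ ∈ Metric.ball x r := by
    intro s hs; rw [mem_ball_iff_norm] at hy ⊢
    calc ‖y + s • t • τ - x‖ = ‖(y - x) + s • t • τ‖ := by congr 1; abel
      _ ≤ ‖y - x‖ + |s| * ‖t • τ‖ := by
          refine (norm_add_le _ _).trans ?_
          rw [norm_smul s, Real.norm_eq_abs]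
      _ < r / 2 + r / 2 := by
          refine add_lt_add_of_lt_of_le (hy.trans_le hb) ?_
          rw [abs_of_nonneg hs.1]; nlinarith [hs.2, norm_nonneg (t • τ), hs.1]
      _ = r := by ring
  refine hh.abs_glue_sub_le (fun s hs => hM.exists_mem (hr (hin s hs))) fun s hs i hi => ?_
  rw [inner_smul_right, ← mul_sub, abs_mul, mul_comm η]
  exact mul_le_mul_of_nonneg_left (hc _ (hin s hs) i hi) (abs_nonneg _)

lemma PiecewiseC1.norm_gradient_mollify_le (hM : M.IsCoarseGrid G) (hh : M.PiecewiseC1 h g)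
    (hB0 : 0 ≤ B) (hB : ∀ i, ∀ x ∈ M.elem i, ‖h i x‖ ≤ B ∧ ‖g i x‖ ≤ B) {x : Pt} {r : ℝ}
    (hr : Metric.ball x r ⊆ G.Ω) (hb : b.rOut ≤ r / 2) : ‖gradient (mollify (M.glue h) b) x‖ ≤ B := by
  set v := gradient (mollify (M.glue h) b) x with hv
  have := hh.inner_gradient_mollify hM hB0 hB (τ := v) (c := 0) (η := B * ‖v‖) hr hb (by positivity) fun y _ i hi => by
      rw [sub_zero]; exact (abs_real_inner_le_norm _ _).trans (mul_le_mul_of_nonneg_right (hB i y hi).2 (norm_nonneg _))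
  rw [sub_zero, ← hv, real_inner_self_eq_norm_sq, abs_of_nonneg (sq_nonneg _)] at this
  rcases (norm_nonneg v).eq_or_lt with h0 | h0
  · rw [← h0]; exact hB0
  · nlinarith

lemma PiecewiseC1.tendsto_proj_gradient_mollify (hM : M.IsCoarseGrid G) (hh : M.PiecewiseC1 h g)
    {x : Pt} (hx : x ∈ G.Ω) (hgood : ∀ i i', x ∈ M.elem i → x ∈ M.elem i' →
      (G.tangentAt x).starProjection (g i x) = (G.tangentAt x).starProjection (g i' x))
    {β : ℕ → ContDiffBump (0 : Pt)} (hβ : Tendsto (fun n => (β n).rOut) atTop (𝓝 0)) :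
    Tendsto (fun n => (G.tangentAt x).starProjection (gradient (mollify (M.glue h) (β n)) x))
      atTop (𝓝 ((G.tangentAt x).starProjection (M.glue g x))) := by
  obtain ⟨B, hB0, hB⟩ := hh.exists_bound
  obtain ⟨i0, hi0⟩ := hM.exists_mem hx
  obtain ⟨i1, hi1, e1⟩ := exists_glue_eq g hi0
  rw [e1, Metric.tendsto_atTop]; intro η hη
  have hnear : ∀ᶠ y in 𝓝 x, y ∈ G.Ω ∧ ∀ i, y ∈ M.elem i → x ∈ M.elem i ∧ ‖g i y - g i x‖ ≤ η / 2 := by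
    refine Filter.Eventually.and (G.isOpen.mem_nhds hx) ?_
    have h2 : ∀ i, ∀ᶠ y in 𝓝 x, y ∈ M.elem i → x ∈ M.elem i → ‖g i y - g i x‖ ≤ η / 2 := by
      intro i
      by_cases hi : x ∈ M.elem i
      · have := Metric.continuousWithinAt_iff'.1 (hh.cont i x hi) (η / 2) (by positivity)
        rw [eventually_nhdsWithin_iff] at this
        filter_upwards [this] with y hy hyi _
        rw [← dist_eq_norm]; exact (hy hyi).le
      · exact .of_forall fun _ _ h => absurd h hi
    filter_upwards [M.eventually_mem_elem x, Filter.eventually_all.2 h2] with y h3 h4 i hi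
    exact ⟨h3 i hi, h4 i hi (h3 i hi)⟩
  obtain ⟨r, hr, hball⟩ := Metric.eventually_nhds_iff_ball.1 hnear
  have hsm : ∀ᶠ n in atTop, (β n).rOut < r / 2 := hβ.eventually_lt_const (by positivity)
  obtain ⟨N, hN⟩ := Filter.eventually_atTop.1 hsm
  refine ⟨N, fun n hn => ?_⟩
  set w := gradient (mollify (M.glue h) (β n)) x with hw
  set v := (G.tangentAt x).starProjection (w - g i1 x) with hv
  have hvm : v ∈ G.tangentAt x := Submodule.starProjection_apply_mem _ _
  have hvv : (G.tangentAt x).starProjection v = v := Submodule.starProjection_eq_self_iff.2 hvm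
  have hin : ∀ u : Pt, ⟪(G.tangentAt x).starProjection u, v⟫_ℝ = ⟪u, v⟫_ℝ := by
    intro u; rw [Submodule.inner_starProjection_left_eq_right, hvv]
  have key := hh.inner_gradient_mollify (b := β n) hM hB0 hB (x := x) (τ := v) (c := ⟪g i1 x, v⟫_ℝ)
    (η := η / 2 * ‖v‖) (fun y hy => (hball y hy).1) (hN n hn).le (by positivity) fun y hy i hi => by
      obtain ⟨hxi, hgi⟩ := (hball y hy).2 i hi
      rw [← hin (g i1 x), hgood i1 i hi1 hxi, hin, ← inner_sub_left]
      exact (abs_real_inner_le_norm _ _).trans (mul_le_mul_of_nonneg_right hgi (norm_nonneg _))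
  rw [← hw, ← inner_sub_left, ← hin, ← hv, real_inner_self_eq_norm_sq, abs_of_nonneg (sq_nonneg _)] at key
  rw [dist_eq_norm, ← map_sub, ← hv]
  rcases (norm_nonneg v).eq_or_lt with h0 | h0
  · rw [← h0]; exact hη
  · nlinarith

lemma PiecewiseC1.tendsto_mollify (hM : M.IsCoarseGrid G) (hh : M.PiecewiseC1 h g) {x : Pt} (hx : x ∈ G.Ω)
    {β : ℕ → ContDiffBump (0 : Pt)} (hβ : Tendsto (fun n => (β n).rOut) atTop (𝓝 0)) :
    Tendsto (fun n => mollify (M.glue h) (β n) x) atTop (𝓝 (M.glue h x)) := by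
  have hc : ContinuousAt (M.glue h) x := by
    refine hh.continuousOn_glue.continuousAt ?_
    rw [hM.iUnion_elem]; exact Filter.mem_of_superset (G.isOpen.mem_nhds hx) subset_closure
  exact ContDiffBump.convolution_tendsto_right hβ (.of_forall fun _ => hh.aestronglyMeasurable_glue _)
    (hc.tendsto.comp Filter.tendsto_snd) tendsto_const_nhds

end QuadMesh

lemma tendsto_toLp_of_dominated {E : Type*} [NormedAddCommGroup E] {ν : Measure Pt} [IsFiniteMeasure ν]
    {F : ℕ → Pt → E} {f : Pt → E} (hF : ∀ n, MemLp (F n) 2 ν) (hf : MemLp f 2 ν) (C : ℝ)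
    (hC : ∀ n, ∀ᵐ x ∂ν, ‖F n x - f x‖ ≤ C)
    (h : ∀ᵐ x ∂ν, Tendsto (fun n => F n x) atTop (𝓝 (f x))) :
    Tendsto (fun n => (hF n).toLp (F n)) atTop (𝓝 (hf.toLp f)) := by
  rw [Lp.tendsto_Lp_iff_tendsto_eLpNorm'']
  have h1 : Tendsto (fun n => ∫⁻ x, ‖(F n - f) x‖ₑ ^ (2 : ℝ) ∂ν) atTop (𝓝 (∫⁻ _, 0 ∂ν)) := by
    refine tendsto_lintegral_of_dominated_convergence' (fun _ => ofReal C ^ (2 : ℝ))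
      (fun n => ?_) (fun n => ?_) ?_ ?_
    · exact (((hF n).1.sub hf.1).enorm).pow_const _
    · filter_upwards [hC n] with x hx
      refine ENNReal.rpow_le_rpow ?_ (by norm_num)
      rw [← ofReal_norm]; exact ofReal_le_ofReal hx
    · rw [lintegral_const]; exact ENNReal.mul_ne_top (by finiteness) (measure_ne_top _ _)
    · filter_upwards [h] with x hx
      have h2 : Tendsto (fun n => ‖(F n - f) x‖ₑ) atTop (𝓝 0) := by
        have := (tendsto_sub_nhds_zero_iff.2 hx).enorm
        simpa using this
      have h3 := ((ENNReal.continuous_rpow_const (y := (2 : ℝ))).tendsto 0).comp h2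
      rwa [ENNReal.zero_rpow_of_pos (by norm_num)] at h3
  rw [lintegral_zero] at h1
  have h4 := ((ENNReal.continuous_rpow_const (y := (1 / 2 : ℝ))).tendsto 0).comp h1
  rw [ENNReal.zero_rpow_of_pos (by norm_num)] at h4
  refine h4.congr fun n => ?_
  rw [eLpNorm_eq_lintegral_rpow_enorm_toReal (by norm_num) (by norm_num)]; simp

lemma smoothGrad_smul {h : Pt → ℝ} {φ : Pt → Pair} {x : Pt} (hh : DifferentiableAt ℝ h x)
    (hφ : DifferentiableAt ℝ φ x) (i : Fin 2) :
    G.smoothGrad (fun y => h y • φ y) x i =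
      φ x i • (G.tangentAt x).starProjection (gradient h x) + h x • G.smoothGrad φ x i := by
  have h1 : DifferentiableAt ℝ (fun y => φ y i) x := by
    have := (EuclideanSpace.proj (𝕜 := ℝ) i).differentiableAt.comp x hφ
    exact this
  have h2 : gradient (fun y => (h y • φ y) i) x = φ x i • gradient h x + h x • gradient (fun y => φ y i) x := by
    have e : (fun y => (h y • φ y) i) = fun y => h y * φ y i := by funext y; simp
    rw [e, gradient, fderiv_fun_mul hh h1]; simp [gradient, add_comm]
  simp only [FracturedDomain.smoothGrad, h2, map_add, map_smul]

lemma continuous_gradient {φ : Pt → ℝ} (hφ : ContDiff ℝ ∞ φ) : Continuous (gradient φ) :=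
  (InnerProductSpace.toDual ℝ Pt).symm.continuous.comp (hφ.continuous_fderiv (by simp))

lemma contDiff_apply {φ : Pt → Pair} (hφ : ContDiff ℝ ∞ φ) (i : Fin 2) : ContDiff ℝ ∞ fun x => φ x i :=
  (EuclideanSpace.proj (𝕜 := ℝ) i).contDiff.comp hφ

lemma aestronglyMeasurable_gradPair {ν : Measure Pt} {F : Pt → GradPair}
    (h : ∀ i, AEStronglyMeasurable (fun x => F x i) ν) : AEStronglyMeasurable F ν := by
  have h2 : AEStronglyMeasurable (fun x i => F x i) ν :=
    (aemeasurable_pi_iff.2 fun i => (h i).aemeasurable).aestronglyMeasurable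
  exact (PiLp.continuous_toLp 2 _).comp_aestronglyMeasurable h2

lemma aestronglyMeasurable_smoothGrad {φ : Pt → Pair} (hφ : ContDiff ℝ ∞ φ) :
    AEStronglyMeasurable (G.smoothGrad φ) G.meas := by
  have h : ∀ i, AEStronglyMeasurable (fun x => (G.tangentAt x).starProjection (gradient (fun y => φ y i) x)) G.meas :=
    fun i => aestronglyMeasurable_proj (continuous_gradient (contDiff_apply hφ i)).aestronglyMeasurable
  exact aestronglyMeasurable_gradPair h

lemma norm_proj_le (K : Submodule ℝ Pt) (v : Pt) : ‖K.starProjection v‖ ≤ ‖v‖ := by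
  have := (K.starProjection).le_of_opNorm_le (Submodule.starProjection_norm_le K) v
  simpa using this

lemma norm_gradPair_le (U : GradPair) {C : ℝ} (hC : ∀ i, ‖U i‖ ≤ C) : ‖U‖ ≤ 2 * C := by
  have h0 : 0 ≤ C := (norm_nonneg _).trans (hC 0)
  rw [PiLp.norm_eq_of_L2, Fin.sum_univ_two]
  refine Real.sqrt_le_iff.2 ⟨by positivity, ?_⟩
  nlinarith [hC 0, hC 1, norm_nonneg (U 0), norm_nonneg (U 1)]

lemma exists_smoothGrad_bound {φ : Pt → Pair} (hφ : ContDiff ℝ ∞ φ) (hc : HasCompactSupport φ) :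
    ∃ B, 0 ≤ B ∧ ∀ x, ‖φ x‖ ≤ B ∧ ∀ i, ‖G.smoothGrad φ x i‖ ≤ B := by
  obtain ⟨B0, h0⟩ := hc.exists_bound_of_continuous hφ.continuous
  have h1 : ∀ i, ∃ B, ∀ x, ‖gradient (fun y => φ y i) x‖ ≤ B := fun i => by
    have hci : HasCompactSupport fun y => φ y i := by
      refine hc.comp_left (g := fun U : Pair => U i) rfl
    have := (hci.fderiv ℝ).exists_bound_of_continuous ((contDiff_apply hφ i).continuous_fderiv (by simp))
    obtain ⟨B, hB⟩ := this
    exact ⟨B, fun x => by rw [gradient, LinearIsometryEquiv.norm_map]; exact hB x⟩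
  choose B1 hB1 using h1
  refine ⟨|B0| + |B1 0| + |B1 1|, by positivity, fun x => ⟨?_, fun i => ?_⟩⟩
  · linarith [h0 x, le_abs_self B0, abs_nonneg (B1 0), abs_nonneg (B1 1)]
  · have := (norm_proj_le (G.tangentAt x) _).trans (hB1 i x)
    change ‖(G.tangentAt x).starProjection (gradient (fun y => φ y i) x)‖ ≤ _
    have h2 : B1 i ≤ |B1 0| + |B1 1| := by
      obtain rfl | rfl : i = 0 ∨ i = 1 := by fin_cases i <;> simp
      · linarith [le_abs_self (B1 0), abs_nonneg (B1 1)]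
      · linarith [le_abs_self (B1 1), abs_nonneg (B1 0)]
    linarith [abs_nonneg B0]

lemma smoothGrad_eq_zero {φ : Pt → Pair} {x : Pt} (hx : x ∉ tsupport φ) : G.smoothGrad φ x = 0 := by
  have h : ∀ i, gradient (fun y => φ y i) x = 0 := fun i => by
    have : (fun y => φ y i) =ᶠ[𝓝 x] fun _ => 0 := by
      filter_upwards [notMem_tsupport_iff_eventuallyEq.1 hx] with y hy
      rw [hy]; rfl
    rw [this.gradient_eq]; simp [gradient]
  ext1 i
  simp [FracturedDomain.smoothGrad, h]

/-- The pair of gradients of a product. -/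
def mulGrad (a : ℝ) (p : Pt) (U : Pair × GradPair) : GradPair := WithLp.toLp 2 fun i => U.1 i • p + a • U.2 i

lemma exists_bump_seq {δ : ℝ} (hδ : 0 < δ) : ∃ β : ℕ → ContDiffBump (0 : Pt),
    Tendsto (fun n => (β n).rOut) atTop (𝓝 0) ∧ ∀ n, (β n).rOut ≤ δ := by
  refine ⟨fun n => ⟨δ / (n + 1) / 2, δ / (n + 1), by positivity, half_lt_self (by positivity)⟩, ?_, fun n => ?_⟩
  · have := (tendsto_one_div_add_atTop_nhds_zero_nat (𝕜 := ℝ)).const_mul δ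
    simpa [div_eq_mul_inv] using this
  · exact div_le_self hδ.le (by linarith [(Nat.cast_nonneg n : (0:ℝ) ≤ n)])

namespace QuadMesh

variable {h : Fin M.N → Pt → ℝ} {g : Fin M.N → Pt → Pt} {S U : Set Pt}

/-- The product of a piecewise `C¹` function and a test function is in the energy space, and the
product rule holds. -/
lemma PiecewiseC1.exists_mem_energySpace (hM : M.IsCoarseGrid G) (hh : M.PiecewiseC1 h g)
    (hS : IsClosed S) (h0 : ∀ i, ∀ x ∈ M.elem i, x ∉ S → h i x = 0) (hSU : G.Ω ∩ S ⊆ U) (hU : IsOpen U)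
    {φ : Pt → Pair} (hφ : ContDiff ℝ ∞ φ) (hc : HasCompactSupport φ) (hφΩ : tsupport φ ⊆ G.Ω) :
    ∃ w ∈ energySpace G G.meas U, w.1 =ᵐ[G.meas] (fun x => M.glue h x • φ x) ∧
      w.2 =ᵐ[G.meas] (fun x => mulGrad (M.glue h x) ((G.tangentAt x).starProjection (M.glue g x))
        (φ x, G.smoothGrad φ x)) ∧ ∀ᵐ x ∂G.meas, x ∉ S → w.1 x = 0 ∧ w.2 x = 0 := by
  obtain ⟨B, hB0, hB⟩ := hh.exists_bound
  obtain ⟨Bφ, hBφ0, hBφ⟩ := exists_smoothGrad_bound (G := G) hφ hc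
  have hgl0 : ∀ x, x ∉ S → M.glue h x = 0 := by
    intro x hx
    by_cases hxi : ∃ i, x ∈ M.elem i
    · obtain ⟨i, hi⟩ := hxi
      rw [hh.glue_eq hi]; exact h0 i x hi hx
    · push Not at hxi; exact glue_of_notMem hxi
  have hcK : IsCompact (tsupport φ) := hc
  obtain ⟨δ1, hδ1, hδ1s⟩ := hcK.exists_thickening_subset_open G.isOpen hφΩ
  have hdisj : Disjoint (tsupport φ \ U) S := by
    rw [disjoint_left]; intro x hx hxS
    exact hx.2 (hSU ⟨hφΩ hx.1, hxS⟩)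
  obtain ⟨δ2, hδ2, hδ2s⟩ := hdisj.exists_thickenings (hcK.diff hU) hS
  obtain ⟨β, hβ, hβle⟩ := exists_bump_seq (δ := min δ1 δ2 / 2) (by positivity)
  have hb1 : ∀ n, (β n).rOut ≤ δ1 / 2 := fun n => (hβle n).trans (by
    have := min_le_left δ1 δ2; linarith)
  have hb2 : ∀ n, (β n).rOut ≤ δ2 / 2 := fun n => (hβle n).trans (by
    have := min_le_right δ1 δ2; linarith)
  have hmeas := hh.aestronglyMeasurable_glue (volume : Measure Pt)
  have habs := hh.abs_glue_le hB0 hB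
  set m := fun n => mollify (M.glue h) (β n)
  set Γ := fun x => mulGrad (M.glue h x) ((G.tangentAt x).starProjection (M.glue g x)) (φ x, G.smoothGrad φ x)
  have hsm : ∀ n, ContDiff ℝ ∞ (m n) := fun n => contDiff_mollify hmeas habs
  have hball : ∀ x ∈ tsupport φ, Metric.ball x δ1 ⊆ G.Ω := fun x hx =>
    (Metric.ball_subset_thickening hx δ1).trans hδ1s
  set ψ : ℕ → Pt → Pair := fun n x => m n x • φ x with hψ
  have hψs : ∀ n, ContDiff ℝ ∞ (ψ n) := fun n => (hsm n).smul hφ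
  have hψc : ∀ n, HasCompactSupport (ψ n) := fun n => hc.smul_left (f := m n)
  have hψt : ∀ n, tsupport (ψ n) ⊆ tsupport φ := fun n =>
    closure_mono fun x hx => by
      simp only [hψ, Function.mem_support] at hx ⊢; exact fun h => hx (by rw [h, smul_zero])
  have hmz : ∀ n x, (∀ y ∈ Metric.ball x (β n).rOut, y ∉ S) → m n x = 0 := by
    intro n x hx
    have := abs_mollify_sub_le (b := β n) hmeas (x := x) (c := 0) le_rfl fun y hy => by
      rw [hgl0 y (hx y hy), sub_zero, abs_zero]
    rwa [sub_zero, abs_nonpos_iff] at this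
  have hψU : ∀ n, tsupport (ψ n) ⊆ U := by
    intro n x hx; by_contra hxU
    have hxK : x ∈ tsupport φ \ U := ⟨hψt n hx, hxU⟩
    refine (notMem_tsupport_iff_eventuallyEq.2 ?_) hx
    filter_upwards [Metric.ball_mem_nhds x (half_pos hδ2)] with y hy
    have : m n y = 0 := by
      refine hmz n y fun z hz hzS => ?_
      refine disjoint_left.1 hδ2s ?_ (Metric.self_subset_thickening hδ2 S hzS)
      refine Metric.ball_subset_thickening hxK δ2 ?_
      rw [Metric.mem_ball] at hy hz ⊢; linarith [dist_triangle z y x, hb2 n]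
    simp [hψ, this]
  have hψg : ∀ n x, G.smoothGrad (ψ n) x = mulGrad (m n x)
      ((G.tangentAt x).starProjection (gradient (m n) x)) (φ x, G.smoothGrad φ x) := by
    intro n x; ext1 i
    exact smoothGrad_smul ((hsm n).differentiable (by simp) x) (hφ.differentiable (by simp) x) i
  have hmolB : ∀ n x, |m n x| ≤ B := fun n x => by
    have := abs_mollify_sub_le (b := β n) hmeas (x := x) (c := 0) hB0 fun y _ => by rw [sub_zero]; exact habs y
    rwa [sub_zero] at this
  have happ : ∀ (U : Pair) i, ‖U i‖ ≤ ‖U‖ := fun U i => PiLp.norm_apply_le U i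
  have hglB : ∀ x, ‖M.glue g x‖ ≤ B := fun x => by
    by_cases hxi : ∃ i, x ∈ M.elem i
    · obtain ⟨i, hi⟩ := hxi
      obtain ⟨i', hi', e⟩ := exists_glue_eq g hi
      rw [e]; exact (hB i' x hi').2
    · push Not at hxi; rw [glue_of_notMem hxi, norm_zero]; exact hB0
  have hmgB : ∀ (a : ℝ) p x, |a| ≤ B → (x ∈ tsupport φ → ‖p‖ ≤ B) →
      ‖mulGrad a p (φ x, G.smoothGrad φ x)‖ ≤ 2 * (Bφ * B + B * Bφ) := by
    intro a p x ha hp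
    refine norm_gradPair_le _ fun i => ?_
    refine (norm_add_le _ _).trans (add_le_add ?_ ?_)
    · rw [norm_smul]
      by_cases hx : x ∈ tsupport φ
      · exact mul_le_mul ((happ _ i).trans (hBφ x).1) (hp hx) (norm_nonneg _) hBφ0
      · rw [image_eq_zero_of_notMem_tsupport hx]; simp; positivity
    · rw [norm_smul]; exact mul_le_mul ha ((hBφ x).2 i) (norm_nonneg _) hB0
  have hm1 : AEStronglyMeasurable (fun x => M.glue h x • φ x) G.meas :=
    (hh.aestronglyMeasurable_glue _).smul hφ.continuous.aestronglyMeasurable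
  have hm2 : AEStronglyMeasurable Γ G.meas := by
    refine aestronglyMeasurable_gradPair fun i => ?_
    refine AEStronglyMeasurable.add ?_ ?_
    · exact (contDiff_apply hφ i).continuous.aestronglyMeasurable.smul (hh.aestronglyMeasurable_proj_glue hM)
    · refine (hh.aestronglyMeasurable_glue _).smul ?_
      exact ((continuous_apply i).comp (PiLp.continuous_ofLp 2 _)).comp_aestronglyMeasurable
        (aestronglyMeasurable_smoothGrad (G := G) hφ)
  have hb1' : ∀ x, ‖M.glue h x • φ x‖ ≤ B * Bφ := fun x => by
    rw [norm_smul]; exact mul_le_mul (habs x) (hBφ x).1 (norm_nonneg _) hB0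
  have hL1 : MemLp (fun x => M.glue h x • φ x) 2 G.meas := MemLp.of_bound hm1 (B * Bφ) (.of_forall hb1')
  have hL2 : MemLp Γ 2 G.meas := MemLp.of_bound hm2 _ (.of_forall fun x => hmgB _ _ x (habs x)
      fun _ => (norm_proj_le _ _).trans (hglB x))
  have hψb : ∀ n x, ‖ψ n x‖ ≤ B * Bφ := fun n x => by
    rw [hψ]; simp only [norm_smul]; exact mul_le_mul (hmolB n x) (hBφ x).1 (norm_nonneg _) hB0
  have hψgb : ∀ n x, ‖G.smoothGrad (ψ n) x‖ ≤ 2 * (Bφ * B + B * Bφ) := fun n x => by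
    rw [hψg]
    exact hmgB _ _ x (hmolB n x) fun hx => (norm_proj_le _ _).trans
      (hh.norm_gradient_mollify_le hM hB0 hB (hball x hx) (hb1 n))
  have hL1n : ∀ n, MemLp (ψ n) 2 G.meas := fun n =>
    MemLp.of_bound (hψs n).continuous.aestronglyMeasurable _ (.of_forall (hψb n))
  have hL2n : ∀ n, MemLp (G.smoothGrad (ψ n)) 2 G.meas := fun n =>
    MemLp.of_bound (aestronglyMeasurable_smoothGrad (hψs n)) _ (.of_forall (hψgb n))
  have ht1 : ∀ x, Tendsto (fun n => ψ n x) atTop (𝓝 (M.glue h x • φ x)) := fun x => by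
    by_cases hx : x ∈ tsupport φ
    · exact (hh.tendsto_mollify hM (hφΩ hx) hβ).smul_const _
    · have hz : φ x = 0 := image_eq_zero_of_notMem_tsupport hx
      simp [hψ, hz]
  have ht2 : ∀ᵐ x ∂G.meas, Tendsto (fun n => G.smoothGrad (ψ n) x) atTop (𝓝 (Γ x)) := by
    filter_upwards [hh.ae_proj_eq hM] with x hgood
    by_cases hx : x ∈ tsupport φ
    · simp only [hψg]
      refine ((PiLp.continuous_toLp 2 _).tendsto _).comp (tendsto_pi_nhds.2 fun i => ?_)
      exact ((hh.tendsto_proj_gradient_mollify hM (hφΩ hx) hgood hβ).const_smul _).add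
        ((hh.tendsto_mollify hM (hφΩ hx) hβ).smul_const _)
    · have e : ∀ n, G.smoothGrad (ψ n) x = 0 := fun n => smoothGrad_eq_zero fun h => hx (hψt n h)
      have e' : Γ x = 0 := by
        ext1 i
        simp [Γ, mulGrad, image_eq_zero_of_notMem_tsupport hx, smoothGrad_eq_zero hx]
      simp only [e, e']; exact tendsto_const_nhds
  have hlim1 := tendsto_toLp_of_dominated hL1n hL1 (B * Bφ + B * Bφ) (fun n => .of_forall
    fun x => (norm_sub_le _ _).trans (add_le_add (hψb n x) (hb1' x))) (.of_forall ht1)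
  have hlim2 := tendsto_toLp_of_dominated hL2n hL2 (2 * (Bφ * B + B * Bφ) + 2 * (Bφ * B + B * Bφ))
    (fun n => .of_forall fun x => (norm_sub_le _ _).trans (add_le_add (hψgb n x)
      (hmgB _ _ x (habs x) fun _ => (norm_proj_le _ _).trans (hglB x)))) ht2
  refine ⟨(hL1.toLp _, hL2.toLp _), ?_, hL1.coeFn_toLp, hL2.coeFn_toLp, ?_⟩
  · refine mem_closure_of_tendsto (hlim1.prodMk_nhds hlim2) (.of_forall fun n => ?_)
    exact Submodule.subset_span ⟨ψ n, hψs n, hψc n, hψU n, (hL1n n).coeFn_toLp, (hL2n n).coeFn_toLp⟩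
  · filter_upwards [hL1.coeFn_toLp, hL2.coeFn_toLp, ht2] with x e1 e2 h2 hx
    refine ⟨by rw [e1, hgl0 x hx, zero_smul], ?_⟩
    rw [e2]
    refine tendsto_nhds_unique h2 (tendsto_const_nhds.congr' ?_)
    obtain ⟨r, hr, hrS⟩ := Metric.isOpen_iff.1 hS.isOpen_compl x hx
    filter_upwards [hβ.eventually_lt_const (half_pos hr)] with n hn
    symm
    refine smoothGrad_eq_zero (notMem_tsupport_iff_eventuallyEq.2 ?_)
    filter_upwards [Metric.ball_mem_nhds x (half_pos hr)] with y hy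
    have : m n y = 0 := by
      refine hmz n y fun z hz => hrS ?_
      rw [Metric.mem_ball] at hy hz ⊢; linarith [dist_triangle z y x]
    simp [hψ, this]

end QuadMesh

/-- Multiplication by a bounded function on `D`, followed by extension by zero. -/
lemma exists_mulCLM {E F : Type*} [NormedAddCommGroup E] [NormedSpace ℝ E] [NormedAddCommGroup F]
    [NormedSpace ℝ F] {ν : Measure Pt} {D : Set Pt} (hD : MeasurableSet D)
    {A : Pt → (E →L[ℝ] F)} (hA : AEStronglyMeasurable A ν) {C : ℝ} (hC : ∀ x, ‖A x‖ ≤ C) :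
    ∃ T : Lp E 2 (ν.restrict D) →L[ℝ] Lp F 2 ν, ∀ u, T u =ᵐ[ν] D.indicator fun x => A x (u x) := by
  have hle : ∀ u : Lp E 2 (ν.restrict D), ∀ x, ‖A x (u x)‖ ≤ C * ‖u x‖ := fun u x =>
    (A x).le_of_opNorm_le (hC x) _
  have hL : ∀ u : Lp E 2 (ν.restrict D), MemLp (fun x => A x (u x)) 2 (ν.restrict D) := fun u =>
    MemLp.of_le_mul (Lp.memLp u) (isBoundedBilinearMap_apply.continuous.comp_aestronglyMeasurable
      (hA.restrict.prodMk (Lp.memLp u).1)) (.of_forall (hle u))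
  have hI : ∀ u : Lp E 2 (ν.restrict D), MemLp (D.indicator fun x => A x (u x)) 2 ν := fun u =>
    (memLp_indicator_iff_restrict hD).2 (hL u)
  have ext : ∀ {P : Pt → Prop}, (∀ᵐ x ∂ν.restrict D, P x) → ∀ᵐ x ∂ν, x ∈ D → P x := fun h =>
    (ae_restrict_iff' hD).1 h
  refine ⟨LinearMap.mkContinuous
    { toFun := fun u => (hI u).toLp _
      map_add' := fun u v => ?_
      map_smul' := fun r u => ?_ } (max C 0) fun u => ?_, fun u => (hI u).coeFn_toLp⟩
  · refine Lp.ext ?_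
    filter_upwards [(hI (u + v)).coeFn_toLp, Lp.coeFn_add ((hI u).toLp _) ((hI v).toLp _),
      (hI u).coeFn_toLp, (hI v).coeFn_toLp, ext (Lp.coeFn_add u v)] with x h1 h2 h3 h4 h5
    rw [h1, h2, Pi.add_apply, h3, h4]
    by_cases hx : x ∈ D
    · simp only [indicator_of_mem hx, h5 hx, Pi.add_apply, map_add]
    · simp only [indicator_of_notMem hx, add_zero]
  · refine Lp.ext ?_
    filter_upwards [(hI (r • u)).coeFn_toLp, Lp.coeFn_smul r ((hI u).toLp _),
      (hI u).coeFn_toLp, ext (Lp.coeFn_smul r u)] with x h1 h2 h3 h5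
    rw [h1, RingHom.id_apply, h2, Pi.smul_apply, h3]
    by_cases hx : x ∈ D
    · simp only [indicator_of_mem hx, h5 hx, Pi.smul_apply, map_smul]
    · simp only [indicator_of_notMem hx, smul_zero]
  · change ‖(hI u).toLp _‖ ≤ _
    rw [Lp.norm_toLp, eLpNorm_indicator_eq_eLpNorm_restrict hD, Lp.norm_def,
      ← toReal_ofReal (le_max_right C 0), ← ENNReal.toReal_mul]
    refine ENNReal.toReal_mono (ENNReal.mul_ne_top ofReal_ne_top (Lp.eLpNorm_ne_top u)) ?_
    refine eLpNorm_le_mul_eLpNorm_of_ae_le_mul (.of_forall fun x => ?_) 2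
    exact (hle u x).trans (mul_le_mul_of_nonneg_right (le_max_left _ _) (norm_nonneg _))

/-- The bilinear map `(p, U) ↦ (Uᵢ p)ᵢ`. -/
def scaleMap : Pt →L[ℝ] Pair →L[ℝ] GradPair := LinearMap.mkContinuous₂
    (LinearMap.mk₂ ℝ (fun (p : Pt) (U : Pair) => (WithLp.toLp 2 fun i => U i • p : GradPair))
      (fun p q U => by ext1 i; simp)
      (fun c p U => by ext1 i; exact smul_comm (U i) c p)
      (fun p U V => by ext1 i; simp [add_smul])
      (fun c p U => by ext1 i; simp [mul_smul])) 2 fun p U => by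
    rw [mul_assoc]
    refine norm_gradPair_le _ fun i => ?_
    change ‖U i • p‖ ≤ _
    rw [norm_smul, mul_comm]; exact mul_le_mul_of_nonneg_left (PiLp.norm_apply_le U i) (norm_nonneg _)

lemma mulGrad_eq (a : ℝ) (p : Pt) (U : Pair × GradPair) : mulGrad a p U = scaleMap p U.1 + a • U.2 := rfl

namespace QuadMesh

variable {h : Fin M.N → Pt → ℝ} {g : Fin M.N → Pt → Pt} {S U D : Set Pt}

lemma PiecewiseC1.exists_mul (hM : M.IsCoarseGrid G) (hh : M.PiecewiseC1 h g)
    (hS : IsClosed S) (h0 : ∀ i, ∀ x ∈ M.elem i, x ∉ S → h i x = 0) (hSU : G.Ω ∩ S ⊆ U) (hU : IsOpen U)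
    (hD : MeasurableSet D) (hSD : S ⊆ D) :
    ∃ T : EField (G.meas.restrict D) →L[ℝ] EField G.meas, (∀ u ∈ G.VRestr D, T u ∈ energySpace G G.meas U) ∧
      ∀ u, ∀ᵐ x ∂G.meas, (x ∉ D → (T u).1 x = 0 ∧ (T u).2 x = 0) ∧ ∀ i, x ∈ M.elem i → x ∈ D →
        (T u).1 x = h i x • u.1 x ∧
        (T u).2 x = mulGrad (h i x) ((G.tangentAt x).starProjection (g i x)) (u.1 x, u.2 x) := by
  obtain ⟨B, hB0, hB⟩ := hh.exists_bound
  have habs := hh.abs_glue_le hB0 hB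
  have hglB : ∀ x, ‖M.glue g x‖ ≤ B := fun x => by
    by_cases hxi : ∃ i, x ∈ M.elem i
    · obtain ⟨i, hi⟩ := hxi
      obtain ⟨i', hi', e⟩ := exists_glue_eq g hi
      rw [e]; exact (hB i' x hi').2
    · push Not at hxi; rw [glue_of_notMem hxi, norm_zero]; exact hB0
  have hms := hh.aestronglyMeasurable_glue G.meas
  have hmul : ∀ {E : Type} [NormedAddCommGroup E] [NormedSpace ℝ E],
      ∃ T : Lp E 2 (G.meas.restrict D) →L[ℝ] Lp E 2 G.meas, ∀ u, T u =ᵐ[G.meas]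
        D.indicator fun x => (M.glue h x • ContinuousLinearMap.id ℝ E) (u x) := by
    intro E _ _
    refine exists_mulCLM hD (hms.smul_const _) (C := B) fun x => ?_
    rw [norm_smul]
    calc _ ≤ B * 1 := mul_le_mul (habs x) ContinuousLinearMap.norm_id_le (norm_nonneg _) hB0
      _ = B := mul_one B
  obtain ⟨T1, hT1⟩ := hmul (E := Pair)
  obtain ⟨T2, hT2⟩ := hmul (E := GradPair)
  obtain ⟨T3, hT3⟩ := exists_mulCLM (ν := G.meas) hD
    (A := fun x => scaleMap ((G.tangentAt x).starProjection (M.glue g x)))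
    (scaleMap.continuous.comp_aestronglyMeasurable (hh.aestronglyMeasurable_proj_glue hM))
    (C := ‖scaleMap‖ * B) fun x => (scaleMap.le_opNorm _).trans
      (mul_le_mul_of_nonneg_left ((norm_proj_le _ _).trans (hglB x)) (norm_nonneg _))
  have hform : ∀ u, ∀ᵐ x ∂G.meas,
      (x ∉ D → (T1 (Prod.fst u)) x = 0 ∧ (T3 (Prod.fst u) + T2 (Prod.snd u) : Lp GradPair 2 G.meas) x = 0) ∧
      (x ∈ D → (T1 (Prod.fst u)) x = M.glue h x • (Prod.fst u) x ∧
        (T3 (Prod.fst u) + T2 (Prod.snd u) : Lp GradPair 2 G.meas) x = mulGrad (M.glue h x)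
          ((G.tangentAt x).starProjection (M.glue g x)) ((Prod.fst u) x, (Prod.snd u) x)) := by
    intro u
    filter_upwards [hT1 u.1, hT2 u.2, hT3 u.1, Lp.coeFn_add (T3 u.1) (T2 u.2)] with x h1 h2 h3 h4
    rw [h4, Pi.add_apply, h1, h2, h3]; constructor
    · intro hx; simp [indicator_of_notMem hx]
    · intro hx; simp [indicator_of_mem hx, mulGrad_eq]
  set T : EField (G.meas.restrict D) →L[ℝ] EField G.meas := (T1.comp (ContinuousLinearMap.fst ℝ _ _)).prod
      (T3.comp (ContinuousLinearMap.fst ℝ _ _) + T2.comp (ContinuousLinearMap.snd ℝ _ _)) with hT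
  refine ⟨T, fun u hu => ?_, fun u => ?_⟩
  · have hspan : ∀ w ∈ Submodule.span ℝ {w : EField (G.meas.restrict D) | ∃ φ : Pt → Pair,
        ContDiff ℝ ∞ φ ∧ HasCompactSupport φ ∧ tsupport φ ⊆ G.Ω ∧ w.1 =ᵐ[G.meas.restrict D] φ ∧
        w.2 =ᵐ[G.meas.restrict D] G.smoothGrad φ}, T w ∈ energySpace G G.meas U := by
      intro w hw; induction hw using Submodule.span_induction with
      | mem w hw =>
        obtain ⟨φ, p1, p2, p3, p4, p5⟩ := hw
        obtain ⟨v, hv, v1, v2, v3⟩ := hh.exists_mem_energySpace hM hS h0 hSU hU p1 p2 p3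
        have e : T w = v := by
          refine Prod.ext (Lp.ext ?_) (Lp.ext ?_)
          · filter_upwards [hform w, v1, v3, (ae_restrict_iff' hD).1 p4] with x q1 q2 q3 q4
            change T1 w.1 x = v.1 x
            by_cases hx : x ∈ D
            · rw [(q1.2 hx).1, q2, q4 hx]
            · rw [(q1.1 hx).1, (q3 fun h => hx (hSD h)).1]
          · filter_upwards [hform w, v2, v3, (ae_restrict_iff' hD).1 p4, (ae_restrict_iff' hD).1 p5]
              with x q1 q2 q3 q4 q5
            change (T3 w.1 + T2 w.2 : Lp GradPair 2 G.meas) x = v.2 x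
            by_cases hx : x ∈ D
            · rw [(q1.2 hx).2, q2, q4 hx, q5 hx]
            · rw [(q1.1 hx).2, (q3 fun h => hx (hSD h)).2]
        rw [e]; exact hv
      | zero => rw [map_zero]; exact zero_mem _
      | add a b _ _ ha hb => rw [map_add]; exact add_mem ha hb
      | smul r a _ ha => rw [map_smul]; exact Submodule.smul_mem _ r ha
    exact closure_minimal hspan ((Submodule.isClosed_topologicalClosure _).preimage T.continuous) hu
  · filter_upwards [hform u, hh.ae_proj_eq hM] with x hx hgood
    refine ⟨hx.1, fun i hi hxD => ?_⟩
    obtain ⟨i', hi', e⟩ := exists_glue_eq g hi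
    rw [← hh.glue_eq hi, hgood i i' hi hi', ← e]; exact hx.2 hxD

lemma PiecewiseC1.exists_mul_V (hM : M.IsCoarseGrid G) (hh : M.PiecewiseC1 h g)
    (hS : IsClosed S) (h0 : ∀ i, ∀ x ∈ M.elem i, x ∉ S → h i x = 0) (hSU : G.Ω ∩ S ⊆ U) (hU : IsOpen U) :
    ∃ T : EField G.meas →L[ℝ] EField G.meas, (∀ u ∈ G.V, T u ∈ energySpace G G.meas U) ∧
      ∀ u, ∀ᵐ x ∂G.meas, ∀ i, x ∈ M.elem i → (T u).1 x = h i x • u.1 x ∧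
        (T u).2 x = mulGrad (h i x) ((G.tangentAt x).starProjection (g i x)) (u.1 x, u.2 x) := by
  obtain ⟨T, hT, hT'⟩ := hh.exists_mul hM hS h0 hSU hU MeasurableSet.univ (subset_univ _)
  refine ⟨T.comp (restrField G univ), fun u hu => hT _ (restrField_mem univ hu), fun u => ?_⟩
  have h1 := restrField_fst univ u
  have h2 := restrField_snd univ u
  rw [Filter.EventuallyEq, ae_restrict_iff' MeasurableSet.univ] at h1 h2
  filter_upwards [hT' (restrField G univ u), h1, h2] with x hx e1 e2 i hi
  have := hx.2 i hi (mem_univ x)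
  rw [e1 (mem_univ x), e2 (mem_univ x)] at this; exact this

end QuadMesh

lemma smoothGrad_add {φ ψ : Pt → Pair} (hφ : ContDiff ℝ ∞ φ) (hψ : ContDiff ℝ ∞ ψ) :
    G.smoothGrad (φ + ψ) = G.smoothGrad φ + G.smoothGrad ψ := by
  funext x; ext1 i
  have h1 : DifferentiableAt ℝ (fun y => φ y i) x := (contDiff_apply hφ i).differentiable (by simp) x
  have h2 : DifferentiableAt ℝ (fun y => ψ y i) x := (contDiff_apply hψ i).differentiable (by simp) x
  change (G.tangentAt x).starProjection (gradient (fun y => φ y i + ψ y i) x) =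
    (G.tangentAt x).starProjection (gradient (fun y => φ y i) x) +
    (G.tangentAt x).starProjection (gradient (fun y => ψ y i) x)
  rw [← map_add, gradient, gradient, gradient, fderiv_fun_add h1 h2, map_add]

lemma smoothGrad_const_smul {φ : Pt → Pair} (hφ : ContDiff ℝ ∞ φ) (r : ℝ) :
    G.smoothGrad (r • φ) = r • G.smoothGrad φ := by
  funext x; ext1 i
  have := smoothGrad_smul (G := G) (h := fun _ => r) (φ := φ) (x := x) (differentiableAt_const r)
    (hφ.differentiable (by simp) x) i
  have e : gradient (fun _ : Pt => r) x = 0 := by simp [gradient]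
  rw [e, map_zero, smul_zero, zero_add] at this; exact this

/-- Finite linear combinations of test functions are test functions. -/
lemma exists_test_of_mem_span {ν : Measure Pt} {U : Set Pt} {w : EField ν}
    (hw : w ∈ Submodule.span ℝ {w : EField ν | ∃ φ : Pt → Pair, ContDiff ℝ ∞ φ ∧ HasCompactSupport φ ∧
      tsupport φ ⊆ U ∧ w.1 =ᵐ[ν] φ ∧ w.2 =ᵐ[ν] G.smoothGrad φ}) :
    ∃ φ : Pt → Pair, ContDiff ℝ ∞ φ ∧ HasCompactSupport φ ∧
      tsupport φ ⊆ U ∧ w.1 =ᵐ[ν] φ ∧ w.2 =ᵐ[ν] G.smoothGrad φ := by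
  induction hw using Submodule.span_induction with
  | mem w hw => exact hw
  | zero =>
    refine ⟨0, contDiff_const, HasCompactSupport.zero, ?_, Lp.coeFn_zero _ _ _, ?_⟩
    · rw [tsupport, Function.support_zero, closure_empty]; exact empty_subset _
    · have := smoothGrad_const_smul (G := G) (φ := 0) contDiff_const 0
      rw [zero_smul, zero_smul] at this; rw [this]; exact Lp.coeFn_zero _ _ _
  | add a b _ _ ha hb =>
    obtain ⟨φ, p1, p2, p3, p4, p5⟩ := ha
    obtain ⟨ψ, q1, q2, q3, q4, q5⟩ := hb
    refine ⟨φ + ψ, p1.add q1, p2.add q2, (tsupport_add φ ψ).trans (union_subset p3 q3),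
      (Lp.coeFn_add _ _).trans (p4.add q4), ?_⟩
    rw [smoothGrad_add p1 q1]; exact (Lp.coeFn_add _ _).trans (p5.add q5)
  | smul r a _ ha =>
    obtain ⟨φ, p1, p2, p3, p4, p5⟩ := ha
    refine ⟨r • φ, p1.const_smul r, p2.smul_left (f := fun _ => r), ?_,
      (Lp.coeFn_smul _ _).trans (p4.const_smul r), ?_⟩
    · refine (closure_mono fun x hx => ?_).trans p3
      simp only [Function.mem_support, Pi.smul_apply] at hx ⊢; exact fun h => hx (by rw [h, smul_zero])
    · rw [smoothGrad_const_smul p1]; exact (Lp.coeFn_smul _ _).trans (p5.const_smul r)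

/-- A closed relation that holds for test functions holds on the energy space. -/
lemma energySpace_induction {ν : Measure Pt} {U : Set Pt} {P : EField ν → Prop} (hP : IsClosed {w | P w})
    (h : ∀ w : EField ν, ∀ φ : Pt → Pair, ContDiff ℝ ∞ φ → HasCompactSupport φ → tsupport φ ⊆ U →
      w.1 =ᵐ[ν] φ → w.2 =ᵐ[ν] G.smoothGrad φ → P w) {w : EField ν} (hw : w ∈ energySpace G ν U) : P w := by
  refine closure_minimal (fun w hw => ?_) hP hw
  obtain ⟨φ, p1, p2, p3, p4, p5⟩ := exists_test_of_mem_span hw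
  exact h w φ p1 p2 p3 p4 p5

/-- Orthonormal coordinates. -/
lemma measurePreserving_frame (b : OrthonormalBasis (Fin 2) ℝ Pt) (a : Pt) :
    MeasurePreserving (fun p : ℝ × ℝ => a + (p.1 • b 0 + p.2 • b 1)) volume volume := by
  have h1 := (MeasureTheory.volume_preserving_finTwoArrow ℝ).symm
  have h2 := (EuclideanSpace.volume_preserving_symm_measurableEquiv_toLp (Fin 2)).symm
  have h3 := b.measurePreserving_repr_symm
  have h4 := measurePreserving_add_left (volume : Measure Pt) a
  have := h4.comp (h3.comp (h2.comp h1))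
  convert this using 1
  funext p; simp only [Function.comp_apply]
  congr 1; rw [← b.sum_repr_symm]
  simp [Fin.sum_univ_two]

lemma exists_frame {d : Pt} (hd : ‖d‖ = 1) : ∃ b : OrthonormalBasis (Fin 2) ℝ Pt, b 0 = d := by
  have h : Orthonormal ℝ (({0} : Set (Fin 2)).restrict fun _ => d) := by
    refine ⟨fun i => hd, fun i j hij => ?_⟩
    exact absurd (Subsingleton.elim i j) hij
  obtain ⟨b, hb⟩ := h.exists_orthonormalBasis_extension_of_card_eq (by simp)
  exact ⟨b, hb 0 rfl⟩

section Poincare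

variable {E : Type*} [NormedAddCommGroup E] [NormedSpace ℝ E] [FiniteDimensional ℝ E] [MeasureSpace E] [BorelSpace E]
  [(volume : Measure E).IsAddHaarMeasure]

lemma lintegral_comp_smul_add_le {D : Set E} (hD : MeasurableSet D) {g : E → ℝ≥0∞} (hg : Measurable g)
    {r : ℝ} (hr : 1 / 2 ≤ r) (z : E) (h : ∀ x ∈ D, r • x + z ∈ D) :
    ∫⁻ x in D, g (r • x + z) ≤ 2 ^ Module.finrank ℝ E * ∫⁻ x in D, g x := by
  have hr0 : 0 < r := by linarith
  set G := D.indicator g with hG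
  have hGm : Measurable G := hg.indicator hD
  have h1 : ∫⁻ x in D, g (r • x + z) ≤ ∫⁻ x, G (r • x + z) := by
    rw [← lintegral_indicator hD]
    refine lintegral_mono fun x => ?_
    by_cases hx : x ∈ D
    · rw [indicator_of_mem hx, hG, indicator_of_mem (h x hx)]
    · rw [indicator_of_notMem hx]; exact bot_le
  have h2 : ∫⁻ x, G (r • x + z) = ofReal |(r ^ Module.finrank ℝ E)⁻¹| * ∫⁻ x, G x := by
    have e1 := lintegral_map (μ := (volume : Measure E)) (f := fun x => G (x + z)) (g := fun x => r • x)
      (hGm.comp (measurable_add_const z)) (measurable_const_smul r)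
    rw [← e1, Measure.map_addHaar_smul _ hr0.ne', lintegral_smul_measure, lintegral_add_right_eq_self, smul_eq_mul]
  refine h1.trans (h2.le.trans ?_)
  rw [hG, lintegral_indicator hD]; gcongr
  have : |(r ^ Module.finrank ℝ E)⁻¹| ≤ 2 ^ Module.finrank ℝ E := by
    rw [abs_of_pos (by positivity), ← inv_pow]; gcongr
    rw [inv_le_comm₀ hr0 (by norm_num)]; linarith
  calc _ ≤ ofReal (2 ^ Module.finrank ℝ E) := ofReal_le_ofReal this
    _ = _ := by rw [ENNReal.ofReal_pow (by norm_num)]; norm_num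

lemma sq_sub_le_lintegral {u : E → ℝ} (hu : ContDiff ℝ 1 u) {x y : E} {δ : ℝ} (hxy : ‖x - y‖ ≤ δ) :
    ofReal ((u x - u y) ^ 2) ≤
      ∫⁻ t in Icc (0 : ℝ) 1, ofReal (δ ^ 2 * ‖fderiv ℝ u ((1 - t) • x + t • y)‖ ^ 2) := by
  have hcf : Continuous (fderiv ℝ u) := hu.continuous_fderiv one_ne_zero
  have hl : Continuous fun t : ℝ => (1 - t) • x + t • y := by fun_prop
  set d := fun t : ℝ => fderiv ℝ u ((1 - t) • x + t • y) (y - x) with hdd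
  have hcont : Continuous d := (hcf.comp hl).clm_apply continuous_const
  have hd : ∀ t : ℝ, HasDerivAt (fun t : ℝ => u ((1 - t) • x + t • y) - u x) (d t) t := by
    intro t
    have h1 : HasDerivAt (fun t : ℝ => (1 - t) • x + t • y) ((-1 : ℝ) • x + (1 : ℝ) • y) t :=
      (((hasDerivAt_id t).const_sub 1).smul_const x).add ((hasDerivAt_id t).smul_const y)
    have h2 := (hu.differentiable (by simp) ((1 - t) • x + t • y)).hasFDerivAt
    refine ((h2.comp_hasDerivAt t h1).sub_const (u x)).congr_deriv ?_
    congr 1; rw [neg_one_smul, one_smul]; abel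
  have key : (u x - u y) ^ 2 ≤ ∫ t in Icc (0 : ℝ) 1, δ ^ 2 * ‖fderiv ℝ u ((1 - t) • x + t • y)‖ ^ 2 := by
    have e : u y - u x = ∫ t in (0 : ℝ)..1, d t := by
      rw [intervalIntegral.integral_eq_sub_of_hasDerivAt (fun t _ => hd t) (hcont.intervalIntegrable _ _)]; simp
    have hsq : (∫ t in (0 : ℝ)..1, d t) ^ 2 ≤ ∫ t in (0 : ℝ)..1, d t ^ 2 := by
      have hA := hcont.intervalIntegrable (μ := volume) 0 1
      have hB : IntervalIntegrable (fun t : ℝ => d t ^ 2) volume 0 1 := (hcont.pow 2).intervalIntegrable _ _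
      set A := ∫ t in (0 : ℝ)..1, d t with hAdef
      have h : 0 ≤ ∫ t in (0 : ℝ)..1, (d t - A) ^ 2 :=
        intervalIntegral.integral_nonneg zero_le_one fun s _ => sq_nonneg _
      have e2 : (fun t : ℝ => (d t - A) ^ 2) = fun t : ℝ => d t ^ 2 - 2 * A * d t + A ^ 2 := by funext t; ring
      rw [e2, intervalIntegral.integral_add (hB.sub (hA.const_mul _)) (by simp),
        intervalIntegral.integral_sub hB (hA.const_mul _), intervalIntegral.integral_const_mul, ← hAdef] at h
      simp only [intervalIntegral.integral_const, smul_eq_mul, sub_zero, one_mul] at h; nlinarith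
    rw [integral_Icc_eq_integral_Ioc, ← intervalIntegral.integral_of_le zero_le_one]
    calc (u x - u y) ^ 2 = (u y - u x) ^ 2 := by ring
      _ ≤ ∫ t in (0 : ℝ)..1, d t ^ 2 := by rw [e]; exact hsq
      _ ≤ _ := by
          refine intervalIntegral.integral_mono_on zero_le_one ((hcont.pow 2).intervalIntegrable _ _)
            ((continuous_const.mul ((hcf.comp hl).norm.pow 2)).intervalIntegrable _ _) fun t _ => ?_
          rw [← sq_abs, ← Real.norm_eq_abs, ← mul_pow, mul_comm δ]
          have h3 : ‖y - x‖ ≤ δ := by rw [norm_sub_rev]; exact hxy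
          exact pow_le_pow_left₀ (norm_nonneg _) (((fderiv ℝ u _).le_opNorm _).trans
            (mul_le_mul_of_nonneg_left h3 (norm_nonneg _))) 2
  rw [← ofReal_integral_eq_lintegral_ofReal]
  · exact ofReal_le_ofReal key
  · exact (continuous_const.mul ((hcf.comp hl).norm.pow 2)).continuousOn.integrableOn_compact isCompact_Icc
  · exact .of_forall fun t => by positivity

end Poincare

/-- The Friedrichs inequality on a piece. -/
lemma friedrichs_piece {φ : Pt → ℝ} {R : ℝ} (hφ : ContDiff ℝ ∞ φ) (hc : HasCompactSupport φ)
    (hφΩ : tsupport φ ⊆ G.Ω) (hR0 : 0 ≤ R) (hR : closure G.Ω ⊆ Metric.closedBall 0 R) (o : Fin (G.nf + 1)) :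
    ∫ x, φ x ^ 2 ∂G.pieceMeas o ≤ 4 * (2 * R + 1) ^ 2 * ∫ x, ‖gradient φ x‖ ^ 2 := by
  have hgc : Continuous fun x => ‖fderiv ℝ φ x‖ ^ 2 := (hφ.continuous_fderiv (by simp)).norm.pow 2
  have hgi : Integrable fun x => (2 * R + 1) ^ 2 * ‖fderiv ℝ φ x‖ ^ 2 := (hgc.integrable_of_hasCompactSupport
      ((hc.fderiv ℝ).comp_left (g := fun L => ‖L‖ ^ 2) (by simp))).const_mul _
  set g := fun x => ofReal ((2 * R + 1) ^ 2 * ‖fderiv ℝ φ x‖ ^ 2)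
  have hgm : Measurable g := (continuous_const.mul hgc).measurable.ennreal_ofReal
  have key : ∀ x w : Pt, ‖x‖ ≤ R → ‖w‖ = 2 * R + 1 →
      ofReal (φ x ^ 2) ≤ ∫⁻ t in Icc (0 : ℝ) 1, g (x + t • w) := fun x w hx hw => by
    have h0 : φ (x + w) = 0 := image_eq_zero_of_notMem_tsupport fun hm => by
      have h1 := mem_closedBall_zero_iff.1 (hR (subset_closure (hφΩ hm)))
      have h2 := norm_sub_le (x + w) x
      rw [add_sub_cancel_left] at h2; linarith
    have := sq_sub_le_lintegral (u := φ) (hφ.of_le (by simp)) (x := x) (y := x + w) (δ := 2 * R + 1) (by simp [hw])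
    rw [h0, sub_zero] at this
    refine this.trans_eq (lintegral_congr fun t => ?_)
    rw [show (1 - t) • x + t • (x + w) = x + t • w by module]
  have main : ∫⁻ x, ofReal (φ x ^ 2) ∂G.pieceMeas o ≤ 4 * ∫⁻ x, g x := by
    induction o using Fin.cases with
    | zero =>
      obtain ⟨w, hw⟩ := exists_norm_eq Pt (c := 2 * R + 1) (by positivity)
      calc _ ≤ ∫⁻ x in G.Ω, ∫⁻ t in Icc (0 : ℝ) 1, g (x + t • w) :=
            setLIntegral_mono' G.isOpen.measurableSet fun x hx =>
              key x _ (mem_closedBall_zero_iff.1 (hR (subset_closure hx))) hw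
        _ ≤ ∫⁻ x, ∫⁻ t in Icc (0 : ℝ) 1, g (x + t • w) := setLIntegral_le_lintegral _ _
        _ = ∫⁻ t in Icc (0 : ℝ) 1, ∫⁻ x, g x := by
            rw [lintegral_lintegral_swap (f := fun x t => g (x + t • w)) (Measurable.aemeasurable
              (hgm.comp (f := fun p : Pt × ℝ => p.1 + p.2 • w) (by fun_prop)))]
            simp only [lintegral_add_right_eq_self]
        _ ≤ _ := by
            rw [setLIntegral_const]; simpa using le_mul_of_one_le_left' (by norm_num : (1 : ℝ≥0∞) ≤ 4)
    | succ l =>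
      obtain ⟨b, hb⟩ := exists_frame (G.norm_dir l)
      have hF := measurePreserving_frame b (G.a l)
      rw [G.pieceMeas_succ_eq_map, (G.isometry_param l).isClosedEmbedding.measurableEmbedding.lintegral_map]
      calc _ ≤ ∫⁻ t in Icc 0 (G.len l), 2 * ∫⁻ s, g (G.a l + (t • b 0 + s • b 1)) := by
            refine setLIntegral_mono' measurableSet_Icc fun t ht => ?_
            have hs := lintegral_comp_smul_add_le .univ (g := fun s : ℝ => g (G.a l + (t • b 0 + s • b 1)))
              (hgm.comp (by fun_prop)) (r := 2 * R + 1) (by linarith) 0 fun _ _ => trivial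
            simp only [Measure.restrict_univ, Module.finrank_self, pow_one, add_zero] at hs
            refine ((key _ ((2 * R + 1) • b 1) (mem_closedBall_zero_iff.1 (hR (G.seg_subset l ?_))) ?_).trans
              (setLIntegral_le_lintegral _ _)).trans (le_trans (le_of_eq ?_) hs)
            · exact (G.preimage_seg l).ge ht
            · rw [norm_smul, b.norm_eq_one, mul_one, Real.norm_of_nonneg (by positivity)]
            · refine lintegral_congr fun s => ?_
              rw [FracturedDomain.param, hb, add_assoc, smul_comm, smul_assoc]
        _ ≤ ∫⁻ t, 2 * ∫⁻ s, g (G.a l + (t • b 0 + s • b 1)) := setLIntegral_le_lintegral _ _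
        _ = 2 * ∫⁻ x, g x := by
            rw [lintegral_const_mul' _ _ (by simp), ← hF.lintegral_comp hgm]; congr 1
            exact (lintegral_prod _ (hgm.comp hF.measurable).aemeasurable).symm
        _ ≤ _ := by gcongr; norm_num
  simp only [gradient, LinearIsometryEquiv.norm_map]
  rw [mul_assoc, ← integral_const_mul, integral_eq_lintegral_of_nonneg_ae (.of_forall fun x => sq_nonneg _)
    (hφ.continuous.pow 2).aestronglyMeasurable]
  refine ENNReal.toReal_le_of_le_ofReal (mul_nonneg zero_le_four (integral_nonneg fun x => by positivity)) ?_
  rw [ofReal_mul zero_le_four, ofReal_integral_eq_lintegral_ofReal hgi (.of_forall fun x => by positivity)]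
  simpa using main

lemma integral_meas_eq {f : Pt → ℝ} (hf : Integrable f G.meas) :
    ∫ x, f x ∂G.meas = ∑ o, G.aper o * ∫ x, f x ∂G.pieceMeas o := by
  have h1 : ∀ o, Integrable f (G.pieceMeas o) := fun o =>
    Integrable.of_measure_le_smul (c := ofReal (G.aper o)⁻¹) ofReal_ne_top (G.pieceMeas_le o) hf
  rw [G.meas_eq, integral_finsetSum_measure fun o _ => (h1 o).smul_measure ofReal_ne_top]
  refine sum_congr rfl fun o _ => ?_
  rw [integral_smul_measure, toReal_ofReal (G.aper_pos o).le, smul_eq_mul]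

lemma sum_integral_gradient_le {w : EField G.meas} {φ : Pt → Pair} (p1 : ContDiff ℝ ∞ φ)
    (p2 : HasCompactSupport φ) (p3 : tsupport φ ⊆ G.Ω) (p5 : w.2 =ᵐ[G.meas] G.smoothGrad φ) :
    ∑ i, ∫ x, ‖gradient (fun y => φ y i) x‖ ^ 2 ≤ ‖w.2‖ ^ 2 := by
  have hsub : (volume : Measure Pt).restrict G.Ω ≤ G.meas := Measure.le_add_right le_rfl
  have hg : ∀ i, Integrable (fun x => ‖gradient (fun y => φ y i) x‖ ^ 2) := fun i => by
    have h1 : Continuous fun x => ‖gradient (fun y => φ y i) x‖ ^ 2 :=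
      ((continuous_gradient (contDiff_apply p1 i)).norm).pow 2
    have h2 : HasCompactSupport fun y => φ y i := p2.comp_left (g := fun U : Pair => U i) rfl
    have h3 : HasCompactSupport fun x => ‖gradient (fun y => φ y i) x‖ ^ 2 :=
      (h2.fderiv ℝ).comp_left (g := fun L => ‖(InnerProductSpace.toDual ℝ Pt).symm L‖ ^ 2) (by simp)
    exact h1.integrable_of_hasCompactSupport h3
  have h1 : ∑ i, ∫ x, ‖gradient (fun y => φ y i) x‖ ^ 2 = ∫ x in G.Ω, ‖w.2 x‖ ^ 2 := by
    rw [← integral_finsetSum _ fun i _ => hg i]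
    have hz : ∀ x, x ∉ G.Ω → ∑ i, ‖gradient (fun y => φ y i) x‖ ^ 2 = 0 := by
      intro x hx
      refine sum_eq_zero fun i _ => ?_
      have hx' : x ∉ tsupport φ := fun h => hx (p3 h)
      have : (fun y => φ y i) =ᶠ[𝓝 x] fun _ => 0 := by
        filter_upwards [notMem_tsupport_iff_eventuallyEq.1 hx'] with y hy
        rw [hy]; rfl
      rw [this.gradient_eq]; simp [gradient]
    have hind : (fun x => ∑ i, ‖gradient (fun y => φ y i) x‖ ^ 2) =
        G.Ω.indicator fun x => ∑ i, ‖gradient (fun y => φ y i) x‖ ^ 2 :=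
      (indicator_eq_self.2 fun x hx => by_contra fun h => hx (hz x h)).symm
    rw [hind, integral_indicator G.isOpen.measurableSet]
    refine integral_congr_ae ?_
    have ht := (G.ae_mu_iff.1 G.tangentAt_ae) 0
    filter_upwards [ae_mono hsub p5, ht] with x hx hx'
    rw [hx, PiLp.norm_sq_eq_of_L2]
    refine sum_congr rfl fun i _ => ?_
    change _ = ‖(G.tangentAt x).starProjection (gradient (fun y => φ y i) x)‖ ^ 2
    have : G.tangentAt x = ⊤ := hx'
    rw [Submodule.starProjection_eq_self_iff.2 (by rw [this]; trivial)]
  rw [h1, norm_sq_L2]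
  exact integral_mono_measure hsub (.of_forall fun x => sq_nonneg ‖w.2 x‖) (integrable_norm_sq (Lp.memLp w.2))

/-- The Friedrichs inequality. -/
lemma exists_friedrichs (G : FracturedDomain) : ∃ C : ℝ, 0 < C ∧ ∀ v ∈ G.V, ‖v.1‖ ^ 2 ≤ C * ‖v.2‖ ^ 2 := by
  obtain ⟨R, hR0, hR⟩ : ∃ R, 0 ≤ R ∧ closure G.Ω ⊆ Metric.closedBall 0 R := by
    obtain ⟨R, hR⟩ := G.isBounded.closure.subset_closedBall 0
    exact ⟨|R|, abs_nonneg R, hR.trans (Metric.closedBall_subset_closedBall (le_abs_self R))⟩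
  have hA : 0 < ∑ o, G.aper o := Finset.sum_pos (fun o _ => G.aper_pos o) ⟨0, Finset.mem_univ _⟩
  refine ⟨(∑ o, G.aper o) * (4 * (2 * R + 1) ^ 2), by positivity, fun v hv => ?_⟩
  refine energySpace_induction (P := fun v => ‖v.1‖ ^ 2 ≤ (∑ o, G.aper o) * (4 * (2 * R + 1) ^ 2) * ‖v.2‖ ^ 2)
    (isClosed_le (by fun_prop) (by fun_prop)) (fun w φ p1 p2 p3 p4 p5 => ?_) hv
  have hs : ∀ i, Integrable (fun x => φ x i ^ 2) G.meas := fun i =>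
    Integrable.of_bound ((contDiff_apply p1 i).continuous.pow 2).aestronglyMeasurable
      (C := ((exists_smoothGrad_bound (G := G) p1 p2).choose) ^ 2) (.of_forall fun x => by
        have h := ((exists_smoothGrad_bound (G := G) p1 p2).choose_spec.2 x).1
        rw [norm_pow]; exact pow_le_pow_left₀ (norm_nonneg _) ((PiLp.norm_apply_le (φ x) i).trans h) 2)
  have e1 : ‖w.1‖ ^ 2 = ∑ i, ∫ x, φ x i ^ 2 ∂G.meas := by
    rw [norm_sq_L2, ← integral_finsetSum _ fun i _ => hs i]
    refine integral_congr_ae ?_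
    filter_upwards [p4] with x hx
    rw [hx, EuclideanSpace.norm_sq_eq]; simp
  have e2 := sum_integral_gradient_le p1 p2 p3 p5
  rw [e1]
  calc ∑ i, ∫ x, φ x i ^ 2 ∂G.meas
      ≤ ∑ i, ∑ o, G.aper o * ((4 * (2 * R + 1) ^ 2) * ∫ x, ‖gradient (fun y => φ y i) x‖ ^ 2) := by
        refine sum_le_sum fun i _ => ?_
        rw [integral_meas_eq (hs i)]
        refine sum_le_sum fun o _ => mul_le_mul_of_nonneg_left ?_ (G.aper_pos o).le
        refine friedrichs_piece (contDiff_apply p1 i) (p2.comp_left (g := fun U : Pair => U i) rfl) ?_ hR0 hR o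
        refine (closure_mono fun x hx => ?_).trans p3
        simp only [Function.mem_support] at hx ⊢; exact fun h => hx (by rw [h]; rfl)
    _ = (∑ o, G.aper o) * (4 * (2 * R + 1) ^ 2) * ∑ i, ∫ x, ‖gradient (fun y => φ y i) x‖ ^ 2 := by
        rw [mul_sum]
        refine sum_congr rfl fun i _ => ?_
        rw [← sum_mul]; ring
    _ ≤ _ := mul_le_mul_of_nonneg_left e2 (by positivity)

section Poincare

variable {E : Type*} [NormedAddCommGroup E] [NormedSpace ℝ E] [FiniteDimensional ℝ E] [MeasureSpace E] [BorelSpace E]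
  [(volume : Measure E).IsAddHaarMeasure]

lemma lintegral_segment_le {D : Set E} (hD : MeasurableSet D) (hc : Convex ℝ D) {g : E → ℝ≥0∞} (hg : Measurable g) :
    ∫⁻ x in D, ∫⁻ y in D, ∫⁻ t in Icc (0 : ℝ) 1, g ((1 - t) • x + t • y) ≤
      2 ^ Module.finrank ℝ E * (volume D * ∫⁻ x in D, g x) := by
  have hm : Measurable fun p : (E × E) × ℝ => g ((1 - p.2) • p.1.1 + p.2 • p.1.2) := by
    refine hg.comp (Continuous.measurable ?_)
    fun_prop
  have e1 : ∫⁻ x in D, ∫⁻ y in D, ∫⁻ t in Icc (0 : ℝ) 1, g ((1 - t) • x + t • y) =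
      ∫⁻ t in Icc (0 : ℝ) 1, ∫⁻ x in D, ∫⁻ y in D, g ((1 - t) • x + t • y) := by
    have h1 : ∀ x, ∫⁻ y in D, ∫⁻ t in Icc (0 : ℝ) 1, g ((1 - t) • x + t • y) =
        ∫⁻ t in Icc (0 : ℝ) 1, ∫⁻ y in D, g ((1 - t) • x + t • y) := fun x =>
      lintegral_lintegral_swap (Measurable.aemeasurable
        (hm.comp (f := fun p : E × ℝ => ((x, p.1), p.2)) (by fun_prop)))
    simp only [h1]
    refine lintegral_lintegral_swap (Measurable.aemeasurable ?_)
    exact Measurable.lintegral_prod_right' (f := fun q : (E × ℝ) × E => g ((1 - q.1.2) • q.1.1 + q.1.2 • q.2))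
      (hm.comp (f := fun q : (E × ℝ) × E => ((q.1.1, q.2), q.1.2)) (by fun_prop))
  rw [e1]
  calc _ ≤ ∫⁻ _ in Icc (0 : ℝ) 1, 2 ^ Module.finrank ℝ E * (volume D * ∫⁻ x in D, g x) := by
        refine setLIntegral_mono' measurableSet_Icc fun t ht => ?_
        rcases le_total t (1 / 2) with h | h
        · have hsw : AEMeasurable (Function.uncurry fun x y => g ((1 - t) • x + t • y))
              (((volume : Measure E).restrict D).prod ((volume : Measure E).restrict D)) :=
            Measurable.aemeasurable (hm.comp (f := fun p : E × E => ((p.1, p.2), t)) (by fun_prop))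
          rw [lintegral_lintegral_swap hsw]
          calc _ ≤ ∫⁻ _ in D, 2 ^ Module.finrank ℝ E * ∫⁻ x in D, g x :=
                setLIntegral_mono' hD fun y hy => lintegral_comp_smul_add_le hD hg (by linarith) _ fun x hx =>
                  hc hx hy (by linarith [ht.2]) ht.1 (by ring)
            _ = _ := by rw [setLIntegral_const]; ring
        · calc _ ≤ ∫⁻ _ in D, 2 ^ Module.finrank ℝ E * ∫⁻ x in D, g x :=
                setLIntegral_mono' hD fun x hx => by
                  simp only [add_comm ((1 - t) • x)]
                  exact lintegral_comp_smul_add_le hD hg (by linarith) _ fun y hy =>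
                    hc hy hx ht.1 (by linarith [ht.2]) (by ring)
            _ = _ := by rw [setLIntegral_const]; ring
    _ = _ := by rw [setLIntegral_const]; simp

lemma integrableOn_of_isBounded {F : Type*} [NormedAddCommGroup F] {f : E → F} (hf : Continuous f) {D : Set E}
    (hb : Bornology.IsBounded D) : IntegrableOn f D :=
  (hf.continuousOn.integrableOn_compact hb.isCompact_closure).mono_set subset_closure

/-- The Poincaré inequality on a convex set, with an explicit constant. -/
lemma poincare_convex {D : Set E} (hD : MeasurableSet D) (hc : Convex ℝ D) (hb : Bornology.IsBounded D)
    {δ : ℝ} (hδ : ∀ x ∈ D, ∀ y ∈ D, ‖x - y‖ ≤ δ) {u : E → ℝ} (hu : ContDiff ℝ 1 u) :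
    volume.real D * ∫ x in D, u x ^ 2 ≤
      2 ^ Module.finrank ℝ E * δ ^ 2 * (volume.real D * ∫ x in D, ‖fderiv ℝ u x‖ ^ 2) + (∫ x in D, u x) ^ 2 := by
  have hfin : volume D ≠ ⊤ := hb.measure_lt_top.ne
  have : IsFiniteMeasure ((volume : Measure E).restrict D) := ⟨by simpa using hb.measure_lt_top⟩
  have hcf : Continuous fun x => ‖fderiv ℝ u x‖ ^ 2 := (hu.continuous_fderiv one_ne_zero).norm.pow 2
  have hI2 : IntegrableOn (fun x => u x ^ 2) D := integrableOn_of_isBounded (hu.continuous.pow 2) hb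
  have hI1 : IntegrableOn u D := integrableOn_of_isBounded hu.continuous hb
  have hIf : IntegrableOn (fun x => ‖fderiv ℝ u x‖ ^ 2) D := integrableOn_of_isBounded hcf hb
  set A := ∫ x in D, u x ^ 2 with hA
  set S := ∫ x in D, u x with hS
  set B := ∫ x in D, ‖fderiv ℝ u x‖ ^ 2 with hB
  set V := volume.real D with hV
  have hin : ∀ x, ∫ y in D, (u x - u y) ^ 2 = V * u x ^ 2 - 2 * u x * S + A := by
    intro x
    have e2 : (fun y => (u x - u y) ^ 2) = fun y => u x ^ 2 - 2 * u x * u y + u y ^ 2 := by funext y; ring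
    have i1 : Integrable (fun y => 2 * u x * u y) ((volume : Measure E).restrict D) := hI1.const_mul _
    have i2 : Integrable (fun y => u x ^ 2 - 2 * u x * u y) ((volume : Measure E).restrict D) :=
      (integrable_const _).sub i1
    rw [e2, integral_add i2 hI2, integral_sub (integrable_const _) (hI1.const_mul _), integral_const_mul, integral_const]
    simp [V, A, S]
  have hout : ∫ x in D, ∫ y in D, (u x - u y) ^ 2 = 2 * V * A - 2 * S ^ 2 := by
    simp only [hin]
    have i1 : Integrable (fun x => V * u x ^ 2) ((volume : Measure E).restrict D) := hI2.const_mul _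
    have i2 : Integrable (fun x => 2 * u x * S) ((volume : Measure E).restrict D) := (hI1.const_mul 2).mul_const _
    have i3 : Integrable (fun x => V * u x ^ 2 - 2 * u x * S) ((volume : Measure E).restrict D) := i1.sub i2
    rw [integral_add i3 (integrable_const _), integral_sub i1 i2, integral_const_mul, integral_mul_const,
      integral_const_mul, integral_const]
    simp [V, A, S]; ring
  have hl : ∫⁻ x in D, ∫⁻ y in D, ofReal ((u x - u y) ^ 2) ≤
      ofReal (2 ^ Module.finrank ℝ E * (V * (δ ^ 2 * B))) := by
    calc _ ≤ ∫⁻ x in D, ∫⁻ y in D, ∫⁻ t in Icc (0 : ℝ) 1,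
          ofReal (δ ^ 2 * ‖fderiv ℝ u ((1 - t) • x + t • y)‖ ^ 2) :=
          setLIntegral_mono' hD fun x hx => setLIntegral_mono' hD fun y hy =>
            sq_sub_le_lintegral hu (hδ x hx y hy)
      _ ≤ 2 ^ Module.finrank ℝ E * (volume D * ∫⁻ x in D, ofReal (δ ^ 2 * ‖fderiv ℝ u x‖ ^ 2)) :=
          lintegral_segment_le hD hc (g := fun x => ofReal (δ ^ 2 * ‖fderiv ℝ u x‖ ^ 2))
            (by have := hcf.measurable; fun_prop)
      _ = _ := by
          rw [← ofReal_integral_eq_lintegral_ofReal (hIf.const_mul _)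
            (.of_forall fun t => by positivity), integral_const_mul,
            ofReal_mul (p := (2 : ℝ) ^ Module.finrank ℝ E) (by positivity),
            ofReal_mul (p := V) measureReal_nonneg, hV, measureReal_def,
            ENNReal.ofReal_toReal hfin, ENNReal.ofReal_pow (by norm_num), ← hB]
          norm_num
  have hB0 : 0 ≤ B := integral_nonneg fun x => by positivity
  have hl2 : ∫⁻ x in D, ∫⁻ y in D, ofReal ((u x - u y) ^ 2) = ofReal (2 * V * A - 2 * S ^ 2) := by
    rw [← hout, ofReal_integral_eq_lintegral_ofReal]
    · refine lintegral_congr fun x => ?_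
      rw [ofReal_integral_eq_lintegral_ofReal (integrableOn_of_isBounded (by fun_prop) hb)
        (.of_forall fun t => by positivity)]
    · simp only [hin]; exact ((hI2.const_mul _).sub ((hI1.const_mul 2).mul_const _)).add (integrable_const _)
    · exact .of_forall fun x => integral_nonneg fun y => by positivity
  rw [hl2, ENNReal.ofReal_le_ofReal_iff (mul_nonneg (by positivity) (mul_nonneg measureReal_nonneg
    (mul_nonneg (sq_nonneg _) hB0)))] at hl
  have h3 : 0 ≤ 2 ^ Module.finrank ℝ E * (V * (δ ^ 2 * B)) := mul_nonneg (by positivity)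
    (mul_nonneg measureReal_nonneg (mul_nonneg (sq_nonneg _) hB0))
  nlinarith

lemma poincare_convex' {D : Set E} (hD : MeasurableSet D) (hc : Convex ℝ D) (hb : Bornology.IsBounded D)
    {δ : ℝ} (hδ : ∀ x ∈ D, ∀ y ∈ D, ‖x - y‖ ≤ δ) {u : E → ℝ} (hu : ContDiff ℝ 1 u) :
    ∫ x in D, u x ^ 2 ≤ 2 ^ Module.finrank ℝ E * δ ^ 2 * (∫ x in D, ‖fderiv ℝ u x‖ ^ 2) +
      (Real.sqrt (volume.real D)⁻¹ * ∫ x in D, u x) ^ 2 := by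
  have h := poincare_convex hD hc hb hδ hu
  rw [mul_pow, Real.sq_sqrt (inv_nonneg.2 measureReal_nonneg)]
  rcases (measureReal_nonneg (μ := (volume : Measure E)) (s := D)).eq_or_lt with h0 | h0
  · have : volume D = 0 := by
      rw [measureReal_def, eq_comm, ENNReal.toReal_eq_zero_iff] at h0; exact h0.resolve_right hb.measure_lt_top.ne
    have e : (volume : Measure E).restrict D = 0 := Measure.restrict_eq_zero.2 this
    simp [e]
  · rw [← mul_le_mul_iff_right₀ h0]
    refine h.trans (le_of_eq ?_)
    field_simp

/-- A bounded convex set splits into finitely many small convex sets. -/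
lemma exists_convex_partition {d : ℕ} (c : E →L[ℝ] (Fin d → ℝ)) {Cc : ℝ} (hCc : ∀ x, ‖x‖ ≤ Cc * ‖c x‖)
    (hCc0 : 0 ≤ Cc) {D : Set E} (hD : MeasurableSet D) (hc : Convex ℝ D) (hb : Bornology.IsBounded D) {δ : ℝ} (hδ : 0 < δ) :
    ∃ (s : Finset (Fin d → ℤ)) (P : (Fin d → ℤ) → Set E), (∀ k, MeasurableSet (P k)) ∧ (∀ k, Convex ℝ (P k)) ∧
      (∀ k, P k ⊆ D) ∧ (∀ k k', k ≠ k' → Disjoint (P k) (P k')) ∧ (⋃ k ∈ s, P k) = D ∧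
      ∀ k, ∀ x ∈ P k, ∀ y ∈ P k, ‖x - y‖ ≤ Cc * δ := by
  obtain ⟨R, hR⟩ : ∃ R, ∀ x ∈ D, ‖c x‖ ≤ R := by
    obtain ⟨R, hR⟩ := hb.exists_norm_le
    refine ⟨‖c‖ * R, fun x hx => (c.le_opNorm x).trans (by gcongr; exact hR x hx)⟩
  set P : (Fin d → ℤ) → Set E := fun k => D ∩ c ⁻¹' (univ.pi fun i => Ico (k i * δ) ((k i + 1) * δ)) with hP
  have hmem : ∀ k x, x ∈ P k ↔ x ∈ D ∧ ∀ i, k i = ⌊c x i / δ⌋ := by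
    intro k x; simp only [hP, mem_inter_iff, mem_preimage, mem_univ_pi, mem_Ico]
    refine and_congr_right fun _ => forall_congr' fun i => ?_
    rw [eq_comm, Int.floor_eq_iff, le_div_iff₀ hδ, div_lt_iff₀ hδ]
  refine ⟨Fintype.piFinset fun _ => Finset.Icc ⌊-R / δ⌋ ⌊R / δ⌋, P, fun k => ?_, fun k => ?_, fun k => inter_subset_left,
    fun k k' hk => ?_, ?_, fun k x hx y hy => ?_⟩
  · exact hD.inter (c.continuous.measurable (MeasurableSet.univ_pi fun i => measurableSet_Ico))
  · exact hc.inter ((convex_pi fun i _ => convex_Ico _ _).linear_preimage c.toLinearMap)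
  · rw [disjoint_left]; intro x hx hx'
    exact hk (funext fun i => by rw [((hmem k x).1 hx).2 i, ((hmem k' x).1 hx').2 i])
  · ext x; simp only [mem_iUnion, exists_prop]
    constructor
    · rintro ⟨k, -, hx⟩; exact hx.1
    · intro hx
      refine ⟨fun i => ⌊c x i / δ⌋, ?_, (hmem _ x).2 ⟨hx, fun i => rfl⟩⟩
      rw [Fintype.mem_piFinset]; intro i
      have h1 : |c x i| ≤ R := by rw [← Real.norm_eq_abs]; exact (norm_le_pi_norm (c x) i).trans (hR x hx)
      rw [abs_le] at h1; rw [Finset.mem_Icc]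
      exact ⟨Int.floor_le_floor (by gcongr; exact h1.1), Int.floor_le_floor (by gcongr; exact h1.2)⟩
  · refine (hCc _).trans (mul_le_mul_of_nonneg_left ?_ hCc0)
    rw [map_sub, pi_norm_le_iff_of_nonneg hδ.le]; intro i
    have h1 := hx.2 i (mem_univ i)
    have h2 := hy.2 i (mem_univ i)
    simp only [mem_Ico] at h1 h2
    rw [Pi.sub_apply, Real.norm_eq_abs, abs_le]; constructor <;> nlinarith [h1.1, h1.2, h2.1, h2.2]

/-- On a bounded convex set, the `L²` norm is controlled by a small multiple of the norm of the gradient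
and finitely many averages. -/
lemma exists_poincare_partition {d : ℕ} (c : E →L[ℝ] (Fin d → ℝ)) {Cc : ℝ} (hCc : ∀ x, ‖x‖ ≤ Cc * ‖c x‖)
    (hCc0 : 0 < Cc) {D : Set E} (hD : MeasurableSet D) (hc : Convex ℝ D) (hb : Bornology.IsBounded D) {ε : ℝ} (hε : 0 < ε) :
    ∃ (s : Finset (Fin d → ℤ)) (P : (Fin d → ℤ) → Set E) (a : (Fin d → ℤ) → ℝ), (∀ k, MeasurableSet (P k)) ∧
      (∀ k, P k ⊆ D) ∧ ∀ u : E → ℝ, ContDiff ℝ 1 u → ∫ x in D, u x ^ 2 ≤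
        ε * (∫ x in D, ‖fderiv ℝ u x‖ ^ 2) + ∑ k ∈ s, (a k * ∫ x in P k, u x) ^ 2 := by
  set δ := Real.sqrt (ε / 2 ^ Module.finrank ℝ E) / Cc with hδ
  have hδ0 : 0 < δ := by positivity
  obtain ⟨s, P, h1, h2, h3, h4, h5, h6⟩ := exists_convex_partition c hCc hCc0.le hD hc hb hδ0
  refine ⟨s, P, fun k => Real.sqrt (volume.real (P k))⁻¹, h1, h3, fun u hu => ?_⟩
  have hs : ∀ f : E → ℝ, Continuous f → ∫ x in D, f x = ∑ k ∈ s, ∫ x in P k, f x := fun f hf => by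
    rw [← h5]
    exact integral_biUnion_finset s (fun k _ => h1 k) (fun k _ k' _ hk => h4 k k' hk)
      fun k _ => integrableOn_of_isBounded hf (hb.subset (h3 k))
  rw [hs (fun x => u x ^ 2) (hu.continuous.pow 2),
    hs (fun x => ‖fderiv ℝ u x‖ ^ 2) ((hu.continuous_fderiv one_ne_zero).norm.pow 2), mul_sum,
    ← sum_add_distrib]
  refine sum_le_sum fun k _ => ?_
  have e : 2 ^ Module.finrank ℝ E * (Cc * δ) ^ 2 = ε := by
    rw [hδ, mul_div_cancel₀ _ hCc0.ne', Real.sq_sqrt (by positivity)]; field_simp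
  have := poincare_convex' (h1 k) (h2 k) (hb.subset (h3 k)) (h6 k) hu
  rwa [e] at this

end Poincare

lemma exists_average_functional {D A : Set Pt} (hD : MeasurableSet D) (hA : MeasurableSet A) (hAD : A ⊆ D)
    (o : Fin (G.nf + 1)) (i : Fin 2) :
    ∃ ℓ : L2 (G.meas.restrict D) →L[ℝ] ℝ, ∀ f, ∀ φ : Pt → ℝ, (fun x => f x i) =ᵐ[G.meas.restrict D] φ →
      ℓ f = ∫ x in A, φ x ∂G.pieceMeas o := by
  classical
  set w : Fin 2 → G.Piece → ℝ := fun i' z => if i' = i then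
    (({o} : Set (Fin (G.nf + 1))) ×ˢ A).indicator (fun _ => (1 : ℝ)) z else 0 with hw
  have hwm : IsWeight w D 1 := by
    refine ⟨fun i' => ?_, fun i' => .of_forall fun z => ?_, fun i' => .of_forall fun z => ?_⟩
    · by_cases h : i' = i
      · simp only [hw, if_pos h]
        exact (measurable_const.indicator ((MeasurableSet.singleton o).prod hA)).aestronglyMeasurable
      · simp only [hw, if_neg h]; exact aestronglyMeasurable_const
    · by_cases h : i' = i
      · simp only [hw, if_pos h]; exact indicator_nonneg (fun _ _ => zero_le_one) z
      · simp only [hw, if_neg h]; exact le_rfl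
    · by_cases h : i' = i
      · simp only [hw, if_pos h]; exact indicator_le_self' (fun _ _ => zero_le_one) z
      · simp only [hw, if_neg h]; exact zero_le_one
  obtain ⟨B, hB⟩ := exists_wForm_bilin hD hwm zero_le_one (ν := G.meas.restrict D) le_rfl
  have hone : MemLp (fun _ : Pt => (WithLp.toLp 2 fun _ => (1 : ℝ) : Pair)) 2 (G.meas.restrict D) := memLp_const _
  refine ⟨B.flip (hone.toLp _), fun f φ hφ => ?_⟩
  rw [ContinuousLinearMap.flip_apply, hB, wForm_congr hD ae_eq_rfl hone.coeFn_toLp, wForm,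
    G.setIntegral_mu hD (hwm.integrable_sum hD (Lp.memLp f) hone), sum_eq_single o]
  · have e : ∀ x, ∑ i', w i' (o, x) * (f x i' * 1) = A.indicator (fun x => f x i) x := by
      intro x; rw [sum_eq_single i]
      · simp only [hw, if_true, mul_one]
        by_cases hx : x ∈ A
        · rw [indicator_of_mem hx, indicator_of_mem (by exact ⟨rfl, hx⟩), one_mul]
        · rw [indicator_of_notMem hx, indicator_of_notMem (fun h => hx h.2), zero_mul]
      · intro i' _ hi'; simp only [hw, if_neg hi', zero_mul]
      · intro h; exact absurd (Finset.mem_univ i) h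
    simp only [e]; rw [setIntegral_indicator hA, inter_eq_right.2 hAD]
    refine integral_congr_ae ?_
    have h1 := (ae_restrict_iff' hD).1 hφ
    have h2 := (G.ae_meas_iff.1 h1) o
    filter_upwards [ae_restrict_of_ae h2, ae_restrict_mem hA] with x hx hxA
    exact hx (hAD hxA)
  · intro o' _ ho'
    refine integral_eq_zero_of_ae (.of_forall fun x => sum_eq_zero fun i' _ => ?_)
    by_cases h : i' = i
    · simp only [hw, if_pos h]; rw [indicator_of_notMem (fun h => ho' h.1), zero_mul]
    · simp only [hw, if_neg h, zero_mul]
  · intro h; exact absurd (Finset.mem_univ o) h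

lemma poincare_matrix {D : Set Pt} (hD : IsClosed D) (hc : Convex ℝ D) (hb : Bornology.IsBounded D) {ε : ℝ}
    (hε : 0 < ε) : ∃ (ι : Type) (_ : Fintype ι) (A : ι → Set Pt) (a : ι → ℝ), (∀ k, MeasurableSet (A k)) ∧
      (∀ k, A k ⊆ D) ∧ ∀ φ : Pt → ℝ, ContDiff ℝ ∞ φ → HasCompactSupport φ → tsupport φ ⊆ G.Ω →
        ∫ x in D, φ x ^ 2 ∂G.pieceMeas 0 ≤ ε * (∫ x in D, ‖(G.tan 0).starProjection (gradient φ x)‖ ^ 2 ∂G.pieceMeas 0) +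
          ∑ k, (a k * ∫ x in A k, φ x ∂G.pieceMeas 0) ^ 2 := by
  obtain ⟨s, P, a, h1, h2, h3⟩ := exists_poincare_partition (E := Pt)
    ((EuclideanSpace.equiv (Fin 2) ℝ) : Pt →L[ℝ] (Fin 2 → ℝ)) (Cc := 2) (fun x => by
      rw [EuclideanSpace.norm_eq, Fin.sum_univ_two]
      have e0 : ‖x 0‖ ≤ ‖(EuclideanSpace.equiv (Fin 2) ℝ) x‖ := norm_le_pi_norm (f := (EuclideanSpace.equiv (Fin 2) ℝ) x) 0
      have e1 : ‖x 1‖ ≤ ‖(EuclideanSpace.equiv (Fin 2) ℝ) x‖ := norm_le_pi_norm (f := (EuclideanSpace.equiv (Fin 2) ℝ) x) 1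
      refine Real.sqrt_le_iff.2 ⟨by positivity, ?_⟩
      change ‖x 0‖ ^ 2 + ‖x 1‖ ^ 2 ≤ (2 * ‖(EuclideanSpace.equiv (Fin 2) ℝ) x‖) ^ 2
      nlinarith [norm_nonneg (x 0), norm_nonneg (x 1)]) two_pos hD.measurableSet hc hb hε
  refine ⟨s, inferInstance, fun k => P k, fun k => a k, fun k => h1 k, fun k => h2 k, fun φ p1 p2 p3 => ?_⟩
  have hz : ∀ (A : Set Pt), MeasurableSet A → ∀ f : Pt → ℝ, (∀ x, x ∉ tsupport φ → f x = 0) →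
      ∫ x in A, f x ∂G.pieceMeas 0 = ∫ x in A, f x := by
    intro A hA f hf
    rw [FracturedDomain.pieceMeas_zero, Measure.restrict_restrict hA, ← integral_indicator hA,
      ← integral_indicator (hA.inter G.isOpen.measurableSet)]
    congr 1; funext x
    by_cases hx : x ∈ G.Ω
    · by_cases hxA : x ∈ A
      · rw [indicator_of_mem hxA, indicator_of_mem (show x ∈ A ∩ G.Ω from ⟨hxA, hx⟩)]
      · rw [indicator_of_notMem hxA, indicator_of_notMem (show x ∉ A ∩ G.Ω from fun h => hxA h.1)]
    · rw [indicator_of_notMem (show x ∉ A ∩ G.Ω from fun h => hx h.2)]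
      by_cases hxA : x ∈ A
      · rw [indicator_of_mem hxA, hf x fun h => hx (p3 h)]
      · rw [indicator_of_notMem hxA]
  have hfd : ∀ x, x ∉ tsupport φ → fderiv ℝ φ x = 0 := fun x hx =>
    image_eq_zero_of_notMem_tsupport fun h => hx (tsupport_fderiv_subset ℝ h)
  have htan : ∀ v : Pt, (G.tan 0).starProjection v = v := fun v =>
    Submodule.starProjection_eq_self_iff.2 (by change v ∈ (⊤ : Submodule ℝ Pt); trivial)
  have hgr : ∀ x, ‖gradient φ x‖ = ‖fderiv ℝ φ x‖ := fun x => by rw [gradient, LinearIsometryEquiv.norm_map]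
  rw [hz D hD.measurableSet _ fun x hx => by rw [image_eq_zero_of_notMem_tsupport hx, zero_pow two_ne_zero],
    hz D hD.measurableSet _ fun x hx => by rw [htan, hgr, hfd x hx, norm_zero, zero_pow two_ne_zero]]
  have e : ∀ k : s, ∫ x in P k, φ x ∂G.pieceMeas 0 = ∫ x in P k, φ x := fun k =>
    hz _ (h1 _) _ fun x hx => image_eq_zero_of_notMem_tsupport hx
  simp only [htan, hgr, e]
  have := h3 φ (p1.of_le (by exact_mod_cast le_top))
  rwa [← sum_coe_sort] at this

lemma poincare_seg {D : Set Pt} (hD : IsClosed D) (hc : Convex ℝ D) {ε : ℝ} (hε : 0 < ε) (l : Fin G.nf) :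
    ∃ (ι : Type) (_ : Fintype ι) (A : ι → Set Pt) (a : ι → ℝ), (∀ k, MeasurableSet (A k)) ∧
      (∀ k, A k ⊆ D) ∧ ∀ φ : Pt → ℝ, ContDiff ℝ ∞ φ → ∫ x in D, φ x ^ 2 ∂G.pieceMeas l.succ ≤
          ε * (∫ x in D, ‖(G.tan l.succ).starProjection (gradient φ x)‖ ^ 2 ∂G.pieceMeas l.succ) +
          ∑ k, (a k * ∫ x in A k, φ x ∂G.pieceMeas l.succ) ^ 2 := by
  set I := Icc 0 (G.len l) ∩ G.param l ⁻¹' D with hI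
  have hIm : MeasurableSet I := measurableSet_Icc.inter ((G.continuous_param l).measurable hD.measurableSet)
  have hconv : Convex ℝ (G.param l ⁻¹' D) := by
    intro s hs t ht α β hα hβ hαβ
    have e : G.param l (α • s + β • t) = α • G.param l s + β • G.param l t := by
      simp only [FracturedDomain.param]
      have : G.a l = (α + β) • G.a l := by rw [hαβ, one_smul]
      nth_rw 1 [this]
      simp only [smul_eq_mul]; module
    rw [mem_preimage, e]; exact hc hs ht hα hβ hαβ
  obtain ⟨s, P, a, h1, h2, h3⟩ := exists_poincare_partition (E := ℝ)
    (ContinuousLinearMap.pi fun _ : Fin 1 => ContinuousLinearMap.id ℝ ℝ) (Cc := 1) (fun x => by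
      rw [one_mul]; exact norm_le_pi_norm (f := (ContinuousLinearMap.pi fun _ : Fin 1 => ContinuousLinearMap.id ℝ ℝ) x) 0)
    one_pos hIm ((convex_Icc _ _).inter hconv) (Metric.isBounded_Icc _ _ |>.subset inter_subset_left) hε
  have hemb := (G.isometry_param l).isClosedEmbedding.measurableEmbedding
  refine ⟨s, inferInstance, fun k => G.param l '' P k, fun k => a k, fun k => hemb.measurableSet_image' (h1 k),
    fun k => ?_, fun φ p1 => ?_⟩
  · rintro _ ⟨t, ht, rfl⟩; exact (h2 k ht).2
  have hset : ∀ (A : Set Pt), MeasurableSet A → ∀ f : Pt → ℝ,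
      ∫ x in A, f x ∂G.pieceMeas l.succ = ∫ t in Icc 0 (G.len l) ∩ G.param l ⁻¹' A, f (G.param l t) := by
    intro A hA f
    rw [G.pieceMeas_succ_eq_map, hemb.setIntegral_map,
      Measure.restrict_restrict ((G.continuous_param l).measurable hA), inter_comm]
  have hsm : ContDiff ℝ ∞ fun t => φ (G.param l t) := by
    refine p1.comp ?_
    unfold FracturedDomain.param; fun_prop
  have hder : ∀ t, ‖fderiv ℝ (fun t => φ (G.param l t)) t‖ =
      ‖(G.tan l.succ).starProjection (gradient φ (G.param l t))‖ := by
    intro t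
    have h1 : HasDerivAt (fun s : ℝ => G.a l + s • G.dir l) ((1 : ℝ) • G.dir l) t :=
      ((hasDerivAt_id t).smul_const (G.dir l)).const_add (G.a l)
    have h2 := (p1.differentiable (by simp) (G.param l t)).hasFDerivAt
    have h3 : HasDerivAt (fun t => φ (G.param l t)) ⟪gradient φ (G.param l t), G.dir l⟫_ℝ t :=
      (h2.comp_hasDerivAt t h1).congr_deriv (by rw [one_smul]; simp [gradient])
    rw [← norm_deriv_eq_norm_fderiv, h3.deriv]; change _ = ‖(G.tangent l).starProjection _‖
    simp only [G.tangent_eq]; rw [norm_starProjection_span (G.norm_dir l), Real.norm_eq_abs]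
  have e : ∀ k : s, ∫ x in G.param l '' P k, φ x ∂G.pieceMeas l.succ = ∫ t in P k, φ (G.param l t) := fun k => by
    rw [hset _ (hemb.measurableSet_image' (h1 k)), preimage_image_eq _ (G.isometry_param l).injective,
      inter_eq_right.2 fun t ht => (h2 k ht).1]
  rw [hset D hD.measurableSet, hset D hD.measurableSet]; simp only [e, ← hder]
  have := h3 _ (hsm.of_le (by exact_mod_cast le_top))
  rwa [← sum_coe_sort] at this

lemma setIntegral_meas_eq {D : Set Pt} (hD : MeasurableSet D) {f : Pt → ℝ} (hf : IntegrableOn f D G.meas) :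
    ∫ x in D, f x ∂G.meas = ∑ o, G.aper o * ∫ x in D, f x ∂G.pieceMeas o := by
  have h1 : ∀ o, IntegrableOn f D (G.pieceMeas o) := fun o =>
    Integrable.of_measure_le_smul (c := ofReal (G.aper o)⁻¹) ofReal_ne_top
      (by rw [← Measure.restrict_smul]; exact Measure.restrict_mono subset_rfl (G.pieceMeas_le o)) hf
  have e : G.meas.restrict D = ∑ o, (ofReal (G.aper o) • (G.pieceMeas o).restrict D) := by
    rw [G.meas_eq, restrict_finsetSum]; exact sum_congr rfl fun o _ => Measure.restrict_smul _ _ _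
  rw [e, integral_finsetSum_measure fun o _ => (h1 o).smul_measure ofReal_ne_top]
  refine sum_congr rfl fun o _ => ?_
  rw [integral_smul_measure, toReal_ofReal (G.aper_pos o).le, smul_eq_mul]

lemma contDiff_tsupport_apply {φ : Pt → Pair} {U : Set Pt} (h2 : HasCompactSupport φ) (h3 : tsupport φ ⊆ U)
    (i : Fin 2) : HasCompactSupport (fun x => φ x i) ∧ tsupport (fun x => φ x i) ⊆ U := by
  refine ⟨h2.comp_left (g := fun U : Pair => U i) rfl, (closure_mono fun x hx => ?_).trans h3⟩
  simp only [Function.mem_support] at hx ⊢; exact fun h => hx (by rw [h]; rfl)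

/-- On a convex set, the `L²` norm of a function of `V(D)` is controlled by a small multiple of the norm of
its gradient and finitely many functionals. -/
lemma exists_compactness {D : Set Pt} (hD : IsClosed D) (hc : Convex ℝ D) (hb : Bornology.IsBounded D) {ε : ℝ}
    (hε : 0 < ε) : ∃ (ι : Type) (_ : Fintype ι) (ℓ : ι → L2 (G.meas.restrict D) →L[ℝ] ℝ),
      ∀ v ∈ G.VRestr D, ‖v.1‖ ^ 2 ≤ ε * ‖v.2‖ ^ 2 + ∑ k, (ℓ k v.1) ^ 2 := by
  have hDm := hD.measurableSet
  have hp : ∀ o, ∃ (ι : Type) (_ : Fintype ι) (A : ι → Set Pt) (a : ι → ℝ), (∀ k, MeasurableSet (A k)) ∧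
      (∀ k, A k ⊆ D) ∧ ∀ φ : Pt → ℝ, ContDiff ℝ ∞ φ → HasCompactSupport φ → tsupport φ ⊆ G.Ω →
        ∫ x in D, φ x ^ 2 ∂G.pieceMeas o ≤ ε * (∫ x in D, ‖(G.tan o).starProjection (gradient φ x)‖ ^ 2 ∂G.pieceMeas o) +
          ∑ k, (a k * ∫ x in A k, φ x ∂G.pieceMeas o) ^ 2 := by
    intro o; induction o using Fin.cases with
    | zero => exact poincare_matrix hD hc hb hε
    | succ l =>
      obtain ⟨ι, hι, A, a, h1, h2, h3⟩ := poincare_seg (G := G) hD hc hε l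
      exact ⟨ι, hι, A, a, h1, h2, fun φ p1 _ _ => h3 φ p1⟩
  choose ι hι A a h1 h2 h3 using hp
  have hfun : ∀ (q : Fin 2 × (Σ o, ι o)), ∃ ℓ : L2 (G.meas.restrict D) →L[ℝ] ℝ, ∀ f, ∀ φ : Pt → ℝ,
      (fun x => f x q.1) =ᵐ[G.meas.restrict D] φ → ℓ f = ∫ x in A q.2.1 q.2.2, φ x ∂G.pieceMeas q.2.1 :=
    fun q => exists_average_functional hDm (h1 _ _) (h2 _ _) _ _
  choose ℓ hℓ using hfun
  refine ⟨Fin 2 × (Σ o, ι o), inferInstance, fun q => (Real.sqrt (G.aper q.2.1) * a q.2.1 q.2.2) • ℓ q, fun v hv => ?_⟩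
  refine energySpace_induction (P := fun v => ‖v.1‖ ^ 2 ≤ ε * ‖v.2‖ ^ 2 +
    ∑ q : Fin 2 × (Σ o, ι o), (((Real.sqrt (G.aper q.2.1) * a q.2.1 q.2.2) • ℓ q) v.1) ^ 2)
    (isClosed_le (by fun_prop) (by fun_prop)) (fun w φ p1 p2 p3 p4 p5 => ?_) hv
  have hb := exists_smoothGrad_bound (G := G) p1 p2
  obtain ⟨B, hB0, hB⟩ := hb
  have hs : ∀ i, IntegrableOn (fun x => φ x i ^ 2) D G.meas := fun i =>
    Integrable.of_bound ((contDiff_apply p1 i).continuous.pow 2).aestronglyMeasurable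
      (C := B ^ 2) (.of_forall fun x => by
        rw [norm_pow]; exact pow_le_pow_left₀ (norm_nonneg _) ((PiLp.norm_apply_le (φ x) i).trans (hB x).1) 2)
  have hg : ∀ i, IntegrableOn (fun x => ‖G.smoothGrad φ x i‖ ^ 2) D G.meas := fun i => by
    have hm : AEStronglyMeasurable (fun x => G.smoothGrad φ x i) G.meas :=
      ((continuous_apply i).comp (PiLp.continuous_ofLp 2 _)).comp_aestronglyMeasurable
        (aestronglyMeasurable_smoothGrad (G := G) p1)
    refine Integrable.of_bound (hm.norm.pow 2).restrict (C := B ^ 2) (.of_forall fun x => ?_)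
    rw [Real.norm_eq_abs, abs_of_nonneg (sq_nonneg _)]; exact pow_le_pow_left₀ (norm_nonneg _) ((hB x).2 i) 2
  have e1 : ‖w.1‖ ^ 2 = ∑ i, ∑ o, G.aper o * ∫ x in D, φ x i ^ 2 ∂G.pieceMeas o := by
    rw [norm_sq_L2]
    calc _ = ∫ x in D, ∑ i, φ x i ^ 2 ∂G.meas := by
          refine integral_congr_ae ?_
          filter_upwards [p4] with x hx
          rw [hx, EuclideanSpace.norm_sq_eq]; simp
      _ = _ := by
          rw [integral_finsetSum _ fun i _ => hs i]
          exact sum_congr rfl fun i _ => setIntegral_meas_eq hDm (hs i)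
  have e2 : ‖w.2‖ ^ 2 = ∑ i, ∑ o, G.aper o *
      ∫ x in D, ‖(G.tan o).starProjection (gradient (fun y => φ y i) x)‖ ^ 2 ∂G.pieceMeas o := by
    rw [norm_sq_L2]
    calc _ = ∫ x in D, ∑ i, ‖G.smoothGrad φ x i‖ ^ 2 ∂G.meas := by
          refine integral_congr_ae ?_
          filter_upwards [p5] with x hx
          rw [hx, PiLp.norm_sq_eq_of_L2]
      _ = _ := by
          rw [integral_finsetSum _ fun i _ => hg i]
          refine sum_congr rfl fun i _ => ?_
          rw [setIntegral_meas_eq hDm (hg i)]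
          refine sum_congr rfl fun o _ => ?_
          congr 1
          refine integral_congr_ae ?_
          filter_upwards [ae_restrict_of_ae ((G.ae_mu_iff.1 G.tangentAt_ae) o)] with x hx
          change ‖(G.tangentAt x).starProjection (gradient (fun y => φ y i) x)‖ ^ 2 = _
          rw [hx]
  have e3 : ∑ q : Fin 2 × (Σ o, ι o), (((Real.sqrt (G.aper q.2.1) * a q.2.1 q.2.2) • ℓ q) w.1) ^ 2 =
      ∑ i, ∑ o, G.aper o * ∑ k, (a o k * ∫ x in A o k, φ x i ∂G.pieceMeas o) ^ 2 := by
    rw [Fintype.sum_prod_type]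
    refine sum_congr rfl fun i _ => ?_
    rw [Fintype.sum_sigma]
    refine sum_congr rfl fun o _ => ?_
    rw [mul_sum]
    refine sum_congr rfl fun k _ => ?_
    rw [smul_apply, hℓ (i, ⟨o, k⟩) w.1 (fun x => φ x i) (by filter_upwards [p4] with x hx; rw [hx])]
    simp only [smul_eq_mul, mul_pow, Real.sq_sqrt (G.aper_pos o).le]; ring
  rw [e1, e2, e3, mul_sum, ← sum_add_distrib]
  refine sum_le_sum fun i _ => ?_
  rw [mul_sum, ← sum_add_distrib]
  refine sum_le_sum fun o _ => ?_
  have hi := contDiff_tsupport_apply p2 p3 i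
  have := mul_le_mul_of_nonneg_left (h3 o (fun x => φ x i) (contDiff_apply p1 i) hi.1 hi.2) (G.aper_pos o).le
  linarith

section Abstract

variable {E : Type*} [NormedAddCommGroup E] [NormedSpace ℝ E]

lemma bilin_sub_self {a : E →L[ℝ] E →L[ℝ] ℝ} (hs : ∀ u v, a u v = a v u) (u v : E) :
    a (u - v) (u - v) = a u u - 2 * a u v + a v v := by
  simp only [map_sub, sub_apply, hs v u]; ring

lemma bilin_add_self {a : E →L[ℝ] E →L[ℝ] ℝ} (hs : ∀ u v, a u v = a v u) (u v : E) :
    a (u + v) (u + v) = a u u + 2 * a u v + a v v := by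
  simp only [map_add, add_apply, hs v u]; ring

lemma continuous_bilin_self (a : E →L[ℝ] E →L[ℝ] ℝ) : Continuous fun v => a v v := a.continuous.clm_apply continuous_id

/-- A quadratic function on a line that is minimal at the origin has zero derivative there. -/
lemma eq_zero_of_quadratic_nonneg {b c : ℝ} (h : ∀ t : ℝ, 0 ≤ 2 * t * b + t ^ 2 * c) : b = 0 := by
  by_contra hb
  have h1 := h (-b / (|c| + 1))
  have e : 2 * (-b / (|c| + 1)) * b + (-b / (|c| + 1)) ^ 2 * c =
      b ^ 2 / (|c| + 1) ^ 2 * (c - 2 * (|c| + 1)) := by field_simp; ring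
  rw [e] at h1
  have h2 : 0 < b ^ 2 / (|c| + 1) ^ 2 := by positivity
  have h3 : c - 2 * (|c| + 1) < 0 := by linarith [le_abs_self c, abs_nonneg c]
  nlinarith

/-- The Rayleigh quotient `a / s` attains its infimum on a closed subspace on which `s` is compact
with respect to `a`. -/
lemma exists_rayleigh_minimizer [CompleteSpace E] {a s : E →L[ℝ] E →L[ℝ] ℝ} (ha : ∀ u v, a u v = a v u)
    (hs : ∀ u v, s u v = s v u) (ha0 : ∀ u, 0 ≤ a u u) (hs0 : ∀ u, 0 ≤ s u u) {W : Submodule ℝ E}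
    (hW : IsClosed (W : Set E)) {C : ℝ} (hC0 : 0 < C) (hC : ∀ v ∈ W, ‖v‖ ^ 2 ≤ C * (a v v + s v v))
    (hcomp : ∀ ε > 0, ∃ (ι : Type) (_ : Fintype ι) (ℓ : ι → E →L[ℝ] ℝ), ∀ v ∈ W,
      s v v ≤ ε * a v v + ∑ k, (ℓ k v) ^ 2) {v₀ : E} (hv₀ : v₀ ∈ W) (hv₀s : 0 < s v₀ v₀) :
    ∃ m : ℝ, ∃ v ∈ W, s v v = 1 ∧ (∀ w ∈ W, a v w = m * s v w) ∧ ∀ w ∈ W, m * s w w ≤ a w w := by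
  set S : Set ℝ := {x | ∃ v ∈ W, s v v = 1 ∧ a v v = x} with hS
  have hSne : S.Nonempty := by
    refine ⟨_, (Real.sqrt (s v₀ v₀))⁻¹ • v₀, W.smul_mem _ hv₀, ?_, rfl⟩
    simp only [map_smul, smul_apply, smul_eq_mul]
    rw [← mul_assoc, ← mul_inv, Real.mul_self_sqrt hv₀s.le, inv_mul_cancel₀ hv₀s.ne']
  have hSb : BddBelow S := ⟨0, by rintro x ⟨v, -, -, rfl⟩; exact ha0 v⟩
  set m := sInf S with hm
  have hm0 : 0 ≤ m := le_csInf hSne (by rintro x ⟨v, -, -, rfl⟩; exact ha0 v)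
  have hmle : ∀ w ∈ W, m * s w w ≤ a w w := by
    intro w hw
    rcases (hs0 w).eq_or_lt with h | h
    · rw [← h, mul_zero]; exact ha0 w
    · have h1 : a w w / s w w ∈ S := by
        refine ⟨(Real.sqrt (s w w))⁻¹ • w, W.smul_mem _ hw, ?_, ?_⟩ <;>
        simp only [map_smul, smul_apply, smul_eq_mul] <;>
        rw [← mul_assoc, ← mul_inv, Real.mul_self_sqrt h.le]
        · rw [inv_mul_cancel₀ h.ne']
        · rw [div_eq_inv_mul]
      exact (le_div_iff₀ h).1 (csInf_le hSb h1)
  obtain ⟨x, -, hxt, hxS⟩ := exists_seq_tendsto_sInf hSne hSb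
  choose v hvW hvs hva using hxS
  have hat : Tendsto (fun n => a (v n) (v n)) atTop (𝓝 m) := by simpa only [hva] using hxt
  set F : Ultrafilter ℕ := Filter.hyperfilter ℕ with hF
  have hFle : (F : Filter ℕ) ≤ atTop := by rw [← Nat.cofinite_eq_atTop]; exact Filter.hyperfilter_le_cofinite
  have haF : Tendsto (fun n => a (v n) (v n)) F (𝓝 m) := hat.mono_left hFle
  have hpar : ∀ n k, a (v n - v k) (v n - v k) ≤
      2 * (a (v n) (v n) - m) + 2 * (a (v k) (v k) - m) + m * s (v n - v k) (v n - v k) := by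
    intro n k
    have h1 := hmle _ (W.add_mem (hvW n) (hvW k))
    rw [bilin_add_self ha, bilin_add_self hs, hvs, hvs] at h1; rw [bilin_sub_self ha, bilin_sub_self hs, hvs, hvs]
    linarith
  have hbd : ∀ n, a (v n) (v n) ≤ m + 1 → ‖v n‖ ^ 2 ≤ C * (m + 2) := fun n hn =>
    (hC _ (hvW n)).trans (mul_le_mul_of_nonneg_left (by rw [hvs]; linarith) hC0.le)
  have hev1 : ∀ᶠ n in (F : Filter ℕ), a (v n) (v n) ≤ m + 1 :=
    (haF.eventually_lt_const (by linarith : m < m + 1)).mono fun n hn => hn.le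
  have hℓ : ∀ ℓ : E →L[ℝ] ℝ, ∃ y, Tendsto (fun n => ℓ (v n)) F (𝓝 y) := by
    intro ℓ
    set R := ‖ℓ‖ * Real.sqrt (C * (m + 2)) with hR
    have hmem : Icc (-R) R ∈ F.map fun n => ℓ (v n) := by
      rw [Ultrafilter.mem_map]
      filter_upwards [hev1] with n hn
      have h1 : ‖v n‖ ≤ Real.sqrt (C * (m + 2)) := Real.le_sqrt_of_sq_le (hbd n hn)
      have h2 : |ℓ (v n)| ≤ R := (ℓ.le_opNorm _).trans (by rw [hR]; gcongr)
      exact abs_le.1 h2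
    obtain ⟨y, -, hy⟩ := isCompact_Icc.ultrafilter_le_nhds' _ hmem
    exact ⟨y, hy⟩
  have hcau : Cauchy (Filter.map v F) := by
    rw [Metric.cauchy_iff]
    refine ⟨inferInstance, fun η hη => ?_⟩
    set ε := η ^ 2 / (8 * C * (m + 1) * (4 * m + 4)) with hε
    have hε0 : 0 < ε := by positivity
    obtain ⟨ι, hι, ℓ, hℓs⟩ := hcomp ε hε0
    choose y hy using fun k => hℓ (ℓ k)
    set τ := η ^ 2 / (16 * C * (m + 1) * (Fintype.card ι + 1)) with hτ
    have hτ0 : 0 < τ := by positivity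
    have h1 : ∀ᶠ n in (F : Filter ℕ), ∀ k, |ℓ k (v n) - y k| < Real.sqrt τ / 2 :=
      Filter.eventually_all.2 fun k => Metric.tendsto_nhds.1 (hy k) _ (by positivity)
    have h2 : ∀ᶠ n in (F : Filter ℕ), a (v n) (v n) < m + η ^ 2 / (16 * C) :=
      haF.eventually_lt_const (by have : 0 < η ^ 2 / (16 * C) := by positivity
                                  linarith)
    refine ⟨v '' {n | (∀ k, |ℓ k (v n) - y k| < Real.sqrt τ / 2) ∧ a (v n) (v n) < m + η ^ 2 / (16 * C) ∧
      a (v n) (v n) ≤ m + 1}, ?_, ?_⟩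
    · exact Filter.image_mem_map ((h1.and (h2.and hev1)))
    · rintro _ ⟨n, ⟨p1, p2, p3⟩, rfl⟩ _ ⟨k, ⟨q1, q2, q3⟩, rfl⟩; rw [dist_eq_norm]
      set d := v n - v k with hd
      have hdW : d ∈ W := W.sub_mem (hvW n) (hvW k)
      have had : a d d ≤ 4 * m + 4 := by
        have := ha0 (v n + v k)
        rw [bilin_add_self ha] at this; rw [hd, bilin_sub_self ha]; linarith
      have hsum : ∑ i, (ℓ i d) ^ 2 ≤ Fintype.card ι * τ := by
        calc ∑ i, (ℓ i d) ^ 2 ≤ ∑ _i : ι, τ := by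
              refine sum_le_sum fun i _ => ?_
              have e : |ℓ i d| ≤ Real.sqrt τ := by
                rw [hd, map_sub]
                have := abs_sub_le (ℓ i (v n)) (y i) (ℓ i (v k))
                have h4 := q1 i
                rw [abs_sub_comm] at h4; linarith [p1 i]
              rw [← sq_abs, ← Real.sq_sqrt hτ0.le]; exact pow_le_pow_left₀ (abs_nonneg _) e 2
          _ = _ := by simp
      have hsd := hℓs d hdW
      have hsd2 : s d d ≤ ε * (4 * m + 4) + Fintype.card ι * τ :=
        hsd.trans (add_le_add (mul_le_mul_of_nonneg_left had hε0.le) hsum)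
      have hN := hC d hdW
      have hp := hpar n k
      rw [← hd] at hp
      have e1 : ε * (4 * m + 4) = η ^ 2 / (8 * C * (m + 1)) := by rw [hε]; field_simp
      have e2 : Fintype.card ι * τ ≤ η ^ 2 / (16 * C * (m + 1)) := by
        rw [hτ]
        have : (Fintype.card ι : ℝ) * (η ^ 2 / (16 * C * (m + 1) * (Fintype.card ι + 1))) =
          η ^ 2 / (16 * C * (m + 1)) * (Fintype.card ι / (Fintype.card ι + 1)) := by field_simp
        rw [this]
        refine mul_le_of_le_one_right (by positivity) ?_
        rw [div_le_one (by positivity)]; linarith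
      have e3 : (m + 1) * s d d ≤ 3 * η ^ 2 / (16 * C) := by
        have h3 : (m + 1) * s d d ≤ (m + 1) * (η ^ 2 / (8 * C * (m + 1)) + η ^ 2 / (16 * C * (m + 1))) := by
          refine mul_le_mul_of_nonneg_left ?_ (by linarith)
          linarith
        refine h3.trans (le_of_eq ?_)
        field_simp; ring
      have e4 : a d d + s d d < η ^ 2 / C := by
        have : η ^ 2 / C = 16 * (η ^ 2 / (16 * C)) := by field_simp
        have h5 : 3 * η ^ 2 / (16 * C) = 3 * (η ^ 2 / (16 * C)) := by ring
        have h6 : 0 < η ^ 2 / (16 * C) := by positivity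
        linarith
      have e5 : ‖d‖ ^ 2 < η ^ 2 := by
        calc ‖d‖ ^ 2 ≤ C * (a d d + s d d) := hN
          _ < C * (η ^ 2 / C) := by gcongr
          _ = η ^ 2 := by field_simp
      exact lt_of_pow_lt_pow_left₀ 2 hη.le e5
  obtain ⟨z, hz⟩ := CompleteSpace.complete hcau
  have hz' : Tendsto v F (𝓝 z) := hz
  have hzW : z ∈ W := hW.mem_of_tendsto hz' (.of_forall hvW)
  have hzs : s z z = 1 := by
    refine tendsto_nhds_unique (((continuous_bilin_self s).tendsto z).comp hz') ?_
    simp only [Function.comp_def, hvs]; exact tendsto_const_nhds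
  have hza : a z z = m := tendsto_nhds_unique (((continuous_bilin_self a).tendsto z).comp hz') haF
  refine ⟨m, z, hzW, hzs, fun w hw => ?_, hmle⟩
  have key : a z w - m * s z w = 0 := eq_zero_of_quadratic_nonneg (c := a w w - m * s w w) fun t => by
    have h1 := hmle _ (W.add_mem hzW (W.smul_mem t hw))
    rw [bilin_add_self ha, bilin_add_self hs, hzs, hza] at h1; simp only [map_smul, smul_apply, smul_eq_mul] at h1
    nlinarith
  linarith

/-- An orthogonality relation to the first eigenvectors of `a = lam s` gives a Poincaré
inequality. -/
lemma spectral_gap [CompleteSpace E] {a s : E →L[ℝ] E →L[ℝ] ℝ} (ha : ∀ u v, a u v = a v u)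
    (hs : ∀ u v, s u v = s v u) (ha0 : ∀ u, 0 ≤ a u u) (hs0 : ∀ u, 0 ≤ s u u) {V : Submodule ℝ E}
    (hV : IsClosed (V : Set E)) {C : ℝ} (hC0 : 0 < C) (hC : ∀ v ∈ V, ‖v‖ ^ 2 ≤ C * (a v v + s v v))
    (hcomp : ∀ ε > 0, ∃ (ι : Type) (_ : Fintype ι) (ℓ : ι → E →L[ℝ] ℝ), ∀ v ∈ V,
      s v v ≤ ε * a v v + ∑ k, (ℓ k v) ^ 2) {lam : ℕ → ℝ} (hmono : Monotone lam) {φ : ℕ → E}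
    (hφV : ∀ k, φ k ∈ V) (hφE : ∀ k, ∀ v ∈ V, a (φ k) v = lam k * s (φ k) v) (hφ0 : ∀ k, φ k ≠ 0)
    (hφo : ∀ k k', k ≠ k' → s (φ k) (φ k') = 0)
    (hφc : ∀ (μ : ℝ), ∀ w ∈ V, (∀ v ∈ V, a w v = μ * s w v) →
      w ∈ Submodule.span ℝ (φ '' {k | lam k = μ})) (L : ℕ) {v : E} (hv : v ∈ V)
    (hvφ : ∀ k < L, s v (φ k) = 0) : lam L * s v v ≤ a v v := by
  have hφs : ∀ k, 0 < s (φ k) (φ k) := by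
    intro k
    refine lt_of_le_of_ne (hs0 _) fun h0 => hφ0 k ?_
    have h1 := hC _ (hφV k)
    rw [hφE k _ (hφV k), ← h0, mul_zero, add_zero, mul_zero] at h1
    exact norm_eq_zero.1 (pow_eq_zero_iff two_ne_zero |>.1 (le_antisymm h1 (sq_nonneg _)))
  obtain ⟨W, hWmem⟩ : ∃ W : Submodule ℝ E, ∀ w, w ∈ W ↔ w ∈ V ∧ ∀ k < L, s (φ k) w = 0 :=
    ⟨{ carrier := {w | w ∈ V ∧ ∀ k < L, s (φ k) w = 0}
       add_mem' := fun {x y} hx hy => ⟨V.add_mem hx.1 hy.1, fun k hk => by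
        rw [map_add, hx.2 k hk, hy.2 k hk, add_zero]⟩
       zero_mem' := ⟨V.zero_mem, fun k _ => map_zero _⟩
       smul_mem' := fun c x hx => ⟨V.smul_mem c hx.1, fun k hk => by
        rw [map_smul, hx.2 k hk, smul_zero]⟩ }, fun w => Iff.rfl⟩
  have hWcl : IsClosed (W : Set E) := by
    have e : (W : Set E) = (V : Set E) ∩ ⋂ k : Fin L, {w | s (φ k) w = 0} := by
      ext w; simp only [SetLike.mem_coe, hWmem, mem_inter_iff, mem_iInter, mem_setOf_eq]
      exact and_congr_right fun _ => ⟨fun h k => h k k.2, fun h k hk => h ⟨k, hk⟩⟩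
    rw [e]; exact hV.inter (isClosed_iInter fun k => isClosed_eq (s (φ k)).continuous continuous_const)
  have hvW : v ∈ W := (hWmem v).2 ⟨hv, fun k hk => by rw [hs]; exact hvφ k hk⟩
  rcases (hs0 v).eq_or_lt with h0 | h0
  · rw [← h0, mul_zero]; exact ha0 v
  obtain ⟨m, z, hzW, hzs, hzE, hmle⟩ := exists_rayleigh_minimizer ha hs ha0 hs0 hWcl hC0
    (fun u hu => hC u ((hWmem u).1 hu).1)
    (fun ε hε => by
      obtain ⟨ι, hι, ℓ, hℓ⟩ := hcomp ε hε
      exact ⟨ι, hι, ℓ, fun u hu => hℓ u ((hWmem u).1 hu).1⟩) hvW h0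
  have hzV := ((hWmem z).1 hzW).1
  have hzφ := ((hWmem z).1 hzW).2
  have heig : ∀ w ∈ V, a z w = m * s z w := by
    intro w hw'
    set c : ℕ → ℝ := fun k => s (φ k) w / s (φ k) (φ k) with hc
    set w' := w - ∑ k ∈ Finset.range L, c k • φ k with hw'def
    have hw'W : w' ∈ W := by
      refine (hWmem _).2 ⟨Submodule.sub_mem _ hw' (Submodule.sum_mem _ fun k _ =>
        Submodule.smul_mem _ _ (hφV k)), fun k hk => ?_⟩
      rw [hw'def, map_sub, map_sum, sum_eq_single k]
      · rw [map_smul, smul_eq_mul, hc, div_mul_cancel₀ _ (hφs k).ne', sub_self]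
      · intro k' _ hk'; rw [map_smul, hφo k k' hk'.symm, smul_zero]
      · intro hk'; exact absurd (Finset.mem_range.2 hk) hk'
    have h1 := hzE w' hw'W
    have h2 : ∀ k < L, s z (φ k) = 0 := fun k hk => by rw [hs]; exact hzφ k hk
    have h3 : ∀ k < L, a z (φ k) = 0 := fun k hk => by rw [ha, hφE k z hzV, hzφ k hk, mul_zero]
    rw [hw'def, map_sub, map_sub, map_sum, map_sum, sum_eq_zero, sum_eq_zero, sub_zero, sub_zero] at h1
    · exact h1
    · intro k hk; rw [map_smul, h2 k (Finset.mem_range.1 hk), smul_zero]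
    · intro k hk; rw [map_smul, h3 k (Finset.mem_range.1 hk), smul_zero]
  have hmL : lam L ≤ m := by
    by_contra hcon
    push Not at hcon
    have h1 := hφc m z hzV heig
    have h2 : ∀ w ∈ Submodule.span ℝ (φ '' {k | lam k = m}), s z w = 0 := by
      intro w hw'; induction hw' using Submodule.span_induction with
      | mem w hw' =>
        obtain ⟨k, hk, rfl⟩ := hw'
        rw [hs]
        refine hzφ k ?_
        by_contra hkL
        push Not at hkL
        have := hmono hkL
        have hk' : lam k = m := hk
        linarith
      | zero => rw [map_zero]
      | add x y _ _ hx hy => rw [map_add, hx, hy, add_zero]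
      | smul r x _ hx => rw [map_smul, hx, smul_zero]
    have := h2 z h1
    rw [hzs] at this; exact one_ne_zero this
  exact (mul_le_mul_of_nonneg_right hmL (hs0 v)).trans (hmle v hvW)

end Abstract

variable {co : Coefficients G} {ρ σ : ℝ} {lo hi γ : ℝ} (hlo : 0 < lo) (h : co.KappaBetween lo hi)
  (hM : M.IsCoarseGrid G) (hγ : M.ShapeRegular γ)

lemma norm_sq_le_add (ν : Measure Pt) (v : EField ν) : ‖v‖ ^ 2 ≤ ‖v.1‖ ^ 2 + ‖v.2‖ ^ 2 := by
  rw [Prod.norm_def]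
  rcases max_cases ‖v.1‖ ‖v.2‖ with ⟨h, -⟩ | ⟨h, -⟩ <;> rw [h] <;> nlinarith [norm_nonneg v.1, norm_nonneg v.2]

include hlo h hM hγ in
lemma exists_sForm_bilin (hhi : 0 ≤ hi)  (j : Fin M.N) {ν : Measure Pt} (hν : G.meas.restrict (M.elem j) ≤ ν) :
    ∃ B : EField ν →L[ℝ] EField ν →L[ℝ] ℝ, ∀ u v, B u v = sForm co M j u.1 v.1 := by
  have hw := isWeight_sWeight hlo h hM hγ j
  obtain ⟨B, hB⟩ := exists_wForm_bilin (measurableSet_elem j) hw (by positivity) hν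
  refine ⟨B.bilinearComp (ContinuousLinearMap.fst ℝ _ _) (ContinuousLinearMap.fst ℝ _ _), fun u v => ?_⟩
  rw [ContinuousLinearMap.bilinearComp_apply]
  exact (hB _ _).trans (sForm_eq hw ((Lp.memLp u.1).mono_measure hν) ((Lp.memLp v.1).mono_measure hν)).symm

include hlo h hM hγ in
/-- The weight of `s` is bounded from below by `κ / (4 H²)`. -/
lemma norm_sq_le_sForm (j : Fin M.N) (u : L2 (G.meas.restrict (M.elem j))) :
    lo * ‖u‖ ^ 2 ≤ 4 * M.meshSize ^ 2 * G.aperSup * sForm co M j u u := by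
  have hw := isWeight_sWeight hlo h hM hγ j
  have hH := hM.meshSize_pos
  rw [sForm_eq hw (Lp.memLp u) (Lp.memLp u)]
  have := le_wForm (measurableSet_elem j) hw (c := lo * (1 / (4 * M.meshSize ^ 2))) (by positivity) (by
    filter_upwards [ae_restrict_of_ae h.ae, ae_restrict_mem (measurable_snd (measurableSet_elem j))] with z hz hm i
    exact mul_le_mul (hz i).1 (le_chiWeight hM j hm) (by positivity) (hlo.le.trans (hz i).1)) rfl u
  have e : lo * ‖u‖ ^ 2 = 4 * M.meshSize ^ 2 * (lo * (1 / (4 * M.meshSize ^ 2)) * ‖u‖ ^ 2) := by field_simp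
  rw [e, mul_assoc (4 * M.meshSize ^ 2) G.aperSup]; exact mul_le_mul_of_nonneg_left this (by positivity)

lemma sForm_comm (j : Fin M.N) (u v : Pt → Pair) : sForm co M j u v = sForm co M j v u := by
  unfold sForm; simp only [mul_right_comm]

include hlo h in
lemma aQ_symm {D : Set Pt} (hD : MeasurableSet D) {ν : Measure Pt} (hν : G.meas.restrict D ≤ ν) (u v : EField ν) :
    aQ co ρ σ D u v = aQ co ρ σ D v u := by
  rw [aQ_eq (h.isWeight hlo _) hD hν, aQ_eq (h.isWeight hlo _) hD hν]
  exact integral_congr_ae (.of_forall fun z => aDen_symm _ _ _ _ _ _)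

include hlo h hM hγ in
lemma sForm_self_nonneg (j : Fin M.N) {ν : Measure Pt}
    (hν : G.meas.restrict (M.elem j) ≤ ν) (u : L2 ν) : 0 ≤ sForm co M j u u := by
  have hw := isWeight_sWeight hlo h hM hγ j
  rw [sForm_eq hw ((Lp.memLp u).mono_measure hν) ((Lp.memLp u).mono_measure hν)]; exact wForm_self_nonneg hw _

include hlo h in
lemma aQ_self_nonneg (hρσ : 0 ≤ ρ * σ) {D : Set Pt}
    (hD : MeasurableSet D) {ν : Measure Pt} (hν : G.meas.restrict D ≤ ν) (u : EField ν) :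
    0 ≤ aQ co ρ σ D u u := by
  rw [aQ_eq (h.isWeight hlo _) hD hν]
  refine integral_nonneg_of_ae ?_
  filter_upwards [ae_restrict_kap_nonneg hlo h _] with z hz
  exact aDen_self_nonneg hz hρσ _

include hlo h hM hγ in
lemma sForm_self_le (hhi : 0 ≤ hi)  (j : Fin M.N) {ν : Measure Pt} (hν : G.meas.restrict (M.elem j) ≤ ν) (u : L2 ν) :
    sForm co M j u u ≤ hi * (4 * (γ / M.meshSize) ^ 2) * G.aperInv * ‖u‖ ^ 2 := by
  have hw := isWeight_sWeight hlo h hM hγ j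
  rw [sForm_eq hw ((Lp.memLp u).mono_measure hν) ((Lp.memLp u).mono_measure hν)]
  exact wForm_le (measurableSet_elem j) hw (by positivity) hν u

include hlo h hM hγ in
lemma exists_compactness_sForm (hhi : 0 ≤ hi) (hρσ : 0 ≤ ρ * σ)  (j : Fin M.N)
    {ε : ℝ} (hε : 0 < ε) : ∃ (ι : Type) (_ : Fintype ι) (ℓ : ι → LocalField G M j →L[ℝ] ℝ),
      ∀ v ∈ G.VRestr (M.elem j), sForm co M j v.1 v.1 ≤ ε * aQ co ρ σ (M.elem j) v v + ∑ k, (ℓ k v) ^ 2 := by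
  have hsup := G.one_le_aperSup
  obtain ⟨A, hA, hAs⟩ : ∃ A > 0, ∀ u : LocalField G M j, sForm co M j u.1 u.1 ≤ A * ‖u.1‖ ^ 2 :=
    ⟨hi * (4 * (γ / M.meshSize) ^ 2) * G.aperInv + 1, by have := G.aperInv_nonneg; positivity, fun u => by
      have := sForm_self_le hlo h hM hγ hhi j le_rfl u.1
      linarith [sq_nonneg ‖u.1‖]⟩
  obtain ⟨ι, hι, ℓ, hℓ⟩ := exists_compactness (G := G) (QuadMesh.isClosed_elem (M := M) j) (QuadMesh.elem_convex j)
    (QuadMesh.isCompact_elem j).isBounded (ε := ε * lo / (A * G.aperSup)) (by positivity)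
  have hex : ∀ k, ∃ f : LocalField G M j →L[ℝ] ℝ, ∀ u, f u = Real.sqrt A * ℓ k u.1 := fun k =>
    ⟨Real.sqrt A • ((ℓ k).comp (ContinuousLinearMap.fst ℝ _ _)), fun u => rfl⟩
  choose f hf using hex
  refine ⟨ι, hι, f, fun u hu => ?_⟩
  have h1 := hℓ u hu
  have h2 := hAs u
  have h3 := norm_grad_sq_le hlo h hρσ (measurableSet_elem j) (ν := G.meas.restrict (M.elem j)) rfl u
  have e : ∑ k, (f k u) ^ 2 = A * ∑ k, (ℓ k u.1) ^ 2 := by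
    rw [mul_sum]
    refine sum_congr rfl fun k _ => ?_
    rw [hf, mul_pow, Real.sq_sqrt hA.le]
  rw [e]
  have h4 := mul_le_mul_of_nonneg_left h1 hA.le
  rw [mul_add] at h4
  have h5 : A * (ε * lo / (A * G.aperSup) * ‖u.2‖ ^ 2) ≤ ε * aQ co ρ σ (M.elem j) u u := by
    have : A * (ε * lo / (A * G.aperSup) * ‖u.2‖ ^ 2) = ε / G.aperSup * (lo * ‖u.2‖ ^ 2) := by field_simp
    rw [this]
    refine (mul_le_mul_of_nonneg_left h3 (by positivity)).trans (le_of_eq ?_)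
    field_simp
  linarith

include hlo h hM hγ in
lemma exists_norm_sq_le_local (hρσ : 0 ≤ ρ * σ)  (j : Fin M.N) :
    ∃ C > 0, ∀ u : LocalField G M j, ‖u‖ ^ 2 ≤ C * (aQ co ρ σ (M.elem j) u u + sForm co M j u.1 u.1) := by
  have hsup := G.one_le_aperSup
  refine ⟨(4 * M.meshSize ^ 2 * G.aperSup + G.aperSup) / lo, by positivity, fun u => ?_⟩
  rw [div_mul_eq_mul_div, le_div_iff₀ hlo]
  have h1 := norm_sq_le_sForm hlo h hM hγ j u.1
  have h2 := norm_grad_sq_le hlo h hρσ (measurableSet_elem j) (ν := G.meas.restrict (M.elem j)) rfl u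
  have h3 := mul_le_mul_of_nonneg_left (norm_sq_le_add _ u) hlo.le
  have h4 := mul_nonneg (show 0 ≤ G.aperSup by linarith) (sForm_self_nonneg hlo h hM hγ j le_rfl u.1)
  have h5 := mul_nonneg (show 0 ≤ 4 * M.meshSize ^ 2 * G.aperSup by positivity)
    (aQ_self_nonneg hlo h hρσ (measurableSet_elem j) le_rfl u)
  linarith

include hlo h hM hγ in
/-- The spectral gap: functions that are orthogonal to the first `L` eigenfunctions satisfy a
Poincaré inequality with the constant `1 / lam L`. -/
lemma IsSpectralSequence.gap (hhi : 0 ≤ hi) (hρσ : 0 ≤ ρ * σ) {j : Fin M.N} {lam : ℕ → ℝ}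
    {φ : ℕ → LocalField G M j} (hφ : IsSpectralSequence co ρ σ M j lam φ) (L : ℕ)
    {v : LocalField G M j} (hv : v ∈ G.VRestr (M.elem j))
    (hvφ : ∀ k < L, sForm co M j v.1 (φ k).1 = 0) :
    lam L * sForm co M j v.1 v.1 ≤ aQ co ρ σ (M.elem j) v v := by
  obtain ⟨a, ha⟩ := exists_aQ_bilin (co := co) hlo h hρσ (measurableSet_elem j) (ν := G.meas.restrict (M.elem j)) le_rfl
  obtain ⟨s, hs⟩ := exists_sForm_bilin (co := co) hlo h hM hγ hhi j (ν := G.meas.restrict (M.elem j)) le_rfl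
  obtain ⟨C, hC0, hC⟩ := exists_norm_sq_le_local (co := co) hlo h hM hγ hρσ j
  rw [← ha, ← hs]
  refine spectral_gap (a := a) (s := s) (V := G.VRestr (M.elem j)) (fun u v => ?_) (fun u v => ?_) (fun u => ?_) (fun u => ?_)
    (Submodule.isClosed_topologicalClosure _) hC0 (fun u _ => ?_) (fun ε hε => ?_) hφ.monotone
    (fun k => (hφ.eigen k).1) (fun k v hv => ?_) hφ.ne_zero (fun k k' hk => ?_) (fun μ w hw hE => ?_) L hv
    (fun k hk => ?_)
  · rw [ha, ha]; exact aQ_symm hlo h (measurableSet_elem j) le_rfl u v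
  · rw [hs, hs]; exact sForm_comm j _ _
  · rw [ha]; exact aQ_self_nonneg hlo h hρσ (measurableSet_elem j) le_rfl u
  · rw [hs]; exact sForm_self_nonneg hlo h hM hγ j le_rfl u.1
  · rw [ha, hs]; exact hC u
  · obtain ⟨ι, hι, ℓ, hℓ⟩ := exists_compactness_sForm (ρ := ρ) (σ := σ) hlo h hM hγ hhi hρσ j hε
    exact ⟨ι, hι, ℓ, fun u hu => by rw [ha, hs]; exact hℓ u hu⟩
  · rw [ha, hs]; exact (hφ.eigen k).2 v hv
  · rw [hs]; exact hφ.orthogonal k k' hk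
  · exact hφ.complete μ w ⟨hw, fun v hv => by rw [← ha, ← hs]; exact hE v hv⟩
  · rw [hs]; exact hvφ k hk

section Abstract

variable {E : Type*} [NormedAddCommGroup E] [NormedSpace ℝ E]

/-- A bilinear form that is definite on a finite-dimensional subspace represents every functional
on it. -/
lemma exists_represent_finite {a : E →L[ℝ] E →L[ℝ] ℝ} (W : Submodule ℝ E) [FiniteDimensional ℝ W]
    (ha : ∀ w ∈ W, a w w ≤ 0 → w = 0) (ℓ : E →L[ℝ] ℝ) : ∃ z ∈ W, ∀ w ∈ W, a z w = ℓ w := by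
  let Φ : W →ₗ[ℝ] Module.Dual ℝ W :=
    { toFun := fun z => (a (z : E)).toLinearMap.comp W.subtype
      map_add' := fun x y => by ext w; simp
      map_smul' := fun c x => by ext w; simp }
  have hinj : Function.Injective Φ := by
    rw [← LinearMap.ker_eq_bot, LinearMap.ker_eq_bot']; intro z hz
    have h1 : a (z : E) z = 0 := LinearMap.congr_fun hz z
    exact Subtype.ext (ha z z.2 h1.le)
  have hsurj : Function.Surjective Φ := (LinearMap.injective_iff_surjective_of_finrank_eq_finrank
      (Subspace.dual_finrank_eq (K := ℝ) (V := W)).symm).1 hinj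
  obtain ⟨z, hz⟩ := hsurj (ℓ.toLinearMap.comp W.subtype)
  exact ⟨z, z.2, fun w hw => LinearMap.congr_fun hz ⟨w, hw⟩⟩

/-- The Lax-Milgram theorem for symmetric forms on a closed subspace. -/
lemma exists_represent [CompleteSpace E] {a : E →L[ℝ] E →L[ℝ] ℝ} (ha : ∀ u v, a u v = a v u)
    {W : Submodule ℝ E} (hW : IsClosed (W : Set E)) {C : ℝ} (hC0 : 0 < C)
    (hC : ∀ v ∈ W, ‖v‖ ^ 2 ≤ C * a v v) (ℓ : E →L[ℝ] ℝ) : ∃ z ∈ W, ∀ w ∈ W, a z w = ℓ w := by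
  set J : E → ℝ := fun v => a v v - 2 * ℓ v with hJ
  have hJc : Continuous J := (continuous_bilin_self a).sub (continuous_const.mul ℓ.continuous)
  have hlow : ∀ v ∈ W, -(C * ‖ℓ‖ ^ 2) ≤ J v := by
    intro v hv
    have h1 := hC v hv
    have h2 : ℓ v ≤ ‖ℓ‖ * ‖v‖ := (le_abs_self _).trans (ℓ.le_opNorm v)
    have h3 : 0 ≤ (‖v‖ - C * ‖ℓ‖) ^ 2 := sq_nonneg _
    have h4 : 0 ≤ C * (J v + C * ‖ℓ‖ ^ 2) := by
      have : C * (J v + C * ‖ℓ‖ ^ 2) = C * a v v - 2 * C * ℓ v + C ^ 2 * ‖ℓ‖ ^ 2 := by rw [hJ]; ring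
      rw [this]; nlinarith [mul_le_mul_of_nonneg_left h2 hC0.le]
    linarith [nonneg_of_mul_nonneg_right h4 hC0]
  set S := J '' W with hS
  have hSne : S.Nonempty := ⟨_, mem_image_of_mem J W.zero_mem⟩
  have hSb : BddBelow S := ⟨_, by rintro _ ⟨v, hv, rfl⟩; exact hlow v hv⟩
  set m := sInf S with hm
  have hmle : ∀ w ∈ W, m ≤ J w := fun w hw => csInf_le hSb ⟨w, hw, rfl⟩
  obtain ⟨x, -, hxt, hxS⟩ := exists_seq_tendsto_sInf hSne hSb
  choose v hvW hvx using hxS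
  have hpar : ∀ n k, a (v n - v k) (v n - v k) ≤ 2 * (J (v n) - m) + 2 * (J (v k) - m) := by
    intro n k
    have h1 := hmle _ (W.smul_mem (1 / 2 : ℝ) (W.add_mem (hvW n) (hvW k)))
    rw [hJ] at h1 ⊢; simp only [map_smul, smul_apply, smul_eq_mul] at h1
    rw [bilin_add_self ha, map_add] at h1; rw [bilin_sub_self ha]
    linarith
  have hcau : CauchySeq v := by
    rw [Metric.cauchySeq_iff]; intro ε hε
    have h1 : ∀ᶠ n in atTop, x n < m + ε ^ 2 / (4 * C) :=
      hxt.eventually_lt_const (by have : 0 < ε ^ 2 / (4 * C) := by positivity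
                                  linarith)
    obtain ⟨N, hN⟩ := Filter.eventually_atTop.1 h1
    refine ⟨N, fun n hn k hk => ?_⟩
    rw [dist_eq_norm]
    have h2 := hC _ (W.sub_mem (hvW n) (hvW k))
    have h3 := hpar n k
    rw [hvx, hvx] at h3
    have h4 := hN n hn
    have h5 := hN k hk
    have h6 : a (v n - v k) (v n - v k) < ε ^ 2 / C := by
      have : ε ^ 2 / C = 4 * (ε ^ 2 / (4 * C)) := by field_simp
      linarith
    have h7 : ‖v n - v k‖ ^ 2 < ε ^ 2 := by
      calc _ ≤ _ := h2
        _ < C * (ε ^ 2 / C) := by gcongr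
        _ = _ := by field_simp
    exact lt_of_pow_lt_pow_left₀ 2 hε.le h7
  obtain ⟨z, hz⟩ := cauchySeq_tendsto_of_complete hcau
  have hzW : z ∈ W := hW.mem_of_tendsto hz (.of_forall hvW)
  have hJz : J z = m := by
    refine tendsto_nhds_unique ((hJc.tendsto z).comp hz) ?_
    simpa only [Function.comp_def, hvx] using hxt
  refine ⟨z, hzW, fun w hw => ?_⟩
  have key : a z w - ℓ w = 0 := eq_zero_of_quadratic_nonneg (c := a w w) fun t => by
    have h1 := hmle _ (W.add_mem hzW (W.smul_mem t hw))
    rw [← hJz, hJ] at h1; simp only at h1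
    rw [bilin_add_self ha] at h1; simp only [map_smul, map_add, smul_apply, smul_eq_mul] at h1
    nlinarith
  linarith

lemma sq_bilin_le {a : E →L[ℝ] E →L[ℝ] ℝ} (ha : ∀ u v, a u v = a v u) (ha0 : ∀ u, 0 ≤ a u u) (u v : E) :
    (a u v) ^ 2 ≤ a u u * a v v := by
  have h : ∀ t : ℝ, 0 ≤ a v v * (t * t) + 2 * a u v * t + a u u := fun t => by
    have := ha0 (u + t • v)
    rw [bilin_add_self ha] at this; simp only [map_smul, smul_apply, smul_eq_mul] at this
    linarith
  have := discrim_le_zero h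
  rw [discrim] at this; nlinarith

lemma bilin_add_self_le {a : E →L[ℝ] E →L[ℝ] ℝ} (ha : ∀ u v, a u v = a v u) (ha0 : ∀ u, 0 ≤ a u u) (u v : E) :
    a (u + v) (u + v) ≤ 2 * a u u + 2 * a v v := by
  have := ha0 (u - v)
  rw [bilin_sub_self ha] at this; rw [bilin_add_self ha]
  linarith

lemma bilin_sum_self_le {a : E →L[ℝ] E →L[ℝ] ℝ} (ha : ∀ u v, a u v = a v u) (ha0 : ∀ u, 0 ≤ a u u)
    {ι : Type*} (s : Finset ι) (u : ι → E) :
    a (∑ i ∈ s, u i) (∑ i ∈ s, u i) ≤ s.card * ∑ i ∈ s, a (u i) (u i) := by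
  classical
  have h : ∀ i j, a (u i) (u j) ≤ (a (u i) (u i) + a (u j) (u j)) / 2 := fun i j => by
    have := ha0 (u i - u j)
    rw [bilin_sub_self ha] at this; linarith
  simp only [map_sum, sum_apply]
  refine (sum_le_sum fun i _ => sum_le_sum fun j _ => h j i).trans (le_of_eq ?_)
  simp only [← Finset.sum_div, sum_add_distrib, sum_const, nsmul_eq_mul]; rw [← mul_sum]; ring

end Abstract

/-- Integrals over sets of bounded overlap. -/
lemma sum_setIntegral_le {α ι : Type*} [MeasurableSpace α] {m : Measure α} {f : α → ℝ} {D : Set α}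
    (hf : IntegrableOn f D m) (hf0 : ∀ᵐ x ∂m.restrict D, 0 ≤ f x) (R : Finset ι) {A : ι → Set α}
    (hA : ∀ i ∈ R, MeasurableSet (A i)) (hAD : ∀ i ∈ R, A i ⊆ D) {K : ℝ}
    (hK : ∀ x, ∀ I ⊆ R, (∀ i ∈ I, x ∈ A i) → (I.card : ℝ) ≤ K) :
    ∑ i ∈ R, ∫ x in A i, f x ∂m ≤ K * ∫ x in D, f x ∂m := by
  classical
  have e : ∀ i ∈ R, ∫ x in A i, f x ∂m = ∫ x in D, (A i).indicator f x ∂m := fun i hi => by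
    rw [setIntegral_indicator (hA i hi), inter_eq_right.2 (hAD i hi)]
  rw [sum_congr rfl e, ← integral_finsetSum _ fun i hi => hf.indicator (hA i hi), ← integral_const_mul]
  refine integral_mono_ae (integrable_finsetSum _ fun i hi => hf.indicator (hA i hi)) (hf.const_mul K) ?_
  filter_upwards [hf0] with x hx
  have e2 : ∑ i ∈ R, (A i).indicator f x = (R.filter fun i => x ∈ A i).card * f x := by
    simp only [indicator_apply, ← Finset.sum_filter, sum_const, nsmul_eq_mul]
  rw [e2]
  exact mul_le_mul_of_nonneg_right (hK x _ (Finset.filter_subset _ _) fun i hi => (Finset.mem_filter.1 hi).2) hx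

lemma setIntegral_le_sum {α ι : Type*} [MeasurableSpace α] {m : Measure α} {f : α → ℝ} {D : Set α}
    (hf : IntegrableOn f D m) (hf0 : ∀ᵐ x ∂m.restrict D, 0 ≤ f x) (R : Finset ι) {A : ι → Set α}
    (hA : ∀ i ∈ R, MeasurableSet (A i)) (hAD : ∀ i ∈ R, A i ⊆ D) 
    (hcov : ∀ᵐ x ∂m.restrict D, ∃ i ∈ R, x ∈ A i) :
    ∫ x in D, f x ∂m ≤ ∑ i ∈ R, ∫ x in A i, f x ∂m := by
  classical
  have e : ∀ i ∈ R, ∫ x in A i, f x ∂m = ∫ x in D, (A i).indicator f x ∂m := fun i hi => by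
    rw [setIntegral_indicator (hA i hi), inter_eq_right.2 (hAD i hi)]
  rw [sum_congr rfl e, ← integral_finsetSum _ fun i hi => hf.indicator (hA i hi)]
  refine integral_mono_ae hf (integrable_finsetSum _ fun i hi => hf.indicator (hA i hi)) ?_
  filter_upwards [hf0, hcov] with x hx ⟨i, hi, hxi⟩
  have : (A i).indicator f x ≤ ∑ i ∈ R, (A i).indicator f x :=
    single_le_sum (f := fun i => (A i).indicator f x) (fun j _ => indicator_apply_nonneg fun _ => hx) hi
  rwa [indicator_of_mem hxi] at this

lemma ae_meas_mem_elem (hM : M.IsCoarseGrid G) : ∀ᵐ x ∂G.meas, ∃ i, x ∈ M.elem i := by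
  rw [G.ae_meas_iff]
  have hcl : ∀ x ∈ closure G.Ω, ∃ i, x ∈ M.elem i := fun x hx => by rw [← hM.iUnion_elem] at hx; exact mem_iUnion.1 hx
  intro o
  refine Fin.cases ?_ (fun l => ?_) o
  · rw [FracturedDomain.pieceMeas_zero]
    filter_upwards [ae_restrict_mem G.isOpen.measurableSet] with x hx
    exact hcl x (subset_closure hx)
  · rw [FracturedDomain.pieceMeas_succ]
    filter_upwards [ae_restrict_mem (measurableSet_seg l)] with x hx
    exact hcl x (G.seg_subset l hx)

include hlo h in
lemma integrableOn_aDen {D : Set Pt} (hD : MeasurableSet D) (u v : EField G.meas) :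
    IntegrableOn (fun z => aDen co ρ σ z (st u z.2) (st v z.2)) (Prod.snd ⁻¹' D) G.mu :=
  integrable_aDen (h.isWeight hlo D) hD ((memLp_st u).mono_measure Measure.restrict_le_self)
    ((memLp_st v).mono_measure Measure.restrict_le_self)

include hlo h in
lemma aQ_eq_integral {D : Set Pt} (hD : MeasurableSet D) (u v : EField G.meas) :
    aQ co ρ σ D u v = ∫ z in Prod.snd ⁻¹' D, aDen co ρ σ z (st u z.2) (st v z.2) ∂G.mu :=
  aQ_eq (h.isWeight hlo D) hD Measure.restrict_le_self u v

include hlo h hM hγ in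
/-- The local energies add up to the energy, up to the number of overlaps. -/
lemma sum_aQ_elem_le (hρσ : 0 ≤ ρ * σ) (R : Finset (Fin M.N)) {D : Set Pt}
    (hD : MeasurableSet D) (hR : ∀ i ∈ R, M.elem i ⊆ D) (u : EField G.meas) :
    ∑ i ∈ R, aQ co ρ σ (M.elem i) u u ≤ QuadMesh.overlap γ * aQ co ρ σ D u u := by
  simp only [aQ_eq_integral hlo h hD, aQ_eq_integral hlo h (measurableSet_elem _)]
  refine sum_setIntegral_le (integrableOn_aDen hlo h hD u u) ?_ R
    (fun i _ => measurable_snd (measurableSet_elem i)) (fun i hi => preimage_mono (hR i hi))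
    (fun x I _ hI => hγ.card_le_overlap hM x.2 I hI)
  filter_upwards [ae_restrict_kap_nonneg hlo h _] with z hz
  exact aDen_self_nonneg hz hρσ _

include hlo h in
lemma aQ_mono (hρσ : 0 ≤ ρ * σ)
    {D D' : Set Pt} (hD : MeasurableSet D) (hD' : MeasurableSet D') (hDD : D ⊆ D') (u : EField G.meas) :
    aQ co ρ σ D u u ≤ aQ co ρ σ D' u u := by
  rw [aQ_eq_integral hlo h hD, aQ_eq_integral hlo h hD']
  refine setIntegral_mono_set (integrableOn_aDen hlo h hD' u u) ?_ (preimage_mono hDD).eventuallyLE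
  filter_upwards [ae_restrict_kap_nonneg hlo h _] with z hz
  exact aDen_self_nonneg hz hρσ _

include hlo h in
lemma aQ_restrField {D : Set Pt} (hD : MeasurableSet D) (u : EField G.meas) :
    aQ co ρ σ D (restrField G D u) (restrField G D u) = aQ co ρ σ D u u := by
  rw [aQ_eq (h.isWeight hlo D) hD le_rfl, aQ_eq (h.isWeight hlo D) hD Measure.restrict_le_self]
  exact aInt_congr hD (st_restrField D u) (st_restrField D u)

include hlo h hM hγ in
lemma sForm_congr {j : Fin M.N} {u u' v v' : Pt → Pair}
    (hu : MemLp u 2 (G.meas.restrict (M.elem j))) (hv : MemLp v 2 (G.meas.restrict (M.elem j)))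
    (huu : u =ᵐ[G.meas.restrict (M.elem j)] u') (hvv : v =ᵐ[G.meas.restrict (M.elem j)] v') :
    sForm co M j u v = sForm co M j u' v' := by
  have hw := isWeight_sWeight hlo h hM hγ j
  rw [sForm_eq hw hu hv, sForm_eq hw (hu.ae_eq huu) (hv.ae_eq hvv)]; exact wForm_congr (measurableSet_elem j) huu hvv

lemma memLp_restr {D : Set Pt} (u : L2 G.meas) : MemLp u 2 (G.meas.restrict D) :=
  (Lp.memLp u).mono_measure Measure.restrict_le_self

include hlo h hM hγ in
lemma sForm_restrField (j : Fin M.N) (u : EField G.meas) (v : L2 (G.meas.restrict (M.elem j))) :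
    sForm co M j (restrField G (M.elem j) u).1 v = sForm co M j u.1 v :=
  sForm_congr hlo h hM hγ (Lp.memLp _) (Lp.memLp _) (restrField_fst _ u) Filter.EventuallyEq.rfl

include hlo h hM hγ in
lemma sForm_restrField_self (j : Fin M.N) (u : EField G.meas) :
    sForm co M j (restrField G (M.elem j) u).1 (restrField G (M.elem j) u).1 = sForm co M j u.1 u.1 :=
  sForm_congr hlo h hM hγ (Lp.memLp _) (Lp.memLp _) (restrField_fst _ u) (restrField_fst _ u)

include hlo h hM hγ in
lemma IsSpectralSequence.gap_restrict (hhi : 0 ≤ hi) (hρσ : 0 ≤ ρ * σ)  {j : Fin M.N} {lam : ℕ → ℝ}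
    {φ : ℕ → LocalField G M j} (hφ : IsSpectralSequence co ρ σ M j lam φ) (L : ℕ)
    {v : EField G.meas} (hv : v ∈ G.V) (hvφ : ∀ k < L, sForm co M j v.1 (φ k).1 = 0) :
    lam L * sForm co M j v.1 v.1 ≤ aQ co ρ σ (M.elem j) v v := by
  have := hφ.gap hlo h hM hγ hhi hρσ L (restrField_mem (M.elem j) hv) fun k hk => by
    rw [sForm_restrField hlo h hM hγ]; exact hvφ k hk
  rwa [sForm_restrField_self hlo h hM hγ, aQ_restrField hlo h (measurableSet_elem j)] at this

lemma norm_sq_restrField (D : Set Pt) (u : EField G.meas) :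
    ‖(restrField G D u).1‖ ^ 2 = ∫ x in D, ‖u.1 x‖ ^ 2 ∂G.meas := by
  rw [norm_sq_L2]; exact integral_congr_ae ((restrField_fst D u).mono fun x hx => by simp only [hx])

lemma sum_norm_sq_restrField_le (hM : M.IsCoarseGrid G) {γ : ℝ} (hγ : M.ShapeRegular γ) (u : EField G.meas) :
    ∑ i, ‖(restrField G (M.elem i) u).1‖ ^ 2 ≤ QuadMesh.overlap γ * ‖u.1‖ ^ 2 := by
  simp only [norm_sq_restrField]; rw [norm_sq_L2, ← setIntegral_univ]
  exact sum_setIntegral_le (integrable_norm_sq (Lp.memLp u.1)).integrableOn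
    (.of_forall fun x => by positivity) Finset.univ (fun i _ => measurableSet_elem i)
    (fun i _ => subset_univ _) (fun x I _ hI => hγ.card_le_overlap hM x I hI)

lemma norm_sq_le_sum_restrField (hM : M.IsCoarseGrid G) (u : EField G.meas) :
    ‖u.1‖ ^ 2 ≤ ∑ i, ‖(restrField G (M.elem i) u).1‖ ^ 2 := by
  simp only [norm_sq_restrField]; rw [norm_sq_L2, ← setIntegral_univ]
  refine setIntegral_le_sum (integrable_norm_sq (Lp.memLp u.1)).integrableOn
    (.of_forall fun x => by positivity) Finset.univ (fun i _ => measurableSet_elem i)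
    (fun i _ => subset_univ _) ?_
  rw [Measure.restrict_univ]
  filter_upwards [ae_meas_mem_elem hM] with x ⟨i, hi⟩
  exact ⟨i, Finset.mem_univ i, hi⟩

include hlo h hM hγ in
lemma sum_sForm_le (hhi : 0 ≤ hi)  (u : EField G.meas) :
    ∑ i, sForm co M i u.1 u.1 ≤ hi * (4 * (γ / M.meshSize) ^ 2) * G.aperInv * (QuadMesh.overlap γ * ‖u.1‖ ^ 2) := by
  have h1 := sum_norm_sq_restrField_le hM hγ u
  have := G.aperInv_nonneg
  refine le_trans ?_ (mul_le_mul_of_nonneg_left h1 (by positivity))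
  rw [mul_sum]
  refine sum_le_sum fun i _ => ?_
  have := sForm_self_le hlo h hM hγ hhi i le_rfl (restrField G (M.elem i) u).1
  rwa [sForm_restrField_self hlo h hM hγ] at this

lemma aDen_outer (co : Coefficients G) (ρ σ : ℝ) (z : G.Piece) (p : Pair) (q : Pt) :
    aDen co ρ σ z ((0 : Pair), scaleMap q p) ((0 : Pair), scaleMap q p) = ‖q‖ ^ 2 * ∑ i, co.kap i z * (p i * p i) := by
  rw [aDen_self, mul_sum]
  have e : ∀ i, (scaleMap q p) i = p i • q := fun i => rfl
  simp only [e, norm_smul, mul_pow, Real.norm_eq_abs, sq_abs]; simp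
  ring

lemma mul_mulGrad_eq (a : ℝ) (q : Pt) (U : Pair × GradPair) :
    (a • U.1, mulGrad a q U) = a • U + ((0 : Pair), scaleMap q U.1) := by
  rw [mulGrad_eq]; ext1
  · simp
  · simp [add_comm]

lemma aDen_smul_smul (z : G.Piece) (a : ℝ) (U : Pair × GradPair) :
    aDen co ρ σ z (a • U) (a • U) = a ^ 2 * aDen co ρ σ z U U := by
  rw [aDen_smul_left, aDen_symm, aDen_smul_left]; ring

lemma aDen_mul_le {z : G.Piece} (hk : ∀ i, 0 ≤ co.kap i z) (hρσ : 0 ≤ ρ * σ) {a : ℝ} (ha : |a| ≤ 1)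
    (q : Pt) (U : Pair × GradPair) :
    aDen co ρ σ z (a • U.1, mulGrad a q U) (a • U.1, mulGrad a q U) ≤
      2 * aDen co ρ σ z U U + 2 * (‖q‖ ^ 2 * ∑ i, co.kap i z * (U.1 i * U.1 i)) := by
  rw [mul_mulGrad_eq]
  refine (aDen_add_self_le hk hρσ _ _).trans ?_
  rw [aDen_smul_smul, aDen_outer]
  have h1 : a ^ 2 ≤ 1 := by rw [← sq_abs]; exact pow_le_one₀ (abs_nonneg _) ha
  have := mul_le_mul_of_nonneg_right h1 (aDen_self_nonneg hk hρσ U)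
  linarith

lemma le_aDen_mul {z : G.Piece} (hk : ∀ i, 0 ≤ co.kap i z) (hρσ : 0 ≤ ρ * σ) {a : ℝ} (ha : 0 ≤ a)
    (q : Pt) (U : Pair × GradPair) {t : ℝ} (ht : 0 < t) :
    -(t / 2 * aDen co ρ σ z U U + t⁻¹ / 2 * (‖q‖ ^ 2 * ∑ i, co.kap i z * (U.1 i * U.1 i))) ≤
      aDen co ρ σ z U (a • U.1, mulGrad a q U) := by
  rw [mul_mulGrad_eq, aDen_symm co ρ σ z U (_ + _), aDen_add_left, aDen_smul_left, ← aDen_outer co ρ σ]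
  have h1 := two_aDen_le hk hρσ ht U ((0 : Pair), scaleMap q U.1)
  rw [aDen_symm co ρ σ z U] at h1
  have h2 := mul_nonneg ha (aDen_self_nonneg hk hρσ U)
  have h3 := neg_abs_le (aDen co ρ σ z ((0 : Pair), scaleMap q U.1) U)
  linarith

include hlo h hM hγ in
lemma kap_le_sForm (j : Fin M.N) {u : Pt → Pair} (hu : MemLp u 2 (G.meas.restrict (M.elem j))) :
    (4 * (γ / M.meshSize)) ^ 2 * wForm co.kap (M.elem j) u u ≤ 64 * γ ^ 2 * sForm co M j u u := by
  have hw := isWeight_sWeight hlo h hM hγ j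
  have hk := h.isWeight hlo (M.elem j)
  rw [sForm_eq hw hu hu]
  have h1 := wForm_mono (u := u) (w := fun i z => 1 / (4 * M.meshSize ^ 2) * co.kap i z) (measurableSet_elem j)
    (hk.const_smul (by positivity)) hw hu (by
      filter_upwards [ae_restrict_of_ae h.ae, ae_restrict_mem (measurable_snd (measurableSet_elem j))] with z hz hm i
      rw [mul_comm]; exact mul_le_mul_of_nonneg_left (le_chiWeight hM j hm) (hlo.le.trans (hz i).1))
  rw [wForm_const_smul] at h1
  have e : (4 * (γ / M.meshSize)) ^ 2 * wForm co.kap (M.elem j) u u =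
      64 * γ ^ 2 * (1 / (4 * M.meshSize ^ 2) * wForm co.kap (M.elem j) u u) := by field_simp; ring
  rw [e]; exact mul_le_mul_of_nonneg_left h1 (by positivity)

include hlo h hM hγ in
/-- The energy on an element of a product with a cut-off function. -/
lemma aQ_elem_mul_le (hρσ : 0 ≤ ρ * σ) (j : Fin M.N) {ν : Measure Pt}
    (hν : G.meas.restrict (M.elem j) ≤ ν) (w : EField G.meas) (u : EField ν) {a : Pt → ℝ} {q : Pt → Pt}
    (hwu : ∀ᵐ x ∂G.meas.restrict (M.elem j), |a x| ≤ 1 ∧ ‖q x‖ ≤ 4 * (γ / M.meshSize) ∧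
      st w x = (a x • u.1 x, mulGrad (a x) (q x) (u.1 x, u.2 x))) :
    aQ co ρ σ (M.elem j) w w ≤ 2 * aQ co ρ σ (M.elem j) u u + 128 * γ ^ 2 * sForm co M j u.1 u.1 := by
  have hm := measurableSet_elem j
  have hu : MemLp u.1 2 (G.meas.restrict (M.elem j)) := (Lp.memLp u.1).mono_measure hν
  have h1 := kap_le_sForm hlo h hM hγ j hu
  rw [aQ_eq_integral hlo h hm, aQ_eq (h.isWeight hlo _) hm hν]
  have iu := integrable_aDen (ρ := ρ) (σ := σ) (h.isWeight hlo _) hm ((memLp_st u).mono_measure hν) ((memLp_st u).mono_measure hν)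
  have ik := (h.isWeight hlo (M.elem j)).integrable_sum hm hu hu
  have key : ∫ z in Prod.snd ⁻¹' M.elem j, aDen co ρ σ z (st w z.2) (st w z.2) ∂G.mu ≤
      ∫ z in Prod.snd ⁻¹' M.elem j, (2 * aDen co ρ σ z (st u z.2) (st u z.2) +
        2 * (4 * (γ / M.meshSize)) ^ 2 * ∑ i, co.kap i z * (u.1 z.2 i * u.1 z.2 i)) ∂G.mu := by
    refine integral_mono_ae (integrableOn_aDen hlo h hm w w) ((iu.const_mul 2).add (ik.const_mul _)) ?_
    filter_upwards [ae_restrict_kap_nonneg hlo h _, ae_snd_of_ae hm hwu] with z hz ⟨h1, h2, h3⟩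
    simp only [h3]
    refine (aDen_mul_le hz hρσ h1 _ _).trans ?_
    have h4 : ‖q z.2‖ ^ 2 ≤ (4 * (γ / M.meshSize)) ^ 2 := pow_le_pow_left₀ (norm_nonneg _) h2 2
    have h5 : 0 ≤ ∑ i, co.kap i z * (u.1 z.2 i * u.1 z.2 i) :=
      sum_nonneg fun i _ => mul_nonneg (hz i) (mul_self_nonneg _)
    have := mul_le_mul_of_nonneg_right h4 h5
    simp only [st]; linarith
  refine key.trans ?_
  rw [integral_add (iu.const_mul 2) (ik.const_mul _), integral_const_mul, integral_const_mul]; simp only [wForm] at h1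
  simp only [aInt]; linarith

lemma ae_mu_of_ae_meas {P : Pt → Prop} (h : ∀ᵐ x ∂G.meas, P x) : ∀ᵐ z ∂G.mu, P z.2 := by
  have := ae_snd_of_ae MeasurableSet.univ (ae_restrict_of_ae (s := univ) h)
  rwa [preimage_univ, Measure.restrict_univ] at this

include hlo h in
/-- The energy of a field that lives on `D`. -/
lemma aQ_univ_eq {D : Set Pt} (hD : MeasurableSet D)
    {w : EField G.meas} (hw : ∀ᵐ x ∂G.meas, x ∉ D → st w x = 0) (v : EField G.meas) :
    aQ co ρ σ univ w v = aQ co ρ σ D w v := by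
  rw [aQ_eq_integral hlo h MeasurableSet.univ, aQ_eq_integral hlo h hD, preimage_univ, setIntegral_univ]
  refine (setIntegral_eq_integral_of_ae_compl_eq_zero ?_).symm
  filter_upwards [ae_mu_of_ae_meas hw] with z hz hzj
  rw [hz hzj]; simp [aDen]

/-! ### Local lifting -/

section Lift

variable {j : Fin M.N} {lam : ℕ → ℝ} {φ : ℕ → LocalField G M j} {L : ℕ}

lemma auxSpace_le_VRestr (hφ : IsSpectralSequence co ρ σ M j lam φ) : auxSpace M j L φ ≤ G.VRestr (M.elem j) :=
  Submodule.span_le.2 (by rintro _ ⟨k, -, rfl⟩; exact (hφ.eigen k).1)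

include hlo h hM hγ in
lemma IsSpectralSequence.aQ_le (hhi : 0 ≤ hi) (hρσ : 0 ≤ ρ * σ) 
    (hφ : IsSpectralSequence co ρ σ M j lam φ) {lamBar : ℝ} (hlam : ∀ k < L, lam k ≤ lamBar)
    {ν : LocalField G M j} (hν : ν ∈ auxSpace M j L φ) :
    aQ co ρ σ (M.elem j) ν ν ≤ lamBar * sForm co M j ν.1 ν.1 := by
  obtain ⟨a, ha⟩ := exists_aQ_bilin (co := co) hlo h hρσ (measurableSet_elem j) (ν := G.meas.restrict (M.elem j)) le_rfl
  obtain ⟨s, hs⟩ := exists_sForm_bilin (co := co) hlo h hM hγ hhi j (ν := G.meas.restrict (M.elem j)) le_rfl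
  have hνV := auxSpace_le_VRestr hφ hν
  rw [auxSpace, Submodule.mem_span_image_iff_exists_fun] at hν
  obtain ⟨t, ht, c, hc⟩ := hν
  rw [← ha, ← hs]
  have e1 : ∀ k : t, s (φ k) ν = c k * s (φ k) (φ k) := by
    intro k; rw [← hc, map_sum, sum_eq_single k]
    · rw [map_smul, smul_eq_mul]
    · intro k' _ hk'; rw [map_smul, hs, hφ.orthogonal k k' (fun h => hk' (Subtype.ext h.symm)), smul_zero]
    · intro hk; exact absurd (Finset.mem_univ k) hk
  have e2 : ∀ k : t, a (φ k) ν = lam k * (c k * s (φ k) (φ k)) := fun k => by rw [ha, (hφ.eigen k).2 ν hνV, ← hs, e1]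
  have e3 : ∀ (b : EField (G.meas.restrict (M.elem j)) →L[ℝ] EField (G.meas.restrict (M.elem j)) →L[ℝ] ℝ) w,
      b ν w = ∑ k : t, c k * b (φ k) w := fun b w => by
    rw [← hc]; simp only [map_sum, sum_apply, map_smul, smul_apply, smul_eq_mul]
  rw [e3 a, e3 s, mul_sum]
  refine sum_le_sum fun k _ => ?_
  rw [e1, e2]
  have h1 : 0 ≤ s (φ k) (φ k) := by rw [hs]; exact sForm_self_nonneg hlo h hM hγ j le_rfl _
  have h2 := hlam k (ht k.2)
  have h3 := mul_le_mul_of_nonneg_right h2 (mul_nonneg (mul_self_nonneg (c k)) h1)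
  linarith

lemma continuousOn_bubble (hM : M.IsCoarseGrid G) (j : Fin M.N) : ContinuousOn (M.bubble j) (M.elem j) :=
  fun _ hx => (QuadMesh.hasGradientWithinAt_bubble hM j hx).differentiableWithinAt.continuousWithinAt

/-- Multiplication of local functions with the truncated bubble function. -/
lemma exists_truncBubble_mul (hM : M.IsCoarseGrid G) (j : Fin M.N) {δ : ℝ} (hδ : 0 < δ) :
    ∃ T : LocalField G M j →L[ℝ] EField G.meas, (∀ u ∈ G.VRestr (M.elem j), T u ∈ G.V0 (M.elem j)) ∧
      (∀ u, ∀ᵐ x ∂G.meas, (x ∉ M.elem j → st (T u) x = 0) ∧ ∀ i, i ≠ j → x ∈ M.elem i → st (T u) x = 0) ∧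
      ∀ u : LocalField G M j, ∀ᵐ x ∂G.meas.restrict (M.elem j),
      (T u).1 x = trunc δ (M.bubble j x) • u.1 x ∧
      (T u).2 x = mulGrad (trunc δ (M.bubble j x)) ((G.tangentAt x).starProjection
        (truncDeriv δ (M.bubble j x) • M.bubbleGrad j x)) (u.1 x, u.2 x) := by
  have hm := measurableSet_elem j
  set S : Set Pt := M.elem j ∩ M.bubble j ⁻¹' Ici δ with hSdef
  have hS : IsClosed S := (continuousOn_bubble hM j).preimage_isClosed_of_isClosed (QuadMesh.isClosed_elem j) isClosed_Ici
  have hSint : S ⊆ interior (M.elem j) := fun x hx => by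
    by_contra hcon
    have h1 := hM.bubble_eq_zero hx.1 hcon
    have h2 : δ ≤ M.bubble j x := hx.2
    linarith
  obtain ⟨T, hTV, hT⟩ := (QuadMesh.piecewiseC1_truncBubble hM hδ j).exists_mul hM hS
    (U := G.Ω ∩ interior (M.elem j)) (fun i x hx hxS => by
      rcases eq_or_ne i j with rfl | hij
      · rw [QuadMesh.truncBubble, if_pos rfl]
        refine trunc_of_le ?_
        by_contra! hcon
        exact hxS ⟨hx, hcon.le⟩
      · rw [QuadMesh.truncBubble, if_neg hij])
    (inter_subset_inter_right _ hSint) (G.isOpen.inter isOpen_interior) hm inter_subset_left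
  refine ⟨T, hTV, fun ν => ?_, fun u => ?_⟩
  · filter_upwards [hT ν] with x hx
    refine ⟨fun hxj => Prod.ext (hx.1 hxj).1 (hx.1 hxj).2, fun i hi hxi => ?_⟩
    by_cases hxj : x ∈ M.elem j
    · obtain ⟨h1, h2⟩ := hx.2 i hxi hxj
      rw [QuadMesh.truncBubble, if_neg hi] at h1 h2; rw [QuadMesh.truncBubbleGrad, if_neg hi, map_zero] at h2
      refine Prod.ext ?_ ?_
      · simp only [st, h1, zero_smul]; rfl
      · simp only [st, h2, mulGrad]; ext; simp
    · exact Prod.ext (hx.1 hxj).1 (hx.1 hxj).2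
  · filter_upwards [ae_restrict_of_ae (hT u), ae_restrict_mem hm] with x hx hxj
    have := hx.2 j hxj hxj
    rwa [QuadMesh.truncBubble, if_pos rfl, QuadMesh.truncBubbleGrad, if_pos rfl] at this

include hlo h hM hγ in
lemma sForm_le_truncBubble {δ : ℝ} (hδ : 0 < δ) (ν : LocalField G M j)
    (w : EField G.meas) (hw : ∀ᵐ x ∂G.meas.restrict (M.elem j), w.1 x = trunc δ (M.bubble j x) • ν.1 x) :
    sForm co M j (fun x => M.bubble j x • ν.1 x) ν.1 ≤ sForm co M j w.1 ν.1 + 2 * δ * sForm co M j ν.1 ν.1 := by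
  have hm := measurableSet_elem j
  have hbc := continuousOn_bubble hM j
  have hW := isWeight_sWeight hlo h hM hγ j
  have mν : MemLp ν.1 2 (G.meas.restrict (M.elem j)) := Lp.memLp ν.1
  have mT : MemLp w.1 2 (G.meas.restrict (M.elem j)) := memLp_restr _
  have mB : MemLp (fun x => M.bubble j x • ν.1 x) 2 (G.meas.restrict (M.elem j)) := by
    refine MemLp.of_le mν ((hbc.aestronglyMeasurable hm).smul mν.1) ?_
    filter_upwards [ae_restrict_mem hm] with x hx
    obtain ⟨h1, h2⟩ := QuadMesh.bubble_mem hM hx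
    rw [norm_smul, Real.norm_eq_abs, abs_of_nonneg h1]; exact mul_le_of_le_one_left (norm_nonneg _) h2
  rw [sForm_eq hW mB mν, sForm_eq hW mT mν, sForm_eq hW mν mν, wForm, wForm, wForm, ← integral_const_mul,
    ← integral_add (hW.integrable_sum hm mT mν) ((hW.integrable_sum hm mν mν).const_mul _)]
  refine integral_mono_ae (hW.integrable_sum hm mB mν)
    ((hW.integrable_sum hm mT mν).add ((hW.integrable_sum hm mν mν).const_mul _)) ?_
  filter_upwards [ae_snd_of_ae hm hw, hW.nonneg 0, hW.nonneg 1] with z hz h0 h1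
  have h2 := sub_le_trunc hδ (s := M.bubble j z.2)
  simp only [hz, mul_sum, ← sum_add_distrib]
  refine sum_le_sum fun i _ => ?_
  have hi : 0 ≤ sWeight co M j i z := by fin_cases i <;> assumption
  simp only [PiLp.smul_apply, smul_eq_mul]
  have := mul_le_mul_of_nonneg_right h2 (mul_nonneg hi (mul_self_nonneg (ν.1 z.2 i)))
  linarith

include hlo h hM hγ in
/-- The data of a local function with respect to the eigenfunctions are matched by a function that
vanishes outside the element. -/
lemma IsSpectralSequence.exists_lift (hhi : 0 ≤ hi) (hρσ : 0 ≤ ρ * σ) 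
    (hφ : IsSpectralSequence co ρ σ M j lam φ) {lamBar : ℝ} (hlamB : 0 ≤ lamBar) (hlam : ∀ k < L, lam k ≤ lamBar)
    {Cπ : ℝ} (hCπ0 : 0 < Cπ)
    (hCπ : ∀ ν ∈ auxSpace M j L φ, sForm co M j ν.1 ν.1 ≤ Cπ * sForm co M j (fun x => M.bubble j x • ν.1 x) ν.1)
    (v : LocalField G M j) :
    ∃ b ∈ G.V0 (M.elem j), (∀ᵐ x ∂G.meas, (x ∉ M.elem j → st b x = 0) ∧ ∀ i, i ≠ j → x ∈ M.elem i → st b x = 0) ∧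
      (∀ k < L, sForm co M j b.1 (φ k).1 = sForm co M j v.1 (φ k).1) ∧
      aQ co ρ σ univ b b ≤ (2 * lamBar + 128 * γ ^ 2) * (4 * Cπ ^ 2) * sForm co M j v.1 v.1 := by
  have hm := measurableSet_elem j
  obtain ⟨a, ha⟩ := exists_aQ_bilin (co := co) hlo h hρσ hm (ν := G.meas.restrict (M.elem j)) le_rfl
  obtain ⟨s, hs⟩ := exists_sForm_bilin (co := co) hlo h hM hγ hhi j (ν := G.meas.restrict (M.elem j)) le_rfl
  obtain ⟨C, hC0, hC⟩ := exists_norm_sq_le_local (co := co) hlo h hM hγ hρσ j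
  have hssymm : ∀ u v, s u v = s v u := fun u v => by rw [hs, hs]; exact sForm_comm j _ _
  have hs0 : ∀ u, 0 ≤ s u u := fun u => by rw [hs]; exact sForm_self_nonneg hlo h hM hγ j le_rfl _
  have hδ : 0 < 1 / (4 * Cπ) := by positivity
  set δ := 1 / (4 * Cπ) with hδdef
  obtain ⟨T, hTV, hT, hTj⟩ := exists_truncBubble_mul hM j hδ
  obtain ⟨β, hβ⟩ : ∃ β : LocalField G M j →L[ℝ] LocalField G M j →L[ℝ] ℝ, ∀ u w, β u w = sForm co M j (T u).1 w.1 :=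
    ⟨s.comp ((restrField G (M.elem j)).comp T), fun u w => by
      rw [ContinuousLinearMap.comp_apply, hs]; exact sForm_restrField hlo h hM hγ j (T u) w.1⟩
  have hcoer : ∀ ν ∈ auxSpace M j L φ, sForm co M j ν.1 ν.1 ≤ 2 * Cπ * β ν ν := by
    intro ν hν
    have key := sForm_le_truncBubble hlo h hM hγ hδ ν (T ν) ((hTj ν).mono fun x hx => hx.1)
    rw [← hβ] at key
    have h1 := mul_le_mul_of_nonneg_left key hCπ0.le
    have h2 := hCπ ν hν
    have h3 : Cπ * (2 * δ * sForm co M j ν.1 ν.1) = sForm co M j ν.1 ν.1 / 2 := by rw [hδdef]; field_simp; ring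
    linarith
  have hfin : FiniteDimensional ℝ (auxSpace M j L φ) := FiniteDimensional.span_of_finite ℝ ((finite_Iio L).image φ)
  have haux : ∀ ν ∈ auxSpace M j L φ, aQ co ρ σ (M.elem j) ν ν ≤ lamBar * sForm co M j ν.1 ν.1 := fun ν hν =>
    hφ.aQ_le hlo h hM hγ hhi hρσ hlam hν
  obtain ⟨ν, hν, hνE⟩ := exists_represent_finite (a := β) (auxSpace M j L φ) (fun w hw hw0 => by
    have h1 := hcoer w hw
    have h2 := haux w hw
    have h3 := hs0 w
    rw [hs] at h3
    have h4 : sForm co M j w.1 w.1 = 0 := le_antisymm (h1.trans (mul_nonpos_of_nonneg_of_nonpos (by positivity) hw0)) h3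
    have h5 := hC w
    rw [h4] at h2 h5
    have h6 : ‖w‖ ^ 2 ≤ 0 := h5.trans (mul_nonpos_of_nonneg_of_nonpos hC0.le (by linarith))
    exact norm_eq_zero.1 (pow_eq_zero_iff two_ne_zero |>.1 (le_antisymm h6 (sq_nonneg _)))) (s v)
  have hT0 := hT ν
  refine ⟨T ν, hTV ν (auxSpace_le_VRestr hφ hν), hT0, fun k hk => ?_, ?_⟩
  · have := hνE (φ k) (Submodule.subset_span ⟨k, hk, rfl⟩)
    rwa [hβ, hs] at this
  · have h1 : aQ co ρ σ univ (T ν) (T ν) = aQ co ρ σ (M.elem j) (T ν) (T ν) := aQ_univ_eq hlo h hm (hT0.mono fun x hx => hx.1) _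
    have h2 := aQ_elem_mul_le (co := co) hlo h hM hγ hρσ j (ν := G.meas.restrict (M.elem j)) le_rfl (T ν) ν (by
      filter_upwards [hTj ν, ae_restrict_mem hm] with x hx hxj
      obtain ⟨h3, h4⟩ := QuadMesh.bubble_mem hM hxj
      refine ⟨?_, ?_, Prod.ext hx.1 hx.2⟩
      · rw [abs_of_nonneg (trunc_nonneg hδ _)]; exact (trunc_le hδ h3).trans h4
      · refine (norm_proj_le _ _).trans ?_
        rw [norm_smul, Real.norm_eq_abs]
        exact (mul_le_of_le_one_left (norm_nonneg _) (abs_truncDeriv_le hδ _)).trans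
          (QuadMesh.norm_bubbleGrad_le hM hγ hxj))
    have h3 := haux ν hν
    have h4 := hcoer ν hν
    rw [hνE ν hν] at h4
    have h5 := sq_bilin_le hssymm hs0 v ν
    rw [hs v v, hs ν ν] at h5
    have h6 : sForm co M j ν.1 ν.1 ≤ 4 * Cπ ^ 2 * sForm co M j v.1 v.1 := by
      have h0 := hs0 ν
      rw [hs] at h0
      rcases h0.eq_or_lt with h7 | h7
      · rw [← h7]
        have := hs0 v
        rw [hs] at this; positivity
      · have h8 : (sForm co M j ν.1 ν.1) ^ 2 ≤ (2 * Cπ * s v ν) ^ 2 := pow_le_pow_left₀ h0 h4 2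
        have h9 : (2 * Cπ * s v ν) ^ 2 ≤ 4 * Cπ ^ 2 * (sForm co M j v.1 v.1 * sForm co M j ν.1 ν.1) := by
          have := mul_le_mul_of_nonneg_left h5 (show 0 ≤ 4 * Cπ ^ 2 by positivity)
          linarith
        have h10 : sForm co M j ν.1 ν.1 * sForm co M j ν.1 ν.1 ≤
            4 * Cπ ^ 2 * sForm co M j v.1 v.1 * sForm co M j ν.1 ν.1 := by
          rw [← pow_two]; linarith
        exact le_of_mul_le_mul_right h10 h7
    have h7 := mul_le_mul_of_nonneg_left h6 (show 0 ≤ 2 * lamBar + 128 * γ ^ 2 by positivity)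
    rw [h1]; linarith

end Lift

namespace QuadMesh

lemma isClosed_oversampled (j : Fin M.N) (n : ℕ) : IsClosed (M.oversampled j n) :=
  (toFinite _).isClosed_biUnion fun i _ => isClosed_elem i

lemma mem_oversampled {j : Fin M.N} {n : ℕ} {x : Pt} : x ∈ M.oversampled j n ↔ ∃ i ∈ M.layer j n, x ∈ M.elem i := by
  simp [oversampled]

lemma elem_subset_oversampled {j i : Fin M.N} {n : ℕ} (hi : i ∈ M.layer j n) : M.elem i ⊆ M.oversampled j n :=
  fun _ hx => mem_oversampled.2 ⟨i, hi, hx⟩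

lemma layer_mono (hM : M.IsCoarseGrid G) (j : Fin M.N) : Monotone (M.layer j) :=
  monotone_nat_of_le_succ fun n => layer_subset_succ hM j n

lemma oversampled_mono (hM : M.IsCoarseGrid G) (j : Fin M.N) : Monotone (M.oversampled j) :=
  fun _ _ h => biUnion_subset_biUnion_left (layer_mono hM j h)

lemma self_mem_layer (hM : M.IsCoarseGrid G) (j : Fin M.N) (n : ℕ) : j ∈ M.layer j n :=
  layer_mono hM j (Nat.zero_le n) (mem_singleton j)

lemma inter_oversampled_subset (hM : M.IsCoarseGrid G) (j : Fin M.N) (n : ℕ) :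
    G.Ω ∩ M.oversampled j n ⊆ G.Ω ∩ interior (M.oversampled j (n + 1)) := by
  rintro x ⟨hx, hxn⟩
  refine ⟨hx, mem_interior_iff_mem_nhds.2 ?_⟩
  obtain ⟨i, hi, hxi⟩ := mem_oversampled.1 hxn
  filter_upwards [eventually_mem_elem M x, G.isOpen.mem_nhds hx] with y hy hyΩ
  obtain ⟨i', hi'⟩ := hM.exists_mem hyΩ
  exact mem_oversampled.2 ⟨i', ⟨i, hi, x, hxi, hy i' hi'⟩, hi'⟩

/-- An element that is not in the layer `n + 1` does not touch the elements of the layer `n`. -/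
lemma elem_subset_compl {j i : Fin M.N} {n : ℕ} (hi : i ∉ M.layer j (n + 1)) :
    M.elem i ⊆ (M.oversampled j n)ᶜ := fun x hx hxn => by
  obtain ⟨i', hi', hx'⟩ := mem_oversampled.1 hxn
  exact hi ⟨i', hi', x, hx', hx⟩

end QuadMesh

/-- The assumptions on the coefficients, the coarse grid and the spectral problems. -/
structure MultiscaleSetting {G : FracturedDomain} (co : Coefficients G) (ρ σ : ℝ) (M : QuadMesh)
    (L : Fin M.N → ℕ) (lam : Fin M.N → ℕ → ℝ) (φ : (j : Fin M.N) → ℕ → LocalField G M j)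
    (lo hi γ lamBar Cπ Λ : ℝ) : Prop where
  lo_pos : 0 < lo
  hi_nonneg : 0 ≤ hi
  kappa : co.KappaBetween lo hi
  exch_nonneg : 0 ≤ ρ * σ
  grid : M.IsCoarseGrid G
  shape : M.ShapeRegular γ
  spectral : ∀ j, IsSpectralSequence co ρ σ M j (lam j) (φ j)
  lamBar_nonneg : 0 ≤ lamBar
  lam_le : ∀ j, ∀ k < L j, lam j k ≤ lamBar
  cpi_pos : 0 < Cπ
  bubble : ∀ j, ∀ ν ∈ auxSpace M j (L j) (φ j),
      sForm co M j ν.1 ν.1 ≤ Cπ * sForm co M j (fun x => M.bubble j x • ν.1 x) ν.1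
  gap_pos : 0 < Λ
  le_lam : ∀ j, Λ ≤ lam j (L j)

namespace MultiscaleSetting

variable {L : Fin M.N → ℕ} {lam : Fin M.N → ℕ → ℝ} {φ : (j : Fin M.N) → ℕ → LocalField G M j}
  {lo hi γ lamBar Cπ Λ : ℝ} (S : MultiscaleSetting co ρ σ M L lam φ lo hi γ lamBar Cπ Λ)

/-- The stability constant of the local lifting. -/
def liftConst (γ lamBar Cπ : ℝ) : ℝ := (2 * lamBar + 128 * γ ^ 2) * (4 * Cπ ^ 2)

include S

lemma exists_data (j : Fin M.N) (k : ℕ) : ∃ d : EField G.meas →L[ℝ] ℝ, ∀ v, d v = sForm co M j v.1 (φ j k).1 := by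
  obtain ⟨s, hs⟩ := exists_sForm_bilin (co := co) S.lo_pos S.kappa S.grid S.shape S.hi_nonneg j
    (ν := G.meas.restrict (M.elem j)) le_rfl
  refine ⟨(s (φ j k)).comp (restrField G (M.elem j)), fun v => ?_⟩
  rw [ContinuousLinearMap.comp_apply, hs, sForm_comm]; exact sForm_restrField S.lo_pos S.kappa S.grid S.shape j v _

/-- The functions of `V` whose data with respect to the auxiliary spaces vanish. -/
lemma exists_kernel : ∃ W : Submodule ℝ (EField G.meas), IsClosed (W : Set (EField G.meas)) ∧ W ≤ G.V ∧
      ∀ w ∈ G.V, (w ∈ W ↔ ∀ j, ∀ k < L j, sForm co M j w.1 (φ j k).1 = 0) := by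
  choose d hd using S.exists_data
  refine ⟨{ carrier := {w | w ∈ G.V ∧ ∀ j, ∀ k < L j, d j k w = 0}
            add_mem' := fun {x y} hx hy => ⟨G.V.add_mem hx.1 hy.1, fun j k hk => by
              rw [map_add, hx.2 j k hk, hy.2 j k hk, add_zero]⟩
            zero_mem' := ⟨G.V.zero_mem, fun j k _ => map_zero _⟩
            smul_mem' := fun c x hx => ⟨G.V.smul_mem c hx.1, fun j k hk => by
              rw [map_smul, hx.2 j k hk, smul_zero]⟩ }, ?_, fun w hw => hw.1, fun w hw => ?_⟩
  · have e : {w | w ∈ G.V ∧ ∀ j, ∀ k < L j, d j k w = 0} =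
        (G.V : Set (EField G.meas)) ∩ ⋂ j, ⋂ k : Fin (L j), {w | d j k w = 0} := by
      ext w; simp only [mem_inter_iff, mem_iInter, mem_setOf_eq, SetLike.mem_coe]
      exact and_congr_right fun _ => ⟨fun h j k => h j k k.2, fun h j k hk => h j ⟨k, hk⟩⟩
    change IsClosed {w | w ∈ G.V ∧ ∀ j, ∀ k < L j, d j k w = 0}
    rw [e]
    exact (Submodule.isClosed_topologicalClosure _).inter
      (isClosed_iInter fun j => isClosed_iInter fun k => isClosed_eq (d j k).continuous continuous_const)
  · change (w ∈ G.V ∧ ∀ j, ∀ k < L j, d j k w = 0) ↔ _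
    simp only [hd, hw, true_and]

lemma gap {j : Fin M.N} {v : EField G.meas} (hv : v ∈ G.V) (hvφ : ∀ k < L j, sForm co M j v.1 (φ j k).1 = 0) :
    Λ * sForm co M j v.1 v.1 ≤ aQ co ρ σ (M.elem j) v v :=
  (mul_le_mul_of_nonneg_right (S.le_lam j) (sForm_self_nonneg S.lo_pos S.kappa S.grid S.shape j
    Measure.restrict_le_self _)).trans
    ((S.spectral j).gap_restrict S.lo_pos S.kappa S.grid S.shape S.hi_nonneg S.exch_nonneg (L j) hv hvφ)

lemma sForm_eq_zero {j : Fin M.N} {v : EField G.meas}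
    (hv : ∀ᵐ x ∂G.meas, x ∈ M.elem j → v.1 x = 0) (u : L2 (G.meas.restrict (M.elem j))) :
    sForm co M j v.1 u = 0 := by
  rw [sForm_congr S.lo_pos S.kappa S.grid S.shape (memLp_restr v.1) (Lp.memLp u) (u' := fun _ => 0)
    (v' := u) ?_ Filter.EventuallyEq.rfl]
  · simp [sForm]
  · filter_upwards [ae_restrict_of_ae hv, ae_restrict_mem (measurableSet_elem j)] with x hx hxj
    exact hx hxj

lemma sForm_eq_of_ae {j : Fin M.N} {v w : EField G.meas}
    (hv : ∀ᵐ x ∂G.meas, x ∈ M.elem j → v.1 x = w.1 x) (u : L2 (G.meas.restrict (M.elem j))) :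
    sForm co M j v.1 u = sForm co M j w.1 u := by
  refine sForm_congr S.lo_pos S.kappa S.grid S.shape (memLp_restr v.1) (Lp.memLp u) ?_ Filter.EventuallyEq.rfl
  filter_upwards [ae_restrict_of_ae hv, ae_restrict_mem (measurableSet_elem j)] with x hx hxj
  exact hx hxj

lemma liftConst_nonneg : 0 ≤ liftConst γ lamBar Cπ := by
  have := S.lamBar_nonneg
  unfold liftConst; positivity

lemma exists_lift (j : Fin M.N) (v : EField G.meas) :
    ∃ b ∈ G.V0 (M.elem j), (∀ᵐ x ∂G.meas, (x ∉ M.elem j → st b x = 0) ∧ ∀ i, i ≠ j → x ∈ M.elem i → st b x = 0) ∧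
      (∀ k < L j, sForm co M j b.1 (φ j k).1 = sForm co M j v.1 (φ j k).1) ∧
      (∀ i, i ≠ j → ∀ k, sForm co M i b.1 (φ i k).1 = 0) ∧
      aQ co ρ σ univ b b ≤ liftConst γ lamBar Cπ * sForm co M j v.1 v.1 := by
  obtain ⟨b, hb, hb0, hbφ, hba⟩ := (S.spectral j).exists_lift S.lo_pos S.kappa S.grid S.shape S.hi_nonneg S.exch_nonneg
    S.lamBar_nonneg (S.lam_le j) S.cpi_pos (S.bubble j) (restrField G (M.elem j) v)
  rw [sForm_restrField_self S.lo_pos S.kappa S.grid S.shape] at hba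
  refine ⟨b, hb, hb0, fun k hk => ?_, fun i hi k => ?_, hba⟩
  · rw [hbφ k hk]; exact sForm_restrField S.lo_pos S.kappa S.grid S.shape j v _
  · exact S.sForm_eq_zero (hb0.mono fun x hx hxi => congrArg Prod.fst (hx.2 i hi hxi)) _

/-- The complement of a cut-off of `θ` after `n + 1` layers. -/
lemma exists_cut (j : Fin M.N) (n : ℕ) {θ : EField G.meas} (hθ : θ ∈ G.V) :
    ∃ y ∈ G.V0 (M.oversampled j (n + 3)), ∀ᵐ x ∂G.meas,
      (∀ i, x ∈ M.elem i → ∃ a : ℝ, ∃ q : Pt, 0 ≤ a ∧ a ≤ 1 ∧ ‖q‖ ≤ 4 * (γ / M.meshSize) ∧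
        st (θ - y) x = (a • θ.1 x, mulGrad a q (θ.1 x, θ.2 x)) ∧ y.1 x = (1 - a) • θ.1 x) ∧
      (x ∈ M.oversampled j (n + 1) → st (θ - y) x = 0) ∧
      (∀ i, i ∉ M.layer j (n + 2) → x ∈ M.elem i → st (θ - y) x = st θ x) := by
  have hM := S.grid
  obtain ⟨T, hTV, hT⟩ := (QuadMesh.piecewiseC1_cut hM j (n + 1)).exists_mul_V hM
    (QuadMesh.isClosed_oversampled j (n + 2)) (fun i x hx hxS => QuadMesh.cutFun_eq_zero (fun hi =>
      hxS (QuadMesh.elem_subset_oversampled hi hx)) x)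
    (QuadMesh.inter_oversampled_subset hM j (n + 2)) (G.isOpen.inter isOpen_interior)
  refine ⟨T θ, hTV θ hθ, ?_⟩
  have key : ∀ᵐ x ∂G.meas, ∀ i, x ∈ M.elem i → st (θ - T θ) x = ((1 - M.cutFun j (n + 1) i x) • θ.1 x,
      mulGrad (1 - M.cutFun j (n + 1) i x) (-(G.tangentAt x).starProjection (M.cutGrad j (n + 1) i x))
        (θ.1 x, θ.2 x)) ∧ (T θ).1 x = M.cutFun j (n + 1) i x • θ.1 x := by
    filter_upwards [hT θ, st_sub θ (T θ)] with x hx hs i hi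
    obtain ⟨h1, h2⟩ := hx i hi
    rw [hs]
    refine ⟨Prod.ext ?_ ?_, h1⟩
    · simp only [st, h1, Prod.fst_sub, sub_smul, one_smul]
    · simp only [st, h2, Prod.snd_sub, mulGrad]; ext1 i
      simp only [PiLp.sub_apply, sub_smul, one_smul, smul_neg]; abel
  filter_upwards [key] with x hx
  refine ⟨fun i hi => ⟨_, _, ?_, ?_, ?_, (hx i hi).1, ?_⟩, fun hxn => ?_, fun i₀ hi hi₀ => ?_⟩
  · linarith [(QuadMesh.cutFun_mem hM j (n + 1) hi).2]
  · linarith [(QuadMesh.cutFun_mem hM j (n + 1) hi).1]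
  · rw [norm_neg]; exact (norm_proj_le _ _).trans (QuadMesh.norm_cutGrad_le hM S.shape j (n + 1) hi)
  · rw [sub_sub_cancel]; exact (hx i hi).2
  · obtain ⟨i, hi, hxi⟩ := QuadMesh.mem_oversampled.1 hxn
    rw [(hx i hxi).1, QuadMesh.cutFun_eq_one hM hi, QuadMesh.cutGrad_eq_zero' hM hi hxi, map_zero]
    refine Prod.ext ?_ ?_
    · simp
    · simp only [mulGrad]; ext; simp
  · rw [(hx i₀ hi₀).1, QuadMesh.cutFun_eq_zero hi, QuadMesh.cutGrad_eq_zero hi, map_zero]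
    refine Prod.ext ?_ ?_
    · simp [st]
    · simp only [mulGrad, st]; ext; simp

end MultiscaleSetting

include hlo h hM hγ in
lemma sForm_mono {j : Fin M.N} {u v : L2 G.meas}
    (huv : ∀ᵐ x ∂G.meas, x ∈ M.elem j → ∃ r : ℝ, |r| ≤ 1 ∧ u x = r • v x) :
    sForm co M j u u ≤ sForm co M j v v := by
  have hw := isWeight_sWeight hlo h hM hγ j
  have hm := measurableSet_elem j
  rw [sForm_eq hw (memLp_restr u) (memLp_restr u), sForm_eq hw (memLp_restr v) (memLp_restr v)]
  refine integral_mono_ae (hw.integrable_sum hm (memLp_restr u) (memLp_restr u))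
    (hw.integrable_sum hm (memLp_restr v) (memLp_restr v)) ?_
  filter_upwards [ae_snd_of_ae hm (ae_restrict_of_ae (s := M.elem j) huv), ae_restrict_mem (measurable_snd hm),
    hw.nonneg 0, hw.nonneg 1] with z hz hzj h0 h1
  obtain ⟨r, hr, hu⟩ := hz hzj
  refine sum_le_sum fun i _ => ?_
  have hi : 0 ≤ sWeight co M j i z := by fin_cases i <;> assumption
  refine mul_le_mul_of_nonneg_left ?_ hi
  rw [hu]; simp only [PiLp.smul_apply, smul_eq_mul]
  have h2 : r ^ 2 ≤ 1 := by rw [← sq_abs]; exact pow_le_one₀ (abs_nonneg _) hr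
  nlinarith [mul_le_mul_of_nonneg_right h2 (mul_self_nonneg (v z.2 i))]

include hlo h in
lemma aQ_add_compl {D D' : Set Pt} (hD : MeasurableSet D) (hD' : MeasurableSet D') (hDD : D ⊆ D') (u : EField G.meas) :
    aQ co ρ σ D u u + aQ co ρ σ (D' \ D) u u = aQ co ρ σ D' u u := by
  rw [aQ_eq_integral hlo h hD, aQ_eq_integral hlo h hD', aQ_eq_integral hlo h (hD'.diff hD), preimage_diff]
  have h1 := setIntegral_union (μ := G.mu) (f := fun z => aDen co ρ σ z (st u z.2) (st u z.2))
    (disjoint_sdiff_right (s := (Prod.snd ⁻¹' D : Set G.Piece)) (t := Prod.snd ⁻¹' D'))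
    ((measurable_snd hD').diff (measurable_snd hD)) (integrableOn_aDen hlo h hD u u)
    ((integrableOn_aDen hlo h hD' u u).mono_set diff_subset)
  rw [← h1, union_diff_cancel (preimage_mono hDD)]

namespace MultiscaleSetting

variable {L : Fin M.N → ℕ} {lam : Fin M.N → ℕ → ℝ} {φ : (j : Fin M.N) → ℕ → LocalField G M j}
  {lo hi γ lamBar Cπ Λ : ℝ} (S : MultiscaleSetting co ρ σ M L lam φ lo hi γ lamBar Cπ Λ)

/-- Pointwise properties of a complemented cut-off function `w` of `θ`. -/
def IsCut (M : QuadMesh) (γ : ℝ) (j : Fin M.N) (n : ℕ) (θ w : EField G.meas) : Prop := ∀ᵐ x ∂G.meas,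
    (∀ i, x ∈ M.elem i → ∃ a : ℝ, ∃ q : Pt, 0 ≤ a ∧ a ≤ 1 ∧ ‖q‖ ≤ 4 * (γ / M.meshSize) ∧
      st w x = (a • θ.1 x, mulGrad a q (θ.1 x, θ.2 x))) ∧
    (x ∈ M.oversampled j (n + 1) → st w x = 0) ∧ (x ∉ M.oversampled j (n + 2) → st w x = st θ x)

include S

lemma integrable_kap_pair (u : L2 G.meas) (D : Set Pt) (hD : MeasurableSet D) :
    IntegrableOn (fun z => ∑ i, co.kap i z * (u z.2 i * u z.2 i)) (Prod.snd ⁻¹' D) G.mu :=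
  (S.kappa.isWeight S.lo_pos D).integrable_sum hD (memLp_restr u) (memLp_restr u)

/-- Integration of a pointwise estimate by the density outside a set and by densities on elements. -/
lemma integral_le_sum_elem {D : Set Pt} (hD : MeasurableSet D) {R : Finset (Fin M.N)} {F f g : G.Piece → ℝ} (hF : Integrable F G.mu)
    (hf : Integrable f G.mu) (hg : Integrable g G.mu)
    (hle : ∀ᵐ z ∂G.mu, F z ≤ (Prod.snd ⁻¹' D).indicator f z + ∑ i ∈ R, (Prod.snd ⁻¹' M.elem i).indicator g z) :
    ∫ z, F z ∂G.mu ≤ (∫ z in Prod.snd ⁻¹' D, f z ∂G.mu) + ∑ i ∈ R, ∫ z in Prod.snd ⁻¹' M.elem i, g z ∂G.mu := by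
  have h1 : Integrable ((Prod.snd ⁻¹' D).indicator f) G.mu := hf.indicator (measurable_snd hD)
  have h2 : ∀ i ∈ R, Integrable ((Prod.snd ⁻¹' M.elem i).indicator g) G.mu := fun i _ =>
    hg.indicator (measurable_snd (measurableSet_elem i))
  have h3 : Integrable (fun z => ∑ i ∈ R, (Prod.snd ⁻¹' M.elem i).indicator g z) G.mu := integrable_finsetSum _ h2
  have h4 := integral_mono_ae hF (h1.add h3) hle
  simp only [Pi.add_apply] at h4
  rw [integral_add h1 h3, integral_finsetSum _ h2, integral_indicator (measurable_snd hD)] at h4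
  refine h4.trans (le_of_eq ?_)
  congr 1; exact sum_congr rfl fun i _ => integral_indicator (measurable_snd (measurableSet_elem i))

lemma integrable_aDen_univ (u v : EField G.meas) : Integrable (fun z => aDen co ρ σ z (st u z.2) (st v z.2)) G.mu := by
  have := integrableOn_aDen (ρ := ρ) (σ := σ) S.lo_pos S.kappa MeasurableSet.univ u v
  rwa [preimage_univ, integrableOn_univ] at this

lemma integrable_kap_univ (u : L2 G.meas) : Integrable (fun z => ∑ i, co.kap i z * (u z.2 i * u z.2 i)) G.mu := by
  have := S.integrable_kap_pair u univ MeasurableSet.univ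
  rwa [preimage_univ, integrableOn_univ] at this

lemma aQ_univ_eq_integral (u v : EField G.meas) :
    aQ co ρ σ univ u v = ∫ z, aDen co ρ σ z (st u z.2) (st v z.2) ∂G.mu := by
  rw [aQ_eq_integral S.lo_pos S.kappa MeasurableSet.univ, preimage_univ, setIntegral_univ]

/-- The pairing of `θ` with a complemented cut-off function of `θ`. -/
lemma le_aQ_cut {j : Fin M.N} {n : ℕ} {θ w : EField G.meas} (hw : IsCut M γ j n θ w) {R : Finset (Fin M.N)}
    (hR : ∀ i, i ∈ M.layer j (n + 2) → i ∉ M.layer j (n + 1) → i ∈ R) {t : ℝ} (ht : 0 < t) :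
    aQ co ρ σ (M.oversampled j (n + 2))ᶜ θ θ ≤ aQ co ρ σ univ θ w +
      ∑ i ∈ R, (t / 2 * aQ co ρ σ (M.elem i) θ θ + t⁻¹ / 2 * (64 * γ ^ 2 * sForm co M i θ.1 θ.1)) := by
  have hD := (QuadMesh.isClosed_oversampled j (n + 2)).measurableSet.compl
  set c := t⁻¹ / 2 * (4 * (γ / M.meshSize)) ^ 2 with hc
  set g : G.Piece → ℝ := fun z => t / 2 * aDen co ρ σ z (st θ z.2) (st θ z.2) +
    c * ∑ i, co.kap i z * (θ.1 z.2 i * θ.1 z.2 i) with hg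
  have i1 : Integrable (fun z => t / 2 * aDen co ρ σ z (st θ z.2) (st θ z.2)) G.mu := (S.integrable_aDen_univ θ θ).const_mul _
  have i2 : Integrable (fun z => c * ∑ i, co.kap i z * (θ.1 z.2 i * θ.1 z.2 i)) G.mu := (S.integrable_kap_univ θ.1).const_mul _
  have ig : Integrable g G.mu := i1.add i2
  have iθ := S.integrable_aDen_univ θ θ
  have iw := S.integrable_aDen_univ θ w
  have key := S.integral_le_sum_elem hD (R := R) (f := fun z => -aDen co ρ σ z (st θ z.2) (st θ z.2))
    (g := g) (F := fun z => -aDen co ρ σ z (st θ z.2) (st w z.2)) iw.neg iθ.neg ig (by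
      filter_upwards [ae_mu_of_ae_meas hw, ae_mu_of_ae_meas (ae_meas_mem_elem S.grid), S.kappa.ae] with z hz ⟨i₀, hi₀⟩ hkz
      have hk : ∀ i, 0 ≤ co.kap i z := fun i => S.lo_pos.le.trans (hkz i).1
      have hK : 0 ≤ ∑ i, co.kap i z * (θ.1 z.2 i * θ.1 z.2 i) :=
        sum_nonneg fun i _ => mul_nonneg (hk i) (mul_self_nonneg _)
      have hg0 : 0 ≤ g z := by
        have := aDen_self_nonneg hk S.exch_nonneg (st θ z.2)
        simp only [hg]; positivity
      have hsum0 : ∀ i, 0 ≤ (Prod.snd ⁻¹' M.elem i).indicator g z := fun i => indicator_apply_nonneg fun _ => hg0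
      by_cases h2 : z.2 ∈ M.oversampled j (n + 2)
      · rw [indicator_of_notMem (by simpa using h2), zero_add]
        by_cases h1 : z.2 ∈ M.oversampled j (n + 1)
        · rw [hz.2.1 h1]
          have : aDen co ρ σ z (st θ z.2) 0 = 0 := by simp [aDen]
          rw [this, neg_zero]; exact sum_nonneg fun i _ => hsum0 i
        · obtain ⟨i, hi, hzi⟩ := QuadMesh.mem_oversampled.1 h2
          have hi1 : i ∈ R := hR i hi fun h => h1 (QuadMesh.elem_subset_oversampled h hzi)
          refine le_trans ?_ (single_le_sum (f := fun i => (Prod.snd ⁻¹' M.elem i).indicator g z)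
            (fun i _ => hsum0 i) hi1)
          rw [indicator_of_mem (by simpa using hzi)]
          obtain ⟨a, q, ha0, -, hq, hst⟩ := hz.1 i hzi
          rw [hst]
          have h3 := le_aDen_mul (co := co) (ρ := ρ) (σ := σ) hk S.exch_nonneg ha0 q (st θ z.2) ht
          have h4 : ‖q‖ ^ 2 ≤ (4 * (γ / M.meshSize)) ^ 2 := pow_le_pow_left₀ (norm_nonneg _) hq 2
          have h5 := mul_le_mul_of_nonneg_left (mul_le_mul_of_nonneg_right h4 hK) (show 0 ≤ t⁻¹ / 2 by positivity)
          simp only [hg, hc]; simp only [st] at h3 ⊢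
          linarith
      · rw [indicator_of_mem (by simpa using h2), hz.2.2 h2]
        have := sum_nonneg fun i (_ : i ∈ R) => hsum0 i
        linarith)
  rw [integral_neg, integral_neg, ← S.aQ_univ_eq_integral, ← aQ_eq_integral S.lo_pos S.kappa hD] at key
  have h6 : ∑ i ∈ R, ∫ z in Prod.snd ⁻¹' M.elem i, g z ∂G.mu ≤
      ∑ i ∈ R, (t / 2 * aQ co ρ σ (M.elem i) θ θ + t⁻¹ / 2 * (64 * γ ^ 2 * sForm co M i θ.1 θ.1)) := by
    refine sum_le_sum fun i _ => ?_
    rw [hg, integral_add i1.integrableOn i2.integrableOn, integral_const_mul, integral_const_mul,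
      aQ_eq_integral S.lo_pos S.kappa (measurableSet_elem i)]
    have h7 := kap_le_sForm S.lo_pos S.kappa S.grid S.shape i (memLp_restr θ.1)
    rw [wForm] at h7
    have h8 := mul_le_mul_of_nonneg_left h7 (show 0 ≤ t⁻¹ / 2 by positivity)
    rw [hc]; linarith
  linarith

/-- The energy of a complemented cut-off function. -/
lemma aQ_cut_le {j : Fin M.N} {n : ℕ} {θ w : EField G.meas} (hw : IsCut M γ j n θ w) {R : Finset (Fin M.N)}
    (hR : ∀ i, i ∈ M.layer j (n + 2) → i ∉ M.layer j (n + 1) → i ∈ R) :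
    aQ co ρ σ univ w w ≤ aQ co ρ σ (M.oversampled j (n + 2))ᶜ θ θ +
      ∑ i ∈ R, (2 * aQ co ρ σ (M.elem i) θ θ + 128 * γ ^ 2 * sForm co M i θ.1 θ.1) := by
  have hD := (QuadMesh.isClosed_oversampled j (n + 2)).measurableSet.compl
  have iθ := S.integrable_aDen_univ θ θ
  have iw := S.integrable_aDen_univ w w
  have key := S.integral_le_sum_elem hD (R := R) (f := fun z => aDen co ρ σ z (st θ z.2) (st θ z.2))
    (g := fun z => aDen co ρ σ z (st w z.2) (st w z.2)) (F := fun z => aDen co ρ σ z (st w z.2) (st w z.2)) iw iθ iw (by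
      filter_upwards [ae_mu_of_ae_meas hw, S.kappa.ae] with z hz hkz
      have hk : ∀ i, 0 ≤ co.kap i z := fun i => S.lo_pos.le.trans (hkz i).1
      have hg0 := aDen_self_nonneg hk S.exch_nonneg (st w z.2)
      have hsum0 : ∀ i, 0 ≤ (Prod.snd ⁻¹' M.elem i).indicator (fun z => aDen co ρ σ z (st w z.2) (st w z.2)) z :=
        fun i => indicator_apply_nonneg fun _ => hg0
      by_cases h2 : z.2 ∈ M.oversampled j (n + 2)
      · rw [indicator_of_notMem (by simpa using h2), zero_add]
        by_cases h1 : z.2 ∈ M.oversampled j (n + 1)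
        · rw [hz.2.1 h1]
          have : aDen co ρ σ z 0 0 = 0 := by simp [aDen]
          rw [this]; exact sum_nonneg fun i _ => hsum0 i
        · obtain ⟨i, hi, hzi⟩ := QuadMesh.mem_oversampled.1 h2
          have hi1 : i ∈ R := hR i hi fun h => h1 (QuadMesh.elem_subset_oversampled h hzi)
          refine le_trans ?_ (single_le_sum (fun i _ => hsum0 i) hi1)
          rw [indicator_of_mem (by simpa using hzi)]
      · rw [indicator_of_mem (by simpa using h2), hz.2.2 h2]
        exact le_add_of_nonneg_right (sum_nonneg fun i _ => hsum0 i))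
  rw [← S.aQ_univ_eq_integral, ← aQ_eq_integral S.lo_pos S.kappa hD] at key
  refine key.trans (add_le_add le_rfl (sum_le_sum fun i _ => ?_))
  rw [← aQ_eq_integral S.lo_pos S.kappa (measurableSet_elem i)]
  have : ∃ a : Pt → ℝ, ∃ q : Pt → Pt, ∀ᵐ x ∂G.meas.restrict (M.elem i), |a x| ≤ 1 ∧ ‖q x‖ ≤ 4 * (γ / M.meshSize) ∧
      st w x = (a x • θ.1 x, mulGrad (a x) (q x) (θ.1 x, θ.2 x)) := by
    have h1 : ∀ x, ∃ a : ℝ, ∃ q : Pt, (∃ a : ℝ, ∃ q : Pt, |a| ≤ 1 ∧ ‖q‖ ≤ 4 * (γ / M.meshSize) ∧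
        st w x = (a • θ.1 x, mulGrad a q (θ.1 x, θ.2 x))) → |a| ≤ 1 ∧ ‖q‖ ≤ 4 * (γ / M.meshSize) ∧
        st w x = (a • θ.1 x, mulGrad a q (θ.1 x, θ.2 x)) := fun x => by
      by_cases h : ∃ a : ℝ, ∃ q : Pt, |a| ≤ 1 ∧ ‖q‖ ≤ 4 * (γ / M.meshSize) ∧
        st w x = (a • θ.1 x, mulGrad a q (θ.1 x, θ.2 x))
      · obtain ⟨a, q, h'⟩ := h; exact ⟨a, q, fun _ => h'⟩
      · exact ⟨0, 0, fun h' => absurd h' h⟩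
    choose a q haq using h1
    refine ⟨a, q, ?_⟩
    filter_upwards [ae_restrict_of_ae hw, ae_restrict_mem (measurableSet_elem i)] with x hx hxi
    obtain ⟨a', q', h0, h1, h2, h3⟩ := hx.1 i hxi
    exact haq x ⟨a', q', by rw [abs_of_nonneg h0]; exact h1, h2, h3⟩
  obtain ⟨a, q, haq⟩ := this
  exact aQ_elem_mul_le S.lo_pos S.kappa S.grid S.shape S.exch_nonneg i Measure.restrict_le_self w θ haq

/-- The decay rate of the multiscale basis functions per pair of layers. -/
def decayRate (γ lamBar Cπ Λ : ℝ) : ℝ :=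
  QuadMesh.overlap γ * ((1 + 32 * γ ^ 2 + liftConst γ lamBar Cπ / 2) / Real.sqrt Λ)

def cutConst (γ lamBar Cπ Λ : ℝ) : ℝ := 2 + QuadMesh.overlap γ * (4 + (256 * γ ^ 2 + 2 * liftConst γ lamBar Cπ) / Λ)

lemma exists_form : ∃ a : EField G.meas →L[ℝ] EField G.meas →L[ℝ] ℝ, (∀ u v, a u v = aQ co ρ σ univ u v) ∧
      (∀ u v, a u v = a v u) ∧ ∀ u, 0 ≤ a u u := by
  have hν : G.meas.restrict univ ≤ G.meas := Measure.restrict_le_self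
  obtain ⟨a, ha⟩ := exists_aQ_bilin (co := co) S.lo_pos S.kappa S.exch_nonneg MeasurableSet.univ hν
  refine ⟨a, ha, fun u v => ?_, fun u => ?_⟩
  · rw [ha, ha]; exact aQ_symm S.lo_pos S.kappa MeasurableSet.univ hν u v
  · rw [ha]; exact aQ_self_nonneg S.lo_pos S.kappa S.exch_nonneg MeasurableSet.univ hν u

lemma aQ_nonneg {D : Set Pt} (hD : MeasurableSet D) (u : EField G.meas) : 0 ≤ aQ co ρ σ D u u :=
  aQ_self_nonneg S.lo_pos S.kappa S.exch_nonneg hD Measure.restrict_le_self u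

/-- Young's inequality for a field that lives on one element. -/
lemma le_aQ_elem {i : Fin M.N}
    (θ : EField G.meas) {b : EField G.meas} (hb : ∀ᵐ x ∂G.meas, x ∉ M.elem i → st b x = 0) {t : ℝ} (ht : 0 < t) :
    -(t / 2 * aQ co ρ σ (M.elem i) θ θ + t⁻¹ / 2 * aQ co ρ σ univ b b) ≤ aQ co ρ σ univ θ b := by
  have hm := measurableSet_elem i
  have hν : G.meas.restrict (M.elem i) ≤ G.meas := Measure.restrict_le_self
  obtain ⟨a, ha⟩ := exists_aQ_bilin (co := co) S.lo_pos S.kappa S.exch_nonneg hm hν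
  have hsymm : ∀ u v, a u v = a v u := fun u v => by rw [ha, ha]; exact aQ_symm S.lo_pos S.kappa hm hν u v
  have h0 := S.aQ_nonneg (co := co) hm (t • θ + b)
  rw [aQ_symm S.lo_pos S.kappa MeasurableSet.univ Measure.restrict_le_self θ b, aQ_univ_eq S.lo_pos S.kappa hm hb,
    aQ_univ_eq S.lo_pos S.kappa hm hb, aQ_symm S.lo_pos S.kappa hm hν b θ]
  rw [← ha, bilin_add_self hsymm] at h0; simp only [map_smul, smul_apply, smul_eq_mul] at h0
  rw [← ha, ← ha, ← ha]
  have e : t / 2 * a θ θ + t⁻¹ / 2 * a b b + a θ b = (t * (t * a θ θ) + 2 * (t * a θ b) + a b b) / (2 * t) := by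
    field_simp; ring
  have : 0 ≤ (t * (t * a θ θ) + 2 * (t * a θ b) + a b b) / (2 * t) := by positivity
  linarith

/-- A function whose data vanish away from `K_j` is split into a function without data and a
function that lives close to `K_j`. -/
lemma exists_splitting (j : Fin M.N) (n : ℕ)
    {θ : EField G.meas} (hθ : θ ∈ G.V) (hθφ : ∀ i, i ≠ j → ∀ k < L i, sForm co M i θ.1 (φ i k).1 = 0) :
    ∃ w ∈ G.V, (∀ i, ∀ k < L i, sForm co M i w.1 (φ i k).1 = 0) ∧ θ - w ∈ G.V0 (M.oversampled j (n + 3)) ∧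
      aQ co ρ σ (M.oversampled j (n + 2))ᶜ θ θ ≤ aQ co ρ σ univ θ w + decayRate γ lamBar Cπ Λ *
        (aQ co ρ σ (M.oversampled j n)ᶜ θ θ - aQ co ρ σ (M.oversampled j (n + 2))ᶜ θ θ) ∧
      aQ co ρ σ univ w w ≤ cutConst γ lamBar Cπ Λ * aQ co ρ σ (M.oversampled j n)ᶜ θ θ := by
  classical
  have hM := S.grid
  obtain ⟨y₀, hy₀, hcut⟩ := S.exists_cut j n hθ
  choose b hb hb0 hbφ hbφ' hba using fun i => S.exists_lift i y₀
  set R : Finset (Fin M.N) := Finset.univ.filter fun i => i ∈ M.layer j (n + 2) ∧ i ∉ M.layer j (n + 1) with hRdef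
  have hRmem : ∀ i, i ∈ R ↔ i ∈ M.layer j (n + 2) ∧ i ∉ M.layer j (n + 1) := fun i => by simp [hRdef]
  have hRj : ∀ i ∈ R, i ≠ j := fun i hi h => ((hRmem i).1 hi).2 (h ▸ QuadMesh.self_mem_layer hM j (n + 1))
  set w₁ := θ - y₀ with hw₁
  have hw₁cut : IsCut M γ j n θ w₁ := by
    filter_upwards [hcut, ae_meas_mem_elem hM] with x hx ⟨i₀, hi₀⟩
    refine ⟨fun i hi => ?_, hx.2.1, fun hxn => hx.2.2 i₀ (fun h =>
      hxn (QuadMesh.elem_subset_oversampled h hi₀)) hi₀⟩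
    obtain ⟨a, q, h1, h2, h3, h4, -⟩ := hx.1 i hi
    exact ⟨a, q, h1, h2, h3, h4⟩
  have hbV : ∀ i, b i ∈ G.V := fun i => V0_le_V _ (hb i)
  have hy₀V : y₀ ∈ G.V := V0_le_V _ hy₀
  have hw₁V : w₁ ∈ G.V := G.V.sub_mem hθ hy₀V
  have hwV : w₁ + ∑ i ∈ R, b i ∈ G.V := G.V.add_mem hw₁V (Submodule.sum_mem _ fun i _ => hbV i)
  have hRR : ∀ i, i ∈ M.layer j (n + 2) → i ∉ M.layer j (n + 1) → i ∈ R := fun i h1 h2 => (hRmem i).2 ⟨h1, h2⟩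
  choose d hd using S.exists_data
  have hΛ := S.gap_pos
  have hD0 := S.liftConst_nonneg
  set D := liftConst γ lamBar Cπ with hDdef
  -- bounds for the elements in the ring
  have hs : ∀ i ∈ R, sForm co M i θ.1 θ.1 ≤ Λ⁻¹ * aQ co ρ σ (M.elem i) θ θ := fun i hi => by
    rw [← div_eq_inv_mul, le_div_iff₀ hΛ, mul_comm]; exact S.gap hθ fun k hk => hθφ i (hRj i hi) k hk
  have hbs : ∀ i ∈ R, aQ co ρ σ univ (b i) (b i) ≤ D * sForm co M i θ.1 θ.1 := fun i hi =>
    (hba i).trans (mul_le_mul_of_nonneg_left (sForm_mono S.lo_pos S.kappa S.grid S.shape (by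
      filter_upwards [hcut] with x hx hxi
      obtain ⟨a, q, h1, h2, h3, h4, h5⟩ := hx.1 i hxi
      exact ⟨1 - a, by rw [abs_le]; constructor <;> linarith, h5⟩)) hD0)
  have hXm : MeasurableSet (M.oversampled j n)ᶜ := (QuadMesh.isClosed_oversampled j n).measurableSet.compl
  have hXm2 : MeasurableSet (M.oversampled j (n + 2))ᶜ := (QuadMesh.isClosed_oversampled j (n + 2)).measurableSet.compl
  have hXX : (M.oversampled j (n + 2))ᶜ ⊆ (M.oversampled j n)ᶜ :=
    compl_subset_compl.2 (QuadMesh.oversampled_mono hM j (by omega))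
  have hdiff := aQ_add_compl (ρ := ρ) (σ := σ) S.lo_pos S.kappa hXm2 hXm hXX θ
  have hov0 : 0 ≤ QuadMesh.overlap γ := by
    have := S.shape.card_le_overlap hM 0 ∅ (by simp)
    simpa using this
  have hring : ∑ i ∈ R, aQ co ρ σ (M.elem i) θ θ ≤ QuadMesh.overlap γ *
      (aQ co ρ σ (M.oversampled j n)ᶜ θ θ - aQ co ρ σ (M.oversampled j (n + 2))ᶜ θ θ) := by
    have h1 := sum_aQ_elem_le (ρ := ρ) (σ := σ) S.lo_pos S.kappa hM S.shape S.exch_nonneg R (hXm.diff hXm2) (fun i hi => by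
      obtain ⟨h1, h2⟩ := (hRmem i).1 hi
      intro x hx; exact ⟨QuadMesh.elem_subset_compl h2 hx, fun h => h (QuadMesh.elem_subset_oversampled h1 hx)⟩) θ
    refine h1.trans (le_of_eq ?_)
    rw [← hdiff]; ring
  have hX2 := S.aQ_nonneg (co := co) (ρ := ρ) (σ := σ) hXm2 θ
  obtain ⟨A, hA, hAsymm, hA0⟩ := S.exists_form
  refine ⟨w₁ + ∑ i ∈ R, b i, hwV, fun i k hk => ?_, ?_, ?_, ?_⟩
  · rw [← hd, map_add, map_sum]
    by_cases hi : i ∈ R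
    · rw [sum_eq_single i, hd, hd, hbφ i k hk, ← hd, ← hd, ← map_add, hw₁, sub_add_cancel, hd]
      · exact hθφ i (hRj i hi) k hk
      · intro i' _ hi'; rw [hd, hbφ' i' i hi'.symm]
      · exact fun h => absurd hi h
    · rw [sum_eq_zero, add_zero]
      · by_cases h2 : i ∈ M.layer j (n + 1)
        · rw [hd]
          refine S.sForm_eq_zero ?_ _
          filter_upwards [hcut] with x hx hxi
          exact congrArg Prod.fst (hx.2.1 (QuadMesh.elem_subset_oversampled h2 hxi))
        · have h3 : i ∉ M.layer j (n + 2) := fun h => hi (hRR i h h2)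
          have hij : i ≠ j := fun h => h2 (h ▸ QuadMesh.self_mem_layer hM j (n + 1))
          rw [← hθφ i hij k hk, hd]
          refine S.sForm_eq_of_ae ?_ _
          filter_upwards [hcut] with x hx hxi
          exact congrArg Prod.fst (hx.2.2 i h3 hxi)
      · intro i' hi'; rw [hd, hbφ' i' i (fun h => hi (h ▸ hi'))]
  · have e : θ - (w₁ + ∑ i ∈ R, b i) = y₀ - ∑ i ∈ R, b i := by rw [hw₁]; abel
    rw [e]
    exact Submodule.sub_mem _ hy₀ (Submodule.sum_mem _ fun i hi =>
      V0_mono (QuadMesh.elem_subset_oversampled (QuadMesh.layer_mono hM j (by omega) ((hRmem i).1 hi).1)) (hb i))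
  · have ht : 0 < (Real.sqrt Λ)⁻¹ := by positivity
    have h1 := S.le_aQ_cut hw₁cut hRR ht
    have h2 : aQ co ρ σ univ θ (w₁ + ∑ i ∈ R, b i) = aQ co ρ σ univ θ w₁ + ∑ i ∈ R, aQ co ρ σ univ θ (b i) := by
      simp only [← hA, map_add, map_sum]
    have h3 := sum_le_sum fun i (hi : i ∈ R) => S.le_aQ_elem θ ((hb0 i).mono fun x hx => hx.1) ht
    have h4 : ∑ i ∈ R, ((Real.sqrt Λ)⁻¹ / 2 * aQ co ρ σ (M.elem i) θ θ +
          (Real.sqrt Λ)⁻¹⁻¹ / 2 * (64 * γ ^ 2 * sForm co M i θ.1 θ.1)) +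
        ∑ i ∈ R, ((Real.sqrt Λ)⁻¹ / 2 * aQ co ρ σ (M.elem i) θ θ + (Real.sqrt Λ)⁻¹⁻¹ / 2 * aQ co ρ σ univ (b i) (b i)) ≤
        (1 + 32 * γ ^ 2 + D / 2) / Real.sqrt Λ * ∑ i ∈ R, aQ co ρ σ (M.elem i) θ θ := by
      rw [← sum_add_distrib, mul_sum]
      refine sum_le_sum fun i hi => ?_
      have h5 := hbs i hi
      have h6 := hs i hi
      have h7 : Real.sqrt Λ * Λ⁻¹ = (Real.sqrt Λ)⁻¹ := by
        have h8 : Λ = Real.sqrt Λ * Real.sqrt Λ := (Real.mul_self_sqrt hΛ.le).symm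
        have h9 : Real.sqrt Λ ≠ 0 := (Real.sqrt_pos.2 hΛ).ne'
        nth_rewrite 2 [h8]
        field_simp
      have h8 : Real.sqrt Λ * sForm co M i θ.1 θ.1 ≤ (Real.sqrt Λ)⁻¹ * aQ co ρ σ (M.elem i) θ θ := by
        rw [← h7, mul_assoc]; exact mul_le_mul_of_nonneg_left h6 (Real.sqrt_nonneg _)
      have h9 := mul_le_mul_of_nonneg_left h5 (show 0 ≤ Real.sqrt Λ / 2 by positivity)
      have h10 := mul_le_mul_of_nonneg_left h8 (show 0 ≤ 32 * γ ^ 2 + D / 2 by positivity)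
      rw [inv_inv, div_eq_mul_inv _ (Real.sqrt Λ)]; linarith
    rw [Finset.sum_neg_distrib] at h3
    have h11 := mul_le_mul_of_nonneg_left hring (show 0 ≤ (1 + 32 * γ ^ 2 + D / 2) / Real.sqrt Λ by positivity)
    rw [h2, decayRate]; linarith
  · have h1 := S.aQ_cut_le hw₁cut hRR
    have h2 : A (∑ i ∈ R, b i) (∑ i ∈ R, b i) = ∑ i ∈ R, A (b i) (b i) := by
      simp only [map_sum, sum_apply]
      refine sum_congr rfl fun i hi => ?_
      rw [sum_eq_single_of_mem i hi]; intro i' _ hii'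
      rw [hA, aQ_univ_eq S.lo_pos S.kappa (measurableSet_elem i') ((hb0 i').mono fun x hx => hx.1),
        aQ_eq_integral S.lo_pos S.kappa (measurableSet_elem i')]
      refine integral_eq_zero_of_ae ?_
      filter_upwards [ae_restrict_of_ae (ae_mu_of_ae_meas (hb0 i)), ae_restrict_mem (measurable_snd (measurableSet_elem i'))]
        with z hz hzi
      rw [hz.2 i' hii' hzi]; simp [aDen]
    have h3 := bilin_add_self_le hAsymm hA0 w₁ (∑ i ∈ R, b i)
    rw [h2] at h3; simp only [hA] at h3
    have h4 : 2 * ∑ i ∈ R, (2 * aQ co ρ σ (M.elem i) θ θ + 128 * γ ^ 2 * sForm co M i θ.1 θ.1) +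
        2 * ∑ i ∈ R, aQ co ρ σ univ (b i) (b i) ≤ (4 + (256 * γ ^ 2 + 2 * D) / Λ) * ∑ i ∈ R, aQ co ρ σ (M.elem i) θ θ := by
      rw [mul_sum, mul_sum, mul_sum, ← sum_add_distrib]
      refine sum_le_sum fun i hi => ?_
      have h5 := hbs i hi
      have h6 := mul_le_mul_of_nonneg_left (hs i hi) (show 0 ≤ 256 * γ ^ 2 + 2 * D by positivity)
      rw [div_eq_mul_inv]; linarith
    have h5 := mul_le_mul_of_nonneg_left hring (show 0 ≤ 4 + (256 * γ ^ 2 + 2 * D) / Λ by positivity)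
    have h6 := aQ_mono (ρ := ρ) (σ := σ) S.lo_pos S.kappa S.exch_nonneg hXm2 hXm hXX θ
    have h7 := mul_nonneg (mul_nonneg hov0 (show 0 ≤ 4 + (256 * γ ^ 2 + 2 * D) / Λ by positivity)) hX2
    rw [cutConst]; linarith

/-- The factor by which the energy decays over two layers. -/
def decayFactor (γ lamBar Cπ Λ : ℝ) : ℝ := decayRate γ lamBar Cπ Λ / (1 + decayRate γ lamBar Cπ Λ)

lemma overlap_nonneg : 0 ≤ QuadMesh.overlap γ := by
  have := S.shape.card_le_overlap S.grid 0 ∅ (by simp)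
  simpa using this

lemma decayRate_nonneg : 0 ≤ decayRate γ lamBar Cπ Λ := by
  have h1 := S.liftConst_nonneg
  have h2 := S.overlap_nonneg
  unfold decayRate; positivity

lemma cutConst_nonneg : 0 ≤ cutConst γ lamBar Cπ Λ := by
  have h1 := S.liftConst_nonneg
  have h2 := S.overlap_nonneg
  have := S.gap_pos
  unfold cutConst; positivity

lemma decayFactor_nonneg : 0 ≤ decayFactor γ lamBar Cπ Λ := by
  have := S.decayRate_nonneg
  unfold decayFactor; positivity

lemma decay (j : Fin M.N)
    {θ : EField G.meas} (hθ : θ ∈ G.V) (hθφ : ∀ i, i ≠ j → ∀ k < L i, sForm co M i θ.1 (φ i k).1 = 0)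
    (hθa : ∀ w ∈ G.V, (∀ i, ∀ k < L i, sForm co M i w.1 (φ i k).1 = 0) → aQ co ρ σ univ θ w = 0) (n k : ℕ) :
    aQ co ρ σ (M.oversampled j (n + 2 * k))ᶜ θ θ ≤
      decayFactor γ lamBar Cπ Λ ^ k * aQ co ρ σ (M.oversampled j n)ᶜ θ θ := by
  have hτ := S.decayRate_nonneg
  have hq := S.decayFactor_nonneg
  induction k with
  | zero => simp
  | succ k ih =>
    obtain ⟨w, hw, hwφ, -, h1, -⟩ := S.exists_splitting j (n + 2 * k) hθ hθφ
    rw [hθa w hw hwφ, zero_add] at h1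
    have h2 : aQ co ρ σ (M.oversampled j (n + 2 * k + 2))ᶜ θ θ ≤
        decayFactor γ lamBar Cπ Λ * aQ co ρ σ (M.oversampled j (n + 2 * k))ᶜ θ θ := by
      rw [decayFactor, div_mul_eq_mul_div, le_div_iff₀ (by positivity)]; linarith
    have e : n + 2 * (k + 1) = n + 2 * k + 2 := by ring
    rw [e, pow_succ', mul_assoc]; exact h2.trans (mul_le_mul_of_nonneg_left ih hq)

/-- The localization error of a function in the multiscale space. -/
lemma corrector_le (j : Fin M.N) {m : ℕ} (hm : 3 ≤ m) {Ψ z : EField G.meas} (hΨ : Ψ ∈ G.V0 (M.oversampled j m))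
    (hΨφ : ∀ i, i ≠ j → ∀ k < L i, sForm co M i Ψ.1 (φ i k).1 = 0)
    (hΨa : ∀ w ∈ G.V0 (M.oversampled j m), (∀ i, ∀ k < L i, sForm co M i w.1 (φ i k).1 = 0) → aQ co ρ σ univ Ψ w = 0)
    (hz : z ∈ G.V) (hzφ : ∀ i, ∀ k < L i, sForm co M i z.1 (φ i k).1 = 0)
    (hza : ∀ w ∈ G.V, (∀ i, ∀ k < L i, sForm co M i w.1 (φ i k).1 = 0) → aQ co ρ σ univ z w = aQ co ρ σ univ Ψ w) :
    aQ co ρ σ univ z z ≤ cutConst γ lamBar Cπ Λ * (decayFactor γ lamBar Cπ Λ ^ ((m - 3) / 2) * aQ co ρ σ univ Ψ Ψ) := by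
  obtain ⟨A, hA, hAs, hA0⟩ := S.exists_form
  choose d hd using S.exists_data
  have hΨV := V0_le_V _ hΨ
  set θ := Ψ - z with hθdef
  have hθ : θ ∈ G.V := G.V.sub_mem hΨV hz
  have hθφ : ∀ i, i ≠ j → ∀ k < L i, sForm co M i θ.1 (φ i k).1 = 0 := fun i hi k hk => by
    rw [← hd, hθdef, map_sub, hd, hd, hΨφ i hi k hk, hzφ i k hk, sub_zero]
  have hθa : ∀ w ∈ G.V, (∀ i, ∀ k < L i, sForm co M i w.1 (φ i k).1 = 0) → aQ co ρ σ univ θ w = 0 := fun w hw hwφ => by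
    rw [← hA, hθdef, map_sub, sub_apply, hA, hA, hza w hw hwφ, sub_self]
  obtain ⟨w, hw, hwφ, hwθ, -, h1⟩ := S.exists_splitting j (m - 3) hθ hθφ
  rw [show m - 3 + 3 = m by omega] at hwθ
  have h2 : aQ co ρ σ univ z (z + w) = 0 := by
    rw [hza _ (G.V.add_mem hz hw) fun i k hk => by rw [← hd, map_add, hd, hd, hzφ i k hk, hwφ i k hk, add_zero]]
    refine hΨa _ ?_ fun i k hk => by rw [← hd, map_add, hd, hd, hzφ i k hk, hwφ i k hk, add_zero]
    have e : z + w = Ψ - (θ - w) := by rw [hθdef]; abel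
    rw [e]; exact Submodule.sub_mem _ hΨ hwθ
  have h3 : A z z ≤ A w w := by
    rw [← hA, map_add] at h2
    have h4 := sq_bilin_le hAs hA0 z w
    have h5 : A z w = - A z z := by linarith
    rw [h5, neg_sq] at h4
    rcases (hA0 z).eq_or_lt with h6 | h6
    · rw [← h6]; exact hA0 w
    · rw [pow_two] at h4; exact le_of_mul_le_mul_left h4 h6
  have h4 : aQ co ρ σ univ θ θ ≤ aQ co ρ σ univ Ψ Ψ := by
    have h5 : A θ z = 0 := by rw [hA]; exact hθa z hz hzφ
    have h6 : Ψ = θ + z := by rw [hθdef]; abel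
    rw [← hA, ← hA, h6, bilin_add_self hAs, h5]; linarith [hA0 z]
  have h5 : aQ co ρ σ (M.oversampled j (m - 3))ᶜ θ θ ≤ decayFactor γ lamBar Cπ Λ ^ ((m - 3) / 2) * aQ co ρ σ univ Ψ Ψ := by
    have h6 := S.decay j hθ hθφ hθa ((m - 3) % 2) ((m - 3) / 2)
    rw [Nat.mod_add_div] at h6
    refine h6.trans (mul_le_mul_of_nonneg_left (le_trans ?_ h4) (pow_nonneg S.decayFactor_nonneg _))
    exact aQ_mono S.lo_pos S.kappa S.exch_nonneg (QuadMesh.isClosed_oversampled _ _).measurableSet.compl MeasurableSet.univ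
      (subset_univ _) θ
  rw [hA, hA] at h3; exact h3.trans (h1.trans (mul_le_mul_of_nonneg_left h5 S.cutConst_nonneg))

/-- Functions without data satisfy a Poincaré inequality on the scale of the mesh size. -/
lemma norm_sq_le_kernel {w : EField G.meas} (hw : w ∈ G.V) (hwφ : ∀ i, ∀ k < L i, sForm co M i w.1 (φ i k).1 = 0) :
    lo * ‖w.1‖ ^ 2 ≤ 4 * M.meshSize ^ 2 * G.aperSup * Λ⁻¹ * QuadMesh.overlap γ * aQ co ρ σ univ w w := by
  have hsup := G.one_le_aperSup
  have h1 := mul_le_mul_of_nonneg_left (norm_sq_le_sum_restrField S.grid w) S.lo_pos.le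
  have h2 := sum_aQ_elem_le (ρ := ρ) (σ := σ) S.lo_pos S.kappa S.grid S.shape S.exch_nonneg Finset.univ MeasurableSet.univ
    (fun i _ => subset_univ _) w
  have hΛ := S.gap_pos
  refine h1.trans ?_
  rw [mul_sum]
  calc ∑ i, lo * ‖(restrField G (M.elem i) w).1‖ ^ 2
      ≤ ∑ i, 4 * M.meshSize ^ 2 * G.aperSup * Λ⁻¹ * aQ co ρ σ (M.elem i) w w := by
        refine sum_le_sum fun i _ => ?_
        have h3 := norm_sq_le_sForm S.lo_pos S.kappa S.grid S.shape i (restrField G (M.elem i) w).1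
        rw [sForm_restrField_self S.lo_pos S.kappa S.grid S.shape] at h3
        refine h3.trans ?_
        have h4 : sForm co M i w.1 w.1 ≤ Λ⁻¹ * aQ co ρ σ (M.elem i) w w := by
          rw [← div_eq_inv_mul, le_div_iff₀ hΛ, mul_comm]; exact S.gap hw (hwφ i)
        rw [mul_assoc (4 * M.meshSize ^ 2 * G.aperSup)]; exact mul_le_mul_of_nonneg_left h4 (by positivity)
    _ ≤ _ := by
        rw [← mul_sum, mul_assoc (4 * M.meshSize ^ 2 * G.aperSup * Λ⁻¹)]
        exact mul_le_mul_of_nonneg_left h2 (by positivity)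

lemma norm_fst_sq_le {CF : ℝ} (hCF0 : 0 < CF)
    (hCF : ∀ v ∈ G.V, ‖v.1‖ ^ 2 ≤ CF * ‖v.2‖ ^ 2) {v : EField G.meas} (hv : v ∈ G.V) :
    lo * ‖v.1‖ ^ 2 ≤ CF * G.aperSup * aQ co ρ σ univ v v := by
  have h1 := norm_grad_sq_le S.lo_pos S.kappa S.exch_nonneg MeasurableSet.univ (ν := G.meas) Measure.restrict_univ v
  have h2 := mul_le_mul_of_nonneg_left (hCF v hv) S.lo_pos.le
  have h3 := mul_le_mul_of_nonneg_left h1 hCF0.le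
  linarith

lemma exists_coercive : ∃ C > 0, ∀ v ∈ G.V, ‖v‖ ^ 2 ≤ C * aQ co ρ σ univ v v := by
  obtain ⟨CF, hCF0, hCF⟩ := exists_friedrichs G
  have hsup := G.one_le_aperSup
  have hlo := S.lo_pos
  refine ⟨(CF * G.aperSup + G.aperSup) / lo, by positivity, fun v hv => ?_⟩
  have h1 := norm_grad_sq_le S.lo_pos S.kappa S.exch_nonneg MeasurableSet.univ (ν := G.meas) Measure.restrict_univ v
  have h2 := S.norm_fst_sq_le hCF0 hCF hv
  have h3 := mul_le_mul_of_nonneg_left (norm_sq_le_add _ v) hlo.le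
  rw [div_mul_eq_mul_div, le_div_iff₀ hlo]; linarith

/-- The `a_Q`-orthogonal projection to the functions without data. -/
lemma exists_kernel_projection (u : EField G.meas) : ∃ z ∈ G.V, (∀ i, ∀ k < L i, sForm co M i z.1 (φ i k).1 = 0) ∧
      ∀ w ∈ G.V, (∀ i, ∀ k < L i, sForm co M i w.1 (φ i k).1 = 0) → aQ co ρ σ univ z w = aQ co ρ σ univ u w := by
  obtain ⟨A, hA, hAs, hA0⟩ := S.exists_form
  obtain ⟨W, hWc, hWV, hW⟩ := S.exists_kernel
  obtain ⟨C, hC0, hC⟩ := S.exists_coercive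
  obtain ⟨z, hz, hzw⟩ := exists_represent hAs hWc hC0 (fun v hv => by rw [hA]; exact hC v (hWV hv)) (A u)
  refine ⟨z, hWV hz, (hW z (hWV hz)).1 hz, fun w hw hwφ => ?_⟩
  rw [← hA, ← hA]; exact hzw w ((hW w hw).2 hwφ)

/-- The multiscale function with the data of `u` on `K_j`. -/
lemma exists_multiscale {m : ℕ}
    {ψ : Fin M.N → ℕ → EField G.meas} (hψ : IsMultiscaleBasis co ρ σ M L φ m ψ) (u : EField G.meas) (j : Fin M.N) :
    ∃ Ψ ∈ msSpace M L ψ, Ψ ∈ G.V0 (M.oversampled j m) ∧ (∀ i, i ≠ j → ∀ k < L i, sForm co M i Ψ.1 (φ i k).1 = 0) ∧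
      (∀ k < L j, sForm co M j Ψ.1 (φ j k).1 = sForm co M j u.1 (φ j k).1) ∧
      (∀ w ∈ G.V0 (M.oversampled j m), (∀ i, ∀ k < L i, sForm co M i w.1 (φ i k).1 = 0) → aQ co ρ σ univ Ψ w = 0) ∧
      aQ co ρ σ univ Ψ Ψ ≤ liftConst γ lamBar Cπ * sForm co M j u.1 u.1 := by
  obtain ⟨A, hA, hAs, hA0⟩ := S.exists_form
  choose d hd using S.exists_data
  set Ψ := ∑ k ∈ Finset.range (L j), d j k u • ψ j k with hΨdef
  have hψV : ∀ k < L j, ψ j k ∈ G.V0 (M.oversampled j m) := fun k hk => (hψ j k hk).1.1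
  have hψd : ∀ k < L j, ∀ i, ∀ k' < L i, d i k' (ψ j k) = if j = i ∧ k = k' then 1 else 0 := fun k hk i k' hk' => by
    rw [hd]; exact (hψ j k hk).1.2 i k' hk'
  have hEL : ∀ k < L j, ∀ w ∈ G.V0 (M.oversampled j m), (∀ i, ∀ k < L i, sForm co M i w.1 (φ i k).1 = 0) →
      A (ψ j k) w = 0 := fun k hk w hw hwφ => by
    refine eq_zero_of_quadratic_nonneg (c := A w w) fun t => ?_
    have h1 := (hψ j k hk).2 (show ψ j k + t • w ∈ _ from ⟨Submodule.add_mem _ (hψV k hk) (Submodule.smul_mem _ t hw),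
      fun i k' hk' => by
        rw [← hd, map_add, map_smul, hd i k' w, hwφ i k' hk', smul_zero, add_zero]; exact hψd k hk i k' hk'⟩)
    simp only [mem_setOf_eq] at h1; rw [← hA, ← hA, bilin_add_self hAs] at h1
    simp only [map_smul, smul_apply, smul_eq_mul] at h1; linarith
  have hΨV : Ψ ∈ G.V0 (M.oversampled j m) := Submodule.sum_mem _ fun k hk =>
    Submodule.smul_mem _ _ (hψV k (Finset.mem_range.1 hk))
  have hΨa : ∀ w ∈ G.V0 (M.oversampled j m), (∀ i, ∀ k < L i, sForm co M i w.1 (φ i k).1 = 0) → A Ψ w = 0 := fun w hw hwφ => by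
    rw [hΨdef, map_sum, sum_apply]
    refine sum_eq_zero fun k hk => ?_
    rw [map_smul, smul_apply, hEL k (Finset.mem_range.1 hk) w hw hwφ, smul_zero]
  have hd1 : ∀ i, i ≠ j → ∀ k < L i, d i k Ψ = 0 := fun i hi k hk => by
    rw [hΨdef, map_sum]
    refine sum_eq_zero fun k' hk' => ?_
    rw [map_smul, hψd k' (Finset.mem_range.1 hk') i k hk, if_neg (fun h => hi h.1.symm), smul_zero]
  have hd2 : ∀ k < L j, d j k Ψ = d j k u := fun k hk => by
    rw [hΨdef, map_sum, sum_eq_single_of_mem k (Finset.mem_range.2 hk)]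
    · rw [map_smul, hψd k hk j k hk, if_pos ⟨rfl, rfl⟩, smul_eq_mul, mul_one]
    · intro k' hk' hne; rw [map_smul, hψd k' (Finset.mem_range.1 hk') j k hk, if_neg (fun h => hne h.2), smul_zero]
  refine ⟨Ψ, Submodule.sum_mem _ fun k hk => Submodule.smul_mem _ _ (Submodule.subset_span ⟨j, k, Finset.mem_range.1 hk, rfl⟩),
    hΨV, fun i hi k hk => by rw [← hd]; exact hd1 i hi k hk, fun k hk => by rw [← hd, ← hd]; exact hd2 k hk,
    fun w hw hwφ => by rw [← hA]; exact hΨa w hw hwφ, ?_⟩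
  obtain ⟨b, hb, -, hbφ, hbφ', hba⟩ := S.exists_lift j u
  refine le_trans ?_ hba
  have hbV : b ∈ G.V0 (M.oversampled j m) :=
    V0_mono (QuadMesh.elem_subset_oversampled (QuadMesh.self_mem_layer S.grid j m)) hb
  have h1 := hΨa (b - Ψ) (Submodule.sub_mem _ hbV hΨV) fun i k hk => by
    rw [← hd, map_sub]
    rcases eq_or_ne i j with rfl | hi
    · rw [hd2 k hk, hd, hbφ k hk, ← hd, sub_self]
    · rw [hd1 i hi k hk, hd, hbφ' i hi k, sub_zero]
  have h2 := bilin_add_self hAs Ψ (b - Ψ)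
  rw [h1, add_sub_cancel] at h2; rw [← hA, ← hA, h2]
  linarith [hA0 (b - Ψ)]

/-- The approximation error of the multiscale space for the elliptic problem. -/
lemma exists_elliptic_approx {m : ℕ} (hm : 3 ≤ m)
    {ψ : Fin M.N → ℕ → EField G.meas} (hψ : IsMultiscaleBasis co ρ σ M L φ m ψ) {CF : ℝ} (hCF0 : 0 < CF)
    (hCF : ∀ v ∈ G.V, ‖v.1‖ ^ 2 ≤ CF * ‖v.2‖ ^ 2) {u : EField G.meas} (hu : u ∈ G.V) {K : ℝ} (hK : 0 ≤ K)
    (huK : ∀ v ∈ G.V, aQ co ρ σ univ u v ≤ K * ‖v.1‖) :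
    ∃ w ∈ msSpace M L ψ, aQ co ρ σ univ (u - w) (u - w) ≤
      (2 * (4 * M.meshSize ^ 2 * G.aperSup * Λ⁻¹ * QuadMesh.overlap γ / lo) +
      2 * (M.N * (cutConst γ lamBar Cπ Λ * decayFactor γ lamBar Cπ Λ ^ ((m - 3) / 2) * (liftConst γ lamBar Cπ *
        (hi * (4 * (γ / M.meshSize) ^ 2) * G.aperInv * (QuadMesh.overlap γ * (CF * G.aperSup / lo) ^ 2)))))) * K ^ 2 := by
  obtain ⟨A, hA, hAs, hA0⟩ := S.exists_form
  choose d hd using S.exists_data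
  choose Ψ hΨm hΨV hΨφ hΨφ' hΨa hΨΨ using S.exists_multiscale hψ u
  obtain ⟨z, hz, hzφ, hza⟩ := S.exists_kernel_projection u
  choose y hy hyφ hya using fun j => S.exists_kernel_projection (Ψ j)
  have hlo := S.lo_pos
  have hΛ := S.gap_pos
  have hsup := G.one_le_aperSup
  have hov := S.overlap_nonneg
  have hq := S.decayFactor_nonneg
  have hcc := S.cutConst_nonneg
  have hll := S.liftConst_nonneg
  have hhi := S.hi_nonneg
  have hinv := G.aperInv_nonneg
  refine ⟨∑ j, Ψ j, Submodule.sum_mem _ fun j _ => hΨm j, ?_⟩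
  set e := u - ∑ j, Ψ j with hedef
  have heV : e ∈ G.V := G.V.sub_mem hu (Submodule.sum_mem _ fun j _ => V0_le_V _ (hΨV j))
  have heφ : ∀ i, ∀ k < L i, sForm co M i e.1 (φ i k).1 = 0 := fun i k hk => by
    rw [← hd, hedef, map_sub, map_sum, sum_eq_single i, hd, hd, hΨφ' i k hk, sub_self]
    · intro j _ hj; rw [hd]; exact hΨφ j i hj.symm k hk
    · exact fun h => absurd (Finset.mem_univ i) h
  set g := z - ∑ j, y j with hgdef
  have hge : A g e = A e e := by
    have h1 : ∀ x, A g x = A z x - ∑ j, A (y j) x := fun x => by rw [hgdef, map_sub, map_sum, sub_apply, sum_apply]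
    have h2 : ∀ x, A e x = A u x - ∑ j, A (Ψ j) x := fun x => by rw [hedef, map_sub, map_sum, sub_apply, sum_apply]
    rw [h1, h2, hA, hza e heV heφ, hA]; congr 1
    refine sum_congr rfl fun j _ => ?_
    rw [hA, hA, hya j e heV heφ]
  have heg : A e e ≤ A g g := by
    have h4 := sq_bilin_le hAs hA0 g e
    rw [hge] at h4
    rcases (hA0 e).eq_or_lt with h6 | h6
    · rw [← h6]; exact hA0 g
    · rw [pow_two] at h4; exact le_of_mul_le_mul_right h4 h6
  have hg2 : A g g ≤ 2 * A z z + 2 * (M.N * ∑ j, A (y j) (y j)) := by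
    have h1 := bilin_add_self_le hAs hA0 z (-∑ j, y j)
    rw [← sub_eq_add_neg, ← hgdef] at h1; simp only [map_neg, neg_apply, neg_neg] at h1
    have h2 := bilin_sum_self_le hAs hA0 Finset.univ y
    rw [Finset.card_univ, Fintype.card_fin] at h2; linarith
  have hzz : A z z ≤ 4 * M.meshSize ^ 2 * G.aperSup * Λ⁻¹ * QuadMesh.overlap γ / lo * K ^ 2 := by
    have h1 := S.norm_sq_le_kernel hz hzφ
    have h2 : A z z ≤ K * ‖z.1‖ := by rw [hA, hza z hz hzφ]; exact huK z hz
    rw [← hA] at h1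
    rcases (hA0 z).eq_or_lt with h6 | h6
    · rw [← h6]; positivity
    · have h3 : (A z z) ^ 2 ≤ (K * ‖z.1‖) ^ 2 := pow_le_pow_left₀ h6.le h2 2
      have h4 := mul_le_mul_of_nonneg_left h1 (sq_nonneg K)
      rw [div_mul_eq_mul_div, le_div_iff₀ hlo]
      refine le_of_mul_le_mul_right ?_ h6
      have h5 := mul_le_mul_of_nonneg_left h3 hlo.le
      linarith
  have hyy : ∑ j, A (y j) (y j) ≤ cutConst γ lamBar Cπ Λ * decayFactor γ lamBar Cπ Λ ^ ((m - 3) / 2) * (liftConst γ lamBar Cπ *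
        (hi * (4 * (γ / M.meshSize) ^ 2) * G.aperInv * (QuadMesh.overlap γ * (CF * G.aperSup / lo) ^ 2))) * K ^ 2 := by
    have h1 : ∀ j, A (y j) (y j) ≤ cutConst γ lamBar Cπ Λ * decayFactor γ lamBar Cπ Λ ^ ((m - 3) / 2) *
        (liftConst γ lamBar Cπ * sForm co M j u.1 u.1) := fun j => by
      rw [hA, mul_assoc]
      refine (S.corrector_le j hm (hΨV j) (hΨφ j) (hΨa j) (hy j) (hyφ j) (hya j)).trans ?_
      have := hΨΨ j
      gcongr
    have h2 : ‖u.1‖ ≤ CF * G.aperSup / lo * K := by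
      have h3 := S.norm_fst_sq_le hCF0 hCF hu
      have h4 := huK u hu
      rcases (norm_nonneg u.1).eq_or_lt with h5 | h5
      · rw [← h5]; positivity
      · rw [div_mul_eq_mul_div, le_div_iff₀ hlo]
        refine le_of_mul_le_mul_right ?_ h5
        have := mul_le_mul_of_nonneg_left h4 (show 0 ≤ CF * G.aperSup by positivity)
        linarith
    have h3 : ‖u.1‖ ^ 2 ≤ (CF * G.aperSup / lo) ^ 2 * K ^ 2 := by
      rw [← mul_pow]; exact pow_le_pow_left₀ (norm_nonneg _) h2 2
    have h4 := sum_sForm_le S.lo_pos S.kappa S.grid S.shape S.hi_nonneg u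
    refine (sum_le_sum fun j _ => h1 j).trans ?_
    rw [← mul_sum, ← mul_sum]
    have h5 : hi * (4 * (γ / M.meshSize) ^ 2) * G.aperInv * (QuadMesh.overlap γ * ‖u.1‖ ^ 2) ≤
        hi * (4 * (γ / M.meshSize) ^ 2) * G.aperInv * (QuadMesh.overlap γ * ((CF * G.aperSup / lo) ^ 2 * K ^ 2)) := by
      gcongr
    have h6 := mul_le_mul_of_nonneg_left (mul_le_mul_of_nonneg_left (h4.trans h5) hll)
      (show 0 ≤ cutConst γ lamBar Cπ Λ * decayFactor γ lamBar Cπ Λ ^ ((m - 3) / 2) by positivity)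
    linarith
  rw [← hA]
  have h7 := mul_le_mul_of_nonneg_left hyy (show (0 : ℝ) ≤ M.N by positivity)
  linarith

end MultiscaleSetting

namespace MultiscaleSetting

lemma decayFactor_eq {γ lamBar Cπ Λ : ℝ} (hB : 0 ≤ decayRate γ lamBar Cπ Λ) :
    decayFactor γ lamBar Cπ Λ = 1 - 1 / (1 + decayRate γ lamBar Cπ Λ) := by
  unfold decayFactor; field_simp; ring

/-- The powers of the mesh size are absorbed by the decay. -/
lemma localization_le {N H lo hi V c c₀ B D P γ Λ x y qe qs : ℝ} (hH : 0 < H) (hlo : 0 < lo) (hhi : 0 ≤ hi)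
    (hΛ : 0 < Λ) (hN : 0 ≤ N) (hNV : N ≤ V * (H⁻¹) ^ 2) (hc : 0 ≤ c) (hcc : c ≤ c₀) (hD : 0 ≤ D) (hP : 0 ≤ P)
    (hqe : 0 ≤ qe) (hqs : 0 ≤ qs) (hx : qe ≤ x) (hs : qs ≤ B ^ 2 * Λ⁻¹) (hy : hi * (H⁻¹) ^ 6 ≤ y * (lo⁻¹) ^ 5)
    (hV : 0 ≤ V) (hfin : V * c₀ * B ^ 2 * D * (4 * γ ^ 2) * P * lo * (lo⁻¹) ^ 5 * y * x ≤ 1) :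
    N * (c * (qe * qs) * (D * (hi * (4 * (γ / H) ^ 2) * P))) ≤ H ^ 2 * lo⁻¹ * Λ⁻¹ := by
  have hc0 : 0 ≤ c₀ := hc.trans hcc
  have hx0 : 0 ≤ x := hqe.trans hx
  have h1 : N * (c * (qe * qs) * (D * (hi * (4 * (γ / H) ^ 2) * P))) ≤
      (V * (H⁻¹) ^ 2) * (c₀ * (x * (B ^ 2 * Λ⁻¹)) * (D * (hi * (4 * (γ / H) ^ 2) * P))) := by
    have h2 : 0 ≤ D * (hi * (4 * (γ / H) ^ 2) * P) := by positivity
    have h3 : qe * qs ≤ x * (B ^ 2 * Λ⁻¹) := mul_le_mul hx hs hqs hx0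
    have h4 : c * (qe * qs) ≤ c₀ * (x * (B ^ 2 * Λ⁻¹)) := mul_le_mul hcc h3 (by positivity) hc0
    exact mul_le_mul hNV (mul_le_mul_of_nonneg_right h4 h2) (by positivity) (by positivity)
  have h2 : (V * (H⁻¹) ^ 2) * (c₀ * (x * (B ^ 2 * Λ⁻¹)) * (D * (hi * (4 * (γ / H) ^ 2) * P))) =
      (hi * (H⁻¹) ^ 6) * (V * c₀ * B ^ 2 * D * (4 * γ ^ 2) * P * x * (H ^ 2 * Λ⁻¹)) := by
    field_simp
  have h3 := mul_le_mul_of_nonneg_right hy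
    (show 0 ≤ V * c₀ * B ^ 2 * D * (4 * γ ^ 2) * P * x * (H ^ 2 * Λ⁻¹) by positivity)
  have h4 : y * (lo⁻¹) ^ 5 * (V * c₀ * B ^ 2 * D * (4 * γ ^ 2) * P * x * (H ^ 2 * Λ⁻¹)) =
      V * c₀ * B ^ 2 * D * (4 * γ ^ 2) * P * lo * (lo⁻¹) ^ 5 * y * x * (H ^ 2 * lo⁻¹ * Λ⁻¹) := by
    field_simp
  have h5 := mul_le_mul_of_nonneg_right hfin (show 0 ≤ H ^ 2 * lo⁻¹ * Λ⁻¹ by positivity)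
  rw [one_mul] at h5; rw [h2] at h1
  rw [h4] at h3; exact h1.trans (h3.trans h5)

lemma pow_six_le {hi H lo y : ℝ} (hH : 0 < H) (hlo : 0 < lo) (hhi : lo ≤ hi) (hX : hi / H ≤ Real.exp y) :
    hi * (H⁻¹) ^ 6 ≤ Real.exp (6 * y) * (lo⁻¹) ^ 5 := by
  have hhip : 0 < hi := hlo.trans_le hhi
  have h1 : hi * (H⁻¹) ^ 6 = (hi / H) ^ 6 * (hi⁻¹) ^ 5 := by field_simp
  have h2 : (hi⁻¹) ^ 5 ≤ (lo⁻¹) ^ 5 := by gcongr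
  have h3 : (hi / H) ^ 6 ≤ Real.exp (6 * y) := by
    have h4 := pow_le_pow_left₀ (div_pos hhip hH).le hX 6
    rw [← Real.exp_nat_mul] at h4; exact_mod_cast h4
  rw [h1]; exact mul_le_mul h3 h2 (by positivity) (by positivity)

/-- With sufficiently many oversampling layers the localization error is negligible. -/
lemma exists_layer_bound {γ lamBar Cπ lo Λ₀ V P : ℝ} (hov : 0 ≤ QuadMesh.overlap γ) (hlam : 0 ≤ lamBar)
    (hlo : 0 < lo) (hΛ₀ : 0 < Λ₀) (hV : 0 ≤ V) (hP : 0 ≤ P) :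
    ∃ K₀ : ℝ, 0 < K₀ ∧ ∀ (hi H Λ N : ℝ) (m : ℕ), lo ≤ hi → 0 < H → Λ₀ ≤ Λ → 0 ≤ N → N * H ^ 2 ≤ V →
      K₀ * max 1 (Real.log (hi / H)) ≤ m → 3 ≤ m ∧
      N * (cutConst γ lamBar Cπ Λ * decayFactor γ lamBar Cπ Λ ^ ((m - 3) / 2) * (liftConst γ lamBar Cπ *
        (hi * (4 * (γ / H) ^ 2) * P))) ≤ H ^ 2 * lo⁻¹ * Λ⁻¹ := by
  have hD : 0 ≤ liftConst γ lamBar Cπ := by unfold liftConst; positivity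
  set D := liftConst γ lamBar Cπ with hDdef
  set B := QuadMesh.overlap γ * (1 + 32 * γ ^ 2 + D / 2) with hB
  have hrate : ∀ Λ, decayRate γ lamBar Cπ Λ = B / Real.sqrt Λ := fun Λ => by rw [decayRate, hB, ← hDdef]; ring
  set τ := B / Real.sqrt Λ₀ with hτ
  set β := 1 / (1 + τ) with hβ
  have hβ0 : 0 < β := by positivity
  set E := V * cutConst γ lamBar Cπ Λ₀ * B ^ 2 * D * (4 * γ ^ 2) * P * lo * (lo⁻¹) ^ 5 with hE
  have hc0 : 0 ≤ cutConst γ lamBar Cπ Λ₀ := by unfold cutConst; positivity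
  have hE0 : 0 ≤ E := by positivity
  refine ⟨8 + 2 * (E + 6) / β, by positivity, fun hi H Λ N m hhi hH hΛ hN hNV hm => ?_⟩
  have hΛp : 0 < Λ := hΛ₀.trans_le hΛ
  have hhip : 0 < hi := hlo.trans_le hhi
  set Y := max 1 (Real.log (hi / H)) with hY
  have hY1 : 1 ≤ Y := le_max_left _ _
  have hm8 : (8 : ℝ) + 2 * (E + 6) * Y / β ≤ m := by
    refine le_trans ?_ hm
    have : (8 + 2 * (E + 6) / β) * Y = 8 * Y + 2 * (E + 6) * Y / β := by ring
    rw [this]; linarith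
  have hm8' : 8 ≤ m := by
    have : (8 : ℝ) ≤ m := le_trans (le_add_of_nonneg_right (by positivity)) hm8
    exact_mod_cast this
  refine ⟨by omega, ?_⟩
  set q := decayFactor γ lamBar Cπ Λ with hq
  have hr0 : 0 ≤ decayRate γ lamBar Cπ Λ := by rw [hrate]; positivity
  have hq0 : 0 ≤ q := by rw [hq, decayFactor]; positivity
  have hqτ : q ≤ B / Real.sqrt Λ := by
    rw [hq, decayFactor, hrate]; exact div_le_self (by positivity) (le_add_of_nonneg_right (by positivity))
  have hq2 : q ^ 2 ≤ B ^ 2 * Λ⁻¹ := by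
    refine (pow_le_pow_left₀ hq0 hqτ 2).trans (le_of_eq ?_)
    rw [div_pow, Real.sq_sqrt hΛp.le, div_eq_mul_inv]
  have hqe : q ≤ Real.exp (-β) := by
    have h1 : q ≤ 1 - β := by
      rw [hq, decayFactor_eq hr0, hrate, hβ, hτ]; gcongr
    linarith [Real.add_one_le_exp (-β)]
  obtain ⟨e, he⟩ : ∃ e, (m - 3) / 2 = e + 2 := ⟨(m - 3) / 2 - 2, by omega⟩
  have hem : (m : ℝ) ≤ 2 * e + 8 := by
    have : m ≤ 2 * e + 8 := by omega
    exact_mod_cast this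
  have hqe' : q ^ e ≤ Real.exp (-(E + 6) * Y) := by
    refine (pow_le_pow_left₀ hq0 hqe e).trans ?_
    rw [← Real.exp_nat_mul, Real.exp_le_exp]
    have h1 : 2 * (E + 6) * Y / β ≤ 2 * e := by linarith
    rw [div_le_iff₀ hβ0] at h1; linarith
  have hX : hi / H ≤ Real.exp Y := by rw [← Real.log_le_iff_le_exp (by positivity)]; exact le_max_right _ _
  have hX6 := pow_six_le hH hlo hhi hX
  have hcut : cutConst γ lamBar Cπ Λ ≤ cutConst γ lamBar Cπ Λ₀ := by unfold cutConst; rw [← hDdef]; gcongr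
  have hcutΛ : 0 ≤ cutConst γ lamBar Cπ Λ := by unfold cutConst; positivity
  have hfin : E * Real.exp (6 * Y) * Real.exp (-(E + 6) * Y) ≤ 1 := by
    have h1 : E ≤ Real.exp (E * Y) := by
      have h2 := Real.add_one_le_exp (E * Y)
      nlinarith [mul_nonneg hE0 (sub_nonneg.2 hY1)]
    calc _ ≤ Real.exp (E * Y) * Real.exp (6 * Y) * Real.exp (-(E + 6) * Y) := by gcongr
      _ = 1 := by rw [← Real.exp_add, ← Real.exp_add, Real.exp_eq_one_iff]; ring
  have hNH : N ≤ V * (H⁻¹) ^ 2 := by rw [inv_pow, ← div_eq_mul_inv, le_div_iff₀ (by positivity)]; exact hNV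
  rw [he, pow_add]
  exact localization_le hH hlo hhip.le hΛp hN hNH hcutΛ hcut hD hP (pow_nonneg hq0 e) (sq_nonneg q) hqe' hq2 hX6 hV hfin

end MultiscaleSetting

section Parabolic

variable {E H : Type*} [NormedAddCommGroup E] [NormedSpace ℝ E] [NormedAddCommGroup H] [InnerProductSpace ℝ H]
  [CompleteSpace H]

lemma integrable_bilin {α F : Type*} [MeasurableSpace α] {μ : Measure α} [NormedAddCommGroup F] [NormedSpace ℝ F]
    (B : E →L[ℝ] F →L[ℝ] ℝ) {u : α → E} {v : α → F} (hu : MemLp u 2 μ) (hv : MemLp v 2 μ) :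
    Integrable (fun t => B (u t) (v t)) μ := by
  rw [← memLp_one_iff_integrable]; exact B.memLp_of_bilin (p := 2) (q := 2) 1 hu hv

lemma continuous_integral_inner_translate {g u : ℝ → H} (hg : MemLp g 2 volume) (hu : MemLp u 2 volume) :
    Continuous fun s : ℝ => ∫ t, ⟪g t, u (t - s)⟫_ℝ := by
  let τ : ℝ → C(ℝ, ℝ) := fun s => ⟨fun t => t - s, by fun_prop⟩
  have hτ : Continuous τ := ContinuousMap.continuous_of_continuous_uncurry _ (by
    show Continuous fun x : ℝ × ℝ => x.2 - x.1
    fun_prop)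
  have hp : ∀ s, MeasurePreserving (τ s) (volume : Measure ℝ) volume := fun s => measurePreserving_sub_right volume s
  have h1 : Continuous fun s => ⟪hg.toLp g, Lp.compMeasurePreserving (τ s) (hp s) (hu.toLp u)⟫_ℝ :=
    continuous_const.inner (Continuous.compMeasurePreservingLp continuous_const hτ hp (by norm_num))
  refine h1.congr fun s => ?_
  rw [L2.inner_def]
  refine integral_congr_ae ?_
  have h2 := Lp.coeFn_compMeasurePreserving (hu.toLp u) (hp s)
  have h3 := (hp s).quasiMeasurePreserving.ae_eq_comp hu.coeFn_toLp
  filter_upwards [hg.coeFn_toLp, h2, h3] with t ht1 ht2 ht3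
  rw [ht1, ht2, ht3]; rfl

/-- If the integrals of `Φ` over short intervals `(0, h)` are at most `h * b`, then `Φ 0 ≤ b`. -/
lemma le_of_integral_le {Φ : ℝ → ℝ} (hΦ : Continuous Φ) {b T : ℝ} (hT : 0 < T)
    (h : ∀ h ∈ Ioc 0 T, ∫ s in (0 : ℝ)..h, Φ s ≤ h * b) : Φ 0 ≤ b := by
  have h1 := (intervalIntegral.integral_hasDerivAt_right (hΦ.intervalIntegrable 0 0)
    hΦ.aestronglyMeasurable.stronglyMeasurableAtFilter hΦ.continuousAt).tendsto_slope_zero_right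
  refine le_of_tendsto h1 ?_
  filter_upwards [Ioc_mem_nhdsGT hT] with s hs
  have := h s hs
  simp only [zero_add, intervalIntegral.integral_same, sub_zero, smul_eq_mul]; rw [inv_mul_le_iff₀ hs.1]; exact this

lemma integral_integral_inner_translate {g u : ℝ → H} (hg : Integrable g) (hu : Integrable u) {h : ℝ} (hh : 0 ≤ h) :
    ∫ s in (0 : ℝ)..h, ∫ t, ⟪g t, u (t - s)⟫_ℝ = ∫ t, ⟪g t, ∫ s in (t - h)..t, u s⟫_ℝ := by
  have h1 := Integrable.convolution_integrand (innerSL ℝ : H →L[ℝ] H →L[ℝ] ℝ) hg hu.comp_neg (μ := volume) (ν := volume)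
  have h2 : Integrable (fun p : ℝ × ℝ => ⟪g p.2, u (p.2 - p.1)⟫_ℝ) (volume.prod volume) :=
    h1.congr (.of_forall fun p => by simp; rfl)
  rw [intervalIntegral.integral_of_le hh, integral_integral_swap (h2.mono_measure
    (Measure.prod_mono Measure.restrict_le_self le_rfl))]
  refine integral_congr_ae (.of_forall fun t => ?_)
  have h3 : Integrable (fun s => u (t - s)) := hu.comp_sub_left t
  show ∫ s in Ioc 0 h, ⟪g t, u (t - s)⟫_ℝ = _
  rw [integral_inner h3.integrableOn, ← intervalIntegral.integral_of_le hh, intervalIntegral.integral_comp_sub_left, sub_zero]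

end Parabolic

section Parabolic

variable {E H : Type*} [NormedAddCommGroup E] [NormedSpace ℝ E] [NormedAddCommGroup H] [InnerProductSpace ℝ H]
  [CompleteSpace H]

/-- `p`, with time derivative `dp`, solves `c(∂p/∂t, v) + a(p, v) = (f, v)` for `v ∈ W`; `π` is the
embedding of the energy space. -/
structure IsWeakSolution (a : E →L[ℝ] E →L[ℝ] ℝ) (c : H →L[ℝ] H →L[ℝ] ℝ) (π : E →L[ℝ] H) (W : Submodule ℝ E)
    (T : ℝ) (f : ℝ → H) (p : ℝ → E) (dp : ℝ → H) : Prop where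
  mem : ∀ t ∈ Icc 0 T, p t ∈ W
  memLp : MemLp p 2 (volume.restrict (Ioc 0 T))
  memLp_deriv : MemLp dp 2 (volume.restrict (Ioc 0 T))
  eq_integral : ∀ t ∈ Icc 0 T, π (p t) = π (p 0) + ∫ s in (0 : ℝ)..t, dp s
  eqn : ∀ᵐ t ∂(volume.restrict (Ioc 0 T)), ∀ v ∈ W, c (dp t) (π v) + a (p t) v = ⟪f t, π v⟫_ℝ

lemma MemLp.integrable_Ioc {T : ℝ} {f : ℝ → H} (hf : MemLp f 2 (volume.restrict (Ioc 0 T))) :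
    IntegrableOn f (Ioc 0 T) := hf.integrable (by norm_num)

variable {a : E →L[ℝ] E →L[ℝ] ℝ} {c : H →L[ℝ] H →L[ℝ] ℝ} {π : E →L[ℝ] H} {W : Submodule ℝ E} {T : ℝ} {f : ℝ → H}
  {p : ℝ → E} {dp : ℝ → H}

lemma IsWeakSolution.integral_backward_le (ha : ∀ u v, a u v = a v u) (ha0 : ∀ u, 0 ≤ a u u) (hT : 0 < T)
    (hp : IsWeakSolution a c π W T f p dp) (hf : MemLp f 2 (volume.restrict (Ioc 0 T)))
    {h : ℝ} (hh : h ∈ Ioc 0 T) :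
    ∫ t in Ioc 0 T, (c (dp t) (∫ s in (t - h)..t, (Ioc 0 T).indicator dp s)
      - ⟪f t, ∫ s in (t - h)..t, (Ioc 0 T).indicator dp s⟫_ℝ) ≤ h * (a (p 0) (p 0) / 2) := by
  set u := (Ioc 0 T).indicator dp with hudef
  have hu : Integrable u := (integrable_indicator_iff measurableSet_Ioc).2 (MemLp.integrable_Ioc hp.memLp_deriv)
  let q : ℝ → E := fun r => p (max r 0)
  let A : ℝ → ℝ := fun r => a (q r) (q r)
  have hq : ∀ r, r ≤ T → q r ∈ W ∧ π (q r) = π (p 0) + ∫ s in (0 : ℝ)..r, u s := fun r hr => by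
    have hm : max r 0 ∈ Icc 0 T := ⟨le_max_right _ _, max_le hr hT.le⟩
    refine ⟨hp.mem _ hm, ?_⟩
    rw [hp.eq_integral _ hm]; congr 1
    rcases le_total r 0 with h0 | h0
    · rw [max_eq_right h0, intervalIntegral.integral_same, intervalIntegral.integral_symm,
        intervalIntegral.integral_of_le h0, setIntegral_eq_zero_of_forall_eq_zero, neg_zero]
      exact fun s hs => indicator_of_notMem (fun hs' => absurd hs.2 (not_le.2 hs'.1)) _
    · rw [max_eq_left h0, intervalIntegral.integral_of_le h0, intervalIntegral.integral_of_le h0]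
      refine setIntegral_congr_fun measurableSet_Ioc fun s hs => ?_
      exact (indicator_of_mem (show s ∈ Ioc 0 T from ⟨hs.1, hs.2.trans hr⟩) _).symm
  have hAi : IntegrableOn A (Ioc (-h) T) := by
    have h1 : IntegrableOn A (Ioc 0 T) := (integrable_bilin a hp.memLp hp.memLp).congr
      ((ae_restrict_mem measurableSet_Ioc).mono fun t ht => by simp only [A, q, max_eq_left ht.1.le])
    have h2 : IntegrableOn A (Ioc (-h) 0) := (integrableOn_const (C := a (p 0) (p 0)) (by simp)).congr_fun
      (fun t ht => by simp only [A, q, max_eq_right ht.2]) measurableSet_Ioc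
    rw [← Ioc_union_Ioc_eq_Ioc (neg_nonpos.2 hh.1.le) hT.le]; exact h2.union h1
  have hI : ∀ x y, -h ≤ x → x ≤ y → y ≤ T → IntervalIntegrable A volume x y := fun x y h1 h2 h3 =>
    (intervalIntegrable_iff_integrableOn_Ioc_of_le h2).2 (hAi.mono_set (Ioc_subset_Ioc h1 h3))
  have hA0 : ∫ t in (-h)..0, A t = h * a (p 0) (p 0) := by
    rw [intervalIntegral.integral_congr (g := fun _ => a (p 0) (p 0)) fun t ht => by
      rw [uIcc_of_le (neg_nonpos.2 hh.1.le)] at ht; simp only [A, q, max_eq_right ht.2]]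
    simp
  have hAs : IntervalIntegrable (fun t => A (t - h)) volume 0 T := by
    simpa using (hI (-h) (T - h) le_rfl (by linarith) (by linarith [hh.1])).comp_sub_right h
  have hAh : ∫ t in (0 : ℝ)..T, (A (t - h) - A t) ≤ h * a (p 0) (p 0) := by
    rw [intervalIntegral.integral_sub hAs (hI 0 T (by linarith [hh.1]) hT.le le_rfl),
      intervalIntegral.integral_comp_sub_right, zero_sub]
    have h2 := intervalIntegral.integral_add_adjacent_intervals (hI (-h) 0 le_rfl (by linarith [hh.1]) hT.le)
      (hI 0 (T - h) (by linarith [hh.1]) (by linarith [hh.2]) (by linarith [hh.1]))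
    have h3 := intervalIntegral.integral_add_adjacent_intervals
      (hI 0 (T - h) (by linarith [hh.1]) (by linarith [hh.2]) (by linarith [hh.1]))
      (hI (T - h) T (by linarith [hh.2]) (by linarith [hh.1]) le_rfl)
    have h4 : 0 ≤ ∫ t in (T - h)..T, A t := intervalIntegral.integral_nonneg (by linarith [hh.1]) fun t _ => ha0 _
    linarith
  have hAi' : IntegrableOn (fun t => (A (t - h) - A t) / 2) (Ioc 0 T) := by
    exact ((intervalIntegrable_iff_integrableOn_Ioc_of_le hT.le).1
      (hAs.sub (hI 0 T (by linarith [hh.1]) hT.le le_rfl))).div_const 2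
  have hpt : ∀ᵐ t ∂(volume.restrict (Ioc 0 T)), c (dp t) (∫ s in (t - h)..t, u s) - ⟪f t, ∫ s in (t - h)..t, u s⟫_ℝ ≤
      (A (t - h) - A t) / 2 := by
    filter_upwards [hp.eqn, ae_restrict_mem measurableSet_Ioc] with t he ht
    have h1 := hq t ht.2
    have h2 := hq (t - h) (by linarith [ht.2, hh.1])
    have h3 : ∫ s in (t - h)..t, u s = π (q t - q (t - h)) := by
      rw [map_sub, h1.2, h2.2, add_sub_add_left_eq_sub, intervalIntegral.integral_interval_sub_left
        hu.intervalIntegrable hu.intervalIntegrable]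
    have h4 := he _ (W.sub_mem h1.1 h2.1)
    have h5 : q t = p t := by simp only [q, max_eq_left ht.1.le]
    have h6 := ha0 (q t - q (t - h))
    rw [bilin_sub_self ha] at h6; rw [h3]
    rw [← h5, (a (q t)).map_sub] at h4; linarith
  have hM : AEStronglyMeasurable (fun t => ∫ s in (t - h)..t, u s) (volume.restrict (Ioc 0 T)) := by
    have h1 : Continuous fun t => ∫ s in (0 : ℝ)..t, u s :=
      intervalIntegral.continuous_primitive (fun _ _ => hu.intervalIntegrable) 0
    refine ((h1.sub (h1.comp (continuous_sub_right h))).congr fun t => ?_).aestronglyMeasurable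
    exact intervalIntegral.integral_interval_sub_left hu.intervalIntegrable hu.intervalIntegrable
  have hMb : MemLp (fun t => ∫ s in (t - h)..t, u s) 2 (volume.restrict (Ioc 0 T)) :=
    MemLp.of_bound hM (∫ s, ‖u s‖) (.of_forall fun t => by
      rw [intervalIntegral.integral_of_le (by linarith [hh.1])]
      exact (norm_integral_le_integral_norm _).trans
        (setIntegral_le_integral hu.norm (.of_forall fun _ => norm_nonneg _)))
  have hi : Integrable (fun t => c (dp t) (∫ s in (t - h)..t, u s) - ⟪f t, ∫ s in (t - h)..t, u s⟫_ℝ) (volume.restrict (Ioc 0 T)) :=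
    (integrable_bilin c hp.memLp_deriv hMb).sub (integrable_bilin (innerSL ℝ) hf hMb)
  refine (integral_mono_ae hi hAi' hpt).trans ?_
  rw [integral_div, ← intervalIntegral.integral_of_le hT.le]; linarith

/-- The energy estimate for the time derivative. -/
lemma IsWeakSolution.integral_deriv_le (ha : ∀ u v, a u v = a v u) (ha0 : ∀ u, 0 ≤ a u u) (hT : 0 < T)
    {c0 : ℝ} (hc0 : 0 < c0) (hc : ∀ h, c0 * ‖h‖ ^ 2 ≤ c h h)
    (hp : IsWeakSolution a c π W T f p dp) (hf : MemLp f 2 (volume.restrict (Ioc 0 T))) :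
    ∫ t in Ioc 0 T, c (dp t) (dp t) ≤ a (p 0) (p 0) + c0⁻¹ * ∫ t in Ioc 0 T, ‖f t‖ ^ 2 := by
  let R := (InnerProductSpace.toDual ℝ H).symm.toContinuousLinearEquiv.toContinuousLinearMap
  have hR : ∀ l x, ⟪R l, x⟫_ℝ = l x := fun l x => InnerProductSpace.toDual_symm_apply
  let g : ℝ → H := (Ioc 0 T).indicator fun t => R (c (dp t)) - f t
  let u : ℝ → H := (Ioc 0 T).indicator dp
  have hg2 : MemLp (fun t => R (c (dp t)) - f t) 2 (volume.restrict (Ioc 0 T)) :=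
    (R.comp_memLp' (c.comp_memLp' hp.memLp_deriv)).sub hf
  have hg : MemLp g 2 volume := (memLp_indicator_iff_restrict measurableSet_Ioc).2 hg2
  have hu : MemLp u 2 volume := (memLp_indicator_iff_restrict measurableSet_Ioc).2 hp.memLp_deriv
  have hgi : Integrable g := (integrable_indicator_iff measurableSet_Ioc).2 (MemLp.integrable_Ioc hg2)
  have hui : Integrable u := (integrable_indicator_iff measurableSet_Ioc).2 (MemLp.integrable_Ioc hp.memLp_deriv)
  have hgt : ∀ y : ℝ → H, ∫ t, ⟪g t, y t⟫_ℝ = ∫ t in Ioc 0 T, (c (dp t) (y t) - ⟪f t, y t⟫_ℝ) := fun y => by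
    rw [← integral_indicator measurableSet_Ioc]
    refine integral_congr_ae (.of_forall fun t => ?_)
    by_cases ht : t ∈ Ioc 0 T
    · simp only [g, indicator_of_mem ht, inner_sub_left, hR]
    · simp only [g, indicator_of_notMem ht, inner_zero_left]
  have h1 := le_of_integral_le (continuous_integral_inner_translate hg hu) hT (b := a (p 0) (p 0) / 2) fun h hh => by
    rw [integral_integral_inner_translate hgi hui hh.1.le, hgt]; exact hp.integral_backward_le ha ha0 hT hf hh
  simp only [sub_zero] at h1
  rw [hgt, setIntegral_congr_fun (g := fun t => c (dp t) (dp t) - ⟪f t, dp t⟫_ℝ) measurableSet_Ioc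
    fun t ht => by simp only [u, indicator_of_mem ht]] at h1
  have i1 := integrable_bilin c hp.memLp_deriv hp.memLp_deriv
  have i2 : Integrable (fun t => ⟪f t, dp t⟫_ℝ) (volume.restrict (Ioc 0 T)) := integrable_bilin (innerSL ℝ) hf hp.memLp_deriv
  have i3 : Integrable (fun t => ‖f t‖ ^ 2) (volume.restrict (Ioc 0 T)) := hf.integrable_norm_pow (by norm_num)
  rw [integral_sub i1 i2] at h1
  have h2 : ∫ t in Ioc 0 T, ⟪f t, dp t⟫_ℝ ≤ ∫ t in Ioc 0 T, (c (dp t) (dp t) / 2 + c0⁻¹ / 2 * ‖f t‖ ^ 2) := by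
    refine integral_mono i2 ((i1.div_const 2).add (i3.const_mul _)) fun t => ?_
    have h3 := real_inner_le_norm (f t) (dp t)
    have h4 := hc (dp t)
    have h5 : 0 ≤ c0⁻¹ * (‖f t‖ - c0 * ‖dp t‖) ^ 2 := by positivity
    have h6 : c0⁻¹ * (‖f t‖ - c0 * ‖dp t‖) ^ 2 = c0⁻¹ * ‖f t‖ ^ 2 - 2 * (‖f t‖ * ‖dp t‖) + c0 * ‖dp t‖ ^ 2 := by
      field_simp; ring
    linarith
  rw [integral_add (i1.div_const 2) (i3.const_mul _), integral_div, integral_const_mul] at h2; linarith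

/-- The chain rule for the square of a primitive. -/
lemma bilin_primitive_sub (hcs : ∀ x y, c x y = c y x) (hT : 0 ≤ T) {u y : ℝ → H}
    (hu : IntegrableOn u (Ioc 0 T)) (hy : ∀ t ∈ Icc 0 T, y t = y 0 + ∫ s in (0 : ℝ)..t, u s) :
    c (y T) (y T) - c (y 0) (y 0) = 2 * ∫ t in (0 : ℝ)..T, c (u t) (y t) := by
  have hui : IntervalIntegrable u volume 0 T := (intervalIntegrable_iff_integrableOn_Ioc_of_le hT).2 hu
  have hcy : ContinuousOn y (uIcc 0 T) := by
    rw [uIcc_of_le hT]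
    refine (continuousOn_const.add ?_).congr hy
    have := intervalIntegral.continuousOn_primitive_interval' hui left_mem_uIcc
    rwa [uIcc_of_le hT] at this
  obtain ⟨B, hB⟩ := isCompact_uIcc.exists_bound_of_continuousOn hcy
  have hB0 : 0 ≤ B := (norm_nonneg _).trans (hB 0 left_mem_uIcc)
  have hN := (hui.norm.absolutelyContinuousOnInterval_intervalIntegral (c := 0) left_mem_uIcc).const_mul (2 * ‖c‖ * B)
  have hd : ∀ s ∈ uIcc 0 T, ∀ t ∈ uIcc 0 T, dist (c (y s) (y s)) (c (y t) (y t)) ≤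
      dist ((2 * ‖c‖ * B) * ∫ r in (0 : ℝ)..s, ‖u r‖) ((2 * ‖c‖ * B) * ∫ r in (0 : ℝ)..t, ‖u r‖) := fun s hs t ht => by
    have hs' : s ∈ Icc 0 T := by rwa [uIcc_of_le hT] at hs
    have ht' : t ∈ Icc 0 T := by rwa [uIcc_of_le hT] at ht
    have i0 : ∀ r ∈ uIcc 0 T, IntervalIntegrable u volume 0 r := fun r hr => hui.mono_set (uIcc_subset_uIcc_left hr)
    have h1 : c (y s) (y s) - c (y t) (y t) = c (y s + y t) (y s - y t) := by
      simp only [map_add, map_sub, add_apply]; rw [hcs (y t) (y s)]; ring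
    have h2 : y s - y t = ∫ r in t..s, u r := by
      rw [hy s hs', hy t ht', add_sub_add_left_eq_sub, intervalIntegral.integral_interval_sub_left (i0 s hs) (i0 t ht)]
    rw [dist_eq_norm, dist_eq_norm, h1, ← mul_sub, norm_mul, intervalIntegral.integral_interval_sub_left (i0 s hs).norm (i0 t ht).norm]
    have h3 : ‖y s - y t‖ ≤ ‖∫ r in t..s, ‖u r‖‖ := by
      rw [h2, Real.norm_eq_abs]; exact intervalIntegral.norm_integral_le_abs_integral_norm
    have h4 : ‖y s + y t‖ ≤ 2 * B := (norm_add_le _ _).trans (by linarith [hB s hs, hB t ht])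
    refine (c.le_opNorm₂ _ _).trans ?_
    rw [Real.norm_of_nonneg (by positivity : 0 ≤ 2 * ‖c‖ * B)]
    have := mul_le_mul_of_nonneg_left h4 (norm_nonneg c)
    have := mul_le_mul this h3 (norm_nonneg _) (by positivity)
    linarith
  have hAC : AbsolutelyContinuousOnInterval (fun t => c (y t) (y t)) 0 T := by
    refine squeeze_zero' (.of_forall fun I => sum_nonneg fun _ _ => dist_nonneg) ?_ hN
    filter_upwards [Filter.mem_inf_of_right (Filter.mem_principal_self _)] with I hI
    exact sum_le_sum fun i hi => hd _ (hI.1 i hi).1 _ (hI.1 i hi).2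
  rw [← hAC.integral_deriv_eq_sub, ← intervalIntegral.integral_const_mul]
  refine intervalIntegral.integral_congr_ae ?_
  have hne : ∀ᵐ t : ℝ, t ≠ T := by simp [ae_iff]
  filter_upwards [hui.ae_hasDerivAt_integral, hne] with t ht htT ht0
  rw [uIoc_of_le hT] at ht0
  have hmem : t ∈ uIcc 0 T := by rw [uIcc_of_le hT]; exact Ioc_subset_Icc_self ht0
  have h1 : HasDerivAt y (u t) t := by
    refine ((ht hmem 0 left_mem_uIcc).const_add (y 0)).congr_of_eventuallyEq ?_
    filter_upwards [Ioo_mem_nhds ht0.1 (lt_of_le_of_ne ht0.2 htT)] with r hr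
    exact hy r (Ioo_subset_Icc_self hr)
  have h2 := (c.hasFDerivAt.comp_hasDerivAt t h1).clm_apply h1
  refine h2.deriv.trans ?_
  show c (u t) (y t) + c (y t) (u t) = _
  rw [hcs (y t)]; ring

end Parabolic

section Parabolic

variable {E H : Type*} [NormedAddCommGroup E] [NormedSpace ℝ E] [NormedAddCommGroup H] [InnerProductSpace ℝ H]
  [CompleteSpace H] {a : E →L[ℝ] E →L[ℝ] ℝ} {c : H →L[ℝ] H →L[ℝ] ℝ} {π : E →L[ℝ] H} {V X : Submodule ℝ E} {T : ℝ}
  {f : ℝ → H} {p pm : ℝ → E} {dp dpm : ℝ → H} {c0 c1 ε : ℝ}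

lemma self_sub_le_of_galerkin (ha : ∀ u v, a u v = a v u) (ha0 : ∀ u, 0 ≤ a u u) {u r w : E} (hr : r ∈ X) (hw : w ∈ X)
    (hru : ∀ v ∈ X, a r v = a u v) : a (u - r) (u - r) ≤ a (u - w) (u - w) := by
  have h1 : a (u - r) (r - w) = 0 := by rw [map_sub a, sub_apply, hru _ (X.sub_mem hr hw), sub_self]
  have h2 := bilin_add_self ha (u - r) (r - w)
  rw [sub_add_sub_cancel, h1] at h2; linarith [ha0 (r - w)]

lemma abs_bilin_le (hcs : ∀ x y, c x y = c y x) (hc0 : ∀ x, 0 ≤ c x x) (hc1 : ∀ x, c x x ≤ c1 * ‖x‖ ^ 2) (hc1' : 0 ≤ c1) (x y : H) :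
    |c x y| ≤ c1 * (‖x‖ * ‖y‖) := by
  refine abs_le_of_sq_le_sq ((sq_bilin_le hcs hc0 x y).trans ?_) (by positivity)
  refine (mul_le_mul (hc1 x) (hc1 y) (hc0 y) (by positivity)).trans (le_of_eq ?_)
  ring

/-- The Aubin-Nitsche estimate for the Galerkin projection. -/
lemma bilin_le_of_galerkin [CompleteSpace E] (ha : ∀ u v, a u v = a v u) (ha0 : ∀ u, 0 ≤ a u u)
    (hV : IsClosed (V : Set E)) {C : ℝ} (hC0 : 0 < C) (hC : ∀ v ∈ V, ‖v‖ ^ 2 ≤ C * a v v)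
    (hcs : ∀ x y, c x y = c y x) (hc0 : ∀ x, 0 ≤ c x x) (hc1 : ∀ x, c x x ≤ c1 * ‖x‖ ^ 2) (hc1' : 0 ≤ c1)
    (hX : X ≤ V) (hap : ∀ u ∈ V, ∀ K, 0 ≤ K → (∀ v ∈ V, a u v ≤ K * ‖π v‖) → ∃ w ∈ X, a (u - w) (u - w) ≤ ε * K ^ 2)
    {u r : E} (hu : u ∈ V) (hr : r ∈ X) (hru : ∀ v ∈ X, a r v = a u v) :
    c (π (u - r)) (π (u - r)) ≤ ε * c1 * a (u - r) (u - r) := by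
  set e := u - r with hedef
  have heV : e ∈ V := V.sub_mem hu (hX hr)
  obtain ⟨z, hz, hze⟩ := exists_represent ha hV hC0 hC ((c (π e)).comp π)
  set q := c (π e) (π e) with hq
  have hq0 : 0 ≤ q := hc0 _
  obtain ⟨w, hw, hwz⟩ := hap z hz (√(q * c1)) (Real.sqrt_nonneg _) fun v hv => by
    rw [hze v hv, ← Real.sqrt_sq (norm_nonneg (π v)), ← Real.sqrt_mul (by positivity)]
    refine Real.le_sqrt_of_sq_le ((sq_bilin_le hcs hc0 _ _).trans ?_)
    rw [mul_assoc]; exact mul_le_mul_of_nonneg_left (hc1 _) hq0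
  rw [Real.sq_sqrt (by positivity)] at hwz
  have h1 : q = a (z - w) e := by
    rw [map_sub a, sub_apply, hze e heV, ha w e, hedef, map_sub a, sub_apply, hru w hw, sub_self, sub_zero]; rfl
  have h2 := sq_bilin_le ha ha0 (z - w) e
  rw [← h1] at h2
  have h3 := h2.trans (mul_le_mul_of_nonneg_right hwz (ha0 e))
  rcases hq0.eq_or_lt with h4 | h4
  · have h5 := hap 0 V.zero_mem 1 zero_le_one fun v _ => by simp
    obtain ⟨w', -, h5⟩ := h5
    have h6 : 0 ≤ ε := by simpa using (ha0 _).trans h5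
    rw [← h4]
    have := ha0 e
    positivity
  · refine le_of_mul_le_mul_right ?_ h4
    linarith

def parabolicConst (c0 c1 : ℝ) : ℝ := c1 + 4 * (1 + c0⁻¹) + (c1 + 2) * (2 + 2 * (c1 ^ 2 * c0⁻¹) * (1 + c0⁻¹))

/-- The error estimate for the Galerkin semidiscretization of a parabolic problem. -/
lemma IsWeakSolution.error_le [CompleteSpace E] (ha : ∀ u v, a u v = a v u) (ha0 : ∀ u, 0 ≤ a u u)
    (hV : IsClosed (V : Set E)) {C : ℝ} (hC0 : 0 < C) (hC : ∀ v ∈ V, ‖v‖ ^ 2 ≤ C * a v v)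
    (hcs : ∀ x y, c x y = c y x) (hc0 : ∀ x, c0 * ‖x‖ ^ 2 ≤ c x x) (hc1 : ∀ x, c x x ≤ c1 * ‖x‖ ^ 2) (h0 : 0 < c0) (h1 : 0 ≤ c1)
    (hX : X ≤ V) [FiniteDimensional ℝ X] (hε : 0 < ε)
    (hap : ∀ u ∈ V, ∀ K, 0 ≤ K → (∀ v ∈ V, a u v ≤ K * ‖π v‖) → ∃ w ∈ X, a (u - w) (u - w) ≤ ε * K ^ 2) (hT : 0 < T)
    (hf : MemLp f 2 (volume.restrict (Ioc 0 T))) (hp : IsWeakSolution a c π V T f p dp) (hpm : IsWeakSolution a c π X T f pm dpm)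
    (hini : ∀ v ∈ X, a (pm 0) v = a (p 0) v) :
    c (π (p T - pm T)) (π (p T - pm T)) + ∫ t in (0 : ℝ)..T, a (p t - pm t) (p t - pm t) ≤
      parabolicConst c0 c1 * ε * (a (p 0) (p 0) + ∫ t in (0 : ℝ)..T, ‖f t‖ ^ 2) := by
  have hcn : ∀ x, 0 ≤ c x x := fun x => (by positivity : 0 ≤ c0 * ‖x‖ ^ 2).trans (hc0 x)
  have m0 : (0 : ℝ) ∈ Icc 0 T := ⟨le_rfl, hT.le⟩
  have hde := hp.memLp_deriv.sub hpm.memLp_deriv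
  have hee := hp.memLp.sub hpm.memLp
  have hchain := bilin_primitive_sub (c := c) hcs hT.le (u := fun t => dp t - dpm t) (y := fun t => π (p t - pm t))
    (MemLp.integrable_Ioc hde) fun t ht => by
      have i1 : ∀ {g : ℝ → H}, MemLp g 2 (volume.restrict (Ioc 0 T)) → IntervalIntegrable g volume 0 t := fun hg =>
        (intervalIntegrable_iff_integrableOn_Ioc_of_le ht.1).2 ((MemLp.integrable_Ioc hg).mono_set (Ioc_subset_Ioc_right ht.2))
      simp only [map_sub]
      rw [hp.eq_integral t ht, hpm.eq_integral t ht, intervalIntegral.integral_sub (i1 hp.memLp_deriv) (i1 hpm.memLp_deriv)]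
      abel
  set F := ∫ t in (0 : ℝ)..T, ‖f t‖ ^ 2 with hF
  have iF : Integrable (fun t => ‖f t‖ ^ 2) (volume.restrict (Ioc 0 T)) := hf.integrable_norm_pow (by norm_num)
  have hE := hp.integral_deriv_le ha ha0 hT h0 hc0 hf
  have hEm := hpm.integral_deriv_le ha ha0 hT h0 hc0 hf
  rw [intervalIntegral.integral_of_le hT.le] at hF; rw [← hF] at hE hEm
  have hF0 : 0 ≤ F := hF ▸ integral_nonneg fun _ => by positivity
  have hA0 : a (pm 0) (pm 0) ≤ a (p 0) (p 0) := by
    have h2 := bilin_sub_self ha (p 0) (pm 0)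
    rw [← hini _ (hpm.mem 0 m0)] at h2; linarith [ha0 (p 0 - pm 0)]
  have he0 : c (π (p 0 - pm 0)) (π (p 0 - pm 0)) ≤ ε * c1 * a (p 0) (p 0) := by
    refine (bilin_le_of_galerkin ha ha0 hV hC0 hC hcs hcn hc1 h1 hX hap (hp.mem 0 m0) (hpm.mem 0 m0) hini).trans
      (mul_le_mul_of_nonneg_left ?_ (by positivity))
    have := self_sub_le_of_galerkin ha ha0 (hpm.mem 0 m0) X.zero_mem hini
    rwa [sub_zero] at this
  have iD := integrable_bilin c hp.memLp_deriv hp.memLp_deriv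
  have iDm := integrable_bilin c hpm.memLp_deriv hpm.memLp_deriv
  have iL : Integrable (fun t => c (dp t - dpm t) (π (p t - pm t))) (volume.restrict (Ioc 0 T)) :=
    integrable_bilin c hde (π.comp_memLp' hee)
  have iA : Integrable (fun t => a (p t - pm t) (p t - pm t)) (volume.restrict (Ioc 0 T)) := integrable_bilin a hee hee
  have hpt : ∀ᵐ t ∂(volume.restrict (Ioc 0 T)), c (dp t - dpm t) (π (p t - pm t)) + a (p t - pm t) (p t - pm t) ≤
      ε * (c (dp t) (dp t) + c (dpm t) (dpm t)) + ε * (c1 / 2 + 1) * (2 * ‖f t‖ ^ 2 + 2 * (c1 ^ 2 * c0⁻¹) * c (dp t) (dp t)) := by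
    filter_upwards [hp.eqn, hpm.eqn, ae_restrict_mem measurableSet_Ioc] with t e1 e2 ht
    have ht' := Ioc_subset_Icc_self ht
    have hpV := hp.mem t ht'
    have hpX := hpm.mem t ht'
    obtain ⟨r, hr, hru⟩ := exists_represent_finite (a := a) X (fun w hw hw0 => by
      have h2 := hC w (hX hw)
      have h3 : ‖w‖ ^ 2 ≤ 0 := h2.trans (mul_nonpos_of_nonneg_of_nonpos hC0.le hw0)
      simpa using le_antisymm h3 (sq_nonneg _)) (a (p t))
    have hK : ∀ v ∈ V, a (p t) v ≤ (‖f t‖ + c1 * ‖dp t‖) * ‖π v‖ := fun v hv => by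
      have h2 := e1 v hv
      have h3 := real_inner_le_norm (f t) (π v)
      have h4 := neg_abs_le (c (dp t) (π v))
      have h5 := abs_bilin_le hcs hcn hc1 h1 (dp t) (π v)
      linarith
    obtain ⟨w, hw, hwp⟩ := hap _ hpV _ (by positivity) hK
    have hη := (self_sub_le_of_galerkin ha ha0 hr hw hru).trans hwp
    have hcη := bilin_le_of_galerkin ha ha0 hV hC0 hC hcs hcn hc1 h1 hX hap hpV hr hru
    have hθ : r - pm t ∈ X := X.sub_mem hr hpX
    have e3 : c (dp t - dpm t) (π (r - pm t)) + a (p t - pm t) (r - pm t) = 0 := by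
      have h2 := e1 _ (hX hθ)
      have h3 := e2 _ hθ
      simp only [map_sub a, map_sub c, sub_apply]; linarith
    have e4 : a (p t - r) (r - pm t) = 0 := by rw [map_sub a, sub_apply, hru _ hθ, sub_self]
    have e5 : c (dp t - dpm t) (π (p t - pm t)) + a (p t - pm t) (p t - pm t) =
        c (dp t - dpm t) (π (p t - r)) + a (p t - r) (p t - r) := by
      have h2 : p t - pm t = (p t - r) + (r - pm t) := (sub_add_sub_cancel _ _ _).symm
      have h3 : a (p t - pm t) (p t - r) = a (p t - r) (p t - r) := by
        rw [h2, map_add, add_apply, ha (r - pm t), e4, add_zero]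
      have h4 : a (p t - pm t) (p t - pm t) = a (p t - pm t) (p t - r) + a (p t - pm t) (r - pm t) := by
        rw [← map_add, ← h2]
      have h5 : c (dp t - dpm t) (π (p t - pm t)) = c (dp t - dpm t) (π (p t - r)) + c (dp t - dpm t) (π (r - pm t)) := by
        rw [← map_add, ← map_add, ← h2]
      linarith
    rw [e5]
    have e6 : c (dp t - dpm t) (π (p t - r)) ≤ ε / 2 * c (dp t - dpm t) (dp t - dpm t) + c1 / 2 * a (p t - r) (p t - r) := by
      have h2 := hcn (ε • (dp t - dpm t) - π (p t - r))
      rw [bilin_sub_self hcs] at h2; simp only [map_smul, smul_apply, smul_eq_mul] at h2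
      refine le_of_mul_le_mul_left ?_ hε
      linarith
    have e7 : c (dp t - dpm t) (dp t - dpm t) ≤ 2 * c (dp t) (dp t) + 2 * c (dpm t) (dpm t) := by
      have h2 := hcn (dp t + dpm t)
      rw [bilin_add_self hcs] at h2; rw [bilin_sub_self hcs]
      linarith
    have e8 : (‖f t‖ + c1 * ‖dp t‖) ^ 2 ≤ 2 * ‖f t‖ ^ 2 + 2 * (c1 ^ 2 * c0⁻¹) * c (dp t) (dp t) := by
      have h2 : ‖dp t‖ ^ 2 ≤ c0⁻¹ * c (dp t) (dp t) := by rw [← div_eq_inv_mul, le_div_iff₀ h0]; linarith [hc0 (dp t)]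
      have h3 := mul_le_mul_of_nonneg_left h2 (sq_nonneg c1)
      have h4 := sq_nonneg (‖f t‖ - c1 * ‖dp t‖)
      linarith
    have e9 : (c1 / 2 + 1) * a (p t - r) (p t - r) ≤ (c1 / 2 + 1) * (ε * (2 * ‖f t‖ ^ 2 + 2 * (c1 ^ 2 * c0⁻¹) * c (dp t) (dp t))) :=
      mul_le_mul_of_nonneg_left (hη.trans (mul_le_mul_of_nonneg_left e8 hε.le)) (by positivity)
    have e10 := mul_le_mul_of_nonneg_left e7 (half_pos hε).le
    linarith
  have i1 : Integrable (fun t => ε * (c (dp t) (dp t) + c (dpm t) (dpm t))) (volume.restrict (Ioc 0 T)) := (iD.add iDm).const_mul ε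
  have i2 : Integrable (fun t => ε * (c1 / 2 + 1) * (2 * ‖f t‖ ^ 2 + 2 * (c1 ^ 2 * c0⁻¹) * c (dp t) (dp t))) (volume.restrict (Ioc 0 T)) :=
    ((iF.const_mul _).add (iD.const_mul _)).const_mul _
  have hint := integral_mono_ae (iL.add iA) (i1.add i2) hpt
  rw [integral_add' iL iA, integral_add' i1 i2, integral_const_mul, integral_const_mul, integral_add iD iDm,
    integral_add (iF.const_mul _) (iD.const_mul _), integral_const_mul, integral_const_mul, ← hF] at hint
  rw [intervalIntegral.integral_of_le hT.le] at hchain ⊢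
  have hAn : 0 ≤ ∫ t in Ioc 0 T, a (p t - pm t) (p t - pm t) := integral_nonneg fun _ => ha0 _
  have hi0 : 0 < c0⁻¹ := inv_pos.2 h0
  set S := a (p 0) (p 0) + F with hS
  have ha0' := ha0 (p 0)
  have hS0 : 0 ≤ S := by positivity
  have hQ : a (p 0) (p 0) + c0⁻¹ * F ≤ (1 + c0⁻¹) * S := by
    have : 0 ≤ c0⁻¹ * a (p 0) (p 0) := by positivity
    rw [hS]; linarith
  have hD1 := hE.trans hQ
  have hD2 : ∫ t in Ioc 0 T, c (dpm t) (dpm t) ≤ (1 + c0⁻¹) * S := by linarith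
  have k1 : ε * c1 * a (p 0) (p 0) ≤ ε * c1 * S := by
    have : a (p 0) (p 0) ≤ S := by rw [hS]; linarith
    gcongr
  have k2 := mul_le_mul_of_nonneg_left (add_le_add hD1 hD2) hε.le
  have k3 : 2 * F + 2 * (c1 ^ 2 * c0⁻¹) * ∫ t in Ioc 0 T, c (dp t) (dp t) ≤ 2 * S + 2 * (c1 ^ 2 * c0⁻¹) * ((1 + c0⁻¹) * S) := by
    have : F ≤ S := by rw [hS]; linarith
    gcongr
  have k4 := mul_le_mul_of_nonneg_left k3 (show 0 ≤ ε * (c1 / 2 + 1) by positivity)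
  unfold parabolicConst; linarith

end Parabolic

include hlo h in
lemma sForm_bubble_nonneg (hM : M.IsCoarseGrid G) (j : Fin M.N)
    (u : Pt → Pair) : 0 ≤ sForm co M j (fun x => M.bubble j x • u x) u := by
  refine sum_nonneg fun i _ => add_nonneg ?_ (sum_nonneg fun l _ => ?_)
  · refine setIntegral_nonneg (G.isOpen.measurableSet.inter (measurableSet_elem j)) fun x hx => ?_
    have h1 := hlo.le.trans (h.1 i x hx.1).1
    have h2 := (QuadMesh.bubble_mem hM hx.2).1
    have h3 := mul_self_nonneg (u x i)
    rw [PiLp.smul_apply, smul_eq_mul, mul_assoc, mul_assoc (M.bubble j x)]; positivity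
  · refine setIntegral_nonneg ((measurableSet_seg l).inter (measurableSet_elem j)) fun x hx => ?_
    have h1 := hlo.le.trans (h.2 l i x hx.1).1
    have h2 := (QuadMesh.bubble_mem hM hx.2).1
    have h3 := mul_self_nonneg (u x i)
    rw [PiLp.smul_apply, smul_eq_mul, mul_assoc, mul_assoc (M.bubble j x)]; positivity

lemma exists_cForm_bilin {lo hi : ℝ} (hlo : 0 < lo) (hhi : 0 ≤ hi) (h : co.CBetween lo hi) :
    ∃ c : L2 G.meas →L[ℝ] L2 G.meas →L[ℝ] ℝ, (∀ u v, c u v = co.cForm u v) ∧ (∀ u v, c u v = c v u) ∧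
      (∀ u, lo / G.aperSup * ‖u‖ ^ 2 ≤ c u u) ∧ ∀ u, c u u ≤ hi * G.aperInv * ‖u‖ ^ 2 := by
  have hν : G.meas.restrict univ = G.meas := Measure.restrict_univ
  have hw := h.isWeight hlo univ
  obtain ⟨c, hc⟩ := exists_wForm_bilin MeasurableSet.univ hw hhi hν.le
  have hc' : ∀ u v, c u v = co.cForm u v := fun u v => by rw [hc, cForm_eq hlo h (Lp.memLp u) (Lp.memLp v)]
  refine ⟨c, hc', fun u v => ?_, fun u => ?_, fun u => ?_⟩
  · rw [hc', hc']; unfold Coefficients.cForm; simp only [mul_right_comm]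
  · rw [hc, div_mul_eq_mul_div, div_le_iff₀ (zero_lt_one.trans_le G.one_le_aperSup), mul_comm _ G.aperSup]
    exact le_wForm MeasurableSet.univ hw hlo.le (ae_restrict_of_ae (h.ae.mono fun z hz i => (hz i).1)) hν u
  · rw [hc]; exact wForm_le MeasurableSet.univ hw hhi hν.le u

instance msSpace.finiteDimensional (L : Fin M.N → ℕ) (ψ : Fin M.N → ℕ → EField G.meas) :
    FiniteDimensional ℝ (msSpace M L ψ) := by
  refine FiniteDimensional.span_of_finite ℝ ((Set.finite_iUnion fun j => (finite_Iio (L j)).image (ψ j)).subset ?_)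
  rintro w ⟨j, k, hk, rfl⟩; exact mem_iUnion.2 ⟨j, k, hk, rfl⟩

lemma msSpace_le {L : Fin M.N → ℕ} {φ : (j : Fin M.N) → ℕ → LocalField G M j} {m : ℕ} {ψ : Fin M.N → ℕ → EField G.meas}
    (hψ : IsMultiscaleBasis co ρ σ M L φ m ψ) : msSpace M L ψ ≤ G.V := by
  refine Submodule.span_le.2 ?_
  rintro w ⟨j, k, hk, rfl⟩; exact V0_le_V _ (hψ j k hk).1.1

lemma IsSolution.isWeakSolution {a : EField G.meas →L[ℝ] EField G.meas →L[ℝ] ℝ} (ha : ∀ u v, a u v = aQ co ρ σ univ u v)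
    {c : L2 G.meas →L[ℝ] L2 G.meas →L[ℝ] ℝ} (hc : ∀ u v, c u v = co.cForm u v) {W : Submodule ℝ (EField G.meas)} {T : ℝ}
    {f : ℝ → L2 G.meas} {p0 : EField G.meas} {p : ℝ → EField G.meas} (h : IsSolution co ρ σ W T f p0 p) :
    ∃ dp, IsWeakSolution a c (ContinuousLinearMap.fst ℝ _ _) W T f p dp := by
  obtain ⟨h0, hW, hp, dp, hdp, hint, he⟩ := h
  refine ⟨dp, hW, hp, hdp, fun t ht => ?_, ?_⟩
  · rw [h0]; exact hint t ht
  · filter_upwards [he] with t ht v hv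
    rw [ha, hc]; exact ht v hv

end

end DualContinuum


theorem theorem1 (G : FracturedDomain) (ρ σ : ℝ) (hρ : 0 ≤ ρ) (hσ : 0 ≤ σ)
    (cmin cmax : ℝ) (hcmin : 0 < cmin) (γ : ℝ) :
    ∃ C : ℝ, 0 < C ∧
    ∀ κmin Λ₀ lamBar Cπ : ℝ, 0 < κmin → 0 < Λ₀ →
    ∃ K₀ : ℝ, 0 < K₀ ∧
    ∀ (co : Coefficients G) (κmax : ℝ), co.KappaBetween κmin κmax → co.CBetween cmin cmax →
    ∀ M : QuadMesh, M.IsCoarseGrid G → M.ShapeRegular γ →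
    ∀ (L : Fin M.N → ℕ) (lam : Fin M.N → ℕ → ℝ) (φ : (j : Fin M.N) → ℕ → LocalField G M j),
    (∀ j, IsSpectralSequence co ρ σ M j (lam j) (φ j)) →
    (∀ j, ∀ k < L j, lam j k ≤ lamBar) →
    (∀ j, ∀ ν ∈ auxSpace M j (L j) (φ j),
      sForm co M j ν.1 ν.1 ≤ Cπ * sForm co M j (fun x => M.bubble j x • ν.1 x) ν.1) →
    ∀ Λ : ℝ, Λ = (⨅ j, lam j (L j)) → Λ₀ ≤ Λ →
    ∀ m : ℕ, 2 ≤ m → K₀ * max 1 (Real.log (κmax / M.meshSize)) ≤ m →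
    ∀ ψ : Fin M.N → ℕ → EField G.meas, IsMultiscaleBasis co ρ σ M L φ m ψ →
    ∀ (T : ℝ), 0 < T →
    ∀ f : ℝ → L2 G.meas, MemLp f 2 (MeasureTheory.volume.restrict (Set.Ioc 0 T)) →
    ∀ p0 ∈ G.V, ∀ p : ℝ → EField G.meas, IsSolution co ρ σ G.V T f p0 p →
    ∀ p0ms : EField G.meas, IsEllipticProjection co ρ σ (msSpace M L ψ) p0 p0ms →
    ∀ pms : ℝ → EField G.meas, IsSolution co ρ σ (msSpace M L ψ) T f p0ms pms →
      co.cForm (p T - pms T).1 (p T - pms T).1 +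
          ∫ t in (0 : ℝ)..T, aQ co ρ σ Set.univ (p t - pms t) (p t - pms t) ≤
        C * M.meshSize ^ 2 * κmin⁻¹ * Λ⁻¹ *
          (aQ co ρ σ Set.univ p0 p0 + ∫ t in (0 : ℝ)..T, ‖f t‖ ^ 2) := by
  have hov : 0 ≤ QuadMesh.overlap γ := by
    have := areaConst_pos
    unfold QuadMesh.overlap; positivity
  have hsup := G.one_le_aperSup
  have hinv := G.aperInv_nonneg
  obtain ⟨CF, hCF0, hCF⟩ := exists_friedrichs G
  obtain ⟨x₀, hx₀⟩ := G.nonempty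
  set c0 := cmin / G.aperSup with hc0def
  set c1 := max cmax 0 * G.aperInv with hc1def
  have hc0 : 0 < c0 := by positivity
  have hc1 : 0 ≤ c1 := mul_nonneg (le_max_right _ _) hinv
  set A := 8 * G.aperSup * QuadMesh.overlap γ + 2 with hA
  have hA0 : 0 < A := by positivity
  refine ⟨parabolicConst c0 c1 * A, ?_, fun κmin Λ₀ lamBar Cπ hκ hΛ₀ => ?_⟩
  · unfold parabolicConst; positivity
  obtain ⟨K₀, hK₀, hK⟩ := MultiscaleSetting.exists_layer_bound (γ := γ) (lamBar := max lamBar 0) (Cπ := max Cπ 1)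
    (V := γ ^ 2 * (volume (closure G.Ω)).toReal / areaConst)
    (P := G.aperInv * (QuadMesh.overlap γ * (CF * G.aperSup / κmin) ^ 2)) hov (le_max_right _ _) hκ hΛ₀
    (by have := areaConst_pos; positivity) (by positivity)
  refine ⟨K₀, hK₀, ?_⟩
  intro co κmax hκm hcm M hM hγ L lam φ hspec hlam hbub Λ hΛ hΛΛ m _ hm ψ hψ T hT f hf p0 hp0 p hp p0ms hp0ms pms hpms
  have hκκ : κmin ≤ κmax := (hκm.1 0 x₀ hx₀).1.trans (hκm.1 0 x₀ hx₀).2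
  have hcc : 0 ≤ cmax := hcmin.le.trans ((hcm.1 0 x₀ hx₀).1.trans (hcm.1 0 x₀ hx₀).2)
  have hH := hM.meshSize_pos
  have hΛ0 : 0 < Λ := hΛ₀.trans_le hΛΛ
  have S : MultiscaleSetting co ρ σ M L lam φ κmin κmax γ (max lamBar 0) (max Cπ 1) Λ :=
    { lo_pos := hκ
      hi_nonneg := hκ.le.trans hκκ
      kappa := hκm
      exch_nonneg := mul_nonneg hρ hσ
      grid := hM
      shape := hγ
      spectral := hspec
      lamBar_nonneg := le_max_right _ _
      lam_le := fun j k hk => (hlam j k hk).trans (le_max_left _ _)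
      cpi_pos := lt_max_of_lt_right one_pos
      bubble := fun j ν hν => (hbub j ν hν).trans
        (mul_le_mul_of_nonneg_right (le_max_left _ _) (sForm_bubble_nonneg hκ hκm hM j ν.1))
      gap_pos := hΛ0
      le_lam := fun j => hΛ ▸ ciInf_le (Set.finite_range _).bddBelow j }
  obtain ⟨hm3, hloc⟩ := hK κmax M.meshSize Λ M.N m hκκ hH hΛΛ (Nat.cast_nonneg _) (hγ.N_mul_le hM) hm
  obtain ⟨a, ha, has, ha0⟩ := S.exists_form
  obtain ⟨c, hc, hcs, hcl, hcu⟩ := exists_cForm_bilin hcmin hcc hcm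
  obtain ⟨CE, hCE0, hCE⟩ := S.exists_coercive
  obtain ⟨dp, hdp⟩ := hp.isWeakSolution ha hc
  obtain ⟨dpm, hdpm⟩ := hpms.isWeakSolution ha hc
  rw [max_eq_left hcc] at hc1def
  have herr := hdp.error_le (ε := A * (M.meshSize ^ 2 * κmin⁻¹ * Λ⁻¹)) has ha0 (Submodule.isClosed_topologicalClosure _) hCE0
    (fun v hv => by rw [ha]; exact hCE v hv) hcs hcl hcu hc0 (hc1def ▸ hc1) (msSpace_le hψ) (by positivity)
    (fun u hu K hK0 huK => by
      obtain ⟨w, hw, hwu⟩ := S.exists_elliptic_approx hm3 hψ hCF0 hCF hu hK0 fun v hv => by rw [← ha]; exact huK v hv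
      refine ⟨w, hw, ?_⟩
      rw [ha]
      refine hwu.trans (mul_le_mul_of_nonneg_right ?_ (sq_nonneg K))
      rw [← mul_assoc (κmax * _)] at hloc
      rw [div_eq_mul_inv, hA]
      linarith) hT hf hdpm
    (fun v hv => by rw [hp.1, hpms.1, ha, ha]; exact hp0ms.2 v hv)
  simp only [ha, hp.1] at herr
  rw [hc] at herr
  refine (le_of_eq ?_).trans (herr.trans (le_of_eq ?_))
  · rfl
  · rw [hc1def]; ring
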